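/- Let $(M,g)$ and $(N,h)$ be oriented smooth Riemannian manifolds with $\dim M=4$ and $\dim N=3$, and let $\varphi:M\to N$ be a smooth submersion which is a harmonic morphism, that is, for every open $W\subseteq N$ and every harmonic function $u$ on $W$, the function $u\circ\varphi$ is harmonic on $\varphi^{-1}(W)$. Let $\lambda>0$ be the dilation of $\varphi$ (the factor by which $\mathrm d\varphi$ stretches horizontal vectors), let $\mathscr V=\ker\mathrm d\varphi$ and $\mathscr H=\mathscr V^{\perp}$. Orient $\mathscr H$ so that $\mathscr H\cong\varphi^*(TN)$ preserves orientations, and $\mathscr V$ so that $TM=\mathscr V\oplus\mathscr H$ preserves orientations. Let $V$ be the fundamental vertical vector field, i.e. the positive vertical vector field with $g(V,V)=\lambda^2$; let $\theta$ be the one-form with $\theta(V)=1$, $\theta|_{\mathscr H}=0$, and let $\Omega=\mathrm d\theta$, where $\mathrm d\theta(A,B)=A(\theta(B))-B(\theta(A))-\theta([A,B])$. Assume that $\varphi$ is twistorial (with respect to the opposite orientation on $M$), which means that $$\mathrm d(\lambda^{-2})|_{\mathscr H}=*_{\mathscr H}\Omega,$$ where $*_{\mathscr H}$ is the Hodge star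 operator of $\mathscr H$ with respect to $\varphi^*(h)$ (thus $(*_{\mathscr H}\Omega)(e_3)=\Omega(e_1,e_2)$ for horizontal $e_1,e_2,e_3$ projected onto a positive orthonormal basis of $(TN,h)$). Assume also that $\Omega_x\neq0$ at each $x\in M$. Put $c=V(\lambda^{-2})$. Call an *adapted frame* on an open set $U\subseteq M$ a smooth frame $(X,Y,Z)$ of $\mathscr H$ on $U$ which is projected by $\varphi$ onto a smooth positive orthonormal frame on an open set of $(N,h)$ and which satisfies $\iota_Z\Omega=0$. Let $E$ be a smooth vector field on $M$, let $E=fV+F$ with $f$ a function and $F$ a horizontal vector field, and let $a\in\mathbb R$. Then $E$ is a soliton flow with constant $a$, i.e. $$\mathrm{Ric}^M+a\,g+\tfrac12\mathcal L_Eg=0\quad\text{on }M,$$ if and only if, locally, the following five relations hold, where $(X,Y,Z)$ is an adapted frame and $F=xX+yY+zZ$: $$V(f)+a-\tfrac12\lambda^2\bigl(fc+z\,\Omega(X,Y)\bigr)=0,$$ $$X(f)-y\,\Omega(X,Y)+\lambda^{-4}V(x)=0,$$ $$Y(f)+x\,\Omega(X,Y)+\lambda^{-4}V(y)=0,$$ $$Z(f)+\lambda^{-4}V(z)=0,$$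 $$\mathcal L_F\bigl(\varphi^*(h)\bigr)+\lambda^2\bigl(-c^2+fc+z\,\Omega(X,Y)+2a\lambda^{-2}\bigr)\varphi^*(h)+2\lambda^2\varphi^*\bigl(\mathrm{Ric}^N\bigr)=0\quad\text{on }\mathscr H.$$ Here "locally" may be read in either way: $E$ is a soliton flow with constant $a$ if and only if the relations hold for every adapted frame on every open set of $M$, and also if and only if each point of $M$ has an open neighbourhood with an adapted frame for which they hold. -/

import Mathlib

open scoped Manifold ContDiff Topology

noncomputable section

namespace SolitonFlow

/-- The model space `ℝⁿ`. -/
abbrev Rn (n : ℕ) : Type := EuclideanSpace ℝ (Fin n)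

/-- The tangent space at `x` of an `n`-dimensional manifold. -/
abbrev Tan (n : ℕ) {M : Type*} [TopologicalSpace M] [ChartedSpace (Rn n) M] (x : M) : Type :=
  TangentSpace (𝓡 n) x

/-- Smooth Riemannian metrics on the `n`-dimensional manifold `M`. -/
abbrev RMetric (n : ℕ) (M : Type*) [TopologicalSpace M] [ChartedSpace (Rn n) M]
    [IsManifold (𝓡 n) ∞ M] : Type _ :=
  Bundle.ContMDiffRiemannianMetric (𝓡 n) ∞ (Rn n) (fun x : M => TangentSpace (𝓡 n) x)

/-! ### Riemannian geometry on `ℝⁿ`, for a field `G` of bilinear forms -/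

section Model

variable {n : ℕ}

/-- The Christoffel symbols `Γ(u, v)` of `G` at `y`: the vector with
`G(Γ(u, v), w) = ½ (∂_u G(v, w) + ∂_v G(u, w) - ∂_w G(u, v))` for all `w`. -/
def christoffel (G : Rn n → (Rn n →L[ℝ] Rn n →L[ℝ] ℝ)) (y u v : Rn n) : Rn n :=
  (G y).inverse ((1 / 2 : ℝ) •
    (fderiv ℝ G y u v + fderiv ℝ G y v u - ((fderiv ℝ G y).flip u).flip v))

/-- The curvature `R(u, v)w = ∇_u ∇_v w - ∇_v ∇_u w` (for constant fields `u, v, w`)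
of the Levi-Civita connection `∇ = D + Γ` of `G` at `y`. -/
def curvature (G : Rn n → (Rn n →L[ℝ] Rn n →L[ℝ] ℝ)) (y u v w : Rn n) : Rn n :=
  fderiv ℝ (fun p => christoffel G p v w) y u - fderiv ℝ (fun p => christoffel G p u w) y v
    + christoffel G y u (christoffel G y v w) - christoffel G y v (christoffel G y u w)

/-- `Ric(v, w) = trace (u ↦ R(u, v)w)`. -/
def modelRicci (G : Rn n → (Rn n →L[ℝ] Rn n →L[ℝ] ℝ)) (y v w : Rn n) : ℝ :=
  ∑ i : Fin n, curvature G y (EuclideanSpace.single i (1 : ℝ)) v w i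

/-- The Hessian `(∇ df)(u, v)`. -/
def modelHessian (G : Rn n → (Rn n →L[ℝ] Rn n →L[ℝ] ℝ)) (f : Rn n → ℝ) (y u v : Rn n) : ℝ :=
  fderiv ℝ (fderiv ℝ f) y u v - fderiv ℝ f y (christoffel G y u v)

/-- The entries `Gⁱʲ` of the inverse of the matrix of `G` at `y`. -/
def modelInv (G : Rn n → (Rn n →L[ℝ] Rn n →L[ℝ] ℝ)) (y : Rn n) (i j : Fin n) : ℝ :=
  ((G y).inverse (EuclideanSpace.proj j : Rn n →L[ℝ] ℝ)) i

/-- The Laplacian `Δf = Gⁱʲ (∇ df)(∂ᵢ, ∂ⱼ)`. -/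
def modelLaplacian (G : Rn n → (Rn n →L[ℝ] Rn n →L[ℝ] ℝ)) (f : Rn n → ℝ) (y : Rn n) : ℝ :=
  ∑ i : Fin n, ∑ j : Fin n, modelInv G y i j *
    modelHessian G f y (EuclideanSpace.single i (1 : ℝ)) (EuclideanSpace.single j (1 : ℝ))

end Model

/-! ### Tensor calculus on manifolds, in the preferred chart around each point -/

section Charts

variable {n : ℕ} {M : Type*} [TopologicalSpace M] [ChartedSpace (Rn n) M]

/-- The preferred chart around `x`, extended to a map `M → ℝⁿ`. -/
abbrev chart (n : ℕ) {M : Type*} [TopologicalSpace M] [ChartedSpace (Rn n) M] (x : M) :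
    PartialEquiv M (Rn n) :=
  extChartAt (𝓡 n) x

/-- The differential at `y` of the inverse of the preferred chart around `x`. -/
def dChartInv (x : M) (y : Rn n) : Rn n →L[ℝ] Tan n ((chart n x).symm y) :=
  mfderiv 𝓘(ℝ, Rn n) (𝓡 n) (chart n x).symm y

/-- The components of `v ∈ T_x M` in the preferred chart around `x`. -/
def coordVec (x : M) (v : Tan n x) : Rn n :=
  mfderiv (𝓡 n) 𝓘(ℝ, Rn n) (chart n x) x v

/-- The derivative `X(f)` of a function along a vector field. -/
def deriveAlong (X : (x : M) → Tan n x) (f : M → ℝ) (x : M) : ℝ :=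
  mvfderiv (𝓡 n) f x (X x)

/-- Smoothness of a vector field on a set. -/
def SmoothFieldOn [IsManifold (𝓡 n) ∞ M] (X : (x : M) → Tan n x) (U : Set M) : Prop :=
  ContMDiffOn (𝓡 n) (𝓡 n).tangent ∞ (fun x => (⟨x, X x⟩ : TangentBundle (𝓡 n) M)) U

/-- A vector field in the preferred chart around `x`. -/
def chartField (X : (p : M) → Tan n p) (x : M) : Rn n → Rn n :=
  VectorField.mpullback 𝓘(ℝ, Rn n) (𝓡 n) (chart n x).symm X

/-- A one-form in the preferred chart around `x`. -/
def chartForm (θ : (p : M) → (Tan n p →L[ℝ] ℝ)) (x : M) (y : Rn n) : Rn n →L[ℝ] ℝ :=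
  (θ ((chart n x).symm y)).comp (dChartInv x y)

/-- The exterior derivative of a one-form, with the normalisation
`dθ(A, B) = A(θ(B)) - B(θ(A)) - θ([A, B])`. -/
def extDer (θ : (p : M) → (Tan n p →L[ℝ] ℝ)) (x : M) (v w : Tan n x) : ℝ :=
  fderiv ℝ (chartForm θ x) (chart n x x) (coordVec x v) (coordVec x w)
    - fderiv ℝ (chartForm θ x) (chart n x x) (coordVec x w) (coordVec x v)

/-- A covariant 2-tensor field in the preferred chart around `x`. -/
def chartTensor (T : (p : M) → Tan n p → Tan n p → ℝ) (x : M) (y u w : Rn n) : ℝ :=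
  T ((chart n x).symm y) (dChartInv x y u) (dChartInv x y w)

/-- The Lie derivative `(L_X T)(v, w)` of a covariant 2-tensor field `T`; in coordinates,
`(L_X T)(v, w) = (∂_X T)(v, w) + T(∂_v X, w) + T(v, ∂_w X)`. -/
def lieDer (X : (p : M) → Tan n p) (T : (p : M) → Tan n p → Tan n p → ℝ)
    (x : M) (v w : Tan n x) : ℝ :=
  fderiv ℝ (fun y => chartTensor T x y (coordVec x v) (coordVec x w)) (chart n x x)
      (chartField X x (chart n x x))
    + chartTensor T x (chart n x x)
        (fderiv ℝ (chartField X x) (chart n x x) (coordVec x v)) (coordVec x w)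
    + chartTensor T x (chart n x x) (coordVec x v)
        (fderiv ℝ (chartField X x) (chart n x x) (coordVec x w))

variable [IsManifold (𝓡 n) ∞ M]

/-- The metric in the preferred chart around `x`. -/
def chartMetric (g : RMetric n M) (x : M) (y : Rn n) : Rn n →L[ℝ] Rn n →L[ℝ] ℝ :=
  let B : Rn n →L[ℝ] Rn n →L[ℝ] ℝ := g.inner ((chart n x).symm y)
  let D : Rn n →L[ℝ] Rn n := dChartInv x y
  B.bilinearComp D D

/-- The Ricci tensor of `g`. -/
def ricci (g : RMetric n M) (x : M) (v w : Tan n x) : ℝ :=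
  modelRicci (chartMetric g x) (chart n x x) (coordVec x v) (coordVec x w)

/-- The Laplacian of `(M, g)` applied to a function. -/
def laplacian (g : RMetric n M) (f : M → ℝ) (x : M) : ℝ :=
  modelLaplacian (chartMetric g x) (f ∘ (chart n x).symm) (chart n x x)

/-- `f` is a harmonic function on the open set `U` of `(M, g)`. -/
def HarmonicOn (g : RMetric n M) (f : M → ℝ) (U : Set M) : Prop :=
  ContMDiffOn (𝓡 n) 𝓘(ℝ, ℝ) 2 f U ∧ ∀ x ∈ U, laplacian g f x = 0

/-- `E` satisfies the soliton equation `Ric + a g + ½ L_E g = 0` on `(M, g)`. -/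
def IsSolitonFlow (g : RMetric n M) (E : (x : M) → Tan n x) (a : ℝ) : Prop :=
  ∀ (x : M) (v w : Tan n x),
    ricci g x v w + a * g.inner x v w
      + (1 / 2) * lieDer E (fun p u u' => g.inner p u u') x v w = 0

end Charts

/-! ### Orientations -/

/-- `v` is a positive basis for the orientation `o`. -/
def IsPositiveBasis {n : ℕ} {W : Type*} [AddCommGroup W] [Module ℝ W]
    (o : Orientation ℝ W (Fin n)) (v : Fin n → W) : Prop :=
  ∃ b : Module.Basis (Fin n) ℝ W, ⇑b = v ∧ b.orientation = o

/-- An orientation of a manifold: an orientation of each tangent space such that around each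
point there is a smooth frame which is positive at every point of its domain. -/
structure ManifoldOrientation (n : ℕ) (M : Type*) [TopologicalSpace M]
    [ChartedSpace (Rn n) M] [IsManifold (𝓡 n) ∞ M] where
  orient : (x : M) → Orientation ℝ (Tan n x) (Fin n)
  exists_positive_frame : ∀ x₀ : M, ∃ U : Set M, IsOpen U ∧ x₀ ∈ U ∧
    ∃ e : Fin n → (x : M) → Tan n x, (∀ i, SmoothFieldOn (e i) U) ∧
      ∀ x ∈ U, IsPositiveBasis (orient x) (fun i => e i x)

/-! ### Harmonic morphisms from 4-manifolds to 3-manifolds -/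

section Morphism

variable {M : Type*} [TopologicalSpace M] [ChartedSpace (Rn 4) M]
  {N : Type*} [TopologicalSpace N] [ChartedSpace (Rn 3) N]

/-- The differential of `φ` at `x`. -/
def dφ (φ : M → N) (x : M) : Tan 4 x →L[ℝ] Tan 3 (φ x) :=
  mfderiv (𝓡 4) (𝓡 3) φ x

/-- `v ∈ T_x M` is vertical: `v ∈ ker dφ`. -/
def IsVertical (φ : M → N) (x : M) (v : Tan 4 x) : Prop := dφ φ x v = 0

variable [IsManifold (𝓡 4) ∞ M] [IsManifold (𝓡 3) ∞ N]

/-- `v ∈ T_x M` is horizontal: orthogonal to `ker dφ`. -/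
def IsHorizontal (g : RMetric 4 M) (φ : M → N) (x : M) (v : Tan 4 x) : Prop :=
  ∀ w : Tan 4 x, IsVertical φ x w → g.inner x v w = 0

/-- The pull-back `φ*h`. -/
def pullbackMetric (h : RMetric 3 N) (φ : M → N) (x : M) (v w : Tan 4 x) : ℝ :=
  h.inner (φ x) (dφ φ x v) (dφ φ x w)

/-- `φ` pulls back harmonic functions, on open subsets of `N`, to harmonic functions. -/
def IsHarmonicMorphism (g : RMetric 4 M) (h : RMetric 3 N) (φ : M → N) : Prop :=
  ∀ (W : Set N) (u : N → ℝ), IsOpen W → HarmonicOn h u W → HarmonicOn g (u ∘ φ) (φ ⁻¹' W)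

/-- The dilation `λ` of `φ`: the factor by which `dφ` stretches unit horizontal vectors.
(The stretching factor does not depend on the vector when `φ` is a submersive harmonic
morphism; the supremum is then this common value.) -/
def dilation (g : RMetric 4 M) (h : RMetric 3 N) (φ : M → N) (x : M) : ℝ :=
  sSup {r : ℝ | ∃ v : Tan 4 x, IsHorizontal g φ x v ∧ g.inner x v v = 1 ∧
    r = Real.sqrt (pullbackMetric h φ x v v)}

/-- The function `λ⁻²`. -/
def dilInvSq (g : RMetric 4 M) (h : RMetric 3 N) (φ : M → N) (x : M) : ℝ :=
  (dilation g h φ x ^ 2)⁻¹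

/-- `V` is the fundamental vertical field: the smooth vertical field with `g(V, V) = λ²` which is
positive, where the vertical distribution is oriented such that, with `H` oriented through
`dφ : H ≅ φ*(TN)`, the isomorphism `TM = ker dφ ⊕ H` preserves the orientations. -/
structure IsFundamentalField (g : RMetric 4 M) (h : RMetric 3 N) (oM : ManifoldOrientation 4 M)
    (oN : ManifoldOrientation 3 N) (φ : M → N) (V : (x : M) → Tan 4 x) : Prop where
  smooth : SmoothFieldOn V Set.univ
  vertical : ∀ x, IsVertical φ x (V x)
  norm_sq : ∀ x, g.inner x (V x) (V x) = dilation g h φ x ^ 2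
  positive : ∀ (x : M) (u : Fin 3 → Tan 4 x), (∀ i, IsHorizontal g φ x (u i)) →
    IsPositiveBasis (oN.orient (φ x)) (fun i => dφ φ x (u i)) →
    IsPositiveBasis (oM.orient x) (Matrix.vecCons (V x) u)

/-- The one-form `θ` dual to `V`: `θ(V) = 1` and `θ = 0` on horizontal vectors. -/
def dualForm (g : RMetric 4 M) (h : RMetric 3 N) (φ : M → N) (V : (x : M) → Tan 4 x) (x : M) :
    Tan 4 x →L[ℝ] ℝ :=
  dilInvSq g h φ x • g.inner x (V x)

/-- The two-form `Ω = dθ`. -/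
def Omega (g : RMetric 4 M) (h : RMetric 3 N) (φ : M → N) (V : (x : M) → Tan 4 x)
    (x : M) (v w : Tan 4 x) : ℝ :=
  extDer (dualForm g h φ V) x v w

/-- `(e₁, e₂, e₃)` is a positive orthonormal basis of `(T_y N, h)`. -/
def IsPosOrthonormal (h : RMetric 3 N) (oN : ManifoldOrientation 3 N) (y : N)
    (e₁ e₂ e₃ : Tan 3 y) : Prop :=
  h.inner y e₁ e₁ = 1 ∧ h.inner y e₂ e₂ = 1 ∧ h.inner y e₃ e₃ = 1 ∧
  h.inner y e₁ e₂ = 0 ∧ h.inner y e₁ e₃ = 0 ∧ h.inner y e₂ e₃ = 0 ∧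
  IsPositiveBasis (oN.orient y) ![e₁, e₂, e₃]

/-- `φ` is twistorial (with respect to the opposite orientation on `M`): `d_H(λ⁻²) = *_H Ω`,
where `*_H` is the Hodge star operator of the horizontal bundle `H`, identified with `φ*(TN)` and
endowed with `φ*h` and the orientation of `N`. Thus, `(*_H Ω)(e₃) = Ω(e₁, e₂)` for any positive
orthonormal basis `(e₁, e₂, e₃)` of a fibre of `H`. -/
def IsTwistorial (g : RMetric 4 M) (h : RMetric 3 N) (oN : ManifoldOrientation 3 N)
    (φ : M → N) (V : (x : M) → Tan 4 x) : Prop :=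
  ∀ (x : M) (e₁ e₂ e₃ : Tan 4 x),
    IsHorizontal g φ x e₁ → IsHorizontal g φ x e₂ → IsHorizontal g φ x e₃ →
    IsPosOrthonormal h oN (φ x) (dφ φ x e₁) (dφ φ x e₂) (dφ φ x e₃) →
    mvfderiv (𝓡 4) (dilInvSq g h φ) x e₃ = Omega g h φ V x e₁ e₂

/-- `(X, Y, Z)` is a smooth frame of `H` on the open set `U`, which is projected by `φ` onto a
smooth positive orthonormal frame `(X', Y', Z')` on an open set of `(N, h)`, and such that
`ι_Z Ω = 0` on `U`. -/
structure IsAdaptedFrame (g : RMetric 4 M) (h : RMetric 3 N) (oN : ManifoldOrientation 3 N)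
    (φ : M → N) (V : (x : M) → Tan 4 x) (U : Set M) (X Y Z : (x : M) → Tan 4 x) : Prop where
  isOpen : IsOpen U
  smooth_X : SmoothFieldOn X U
  smooth_Y : SmoothFieldOn Y U
  smooth_Z : SmoothFieldOn Z U
  horizontal_X : ∀ x ∈ U, IsHorizontal g φ x (X x)
  horizontal_Y : ∀ x ∈ U, IsHorizontal g φ x (Y x)
  horizontal_Z : ∀ x ∈ U, IsHorizontal g φ x (Z x)
  projectable : ∃ (W : Set N) (X' Y' Z' : (y : N) → Tan 3 y), IsOpen W ∧ Set.MapsTo φ U W ∧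
    SmoothFieldOn X' W ∧ SmoothFieldOn Y' W ∧ SmoothFieldOn Z' W ∧
    (∀ y ∈ W, IsPosOrthonormal h oN y (X' y) (Y' y) (Z' y)) ∧
    ∀ x ∈ U, dφ φ x (X x) = X' (φ x) ∧ dφ φ x (Y x) = Y' (φ x) ∧ dφ φ x (Z x) = Z' (φ x)
  omega_Z : ∀ x ∈ U, ∀ w : Tan 4 x, Omega g h φ V x (Z x) w = 0

/-- The five relations at the point `p`, for `E = fV + F`, the constant `a`, the frame
`(X, Y, Z)` and the components `x, y, z` of `F`; here `c = V(λ⁻²)`. -/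
def FiveRelations (g : RMetric 4 M) (h : RMetric 3 N) (φ : M → N) (V : (x : M) → Tan 4 x)
    (f : M → ℝ) (F : (x : M) → Tan 4 x) (a : ℝ) (X Y Z : (x : M) → Tan 4 x)
    (x y z : M → ℝ) (p : M) : Prop :=
  let lam : ℝ := dilation g h φ p
  let c : ℝ := deriveAlong V (dilInvSq g h φ) p
  let ΩXY : ℝ := Omega g h φ V p (X p) (Y p)
  deriveAlong V f p + a - (1 / 2) * lam ^ 2 * (f p * c + z p * ΩXY) = 0 ∧
  deriveAlong X f p - y p * ΩXY + (lam ^ 4)⁻¹ * deriveAlong V x p = 0 ∧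
  deriveAlong Y f p + x p * ΩXY + (lam ^ 4)⁻¹ * deriveAlong V y p = 0 ∧
  deriveAlong Z f p + (lam ^ 4)⁻¹ * deriveAlong V z p = 0 ∧
  ∀ v w : Tan 4 p, IsHorizontal g φ p v → IsHorizontal g φ p w →
    lieDer F (pullbackMetric h φ) p v w
      + lam ^ 2 * (-c ^ 2 + f p * c + z p * ΩXY + 2 * a * (lam ^ 2)⁻¹) * pullbackMetric h φ p v w
      + 2 * lam ^ 2 * ricci h (φ p) (dφ φ p v) (dφ φ p w) = 0

end Morphism

end SolitonFlow

end

open scoped Manifold ContDiff Topology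
noncomputable section
set_option maxSynthPendingDepth 3
set_option linter.unusedSimpArgs false

namespace SolitonFlow

/-! ### The Levi-Civita connection of a field of bilinear forms -/

section ModelGeometry

variable {n : ℕ}

/-! Put u = λ⁻², let (e_i) be a positive orthonormal frame on N and (X_i) its horizontal lift. In
the frame (V, X_i) everything is explicit: g(V,V) = 1/u, g(X_i,X_j) = u δ_ij, [V,X_i] is vertical,
and the vertical part of [X_i,X_j] is -Ω(X_i,X_j) V. The harmonic morphism property amounts to this
conformality together with [V,X_i] = 0, and twistoriality says Ω = ∗d_H u.

Consequences. The Jacobi identity for V, X_i, X_j gives V(X_k u) = 0. Hence X_k(c) = 0 for c = V(u),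
and applying [X_i,X_j] to c gives Ω(X_i,X_j) V(c) = 0, so c is locally constant because Ω has no
zeros. The Jacobi identity for the three X_i (that is, dΩ = 0) says that the horizontal Laplacian of
u vanishes. Inserting this into the connection coefficients, the Ricci tensor collapses to Ric(V,·)
= 0 and Ric = φ*Ric^N - (c²/2) φ*h on the horizontal bundle (`ricciOfConn_lift`,
`TwistorFrame.ricci`).

In an adapted frame X(u) = Y(u) = 0 and Z(u) = Ω(X,Y), so E(u) = fc + zΩ(X,Y). The Lie derivative of
g is then read off from the brackets, and the components (V,V), (V,X_i), (X_i,X_j) of the soliton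
equation are, up to positive factors, the five relations at the given point
(`soliton_iff_of_basicFrame`).

The definition of a harmonic morphism only mentions pull-backs of harmonic functions, so
conformality and [V,X_i] = 0 have to be extracted from it. This needs many local harmonic functions
on N: with differential at a point close to any prescribed one, or with small differential and
second derivative close to any prescribed trace-free form. Blowing up at the point turns the
Laplacian into a small perturbation of a constant coefficient operator, which is inverted on
absolutely convergent sums of plane waves by a Neumann series (`exists_perturbed_solution`,
`exists_harmonic_perturbation`). Testing with prescribed second derivatives gives conformality
(`PreservesHarmonicAt.conformal`); testing with prescribed differentials, through u Δ(f∘φ) = Δf + Σ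
θ([V,X_k]) e_k(f), gives [V,X_i] = 0 (`LiftedFrame.vertBracket_eq_zero`).

Both readings of "locally" follow from the pointwise equivalence once adapted frames exist
everywhere. Since V(X_k u) = 0, the horizontal gradient of u descends locally to N
(`LiftedFrame.descend`), and Gram-Schmidt started from it yields a frame with Z along the gradient
(`exists_adaptedFrame`). -/

/-- `G` is a smooth Riemannian metric on the open set `s ⊆ ℝⁿ`. -/
structure IsMetricOn (G : Rn n → (Rn n →L[ℝ] Rn n →L[ℝ] ℝ)) (s : Set (Rn n)) : Prop where
  isOpen : IsOpen s
  smooth : ContDiffOn ℝ ∞ G s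
  symm : ∀ y ∈ s, ∀ u v, G y u v = G y v u
  pos : ∀ y ∈ s, ∀ v, v ≠ 0 → 0 < G y v v

/-- Positivity makes `B` injective, and `Rn n` and its dual have the same dimension. -/
theorem isInvertible_of_pos {B : Rn n →L[ℝ] Rn n →L[ℝ] ℝ} (hB : ∀ v, v ≠ 0 → 0 < B v v) :
    B.IsInvertible := by
  have hinj : Function.Injective B := by
    rw [injective_iff_map_eq_zero]
    intro v hv
    by_contra h
    have := hB v h
    simp [hv] at this
  let e₁ : (Rn n →L[ℝ] ℝ) ≃ₗ[ℝ] Module.Dual ℝ (Rn n) := LinearMap.toContinuousLinearMap.symm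
  have hfin : Module.finrank ℝ (Rn n) = Module.finrank ℝ (Rn n →L[ℝ] ℝ) := by
    rw [e₁.finrank_eq, Subspace.dual_finrank_eq]
  let e := LinearEquiv.ofInjectiveOfFinrankEq (B : Rn n →ₗ[ℝ] (Rn n →L[ℝ] ℝ)) hinj hfin
  exact ⟨e.toContinuousLinearEquiv, by ext; rfl⟩

namespace IsMetricOn

variable {G : Rn n → (Rn n →L[ℝ] Rn n →L[ℝ] ℝ)} {s : Set (Rn n)}

theorem mono (hG : IsMetricOn G s) {t : Set (Rn n)} (ht : IsOpen t) (hts : t ⊆ s) :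
    IsMetricOn G t :=
  ⟨ht, hG.smooth.mono hts, fun y hy => hG.symm y (hts hy), fun y hy => hG.pos y (hts hy)⟩

theorem invertible (hG : IsMetricOn G s) {y : Rn n} (hy : y ∈ s) : (G y).IsInvertible :=
  isInvertible_of_pos (hG.pos y hy)

theorem apply_inverse (hG : IsMetricOn G s) {y : Rn n} (hy : y ∈ s) (L : Rn n →L[ℝ] ℝ) :
    G y ((G y).inverse L) = L :=
  (hG.invertible hy).self_apply_inverse L

theorem ext_of_apply (hG : IsMetricOn G s) {y : Rn n} (hy : y ∈ s) {u v : Rn n}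
    (h : ∀ w, G y u w = G y v w) : u = v := by
  have h1 : G y u = G y v := ContinuousLinearMap.ext h
  have h2 := congrArg (G y).inverse h1
  rwa [(hG.invertible hy).inverse_apply_self, (hG.invertible hy).inverse_apply_self] at h2

theorem contDiffAt (hG : IsMetricOn G s) {y : Rn n} (hy : y ∈ s) : ContDiffAt ℝ ∞ G y :=
  hG.smooth.contDiffAt (hG.isOpen.mem_nhds hy)

theorem differentiableAt (hG : IsMetricOn G s) {y : Rn n} (hy : y ∈ s) :
    DifferentiableAt ℝ G y :=
  (hG.contDiffAt hy).differentiableAt (by simp)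

theorem smooth_inverse (hG : IsMetricOn G s) : ContDiffOn ℝ ∞ (fun y => (G y).inverse) s :=
  fun y hy => ((hG.invertible hy).contDiffAt_map_inverse.comp y
    (hG.contDiffAt hy)).contDiffWithinAt

theorem smooth_fderiv (hG : IsMetricOn G s) : ContDiffOn ℝ ∞ (fderiv ℝ G) s :=
  hG.smooth.fderiv_of_isOpen hG.isOpen (by simp)

theorem christoffel_spec (hG : IsMetricOn G s) {y : Rn n} (hy : y ∈ s) (u v w : Rn n) :
    G y (christoffel G y u v) w
      = (1 / 2) * (fderiv ℝ G y u v w + fderiv ℝ G y v u w - fderiv ℝ G y w u v) := by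
  rw [christoffel, hG.apply_inverse hy]
  simp

theorem fderiv_symm (hG : IsMetricOn G s) {y : Rn n} (hy : y ∈ s) (a u v : Rn n) :
    fderiv ℝ G y a u v = fderiv ℝ G y a v u := by
  have hd := hG.differentiableAt hy
  have key : ∀ u v : Rn n, fderiv ℝ G y a u v = fderiv ℝ (fun p => G p u v) y a := by
    intro u v
    have h1 : HasFDerivAt (fun p => G p u v)
        (((fderiv ℝ G y).flip u).flip v) y := by
      have := (hd.hasFDerivAt.clm_apply (hasFDerivAt_const u y)).clm_apply (hasFDerivAt_const v y)
      exact this.congr_fderiv (by ext b; simp)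
    rw [h1.fderiv]; simp
  rw [key, key]
  congr 1
  apply Filter.EventuallyEq.fderiv_eq
  filter_upwards [hG.isOpen.mem_nhds hy] with p hp using hG.symm p hp u v

theorem christoffel_symm (hG : IsMetricOn G s) {y : Rn n} (hy : y ∈ s) (u v : Rn n) :
    christoffel G y u v = christoffel G y v u := by
  apply hG.ext_of_apply hy
  intro w
  rw [hG.christoffel_spec hy, hG.christoffel_spec hy, hG.fderiv_symm hy w u v]
  ring

end IsMetricOn

/-- The Christoffel symbols as a bilinear map. -/
def christoffelL (G : Rn n → (Rn n →L[ℝ] Rn n →L[ℝ] ℝ)) (y : Rn n) :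
    Rn n →L[ℝ] Rn n →L[ℝ] Rn n :=
  (ContinuousLinearMap.compL ℝ (Rn n) (Rn n →L[ℝ] ℝ) (Rn n) (G y).inverse).comp
    ((1 / 2 : ℝ) • (fderiv ℝ G y + (fderiv ℝ G y).flip
      - ((ContinuousLinearMap.flipₗᵢ ℝ (Rn n) (Rn n) ℝ).toContinuousLinearEquiv :
          (Rn n →L[ℝ] Rn n →L[ℝ] ℝ) →L[ℝ] (Rn n →L[ℝ] Rn n →L[ℝ] ℝ)).comp (fderiv ℝ G y).flip))

@[simp] theorem christoffelL_apply (G : Rn n → (Rn n →L[ℝ] Rn n →L[ℝ] ℝ)) (y u v : Rn n) :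
    christoffelL G y u v = christoffel G y u v := by
  simp only [christoffelL, christoffel]
  rfl

theorem IsMetricOn.smooth_christoffelL {G : Rn n → (Rn n →L[ℝ] Rn n →L[ℝ] ℝ)} {s : Set (Rn n)}
    (hG : IsMetricOn G s) : ContDiffOn ℝ ∞ (christoffelL G) s := by
  have hflip : ContDiffOn ℝ ∞ (fun y => (fderiv ℝ G y).flip) s :=
    (ContinuousLinearMap.flipₗᵢ ℝ (Rn n) (Rn n)
      (Rn n →L[ℝ] ℝ)).contDiff.comp_contDiffOn hG.smooth_fderiv
  refine ContDiffOn.clm_comp ?_ (ContDiffOn.const_smul _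
    ((hG.smooth_fderiv.add hflip).sub (contDiffOn_const.clm_comp hflip)))
  exact (ContinuousLinearMap.compL ℝ (Rn n) (Rn n →L[ℝ] ℝ) (Rn n)).contDiff.comp_contDiffOn
    hG.smooth_inverse

/-- The covariant derivative `∇_A B`. -/
def cov (G : Rn n → (Rn n →L[ℝ] Rn n →L[ℝ] ℝ)) (A B : Rn n → Rn n) (y : Rn n) : Rn n :=
  fderiv ℝ B y (A y) + christoffel G y (A y) (B y)

/-- The derivative of a bilinear form evaluated on two vector fields. -/
theorem fderiv_bilin {F : Type*} [NormedAddCommGroup F] [NormedSpace ℝ F]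
    {B : Rn n → (F →L[ℝ] F →L[ℝ] ℝ)} {X Y : Rn n → F} {y : Rn n}
    (hB : DifferentiableAt ℝ B y) (hX : DifferentiableAt ℝ X y) (hY : DifferentiableAt ℝ Y y)
    (a : Rn n) :
    fderiv ℝ (fun p => B p (X p) (Y p)) y a
      = fderiv ℝ B y a (X y) (Y y) + B y (fderiv ℝ X y a) (Y y) + B y (X y) (fderiv ℝ Y y a) := by
  have h := (hB.hasFDerivAt.clm_apply hX.hasFDerivAt).clm_apply hY.hasFDerivAt
  rw [h.fderiv]
  simp
  ring

/-- Metric compatibility of ∇ = D + Γ: by the defining formula of Γ, the two Christoffel terms add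
up to the derivative of `G`. -/
theorem IsMetricOn.fderiv_metric {G : Rn n → (Rn n →L[ℝ] Rn n →L[ℝ] ℝ)} {s : Set (Rn n)}
    (hG : IsMetricOn G s) {y : Rn n} (hy : y ∈ s) {A X Y : Rn n → Rn n}
    (hX : DifferentiableAt ℝ X y) (hY : DifferentiableAt ℝ Y y) :
    fderiv ℝ (fun p => G p (X p) (Y p)) y (A y)
      = G y (cov G A X y) (Y y) + G y (X y) (cov G A Y y) := by
  rw [fderiv_bilin (hG.differentiableAt hy) hX hY, cov, cov]
  simp only [map_add, add_apply]
  rw [hG.symm y hy (X y) (christoffel G y _ _), hG.christoffel_spec hy, hG.christoffel_spec hy,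
    hG.fderiv_symm hy (A y) (Y y) (X y), hG.fderiv_symm hy (X y) (A y) (Y y),
    hG.fderiv_symm hy (Y y) (A y) (X y)]
  ring

theorem IsMetricOn.cov_sub_cov {G : Rn n → (Rn n →L[ℝ] Rn n →L[ℝ] ℝ)} {s : Set (Rn n)}
    (hG : IsMetricOn G s) {y : Rn n} (hy : y ∈ s) (A B : Rn n → Rn n) :
    cov G A B y - cov G B A y = VectorField.lieBracket ℝ A B y := by
  rw [cov, cov, VectorField.lieBracket, hG.christoffel_symm hy (B y) (A y)]
  abel

theorem IsMetricOn.fderiv_christoffel {G : Rn n → (Rn n →L[ℝ] Rn n →L[ℝ] ℝ)} {s : Set (Rn n)}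
    (hG : IsMetricOn G s) {y : Rn n} (hy : y ∈ s) {X Y : Rn n → Rn n}
    (hX : DifferentiableAt ℝ X y) (hY : DifferentiableAt ℝ Y y) (a : Rn n) :
    HasFDerivAt (fun p => christoffel G p (X p) (Y p))
      (fderiv ℝ (fun p => christoffel G p (X p) (Y p)) y) y ∧
    fderiv ℝ (fun p => christoffel G p (X p) (Y p)) y a
      = fderiv ℝ (christoffelL G) y a (X y) (Y y) + christoffel G y (fderiv ℝ X y a) (Y y)
        + christoffel G y (X y) (fderiv ℝ Y y a) := by
  have hd : DifferentiableAt ℝ (christoffelL G) y :=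
    (hG.smooth_christoffelL.contDiffAt (hG.isOpen.mem_nhds hy)).differentiableAt (by simp)
  have h := (hd.hasFDerivAt.clm_apply hX.hasFDerivAt).clm_apply hY.hasFDerivAt
  simp only [christoffelL_apply] at h
  refine ⟨h.differentiableAt.hasFDerivAt, ?_⟩
  rw [h.fderiv]
  simp only [add_apply, ContinuousLinearMap.comp_apply,
    ContinuousLinearMap.flip_apply, christoffelL_apply]
  abel

theorem IsMetricOn.curvature_eq {G : Rn n → (Rn n →L[ℝ] Rn n →L[ℝ] ℝ)} {s : Set (Rn n)}
    (hG : IsMetricOn G s) {y : Rn n} (hy : y ∈ s) {u v w : Rn n} :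
    curvature G y u v w = fderiv ℝ (christoffelL G) y u v w - fderiv ℝ (christoffelL G) y v u w
      + christoffelL G y u (christoffelL G y v w) - christoffelL G y v (christoffelL G y u w) := by
  have h1 := fun a b : Rn n => (hG.fderiv_christoffel hy (differentiableAt_const a (x := y))
    (differentiableAt_const w) b).2
  simp only [fderiv_fun_const, Pi.zero_apply, zero_apply, ← christoffelL_apply,
    map_zero, add_zero] at h1
  simp only [curvature, ← christoffelL_apply, h1]

/-- The second derivatives of `C` cancel by symmetry, and the terms with derivatives of `A` and `B`
form the term with the bracket. This links the coordinate curvature, defined on constant fields, to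
moving frames. -/
theorem IsMetricOn.curvature_fields {G : Rn n → (Rn n →L[ℝ] Rn n →L[ℝ] ℝ)} {s : Set (Rn n)}
    (hG : IsMetricOn G s) {y : Rn n} (hy : y ∈ s) {A B C : Rn n → Rn n}
    (hA : ContDiffOn ℝ ∞ A s) (hB : ContDiffOn ℝ ∞ B s) (hC : ContDiffOn ℝ ∞ C s) :
    curvature G y (A y) (B y) (C y) = cov G A (cov G B C) y - cov G B (cov G A C) y
      - cov G (VectorField.lieBracket ℝ A B) C y := by
  have hs := hG.isOpen.mem_nhds hy
  have dA : DifferentiableAt ℝ A y := (hA.contDiffAt hs).differentiableAt (by simp)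
  have dB : DifferentiableAt ℝ B y := (hB.contDiffAt hs).differentiableAt (by simp)
  have dC : DifferentiableAt ℝ C y := (hC.contDiffAt hs).differentiableAt (by simp)
  have dC' : DifferentiableAt ℝ (fderiv ℝ C) y :=
    ((hC.contDiffAt hs).fderiv_right (m := ∞) (by simp)).differentiableAt (by simp)
  have hsym : IsSymmSndFDerivAt ℝ C y :=
    (hC.contDiffAt hs).isSymmSndFDerivAt (by simpa using ENat.LEInfty.out)
  have key : ∀ {X Y : Rn n → Rn n}, DifferentiableAt ℝ Y y → fderiv ℝ (cov G Y C) y (X y)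
      = fderiv ℝ (fderiv ℝ C) y (X y) (Y y) + fderiv ℝ C y (fderiv ℝ Y y (X y))
        + (fderiv ℝ (christoffelL G) y (X y) (Y y) (C y)
          + christoffel G y (fderiv ℝ Y y (X y)) (C y)
          + christoffel G y (Y y) (fderiv ℝ C y (X y))) := by
    intro X Y dY
    have h1 := dC'.hasFDerivAt.clm_apply dY.hasFDerivAt
    have h2 := hG.fderiv_christoffel hy dY dC (X y)
    have h3 : HasFDerivAt (cov G Y C) _ y := h1.add h2.1
    rw [h3.fderiv, add_apply, h2.2]
    simp only [add_apply, ContinuousLinearMap.comp_apply,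
      ContinuousLinearMap.flip_apply]
    abel
  rw [hG.curvature_eq hy, cov, cov, cov, key dB, key dA, VectorField.lieBracket_eq,
    hsym.eq (A y) (B y), cov, cov]
  simp only [← christoffelL_apply, map_add, map_sub, sub_apply]
  abel

/-- A trace does not depend on the basis, so the standard basis of `modelRicci` may be replaced by a
frame. -/
theorem IsMetricOn.modelRicci_eq_trace {G : Rn n → (Rn n →L[ℝ] Rn n →L[ℝ] ℝ)} {s : Set (Rn n)}
    (hG : IsMetricOn G s) {y : Rn n} (hy : y ∈ s) (b : Module.Basis (Fin n) ℝ (Rn n))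
    (v w : Rn n) :
    modelRicci G y v w = ∑ i, b.repr (curvature G y (b i) v w) i := by
  let L : Rn n →ₗ[ℝ] Rn n :=
    { toFun := fun u => curvature G y u v w
      map_add' := fun u u' => by
        simp only [hG.curvature_eq hy, map_add, add_apply]; abel
      map_smul' := fun c u => by
        simp only [hG.curvature_eq hy, map_smul, smul_apply,
          RingHom.id_apply, smul_add, smul_sub] }
  have h1 := LinearMap.trace_eq_matrix_trace ℝ b L
  have h2 := LinearMap.trace_eq_matrix_trace ℝ (EuclideanSpace.basisFun (Fin n) ℝ).toBasis L
  rw [h1] at h2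
  simp only [Matrix.trace, Matrix.diag, LinearMap.toMatrix_apply] at h2
  rw [modelRicci]
  refine Eq.trans ?_ h2.symm
  simp [L]

end ModelGeometry

/-! ### Moving frames -/

section Frames

variable {n : ℕ} {G : Rn n → (Rn n →L[ℝ] Rn n →L[ℝ] ℝ)} {s : Set (Rn n)}

theorem cov_congr {A B B' : Rn n → Rn n} {y : Rn n} (h : B =ᶠ[𝓝 y] B') :
    cov G A B y = cov G A B' y := by
  rw [cov, cov, h.fderiv_eq, h.eq_of_nhds]

theorem cov_sum_left {ι : Type*} (t : Finset ι) (f : ι → ℝ) (E : ι → Rn n → Rn n)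
    {A : Rn n → Rn n} (B : Rn n → Rn n) {y : Rn n} (hA : A y = ∑ i ∈ t, f i • E i y) :
    cov G A B y = ∑ i ∈ t, f i • cov G (E i) B y := by
  simp only [cov, hA, ← christoffelL_apply, map_sum, map_smul, smul_add, Finset.sum_add_distrib,
    sum_apply, smul_apply]

theorem cov_sum_right {ι : Type*} (t : Finset ι) {f : ι → Rn n → ℝ} {E : ι → Rn n → Rn n}
    (A : Rn n → Rn n) {y : Rn n} (hf : ∀ i ∈ t, DifferentiableAt ℝ (f i) y)
    (hE : ∀ i ∈ t, DifferentiableAt ℝ (E i) y) :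
    cov G A (fun p => ∑ i ∈ t, f i p • E i p) y
      = ∑ i ∈ t, (fderiv ℝ (f i) y (A y) • E i y + f i y • cov G A (E i) y) := by
  rw [cov, fderiv_fun_sum fun i hi => (hf i hi).fun_smul (hE i hi)]
  simp only [← christoffelL_apply, map_sum, map_smul, cov, smul_add, Finset.sum_add_distrib,
    sum_apply]
  rw [← add_assoc, add_left_inj, ← Finset.sum_add_distrib]
  refine Finset.sum_congr rfl fun i hi => ?_
  rw [fderiv_fun_smul (hf i hi) (hE i hi)]
  simp [add_comm]

/-- Uniqueness of the Levi-Civita connection: the difference `T` of the two candidates is symmetric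
in its two arguments, while G(T(a,b),c) is skew in b and c; a three-index array with both symmetries
is zero. Coefficients can therefore be guessed and verified. -/
theorem IsMetricOn.cov_eq_of_torsion_of_metric (hG : IsMetricOn G s) {ι : Type*} [Fintype ι]
    {E : ι → Rn n → Rn n} {K : ι → ι → ι → Rn n → ℝ} {y : Rn n} (hy : y ∈ s)
    (hE : ∀ i, DifferentiableAt ℝ (E i) y)
    (hspan : Submodule.span ℝ (Set.range fun i => E i y) = ⊤)
    (htor : ∀ a b, VectorField.lieBracket ℝ (E a) (E b) y
      = ∑ c, (K a b c y - K b a c y) • E c y)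
    (hmet : ∀ a b c, fderiv ℝ (fun p => G p (E b p) (E c p)) y (E a y)
      = ∑ d, K a b d y * G y (E d y) (E c y) + ∑ d, K a c d y * G y (E b y) (E d y)) (a b : ι) :
    cov G (E a) (E b) y = ∑ c, K a b c y • E c y := by
  set T : ι → ι → Rn n := fun a b => cov G (E a) (E b) y - ∑ c, K a b c y • E c y with hT
  have hTsymm : ∀ a b, T a b = T b a := by
    intro a b
    have h1 := hG.cov_sub_cov hy (E a) (E b)
    rw [htor] at h1
    simp only [sub_smul, Finset.sum_sub_distrib] at h1
    simp only [hT]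
    rw [sub_eq_sub_iff_sub_eq_sub, h1]
  have hTmet : ∀ a b c, G y (T a b) (E c y) + G y (T a c) (E b y) = 0 := by
    intro a b c
    have h1 := hG.fderiv_metric hy (A := E a) (hE b) (hE c)
    rw [hmet, hG.symm y hy (E b y) (cov G (E a) (E c) y)] at h1
    simp only [hT, map_sub, map_sum, map_smul, sub_apply, sum_apply, smul_apply,
      smul_eq_mul]
    have h2 : ∀ d, G y (E b y) (E d y) = G y (E d y) (E b y) := fun d => hG.symm y hy _ _
    simp only [h2] at h1
    linarith
  have hT0 : ∀ a b c, G y (T a b) (E c y) = 0 := by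
    intro a b c
    have e1 := hTmet a b c
    have e2 := hTmet b c a
    have e3 := hTmet c a b
    rw [hTsymm b a] at e2
    rw [hTsymm c b, hTsymm c a] at e3
    linarith
  have : T a b = 0 := by
    apply hG.ext_of_apply hy
    intro w
    have hw : w ∈ Submodule.span ℝ (Set.range fun i => E i y) := hspan ▸ Submodule.mem_top
    induction hw using Submodule.span_induction with
    | mem x hx => obtain ⟨i, rfl⟩ := hx; simpa using hT0 a b i
    | zero => simp
    | add x z _ _ hx hz => simp [hx, hz]
    | smul r x _ hx => simp [hx]
  exact sub_eq_zero.mp this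

/-- Expand ∇∇ with the coefficients `K`; absence of torsion gives the bracket of the frame fields
the coefficients K_abk - K_bak. -/
theorem IsMetricOn.curvature_frame (hG : IsMetricOn G s) {ι : Type*} [Fintype ι]
    {E : ι → Rn n → Rn n} {K : ι → ι → ι → Rn n → ℝ}
    (hE : ∀ i, ContDiffOn ℝ ∞ (E i) s)
    (hcov : ∀ y ∈ s, ∀ a b, cov G (E a) (E b) y = ∑ c, K a b c y • E c y)
    {y : Rn n} (hy : y ∈ s) (hK : ∀ a b c, DifferentiableAt ℝ (K a b c) y) (a b d : ι) :
    curvature G y (E a y) (E b y) (E d y) = ∑ c, (fderiv ℝ (K b d c) y (E a y)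
      - fderiv ℝ (K a d c) y (E b y) + ∑ k, (K b d k y * K a k c y - K a d k y * K b k c y)
      - ∑ k, (K a b k y - K b a k y) * K k d c y) • E c y := by
  have hs := hG.isOpen.mem_nhds hy
  have dE : ∀ i, DifferentiableAt ℝ (E i) y :=
    fun i => ((hE i).contDiffAt hs).differentiableAt (by simp)
  have h2 : ∀ a b d, cov G (E a) (cov G (E b) (E d)) y
      = ∑ c, (fderiv ℝ (K b d c) y (E a y) + ∑ k, K b d k y * K a k c y) • E c y := by
    intro a b d
    have hev : cov G (E b) (E d) =ᶠ[𝓝 y] fun p => ∑ c, K b d c p • E c p := by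
      filter_upwards [hs] with p hp using hcov p hp b d
    rw [cov_congr hev, cov_sum_right _ _ (fun c _ => hK b d c) (fun c _ => dE c)]
    simp only [hcov y hy, Finset.smul_sum, add_smul, Finset.sum_add_distrib, Finset.sum_smul,
      smul_smul]
    rw [Finset.sum_comm]
  have h3 : cov G (VectorField.lieBracket ℝ (E a) (E b)) (E d) y
      = ∑ c, (∑ k, (K a b k y - K b a k y) * K k d c y) • E c y := by
    rw [cov_sum_left Finset.univ (fun k => K a b k y - K b a k y) E]
    · simp only [hcov y hy, Finset.smul_sum, Finset.sum_smul, smul_smul]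
      rw [Finset.sum_comm]
    · rw [← hG.cov_sub_cov hy, hcov y hy, hcov y hy]
      simp only [sub_smul, Finset.sum_sub_distrib]
  rw [hG.curvature_fields hy (hE a) (hE b) (hE d), h2, h2, h3, ← Finset.sum_sub_distrib,
    ← Finset.sum_sub_distrib]
  refine Finset.sum_congr rfl fun c _ => ?_
  rw [← sub_smul, ← sub_smul]
  congr 1
  rw [Finset.sum_sub_distrib]
  ring

theorem IsMetricOn.modelRicci_frame (hG : IsMetricOn G s)
    {E : Fin n → Rn n → Rn n} {K : Fin n → Fin n → Fin n → Rn n → ℝ}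
    (hE : ∀ i, ContDiffOn ℝ ∞ (E i) s)
    (hcov : ∀ y ∈ s, ∀ a b, cov G (E a) (E b) y = ∑ c, K a b c y • E c y)
    {y : Rn n} (hy : y ∈ s) (hK : ∀ a b c, DifferentiableAt ℝ (K a b c) y)
    (hli : LinearIndependent ℝ fun i => E i y) (b d : Fin n) :
    modelRicci G y (E b y) (E d y) = ∑ a, (fderiv ℝ (K b d a) y (E a y)
      - fderiv ℝ (K a d a) y (E b y) + ∑ k, (K b d k y * K a k a y - K a d k y * K b k a y)
      - ∑ k, (K a b k y - K b a k y) * K k d a y) := by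
  rcases Nat.eq_zero_or_pos n with h0 | hn
  · subst h0; exact b.elim0
  have : Nonempty (Fin n) := ⟨⟨0, hn⟩⟩
  let B := basisOfLinearIndependentOfCardEqFinrank hli (by simp)
  have hB : ∀ i, B i = E i y := fun i => by simp [B]
  rw [hG.modelRicci_eq_trace hy B]
  refine Finset.sum_congr rfl fun a _ => ?_
  rw [hB a, hG.curvature_frame hE hcov hy hK]
  simp only [← hB, map_sum, map_smul, Module.Basis.repr_self, Finsupp.coe_finsetSum,
    Finsupp.coe_smul, Finset.sum_apply, Pi.smul_apply, Finsupp.single_apply, smul_eq_mul, mul_ite,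
    mul_one, mul_zero, Finset.sum_ite_eq', Finset.mem_univ, if_true]

end Frames

/-! ### Connection coefficients and Ricci tensor of the frame (V, X_i): the algebra -/

/-- The entry a, b, c is the coefficient of E_c in ∇_{E_a} E_b, where index 0 is the vertical vector
and `i.succ` the horizontal X_i. Here `w` is the connection of the frame on the base, `u` the
squared length of the X_i and 1/u that of V, `c` and `du` are the derivatives of `u` along V and
X_k, and `b`, `D` are the vertical components of [V,X_k] and [X_i,X_j]. The entries come from the
Koszul formula. -/
def frameConn (w : Fin 3 → Fin 3 → Fin 3 → ℝ) (u c : ℝ) (du b : Fin 3 → ℝ)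
    (D : Fin 3 → Fin 3 → ℝ) : Fin 4 → Fin 4 → Fin 4 → ℝ :=
  Fin.cases
    (Fin.cases
      (Fin.cases (-c / (2 * u)) fun k => du k / (2 * u ^ 3) - b k / u ^ 2)
      fun j => Fin.cases (-du j / (2 * u) + b j)
        fun k => ((if j = k then u * c else 0) - D j k) / (2 * u ^ 2))
    fun i => Fin.cases
      (Fin.cases (-du i / (2 * u)) fun k => ((if i = k then u * c else 0) - D i k) / (2 * u ^ 2))
      fun j => Fin.cases ((-(if i = j then u * c else 0) + D i j) / 2)
        fun k => w i j k + ((if j = k then du i else 0) + (if i = k then du j else 0)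
          - (if i = j then du k else 0)) / (2 * u)

/-- derivative when b = 0 and c const -/
def frameConnDeriv (w' : Fin 3 → Fin 3 → Fin 3 → ℝ) (u c u' : ℝ) (du du' : Fin 3 → ℝ)
    (D D' : Fin 3 → Fin 3 → ℝ) : Fin 4 → Fin 4 → Fin 4 → ℝ :=
  Fin.cases
    (Fin.cases
      (Fin.cases (c * u' / (2 * u ^ 2)) fun k => du' k / (2 * u ^ 3) - 3 * du k * u' / (2 * u ^ 4))
      fun j => Fin.cases (-du' j / (2 * u) + du j * u' / (2 * u ^ 2))
        fun k => ((if j = k then u' * c else 0) - D' j k) / (2 * u ^ 2)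
          - ((if j = k then u * c else 0) - D j k) * u' / u ^ 3)
    fun i => Fin.cases
      (Fin.cases (-du' i / (2 * u) + du i * u' / (2 * u ^ 2))
        fun k => ((if i = k then u' * c else 0) - D' i k) / (2 * u ^ 2)
          - ((if i = k then u * c else 0) - D i k) * u' / u ^ 3)
      fun j => Fin.cases ((-(if i = j then u' * c else 0) + D' i j) / 2)
        fun k => w' i j k + ((if j = k then du' i else 0) + (if i = k then du' j else 0)
          - (if i = j then du' k else 0)) / (2 * u)
          - ((if j = k then du i else 0) + (if i = k then du j else 0)
          - (if i = j then du k else 0)) * u' / (2 * u ^ 2)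

/-- The Hodge star of the one-form with components `a` in a positive orthonormal frame: the entry
(i, j) is `a k` for (i, j, k) cyclic. -/
def starForm (a : Fin 3 → ℝ) : Fin 3 → Fin 3 → ℝ :=
  ![![0, a 2, -a 1], ![-a 2, 0, a 0], ![a 1, -a 0, 0]]

/-- The contraction giving the Ricci tensor. -/
def ricciOfConn {n : ℕ} (K : Fin n → Fin n → Fin n → ℝ) (K' : Fin n → Fin n → Fin n → Fin n → ℝ)
    (b d : Fin n) : ℝ :=
  ∑ a, (K' a b d a - K' b a d a + ∑ k, (K b d k * K a k a - K a d k * K b k a)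
      - ∑ k, (K a b k - K b a k) * K k d a)

variable (w : Fin 3 → Fin 3 → Fin 3 → ℝ) (w' : Fin 3 → Fin 3 → Fin 3 → Fin 3 → ℝ) (u c : ℝ)
  (du : Fin 3 → ℝ) (ddu : Fin 3 → Fin 3 → ℝ)

/-- The case [V,X_i] = 0 with the monopole equation, where θ([X_i,X_j]) = -Ω(X_i,X_j) = -(∗du)_ij.
-/
def liftConn := frameConn w u c du 0 (fun i j => - starForm du i j)
-- The first index is the direction of differentiation. Along V the base coefficients and the X_k(u)
-- are constant and `u` grows at rate `c`; along X_m, `ddu m k` stands for X_m(X_k u).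
def liftConnDeriv : Fin 4 → Fin 4 → Fin 4 → Fin 4 → ℝ := Fin.cases
  (frameConnDeriv 0 u c c du 0 (fun i j => - starForm du i j) 0)
  fun m => frameConnDeriv (w' m) u c (du m) du (ddu m) (fun i j => - starForm du i j)
    (fun i j => - starForm (ddu m) i j)

set_option maxHeartbeats 4000000 in
-- A rational identity in the frame data, valid modulo two constraints on the second derivatives of
-- u: `hcomm` is [X_m,X_k] applied to u, and `hdiv` is the vanishing of the horizontal Laplacian of
-- u, which encodes dΩ = 0.
theorem ricciOfConn_lift (hu : u ≠ 0) (hw : ∀ i j k, w i j k = - w i k j)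
    (hw' : ∀ m i j k, w' m i j k = - w' m i k j)
    (hcomm : ∀ m k, ddu m k - ddu k m = ∑ l, (w m k l - w k m l) * du l - starForm du m k * c)
    (hdiv : ∑ m, ddu m m = ∑ m, ∑ l, w m m l * du l) :
    (ricciOfConn (liftConn w u c du) (liftConnDeriv w' u c du ddu) 0 0 = 0) ∧
    (∀ i : Fin 3, ricciOfConn (liftConn w u c du) (liftConnDeriv w' u c du ddu) 0 i.succ = 0) ∧
    (∀ i : Fin 3, ricciOfConn (liftConn w u c du) (liftConnDeriv w' u c du ddu) i.succ 0 = 0) ∧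
    (∀ i j : Fin 3, ricciOfConn (liftConn w u c du) (liftConnDeriv w' u c du ddu) i.succ j.succ
      = ricciOfConn w w' i j - if i = j then c ^ 2 / 2 else 0) := by
  have w00 : ∀ i, w i 0 0 = 0 := fun i => by linarith [hw i 0 0]
  have w11 : ∀ i, w i 1 1 = 0 := fun i => by linarith [hw i 1 1]
  have w22 : ∀ i, w i 2 2 = 0 := fun i => by linarith [hw i 2 2]
  have w10 : ∀ i, w i 1 0 = - w i 0 1 := fun i => hw i 1 0
  have w20 : ∀ i, w i 2 0 = - w i 0 2 := fun i => hw i 2 0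
  have w21 : ∀ i, w i 2 1 = - w i 1 2 := fun i => hw i 2 1
  have v00 : ∀ m i, w' m i 0 0 = 0 := fun m i => by linarith [hw' m i 0 0]
  have v11 : ∀ m i, w' m i 1 1 = 0 := fun m i => by linarith [hw' m i 1 1]
  have v22 : ∀ m i, w' m i 2 2 = 0 := fun m i => by linarith [hw' m i 2 2]
  have v10 : ∀ m i, w' m i 1 0 = - w' m i 0 1 := fun m i => hw' m i 1 0
  have v20 : ∀ m i, w' m i 2 0 = - w' m i 0 2 := fun m i => hw' m i 2 0
  have v21 : ∀ m i, w' m i 2 1 = - w' m i 1 2 := fun m i => hw' m i 2 1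
  have c01 := hcomm 1 0
  have c02 := hcomm 2 0
  have c12 := hcomm 2 1
  simp only [Fin.sum_univ_three, starForm, Matrix.cons_val, w00, w11, w22, w10, w20, w21]
    at c01 c02 c12 hdiv
  -- Solving the constraints for four of the nine second derivatives leaves five free ones; after
  -- substitution each component is an identity of rational functions.
  have d10 := eq_add_of_sub_eq c01
  have d20 := eq_add_of_sub_eq c02
  have d21 := eq_add_of_sub_eq c12
  have d22 := eq_sub_of_add_eq' hdiv
  clear c01 c02 c12 hdiv hcomm hw hw'
  refine ⟨?_, ?_, ?_, ?_⟩
  · simp only [ricciOfConn, liftConn, liftConnDeriv, frameConn, frameConnDeriv, Fin.sum_univ_succ,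
      Fin.cases_zero, Fin.cases_succ]
    simp [starForm, w00, w11, w22, w10, w20, w21, v00, v11, v22, v10, v20, v21, d10, d20, d21, d22]
    field_simp
    ring
  · intro i
    fin_cases i <;>
    simp only [ricciOfConn, liftConn, liftConnDeriv, frameConn, frameConnDeriv, Fin.sum_univ_succ,
      Fin.cases_zero, Fin.cases_succ] <;>
    simp [starForm, w00, w11, w22, w10, w20, w21, v00, v11, v22, v10, v20, v21, d10, d20, d21,
      d22] <;>
    field_simp <;>
    ring
  · intro i
    fin_cases i <;>
    simp only [ricciOfConn, liftConn, liftConnDeriv, frameConn, frameConnDeriv, Fin.sum_univ_succ,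
      Fin.cases_zero, Fin.cases_succ] <;>
    simp [starForm, w00, w11, w22, w10, w20, w21, v00, v11, v22, v10, v20, v21, d10, d20, d21,
      d22] <;>
    field_simp <;>
    ring
  · intro i j
    fin_cases i <;> fin_cases j <;>
    simp only [ricciOfConn, liftConn, liftConnDeriv, frameConn, frameConnDeriv, Fin.sum_univ_succ,
      Fin.cases_zero, Fin.cases_succ] <;>
    simp [starForm, w00, w11, w22, w10, w20, w21, v00, v11, v22, v10, v20, v21, d10, d20, d21,
      d22] <;>
    field_simp <;>
    ring

/-! ### Frames adapted to a horizontally conformal submersion -/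

section Smooth

variable {E F : Type*} [NormedAddCommGroup E] [NormedSpace ℝ E] [NormedAddCommGroup F]
  [NormedSpace ℝ F] {s : Set E}

theorem differentiableAt_of_smoothOn {f : E → F} (hs : IsOpen s) (hf : ContDiffOn ℝ ∞ f s)
    {y : E} (hy : y ∈ s) : DifferentiableAt ℝ f y :=
  (hf.contDiffAt (hs.mem_nhds hy)).differentiableAt (by simp)

theorem smoothOn_fderiv_apply {f : E → F} {A : E → E} (hs : IsOpen s) (hf : ContDiffOn ℝ ∞ f s)
    (hA : ContDiffOn ℝ ∞ A s) : ContDiffOn ℝ ∞ (fun y => fderiv ℝ f y (A y)) s :=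
  (hf.fderiv_of_isOpen hs (by simp)).clm_apply hA

theorem smoothOn_lieBracket {A B : E → E} (hs : IsOpen s) (hA : ContDiffOn ℝ ∞ A s)
    (hB : ContDiffOn ℝ ∞ B s) : ContDiffOn ℝ ∞ (VectorField.lieBracket ℝ A B) s :=
  (smoothOn_fderiv_apply hs hB hA).sub (smoothOn_fderiv_apply hs hA hB)

theorem fderiv_lieBracket {f : E → ℝ} {A B : E → E} (hs : IsOpen s) (hf : ContDiffOn ℝ ∞ f s)
    (hA : ContDiffOn ℝ ∞ A s) (hB : ContDiffOn ℝ ∞ B s) {y : E} (hy : y ∈ s) :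
    fderiv ℝ f y (VectorField.lieBracket ℝ A B y)
      = fderiv ℝ (fun p => fderiv ℝ f p (B p)) y (A y)
        - fderiv ℝ (fun p => fderiv ℝ f p (A p)) y (B y) :=
  VectorField.fderiv_apply_lieBracket (hf.contDiffAt (hs.mem_nhds hy))
    (by simpa using ENat.LEInfty.out) (differentiableAt_of_smoothOn hs hB hy)
    (differentiableAt_of_smoothOn hs hA hy)

/-- Differentiate dΦ(C) = C'∘Φ along the other field: brackets of Φ-related fields are Φ-related. -/
theorem fderiv_lieBracket_related {Φ : E → F} {A B : E → E} {A' B' : F → F} {t : Set F}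
    (hs : IsOpen s) (ht : IsOpen t) (hΦ : ContDiffOn ℝ ∞ Φ s) (hm : Set.MapsTo Φ s t)
    (hA : ContDiffOn ℝ ∞ A s) (hB : ContDiffOn ℝ ∞ B s) (hA' : ContDiffOn ℝ ∞ A' t)
    (hB' : ContDiffOn ℝ ∞ B' t) (hAA' : ∀ y ∈ s, fderiv ℝ Φ y (A y) = A' (Φ y))
    (hBB' : ∀ y ∈ s, fderiv ℝ Φ y (B y) = B' (Φ y)) {y : E} (hy : y ∈ s) :
    fderiv ℝ Φ y (VectorField.lieBracket ℝ A B y) = VectorField.lieBracket ℝ A' B' (Φ y) := by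
  have key : ∀ {C : E → E} {C' : F → F}, ContDiffOn ℝ ∞ C' t →
      (∀ y ∈ s, fderiv ℝ Φ y (C y) = C' (Φ y)) → ∀ a,
      fderiv ℝ (fun p => fderiv ℝ Φ p (C p)) y a = fderiv ℝ C' (Φ y) (fderiv ℝ Φ y a) := by
    intro C C' hC' h a
    have h1 : (fun p => fderiv ℝ Φ p (C p)) =ᶠ[𝓝 y] C' ∘ Φ := by
      filter_upwards [hs.mem_nhds hy] with p hp using h p hp
    rw [h1.fderiv_eq, fderiv_comp y (differentiableAt_of_smoothOn ht hC' (hm hy))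
      (differentiableAt_of_smoothOn hs hΦ hy)]
    rfl
  rw [VectorField.fderiv_apply_lieBracket (hΦ.contDiffAt (hs.mem_nhds hy))
    (by simpa using ENat.LEInfty.out) (differentiableAt_of_smoothOn hs hB hy)
    (differentiableAt_of_smoothOn hs hA hy), key hB' hBB', key hA' hAA', hAA' y hy, hBB' y hy]
  rfl

end Smooth

theorem linearIndependent_of_orthogonal {n : ℕ} {ι : Type*} [Fintype ι] [DecidableEq ι]
    (B : Rn n →L[ℝ] Rn n →L[ℝ] ℝ) (E : ι → Rn n) (ε : ι → ℝ) (hε : ∀ i, ε i ≠ 0)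
    (h : ∀ i j, B (E i) (E j) = if i = j then ε i else 0) : LinearIndependent ℝ E := by
  rw [Fintype.linearIndependent_iff]
  intro c hc j
  have h1 : B (∑ i, c i • E i) (E j) = 0 := by rw [hc]; simp
  simp only [map_sum, map_smul, sum_apply, smul_apply, h, smul_eq_mul, mul_ite, mul_zero,
    Finset.sum_ite_eq', Finset.mem_univ, if_true, mul_eq_zero] at h1
  exact h1.resolve_right (hε j)

/-- A frame `e` of `ℝ³`, orthonormal for `H`, and its horizontal lift `X` with respect to the
submersion `Φ`, horizontally conformal with dilation `u^{-1/2}`, with vertical field `v`. -/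
structure LiftedFrame (G : Rn 4 → (Rn 4 →L[ℝ] Rn 4 →L[ℝ] ℝ)) (s : Set (Rn 4))
    (H : Rn 3 → (Rn 3 →L[ℝ] Rn 3 →L[ℝ] ℝ)) (t : Set (Rn 3)) (Φ : Rn 4 → Rn 3)
    (v : Rn 4 → Rn 4) (u : Rn 4 → ℝ) (e : Fin 3 → Rn 3 → Rn 3) (X : Fin 3 → Rn 4 → Rn 4) :
    Prop where
  metric : IsMetricOn G s
  metric' : IsMetricOn H t
  maps : Set.MapsTo Φ s t
  smooth_map : ContDiffOn ℝ ∞ Φ s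
  smooth_v : ContDiffOn ℝ ∞ v s
  smooth_u : ContDiffOn ℝ ∞ u s
  smooth_e : ∀ i, ContDiffOn ℝ ∞ (e i) t
  smooth_X : ∀ i, ContDiffOn ℝ ∞ (X i) s
  pos : ∀ y ∈ s, 0 < u y
  vert : ∀ y ∈ s, fderiv ℝ Φ y (v y) = 0
  proj : ∀ y ∈ s, ∀ i, fderiv ℝ Φ y (X i y) = e i (Φ y)
  orth : ∀ y ∈ s, ∀ i, G y (v y) (X i y) = 0
  norm_v : ∀ y ∈ s, G y (v y) (v y) = (u y)⁻¹
  norm_X : ∀ y ∈ s, ∀ i j, G y (X i y) (X j y) = if i = j then u y else 0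
  orthonormal : ∀ q ∈ t, ∀ i j, H q (e i q) (e j q) = if i = j then 1 else 0

/-- The connection coefficients of an orthonormal frame. -/
def connCoeff {n m : ℕ} (H : Rn n → (Rn n →L[ℝ] Rn n →L[ℝ] ℝ)) (e : Fin m → Rn n → Rn n)
    (i j k : Fin m) (q : Rn n) : ℝ := H q (cov H (e i) (e j) q) (e k q)

section Orthonormal

variable {n : ℕ} {H : Rn n → (Rn n →L[ℝ] Rn n →L[ℝ] ℝ)} {t : Set (Rn n)}
  {e : Fin n → Rn n → Rn n}

theorem eq_sum_of_orthonormal {B : Rn n →L[ℝ] Rn n →L[ℝ] ℝ} {e : Fin n → Rn n}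
    (ho : ∀ i j, B (e i) (e j) = if i = j then 1 else 0) (a : Rn n) :
    a = ∑ k, B a (e k) • e k := by
  rcases Nat.eq_zero_or_pos n with h0 | hn
  · subst h0; exact Subsingleton.elim _ _
  have : Nonempty (Fin n) := ⟨⟨0, hn⟩⟩
  have hli := linearIndependent_of_orthogonal B e (fun _ => 1) (fun _ => one_ne_zero) ho
  let b := basisOfLinearIndependentOfCardEqFinrank hli (by simp)
  have hb : ∀ i, b i = e i := fun i => by simp [b]
  have h1 := b.sum_repr a
  simp only [hb] at h1
  have h2 : ∀ k, B a (e k) = b.repr a k := by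
    intro k
    conv_lhs => rw [← h1]
    simp [ho]
  simp only [h2, h1]

theorem cov_orthonormal
    (ho : ∀ q ∈ t, ∀ i j, H q (e i q) (e j q) = if i = j then 1 else 0) {q : Rn n} (hq : q ∈ t)
    (i j : Fin n) : cov H (e i) (e j) q = ∑ k, connCoeff H e i j k q • e k q :=
  eq_sum_of_orthonormal (ho q hq) _

theorem IsMetricOn.connCoeff_antisymm (hH : IsMetricOn H t)
    (he : ∀ i, ContDiffOn ℝ ∞ (e i) t)
    (ho : ∀ q ∈ t, ∀ i j, H q (e i q) (e j q) = if i = j then 1 else 0) {q : Rn n} (hq : q ∈ t)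
    (i j k : Fin n) : connCoeff H e i j k q = - connCoeff H e i k j q := by
  have hd := fun i => differentiableAt_of_smoothOn hH.isOpen (he i) hq
  have h1 := hH.fderiv_metric hq (A := e i) (hd j) (hd k)
  have h2 : (fun p => H p (e j p) (e k p)) =ᶠ[𝓝 q] fun _ => if j = k then 1 else 0 := by
    filter_upwards [hH.isOpen.mem_nhds hq] with p hp using ho p hp j k
  rw [h2.fderiv_eq, hH.symm q hq (e j q)] at h1
  simp only [fderiv_fun_const, Pi.zero_apply, zero_apply] at h1
  rw [connCoeff, connCoeff]
  linarith

theorem IsMetricOn.smooth_cov (hH : IsMetricOn H t) {A B : Rn n → Rn n}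
    (hA : ContDiffOn ℝ ∞ A t) (hB : ContDiffOn ℝ ∞ B t) : ContDiffOn ℝ ∞ (cov H A B) t := by
  have h1 := (hH.smooth_christoffelL.clm_apply hA).clm_apply hB
  simp only [christoffelL_apply] at h1
  exact (smoothOn_fderiv_apply hH.isOpen hB hA).add h1

theorem IsMetricOn.smooth_connCoeff (hH : IsMetricOn H t) (he : ∀ i, ContDiffOn ℝ ∞ (e i) t)
    (i j k : Fin n) : ContDiffOn ℝ ∞ (connCoeff H e i j k) t :=
  (hH.smooth.clm_apply (hH.smooth_cov (he i) (he j))).clm_apply (he k)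

end Orthonormal

namespace LiftedFrame

variable {G : Rn 4 → (Rn 4 →L[ℝ] Rn 4 →L[ℝ] ℝ)} {s : Set (Rn 4)}
    {H : Rn 3 → (Rn 3 →L[ℝ] Rn 3 →L[ℝ] ℝ)} {t : Set (Rn 3)} {Φ : Rn 4 → Rn 3}
    {v : Rn 4 → Rn 4} {u : Rn 4 → ℝ} {e : Fin 3 → Rn 3 → Rn 3} {X : Fin 3 → Rn 4 → Rn 4}

/-- The frame `(v, X₀, X₁, X₂)`. -/
def frame (v : Rn 4 → Rn 4) (X : Fin 3 → Rn 4 → Rn 4) : Fin 4 → Rn 4 → Rn 4 := Fin.cases v X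

@[simp] theorem frame_zero : frame v X 0 = v := rfl
@[simp] theorem frame_succ (i : Fin 3) : frame v X i.succ = X i := rfl

/-- The squared lengths of the vectors of the frame. -/
def frameNorm (r : ℝ) : Fin 4 → ℝ := Fin.cases r⁻¹ fun _ => r

theorem orth' (h : LiftedFrame G s H t Φ v u e X) {y : Rn 4} (hy : y ∈ s) (i : Fin 3) :
    G y (X i y) (v y) = 0 := by rw [h.metric.symm y hy, h.orth y hy]

theorem frame_orthogonal (h : LiftedFrame G s H t Φ v u e X) {y : Rn 4} (hy : y ∈ s)
    (a b : Fin 4) :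
    G y (frame v X a y) (frame v X b y) = if a = b then frameNorm (u y) a else 0 := by
  cases a using Fin.cases <;> cases b using Fin.cases <;>
    simp [h.orth y hy, h.orth' hy, h.norm_v y hy, h.norm_X y hy, frameNorm, Fin.succ_ne_zero,
      (Fin.succ_ne_zero _).symm]

theorem smooth_frame (h : LiftedFrame G s H t Φ v u e X) (a : Fin 4) :
    ContDiffOn ℝ ∞ (frame v X a) s := by
  cases a using Fin.cases
  exacts [h.smooth_v, h.smooth_X _]

theorem linearIndependent_frame (h : LiftedFrame G s H t Φ v u e X) {y : Rn 4} (hy : y ∈ s) :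
    LinearIndependent ℝ fun a => frame v X a y := by
  refine linearIndependent_of_orthogonal (G y) _ (frameNorm (u y)) ?_ (h.frame_orthogonal hy)
  intro a
  have := (h.pos y hy).ne'
  cases a using Fin.cases <;> simp [frameNorm, this]

theorem span_frame (h : LiftedFrame G s H t Φ v u e X) {y : Rn 4} (hy : y ∈ s) :
    Submodule.span ℝ (Set.range fun a => frame v X a y) = ⊤ :=
  (h.linearIndependent_frame hy).span_eq_top_of_card_eq_finrank (by simp)

/-- Both sides are linear in `a` and agree on the frame. The functional u G(v,·) is θ, and the other
coefficients are the components of dΦ(a). -/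
theorem decomp (h : LiftedFrame G s H t Φ v u e X) {y : Rn 4} (hy : y ∈ s) (a : Rn 4) :
    a = (u y * G y (v y) a) • v y + ∑ k, H (Φ y) (fderiv ℝ Φ y a) (e k (Φ y)) • X k y := by
  have hu := (h.pos y hy).ne'
  have ha : a ∈ Submodule.span ℝ (Set.range fun a => frame v X a y) :=
    h.span_frame hy ▸ Submodule.mem_top
  induction ha using Submodule.span_induction with
  | mem x hx =>
    obtain ⟨i, rfl⟩ := hx
    cases i using Fin.cases with
    | zero => simp [h.norm_v y hy, h.vert y hy, hu]
    | succ i =>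
      simp [h.orth y hy, h.proj y hy, h.orthonormal _ (h.maps hy)]
  | zero => simp
  | add x z _ _ hx hz =>
    conv_lhs => rw [hx, hz]
    simp only [map_add, mul_add, add_smul, Finset.sum_add_distrib, add_apply]
    abel
  | smul r x _ hx =>
    conv_lhs => rw [hx]
    simp only [map_smul, smul_apply, smul_add, Finset.smul_sum, smul_smul, smul_eq_mul]
    ring_nf

/-- `θ([X_i, X_j])`. -/
def vertBracket (G : Rn 4 → (Rn 4 →L[ℝ] Rn 4 →L[ℝ] ℝ)) (v : Rn 4 → Rn 4) (u : Rn 4 → ℝ)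
    (A B : Rn 4 → Rn 4) (y : Rn 4) : ℝ := u y * G y (v y) (VectorField.lieBracket ℝ A B y)

/-- Since `v` is Φ-related to the zero field, its bracket with the projectable field `X i` is
vertical. -/
theorem lieBracket_v (h : LiftedFrame G s H t Φ v u e X) {y : Rn 4} (hy : y ∈ s) (i : Fin 3) :
    VectorField.lieBracket ℝ v (X i) y = vertBracket G v u v (X i) y • v y := by
  have h1 := h.decomp hy (VectorField.lieBracket ℝ v (X i) y)
  have h2 := fderiv_lieBracket_related (A' := 0) h.metric.isOpen h.metric'.isOpen h.smooth_map
    h.maps h.smooth_v (h.smooth_X i) contDiffOn_const (h.smooth_e i) h.vert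
    (fun y hy => h.proj y hy i) hy
  rw [VectorField.lieBracket_zero_left] at h2
  simpa [h2, vertBracket] using h1

/-- The horizontal part is the lift of [e_i,e_j], which is ∇_{e_i} e_j - ∇_{e_j} e_i. -/
theorem lieBracket_X (h : LiftedFrame G s H t Φ v u e X) {y : Rn 4} (hy : y ∈ s) (i j : Fin 3) :
    VectorField.lieBracket ℝ (X i) (X j) y = vertBracket G v u (X i) (X j) y • v y
      + ∑ k, (connCoeff H e i j k (Φ y) - connCoeff H e j i k (Φ y)) • X k y := by
  have h1 := h.decomp hy (VectorField.lieBracket ℝ (X i) (X j) y)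
  have h2 := fderiv_lieBracket_related h.metric.isOpen h.metric'.isOpen h.smooth_map
    h.maps (h.smooth_X i) (h.smooth_X j) (h.smooth_e i) (h.smooth_e j)
    (fun y hy => h.proj y hy i) (fun y hy => h.proj y hy j) hy
  rw [h2, ← h.metric'.cov_sub_cov (h.maps hy)] at h1
  simpa only [connCoeff, map_sub, sub_apply, vertBracket] using h1

/-- The connection coefficients of the lifted frame. -/
def liftedConn (G : Rn 4 → (Rn 4 →L[ℝ] Rn 4 →L[ℝ] ℝ)) (H : Rn 3 → (Rn 3 →L[ℝ] Rn 3 →L[ℝ] ℝ))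
    (Φ : Rn 4 → Rn 3) (v : Rn 4 → Rn 4) (u : Rn 4 → ℝ) (e : Fin 3 → Rn 3 → Rn 3)
    (X : Fin 3 → Rn 4 → Rn 4) (a b c : Fin 4) (y : Rn 4) : ℝ :=
  frameConn (fun i j k => connCoeff H e i j k (Φ y)) (u y) (fderiv ℝ u y (v y))
    (fun k => fderiv ℝ u y (X k y)) (fun k => vertBracket G v u v (X k) y)
    (fun i j => vertBracket G v u (X i) (X j) y) a b c

theorem vertBracket_antisymm (A B : Rn 4 → Rn 4) (y : Rn 4) :
    vertBracket G v u A B y = - vertBracket G v u B A y := by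
  rw [vertBracket, VectorField.lieBracket_swap, vertBracket]
  simp

/-- The coefficients `frameConn` reproduce the brackets and the derivatives of the inner products of
the frame, and the Levi-Civita connection is determined by these. -/
theorem cov_frame (h : LiftedFrame G s H t Φ v u e X) {y : Rn 4} (hy : y ∈ s) (a b : Fin 4) :
    cov G (frame v X a) (frame v X b) y
      = ∑ c, liftedConn G H Φ v u e X a b c y • frame v X c y := by
  have hu := (h.pos y hy).ne'
  have hs := h.metric.isOpen.mem_nhds hy
  have hdu := differentiableAt_of_smoothOn h.metric.isOpen h.smooth_u hy
  have hw := fun i j k => h.metric'.connCoeff_antisymm h.smooth_e h.orthonormal (h.maps hy) i j k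
  refine h.metric.cov_eq_of_torsion_of_metric hy
    (fun i => differentiableAt_of_smoothOn h.metric.isOpen (h.smooth_frame i) hy)
    (h.span_frame hy) ?_ ?_ a b
  · intro a b
    cases a using Fin.cases with
    | zero =>
      cases b using Fin.cases with
      | zero => simp
      | succ j =>
        rw [frame_zero, frame_succ, h.lieBracket_v hy, Fin.sum_univ_succ]
        simp [liftedConn, frameConn]
    | succ i =>
      cases b using Fin.cases with
      | zero =>
        rw [frame_zero, frame_succ, VectorField.lieBracket_swap, h.lieBracket_v hy,
          Fin.sum_univ_succ]
        simp [liftedConn, frameConn]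
      | succ j =>
        rw [frame_succ, frame_succ, h.lieBracket_X hy, Fin.sum_univ_succ (n := 3)]
        simp only [liftedConn, frameConn, Fin.cases_succ, Fin.cases_zero, frame_zero, frame_succ]
        congr 1
        · rw [vertBracket_antisymm (X j)]
          simp only [eq_comm (a := j) (b := i)]
          congr 1
          ring
        · refine Finset.sum_congr rfl fun k _ => ?_
          simp only [eq_comm (a := j) (b := i)]
          congr 1
          ring
  · intro a b c
    have h1 : (fun p => G p (frame v X b p) (frame v X c p)) =ᶠ[𝓝 y]
        fun p => if b = c then frameNorm (u p) b else 0 := by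
      filter_upwards [hs] with p hp using h.frame_orthogonal hp b c
    rw [h1.fderiv_eq]
    simp only [h.frame_orthogonal hy, mul_ite, mul_zero, Finset.sum_ite_eq, Finset.sum_ite_eq',
      Finset.mem_univ, if_true]
    have h2 : ∀ ξ, fderiv ℝ (fun p => (u p)⁻¹) y ξ = - (fderiv ℝ u y ξ) / (u y) ^ 2 := by
      intro ξ
      have h3 : HasFDerivAt (fun p => (u p)⁻¹) _ y :=
        (hasDerivAt_inv hu).comp_hasFDerivAt y hdu.hasFDerivAt
      rw [h3.fderiv]
      simp
      ring
    have hb := fun i j => vertBracket_antisymm (G := G) (v := v) (u := u) (X i) (X j) y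
    cases a using Fin.cases <;> cases b using Fin.cases <;> cases c using Fin.cases <;>
      simp only [liftedConn, frameConn, Fin.cases_succ, Fin.cases_zero, frame_zero, frame_succ,
        frameNorm, if_true, Fin.succ_ne_zero, (Fin.succ_ne_zero _).symm, if_false, h2,
        fderiv_fun_const, Pi.zero_apply, zero_apply, Fin.succ_inj]
    · field_simp
      ring
    · field_simp
      ring
    · field_simp
      ring
    · rename_i j k
      have := hb k j
      by_cases hjk : j = k
      · subst hjk
        simp only [if_true]
        field_simp
        linarith
      · simp only [hjk, Ne.symm hjk, if_false, fderiv_fun_const, Pi.zero_apply, zero_apply]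
        field_simp
        linarith
    · field_simp
      ring
    · rename_i i k
      field_simp
      ring
    · rename_i i k
      field_simp
      ring
    · rename_i i j k
      have := hw i j k
      by_cases hjk : j = k
      · subst hjk
        have h0 : connCoeff H e i j j (Φ y) = 0 := by linarith
        simp only [if_true, h0]
        field_simp
        ring
      · simp only [hjk, Ne.symm hjk, if_false, fderiv_fun_const, Pi.zero_apply, zero_apply, this]
        field_simp
        ring

end LiftedFrame

/-! ### The Ricci tensor of the total space in an adapted frame -/

theorem lieBracket_sum_right {n : ℕ} {ι : Type*} (t : Finset ι) {f : ι → Rn n → ℝ}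
    {E : ι → Rn n → Rn n} (A : Rn n → Rn n) {y : Rn n}
    (hf : ∀ i ∈ t, DifferentiableAt ℝ (f i) y) (hE : ∀ i ∈ t, DifferentiableAt ℝ (E i) y) :
    VectorField.lieBracket ℝ A (fun p => ∑ i ∈ t, f i p • E i p) y
      = ∑ i ∈ t, (fderiv ℝ (f i) y (A y) • E i y + f i y • VectorField.lieBracket ℝ A (E i) y) := by
  rw [VectorField.lieBracket_eq]
  simp only
  rw [fderiv_fun_sum fun i hi => (hf i hi).fun_smul (hE i hi)]
  simp only [map_sum, map_smul, VectorField.lieBracket_eq, smul_sub, sum_apply]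
  rw [← Finset.sum_sub_distrib]
  refine Finset.sum_congr rfl fun i hi => ?_
  rw [fderiv_fun_smul (hf i hi) (hE i hi)]
  simp
  abel

/-! ### Derivatives of the connection coefficients -/

section Derivatives

variable {E : Type*} [NormedAddCommGroup E] [NormedSpace ℝ E]

theorem fderiv_div_apply {f g : E → ℝ} {y : E} (hf : DifferentiableAt ℝ f y)
    (hg : DifferentiableAt ℝ g y) (h0 : g y ≠ 0) (ξ : E) :
    fderiv ℝ (fun p => f p / g p) y ξ
      = (fderiv ℝ f y ξ * g y - f y * fderiv ℝ g y ξ) / g y ^ 2 := by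
  have h3 : HasFDerivAt (fun p => (g p)⁻¹) _ y :=
    (hasDerivAt_inv h0).comp_hasFDerivAt y hg.hasFDerivAt
  have h4 := hf.hasFDerivAt.fun_mul h3
  have h5 : (fun p => f p / g p) = fun p => f p * (g p)⁻¹ := by
    ext p; rw [div_eq_mul_inv]
  rw [h5, h4.fderiv]
  simp
  field_simp
  ring

/-- Quotient rule, entry by entry. The hypothesis that `c` has zero derivative and the value `b = 0`
keep the derivatives of these two out of `frameConnDeriv`. -/
theorem fderiv_frameConn {w : Fin 3 → Fin 3 → Fin 3 → E → ℝ} {u c : E → ℝ} {du : Fin 3 → E → ℝ}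
    {D : Fin 3 → Fin 3 → E → ℝ} {y : E} (hw : ∀ i j k, DifferentiableAt ℝ (w i j k) y)
    (hu : DifferentiableAt ℝ u y) (hu0 : u y ≠ 0) (hc : HasFDerivAt c (0 : E →L[ℝ] ℝ) y)
    (hdu : ∀ k, DifferentiableAt ℝ (du k) y) (hD : ∀ i j, DifferentiableAt ℝ (D i j) y)
    (ξ : E) (a b d : Fin 4) :
    DifferentiableAt ℝ (fun p => frameConn (fun i j k => w i j k p) (u p) (c p)
      (fun k => du k p) 0 (fun i j => D i j p) a b d) y ∧
    fderiv ℝ (fun p => frameConn (fun i j k => w i j k p) (u p) (c p)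
      (fun k => du k p) 0 (fun i j => D i j p) a b d) y ξ
      = frameConnDeriv (fun i j k => fderiv ℝ (w i j k) y ξ) (u y) (c y) (fderiv ℝ u y ξ)
        (fun k => du k y) (fun k => fderiv ℝ (du k) y ξ) (fun i j => D i j y)
        (fun i j => fderiv ℝ (D i j) y ξ) a b d := by
  have hcd := hc.differentiableAt
  have hite : ∀ (P : Prop) [Decidable P] {f : E → ℝ}, DifferentiableAt ℝ f y →
      DifferentiableAt ℝ (fun p => if P then f p else 0) y := by
    intro P _ f hf
    split_ifs
    exacts [hf, differentiableAt_const _]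
  have hite' : ∀ (P : Prop) [Decidable P] (f : E → ℝ),
      fderiv ℝ (fun p => if P then f p else 0) y ξ = if P then fderiv ℝ f y ξ else 0 := by
    intro P _ f
    split_ifs
    exacts [rfl, by simp]
  have huc : DifferentiableAt ℝ (fun p => u p * c p) y := hu.mul hcd
  have huc' : fderiv ℝ (fun p => u p * c p) y ξ = fderiv ℝ u y ξ * c y := by
    rw [fderiv_fun_mul hu hcd, hc.fderiv]
    simp [mul_comm]
  have h2 : ∀ m : ℕ, DifferentiableAt ℝ (fun p => 2 * u p ^ m) y :=
    fun m => (hu.pow m).const_mul 2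
  have h2' : ∀ m : ℕ, fderiv ℝ (fun p => 2 * u p ^ m) y ξ
      = 2 * (m * u y ^ (m - 1) * fderiv ℝ u y ξ) := by
    intro m
    have h := (hu.hasFDerivAt.pow m).const_mul 2
    rw [h.fderiv]
    simp
  have h1 : DifferentiableAt ℝ (fun p => 2 * u p) y := hu.const_mul 2
  have h1' : fderiv ℝ (fun p => 2 * u p) y ξ = 2 * fderiv ℝ u y ξ := by
    rw [fderiv_const_mul hu]; simp
  have n0 : ∀ m : ℕ, 2 * u y ^ m ≠ 0 := fun m => mul_ne_zero two_ne_zero (pow_ne_zero _ hu0)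
  have n1 : 2 * u y ≠ 0 := mul_ne_zero two_ne_zero hu0
  have hneg : ∀ f : E → ℝ, fderiv ℝ (fun p => - f p) y ξ = - fderiv ℝ f y ξ := by
    intro f; rw [fderiv_fun_neg]; rfl
  have hdiv : ∀ {f : E → ℝ} {g : E → ℝ}, DifferentiableAt ℝ f y → DifferentiableAt ℝ g y →
      g y ≠ 0 → DifferentiableAt ℝ (fun p => f p / g p) y := by
    intro f g hf hg h0
    simp only [div_eq_mul_inv]
    exact hf.fun_mul (hg.fun_inv h0)
  cases a using Fin.cases with
  | zero =>
    cases b using Fin.cases with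
    | zero =>
      cases d using Fin.cases with
      | zero =>
        simp only [frameConn, frameConnDeriv, Fin.cases_zero, Fin.cases_succ]
        refine ⟨hdiv hcd.fun_neg h1 n1, ?_⟩
        rw [fderiv_div_apply hcd.fun_neg h1 n1, hneg, hc.fderiv, h1']
        simp
        field_simp
      | succ k =>
        simp only [frameConn, frameConnDeriv, Fin.cases_zero, Fin.cases_succ, Pi.zero_apply,
          zero_div, sub_zero]
        refine ⟨hdiv (hdu k) (h2 3) (n0 3), ?_⟩
        rw [fderiv_div_apply (hdu k) (h2 3) (n0 3), h2']
        simp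
        field_simp
    | succ j =>
      cases d using Fin.cases with
      | zero =>
        simp only [frameConn, frameConnDeriv, Fin.cases_zero, Fin.cases_succ, Pi.zero_apply,
          add_zero]
        refine ⟨hdiv (hdu j).fun_neg h1 n1, ?_⟩
        rw [fderiv_div_apply (hdu j).fun_neg h1 n1, hneg, h1']
        field_simp
        ring
      | succ k =>
        simp only [frameConn, frameConnDeriv, Fin.cases_zero, Fin.cases_succ]
        have hA := (hite (j = k) huc).fun_sub (hD j k)
        refine ⟨hdiv hA (h2 2) (n0 2), ?_⟩
        rw [fderiv_div_apply hA (h2 2) (n0 2), h2', fderiv_fun_sub (hite _ huc) (hD j k),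
          sub_apply, hite', huc']
        simp
        field_simp
  | succ i =>
    cases b using Fin.cases with
    | zero =>
      cases d using Fin.cases with
      | zero =>
        simp only [frameConn, frameConnDeriv, Fin.cases_zero, Fin.cases_succ]
        refine ⟨hdiv (hdu i).fun_neg h1 n1, ?_⟩
        rw [fderiv_div_apply (hdu i).fun_neg h1 n1, hneg, h1']
        field_simp
        ring
      | succ k =>
        simp only [frameConn, frameConnDeriv, Fin.cases_zero, Fin.cases_succ]
        have hA := (hite (i = k) huc).fun_sub (hD i k)
        refine ⟨hdiv hA (h2 2) (n0 2), ?_⟩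
        rw [fderiv_div_apply hA (h2 2) (n0 2), h2', fderiv_fun_sub (hite _ huc) (hD i k),
          sub_apply, hite', huc']
        simp
        field_simp
    | succ j =>
      cases d using Fin.cases with
      | zero =>
        simp only [frameConn, frameConnDeriv, Fin.cases_zero, Fin.cases_succ]
        have hA := (hite (i = j) huc).fun_neg.fun_add (hD i j)
        refine ⟨hdiv hA (differentiableAt_const _) two_ne_zero, ?_⟩
        rw [fderiv_div_apply hA (differentiableAt_const _) two_ne_zero,
          fderiv_fun_add (hite _ huc).fun_neg (hD i j), add_apply, hneg, hite', huc']
        simp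
        field_simp
      | succ k =>
        simp only [frameConn, frameConnDeriv, Fin.cases_zero, Fin.cases_succ]
        have hA1 := (hite (j = k) (hdu i)).fun_add (hite (i = k) (hdu j))
        have hA := hA1.fun_sub (hite (i = j) (hdu k))
        refine ⟨(hw i j k).fun_add (hdiv hA h1 n1), ?_⟩
        rw [fderiv_fun_add (hw i j k) (hdiv hA h1 n1), add_apply, fderiv_div_apply hA h1 n1,
          fderiv_fun_sub hA1 (hite (i = j) (hdu k)), sub_apply,
          fderiv_fun_add (hite (j = k) (hdu i)) (hite (i = k) (hdu j)), add_apply, hite', hite',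
          hite', h1']
        field_simp
        ring

end Derivatives

/-- A lifted frame for which `ι_V Ω = 0`, the monopole equation `d_H u = *_H Ω` holds and
`Ω ≠ 0`. -/
structure TwistorFrame (G : Rn 4 → (Rn 4 →L[ℝ] Rn 4 →L[ℝ] ℝ)) (s : Set (Rn 4))
    (H : Rn 3 → (Rn 3 →L[ℝ] Rn 3 →L[ℝ] ℝ)) (t : Set (Rn 3)) (Φ : Rn 4 → Rn 3)
    (v : Rn 4 → Rn 4) (u : Rn 4 → ℝ) (e : Fin 3 → Rn 3 → Rn 3) (X : Fin 3 → Rn 4 → Rn 4) : Prop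
    extends LiftedFrame G s H t Φ v u e X where
  basic : ∀ y ∈ s, ∀ i, LiftedFrame.vertBracket G v u v (X i) y = 0
  monopole : ∀ y ∈ s, ∀ i j, LiftedFrame.vertBracket G v u (X i) (X j) y
    = - starForm (fun k => fderiv ℝ u y (X k y)) i j
  nonzero : ∀ y ∈ s, ∃ k, fderiv ℝ u y (X k y) ≠ 0

namespace TwistorFrame

open LiftedFrame

variable {G : Rn 4 → (Rn 4 →L[ℝ] Rn 4 →L[ℝ] ℝ)} {s : Set (Rn 4)}
    {H : Rn 3 → (Rn 3 →L[ℝ] Rn 3 →L[ℝ] ℝ)} {t : Set (Rn 3)} {Φ : Rn 4 → Rn 3}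
    {v : Rn 4 → Rn 4} {u : Rn 4 → ℝ} {e : Fin 3 → Rn 3 → Rn 3} {X : Fin 3 → Rn 4 → Rn 4}

theorem lieBracket_v_X (h : TwistorFrame G s H t Φ v u e X) {y : Rn 4} (hy : y ∈ s) (i : Fin 3) :
    VectorField.lieBracket ℝ v (X i) y = 0 := by
  rw [h.lieBracket_v hy, h.basic y hy, zero_smul]

/-- The coefficients of `[X_i, X_j]` in the frame. -/
def bracketCoeff (G : Rn 4 → (Rn 4 →L[ℝ] Rn 4 →L[ℝ] ℝ)) (H : Rn 3 → (Rn 3 →L[ℝ] Rn 3 →L[ℝ] ℝ))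
    (Φ : Rn 4 → Rn 3) (v : Rn 4 → Rn 4) (u : Rn 4 → ℝ) (e : Fin 3 → Rn 3 → Rn 3)
    (X : Fin 3 → Rn 4 → Rn 4) (i j : Fin 3) : Fin 4 → Rn 4 → ℝ :=
  Fin.cases (vertBracket G v u (X i) (X j))
    fun k y => connCoeff H e i j k (Φ y) - connCoeff H e j i k (Φ y)

theorem smooth_connCoeff_comp (h : LiftedFrame G s H t Φ v u e X) (i j k : Fin 3) :
    ContDiffOn ℝ ∞ (fun y => connCoeff H e i j k (Φ y)) s :=
  (h.metric'.smooth_connCoeff h.smooth_e i j k).comp h.smooth_map h.maps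

theorem smooth_vertBracket (h : LiftedFrame G s H t Φ v u e X) {A B : Rn 4 → Rn 4}
    (hA : ContDiffOn ℝ ∞ A s) (hB : ContDiffOn ℝ ∞ B s) :
    ContDiffOn ℝ ∞ (vertBracket G v u A B) s :=
  h.smooth_u.mul ((h.metric.smooth.clm_apply h.smooth_v).clm_apply
    (smoothOn_lieBracket h.metric.isOpen hA hB))

theorem smooth_bracketCoeff (h : LiftedFrame G s H t Φ v u e X) (i j : Fin 3) (c : Fin 4) :
    ContDiffOn ℝ ∞ (bracketCoeff G H Φ v u e X i j c) s := by
  cases c using Fin.cases with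
  | zero => exact smooth_vertBracket h (h.smooth_X i) (h.smooth_X j)
  | succ k => exact (smooth_connCoeff_comp h i j k).sub (smooth_connCoeff_comp h j i k)

theorem lieBracket_X_X (h : LiftedFrame G s H t Φ v u e X) {y : Rn 4} (hy : y ∈ s) (i j : Fin 3) :
    VectorField.lieBracket ℝ (X i) (X j) y
      = ∑ c, bracketCoeff G H Φ v u e X i j c y • frame v X c y := by
  rw [h.lieBracket_X hy, Fin.sum_univ_succ (n := 3)]
  rfl

theorem lieBracket_lieBracket (h : LiftedFrame G s H t Φ v u e X) {y : Rn 4} (hy : y ∈ s)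
    (A : Rn 4 → Rn 4) (i j : Fin 3) :
    VectorField.lieBracket ℝ A (VectorField.lieBracket ℝ (X i) (X j)) y
      = ∑ c, (fderiv ℝ (bracketCoeff G H Φ v u e X i j c) y (A y) • frame v X c y
        + bracketCoeff G H Φ v u e X i j c y • VectorField.lieBracket ℝ A (frame v X c) y) := by
  have h1 : VectorField.lieBracket ℝ (X i) (X j) =ᶠ[𝓝 y]
      fun p => ∑ c, bracketCoeff G H Φ v u e X i j c p • frame v X c p := by
    filter_upwards [h.metric.isOpen.mem_nhds hy] with p hp using lieBracket_X_X h hp i j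
  rw [Filter.EventuallyEq.lieBracket_vectorField_eq (Filter.EventuallyEq.refl _ A) h1]
  exact lieBracket_sum_right _ _
    (fun c _ => differentiableAt_of_smoothOn h.metric.isOpen (smooth_bracketCoeff h i j c) hy)
    (fun c _ => differentiableAt_of_smoothOn h.metric.isOpen (h.smooth_frame c) hy)

theorem fderiv_connCoeff_comp (h : LiftedFrame G s H t Φ v u e X) {y : Rn 4} (hy : y ∈ s)
    (i j k : Fin 3) (ξ : Rn 4) : fderiv ℝ (fun y => connCoeff H e i j k (Φ y)) y ξ
      = fderiv ℝ (connCoeff H e i j k) (Φ y) (fderiv ℝ Φ y ξ) := by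
  have := fderiv_comp y (differentiableAt_of_smoothOn h.metric'.isOpen
    (h.metric'.smooth_connCoeff h.smooth_e i j k) (h.maps hy))
    (differentiableAt_of_smoothOn h.metric.isOpen h.smooth_map hy)
  exact DFunLike.congr_fun this ξ

theorem leibniz (h : LiftedFrame G s H t Φ v u e X) {A B C : Rn 4 → Rn 4}
    (hA : ContDiffOn ℝ ∞ A s) (hB : ContDiffOn ℝ ∞ B s) (hC : ContDiffOn ℝ ∞ C s) {y : Rn 4}
    (hy : y ∈ s) : VectorField.lieBracket ℝ A (VectorField.lieBracket ℝ B C) y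
      = VectorField.lieBracket ℝ (VectorField.lieBracket ℝ A B) C y
        + VectorField.lieBracket ℝ B (VectorField.lieBracket ℝ A C) y := by
  have hs := h.metric.isOpen.mem_nhds hy
  exact VectorField.leibniz_identity_lieBracket (n := ∞) (by simpa using ENat.LEInfty.out)
    (hA.contDiffAt hs) (hB.contDiffAt hs) (hC.contDiffAt hs)

/-- By Jacobi and [v,X_i] = 0 the double bracket [v,[X_i,X_j]] is zero. The horizontal coefficients
of [X_i,X_j] are pulled back from the base, hence constant along `v`, and only v(θ([X_i,X_j])) v is
left. -/
theorem fderiv_vertBracket_v (h : TwistorFrame G s H t Φ v u e X) {y : Rn 4} (hy : y ∈ s)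
    (i j : Fin 3) : fderiv ℝ (vertBracket G v u (X i) (X j)) y (v y) = 0 := by
  have h0 : ∀ i, VectorField.lieBracket ℝ v (X i) =ᶠ[𝓝 y] 0 := by
    intro i
    filter_upwards [h.metric.isOpen.mem_nhds hy] with p hp using h.lieBracket_v_X hp i
  have h1 := leibniz h.toLiftedFrame h.smooth_v (h.smooth_X i) (h.smooth_X j) hy
  rw [Filter.EventuallyEq.lieBracket_vectorField_eq (h0 i) (Filter.EventuallyEq.refl _ (X j)),
    Filter.EventuallyEq.lieBracket_vectorField_eq (Filter.EventuallyEq.refl _ (X i)) (h0 j),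
    lieBracket_lieBracket h.toLiftedFrame hy, VectorField.lieBracket_zero_left,
    VectorField.lieBracket_zero_right, Fin.sum_univ_succ] at h1
  have h2 : ∀ k : Fin 3, fderiv ℝ (bracketCoeff G H Φ v u e X i j k.succ) y (v y) = 0 := by
    intro k
    have e1 := differentiableAt_of_smoothOn h.metric.isOpen
      (smooth_connCoeff_comp h.toLiftedFrame i j k) hy
    have e2 := differentiableAt_of_smoothOn h.metric.isOpen
      (smooth_connCoeff_comp h.toLiftedFrame j i k) hy
    simp only [bracketCoeff, Fin.cases_succ]
    rw [fderiv_fun_sub e1 e2, sub_apply, fderiv_connCoeff_comp h.toLiftedFrame hy,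
      fderiv_connCoeff_comp h.toLiftedFrame hy, h.vert y hy]
    simp
  simp only [frame_zero, frame_succ, h.lieBracket_v_X hy, h2, VectorField.lieBracket_self,
    Pi.zero_apply, smul_zero, zero_smul, add_zero, Finset.sum_const_zero] at h1
  have hv : v y ≠ 0 := by
    intro hv
    have := h.norm_v y hy
    rw [hv] at this
    simp at this
    exact (h.pos y hy).ne this
  exact (smul_eq_zero.mp h1).resolve_right hv

theorem smooth_du (h : LiftedFrame G s H t Φ v u e X) (k : Fin 3) :
    ContDiffOn ℝ ∞ (fun y => fderiv ℝ u y (X k y)) s :=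
  smoothOn_fderiv_apply h.metric.isOpen h.smooth_u (h.smooth_X k)

theorem smooth_c (h : LiftedFrame G s H t Φ v u e X) :
    ContDiffOn ℝ ∞ (fun y => fderiv ℝ u y (v y)) s :=
  smoothOn_fderiv_apply h.metric.isOpen h.smooth_u h.smooth_v

/-- By the monopole equation X_k(u) is, up to sign, one of the vertical brackets, which are constant
along `v`. -/
theorem fderiv_du_v (h : TwistorFrame G s H t Φ v u e X) {y : Rn 4} (hy : y ∈ s) (k : Fin 3) :
    fderiv ℝ (fun y => fderiv ℝ u y (X k y)) y (v y) = 0 := by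
  have key : ∀ i j, (∀ a : Fin 3 → ℝ, starForm a i j = a k) →
      fderiv ℝ (fun y => fderiv ℝ u y (X k y)) y (v y) = 0 := by
    intro i j hij
    have h1 : (fun y => fderiv ℝ u y (X k y)) =ᶠ[𝓝 y] fun p => - vertBracket G v u (X i) (X j) p := by
      filter_upwards [h.metric.isOpen.mem_nhds hy] with p hp
      rw [h.monopole p hp, hij, neg_neg]
    rw [h1.fderiv_eq, fderiv_fun_neg, neg_apply, h.fderiv_vertBracket_v hy, neg_zero]
  fin_cases k
  · exact key 1 2 fun a => by simp [starForm]
  · exact key 2 0 fun a => by simp [starForm]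
  · exact key 0 1 fun a => by simp [starForm]

/-- Since [v,X_k] = 0, X_k(v(u)) = v(X_k(u)) = 0. -/
theorem fderiv_c_X (h : TwistorFrame G s H t Φ v u e X) {y : Rn 4} (hy : y ∈ s) (k : Fin 3) :
    fderiv ℝ (fun y => fderiv ℝ u y (v y)) y (X k y) = 0 := by
  have h1 := fderiv_lieBracket h.metric.isOpen h.smooth_u h.smooth_v (h.smooth_X k) hy
  rw [h.lieBracket_v_X hy, h.fderiv_du_v hy, map_zero] at h1
  linarith

/-- The function c = v(u) is killed by all X_i, hence by [X_i,X_j], whose vertical part is a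
multiple of `v`. Choosing i, j with X_k(u) ≠ 0 for the complementary index k gives v(c) = 0; the
non-vanishing of Ω is essential here. -/
theorem fderiv_c (h : TwistorFrame G s H t Φ v u e X) {y : Rn 4} (hy : y ∈ s) :
    fderiv ℝ (fun y => fderiv ℝ u y (v y)) y = 0 := by
  have hv : fderiv ℝ (fun y => fderiv ℝ u y (v y)) y (v y) = 0 := by
    obtain ⟨k, hk⟩ := h.nonzero y hy
    have key : ∀ i j, (∀ a : Fin 3 → ℝ, starForm a i j = a k) →
        fderiv ℝ (fun y => fderiv ℝ u y (v y)) y (v y) = 0 := by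
      intro i j hij
      have h1 := fderiv_lieBracket h.metric.isOpen (smooth_c h.toLiftedFrame)
        (h.smooth_X i) (h.smooth_X j) hy
      have h0 : ∀ l, (fun p => fderiv ℝ (fun y => fderiv ℝ u y (v y)) p (X l p)) =ᶠ[𝓝 y]
          fun _ => 0 := by
        intro l
        filter_upwards [h.metric.isOpen.mem_nhds hy] with p hp using h.fderiv_c_X hp l
      rw [(h0 i).fderiv_eq, (h0 j).fderiv_eq, h.lieBracket_X hy, map_add, map_sum, map_smul,
        h.monopole y hy, hij] at h1
      simp only [map_smul, h.fderiv_c_X hy, smul_zero, Finset.sum_const_zero, add_zero,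
        fderiv_fun_const, Pi.zero_apply, zero_apply, sub_zero, smul_eq_mul, mul_zero] at h1
      exact (mul_eq_zero.mp h1).resolve_left (neg_ne_zero.mpr hk)
    fin_cases k
    · exact key 1 2 fun a => by simp [starForm]
    · exact key 2 0 fun a => by simp [starForm]
    · exact key 0 1 fun a => by simp [starForm]
  ext ξ
  rw [h.decomp hy ξ, map_add, map_sum, map_smul, hv]
  simp only [map_smul, h.fderiv_c_X hy]
  simp

theorem comm_du (h : TwistorFrame G s H t Φ v u e X) {y : Rn 4} (hy : y ∈ s) (m k : Fin 3) :
    fderiv ℝ (fun y => fderiv ℝ u y (X k y)) y (X m y)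
      - fderiv ℝ (fun y => fderiv ℝ u y (X m y)) y (X k y)
      = ∑ l, (connCoeff H e m k l (Φ y) - connCoeff H e k m l (Φ y)) * fderiv ℝ u y (X l y)
        - starForm (fun k => fderiv ℝ u y (X k y)) m k * fderiv ℝ u y (v y) := by
  rw [← fderiv_lieBracket h.metric.isOpen h.smooth_u (h.smooth_X m) (h.smooth_X k) hy,
    h.lieBracket_X hy, map_add, map_sum, map_smul, h.monopole y hy]
  simp only [map_smul, smul_eq_mul]
  ring

/-- The θ-component of the Jacobi identity for X_0, X_1, X_2 is dΩ = 0; with Ω = ∗d_H u it says that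
d_H u is divergence-free. -/
theorem div_du (h : TwistorFrame G s H t Φ v u e X) {y : Rn 4} (hy : y ∈ s) :
    ∑ m, fderiv ℝ (fun y => fderiv ℝ u y (X m y)) y (X m y)
      = ∑ m, ∑ l, connCoeff H e m m l (Φ y) * fderiv ℝ u y (X l y) := by
  have hw := fun i j k => h.metric'.connCoeff_antisymm h.smooth_e h.orthonormal (h.maps hy) i j k
  have h1 := leibniz h.toLiftedFrame (h.smooth_X 0) (h.smooth_X 1) (h.smooth_X 2) hy
  rw [VectorField.lieBracket_swap (V := VectorField.lieBracket ℝ (X 0) (X 1)),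
    lieBracket_lieBracket h.toLiftedFrame hy, lieBracket_lieBracket h.toLiftedFrame hy,
    lieBracket_lieBracket h.toLiftedFrame hy] at h1
  -- θ of a double bracket: the derivative of the vertical coefficient plus the vertical parts of
  -- the [X_k,X_l]; the term with [X_k,v] drops out.
  have hθ : ∀ i j k, u y * G y (v y) (∑ c, (fderiv ℝ (bracketCoeff G H Φ v u e X i j c) y (X k y)
      • frame v X c y + bracketCoeff G H Φ v u e X i j c y
      • VectorField.lieBracket ℝ (X k) (frame v X c) y))
      = fderiv ℝ (vertBracket G v u (X i) (X j)) y (X k y)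
        + ∑ l, (connCoeff H e i j l (Φ y) - connCoeff H e j i l (Φ y))
          * vertBracket G v u (X k) (X l) y := by
    intro i j k
    have hvv := h.norm_v y hy
    have hu := (h.pos y hy).ne'
    have hb : VectorField.lieBracket ℝ (X k) v y = 0 := by
      rw [VectorField.lieBracket_swap, h.lieBracket_v_X hy, neg_zero]
    rw [Fin.sum_univ_succ]
    simp only [frame_zero, frame_succ, hb, smul_zero, add_zero, map_add, map_sum, map_smul,
      h.orth y hy, hvv, smul_eq_mul, mul_zero, zero_add, bracketCoeff, Fin.cases_zero,
      Fin.cases_succ, vertBracket]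
    rw [mul_add, Finset.mul_sum, mul_left_comm, mul_inv_cancel₀ hu, mul_one]
    congr 1
    refine Finset.sum_congr rfl fun l _ => ?_
    ring
  have h2 := congrArg (fun z => u y * G y (v y) z) h1
  simp only [map_add, map_neg, mul_add, mul_neg, hθ] at h2
  have hD : ∀ i j, vertBracket G v u (X i) (X j) =ᶠ[𝓝 y]
      fun p => - starForm (fun k => fderiv ℝ u p (X k p)) i j := by
    intro i j
    filter_upwards [h.metric.isOpen.mem_nhds hy] with p hp using h.monopole p hp i j
  rw [(hD 1 2).fderiv_eq, (hD 0 1).fderiv_eq, (hD 0 2).fderiv_eq] at h2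
  simp only [h.monopole y hy] at h2
  simp only [starForm, Matrix.cons_val, Fin.sum_univ_three, fderiv_fun_neg, neg_apply, neg_neg]
    at h2
  simp only [Fin.sum_univ_three]
  have w00 : ∀ i, connCoeff H e i 0 0 (Φ y) = 0 := fun i => by linarith [hw i 0 0]
  have w11 : ∀ i, connCoeff H e i 1 1 (Φ y) = 0 := fun i => by linarith [hw i 1 1]
  have w22 : ∀ i, connCoeff H e i 2 2 (Φ y) = 0 := fun i => by linarith [hw i 2 2]
  simp only [w00, w11, w22, hw _ 1 0, hw _ 2 0, hw _ 2 1] at h2 ⊢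
  linarith

theorem ricci (h : TwistorFrame G s H t Φ v u e X) {y : Rn 4} (hy : y ∈ s) :
    modelRicci G y (v y) (v y) = 0 ∧ (∀ i, modelRicci G y (v y) (X i y) = 0) ∧
    (∀ i, modelRicci G y (X i y) (v y) = 0) ∧
    ∀ i j, modelRicci G y (X i y) (X j y) = modelRicci H (Φ y) (e i (Φ y)) (e j (Φ y))
      - if i = j then fderiv ℝ u y (v y) ^ 2 / 2 else 0 := by
  have hu := (h.pos y hy).ne'
  have hs := h.metric.isOpen.mem_nhds hy
  have hw := fun i j k => h.metric'.connCoeff_antisymm h.smooth_e h.orthonormal (h.maps hy) i j k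
  let w : Fin 3 → Fin 3 → Fin 3 → Rn 4 → ℝ := fun i j k p => connCoeff H e i j k (Φ p)
  let du : Fin 3 → Rn 4 → ℝ := fun k p => fderiv ℝ u p (X k p)
  let c : Rn 4 → ℝ := fun p => fderiv ℝ u p (v p)
  let D : Fin 3 → Fin 3 → Rn 4 → ℝ := fun i j => vertBracket G v u (X i) (X j)
  let K : Fin 4 → Fin 4 → Fin 4 → Rn 4 → ℝ := fun a b d p =>
    frameConn (fun i j k => w i j k p) (u p) (c p) (fun k => du k p) 0 (fun i j => D i j p) a b d
  have hcov : ∀ p ∈ s, ∀ a b, cov G (frame v X a) (frame v X b) p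
      = ∑ d, K a b d p • frame v X d p := by
    intro p hp a b
    rw [h.cov_frame hp]
    refine Finset.sum_congr rfl fun d _ => ?_
    simp only [liftedConn, K, h.basic p hp]
    rfl
  have hD : ∀ i j, D i j =ᶠ[𝓝 y] fun p => - starForm (fun k => du k p) i j := by
    intro i j
    filter_upwards [hs] with p hp using h.monopole p hp i j
  have hdu : ∀ k, DifferentiableAt ℝ (du k) y := fun k =>
    differentiableAt_of_smoothOn h.metric.isOpen (smooth_du h.toLiftedFrame k) hy
  have hD' : ∀ i j ξ, fderiv ℝ (D i j) y ξ = - starForm (fun k => fderiv ℝ (du k) y ξ) i j := by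
    intro i j ξ
    rw [(hD i j).fderiv_eq]
    fin_cases i <;> fin_cases j <;> simp [starForm]
  have hK := fderiv_frameConn (w := w) (u := u) (c := c) (du := du) (D := D) (y := y)
    (fun i j k => differentiableAt_of_smoothOn h.metric.isOpen
      (smooth_connCoeff_comp h.toLiftedFrame i j k) hy)
    (differentiableAt_of_smoothOn h.metric.isOpen h.smooth_u hy) hu
    (by
      have := (differentiableAt_of_smoothOn h.metric.isOpen
        (smooth_c h.toLiftedFrame) hy).hasFDerivAt
      rwa [h.fderiv_c hy] at this)
    hdu (fun i j => differentiableAt_of_smoothOn h.metric.isOpen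
      (smooth_vertBracket h.toLiftedFrame (h.smooth_X i) (h.smooth_X j)) hy)
  have hR := fun b d => h.metric.modelRicci_frame (K := K) h.smooth_frame hcov hy
    (fun a b d => (hK 0 a b d).1) (h.linearIndependent_frame hy) b d
  let w₀ : Fin 3 → Fin 3 → Fin 3 → ℝ := fun i j k => w i j k y
  let w₁ : Fin 3 → Fin 3 → Fin 3 → Fin 3 → ℝ :=
    fun m i j k => fderiv ℝ (connCoeff H e i j k) (Φ y) (e m (Φ y))
  let du₀ : Fin 3 → ℝ := fun k => du k y
  let ddu : Fin 3 → Fin 3 → ℝ := fun m k => fderiv ℝ (du k) y (X m y)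
  have hK0 : ∀ a b d, K a b d y = liftConn w₀ (u y) (c y) du₀ a b d := by
    intro a b d
    simp only [K, liftConn, (hD _ _).eq_of_nhds]
    rfl
  have hw1 : ∀ i j k ξ, fderiv ℝ (w i j k) y ξ
      = fderiv ℝ (connCoeff H e i j k) (Φ y) (fderiv ℝ Φ y ξ) :=
    fun i j k ξ => fderiv_connCoeff_comp h.toLiftedFrame hy i j k ξ
  have hK1 : ∀ m a b d, fderiv ℝ (K a b d) y (frame v X m y)
      = liftConnDeriv w₁ (u y) (c y) du₀ ddu m a b d := by
    intro m a b d
    rw [(hK _ a b d).2]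
    simp only [hD', hw1, (hD _ _).eq_of_nhds]
    cases m using Fin.cases with
    | zero =>
      simp only [frame_zero, h.vert y hy, map_zero, liftConnDeriv, Fin.cases_zero]
      have e1 : ∀ k, fderiv ℝ (du k) y (v y) = 0 := h.fderiv_du_v hy
      simp only [e1]
      -- Along `v` the X_k(u) do not change, so neither do the vertical brackets: this is the entry
      -- `0` for `D'` in `liftConnDeriv`.
      have e2 : (fun i j => - starForm (fun _ => (0 : ℝ)) i j) = 0 := by
        ext i j
        fin_cases i <;> fin_cases j <;> simp [starForm]
      rw [e2]
      rfl
    | succ m =>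
      simp only [frame_succ, h.proj y hy, liftConnDeriv, Fin.cases_succ]
      rfl
  have hR' : ∀ b d, modelRicci G y (frame v X b y) (frame v X d y)
      = ricciOfConn (liftConn w₀ (u y) (c y) du₀) (liftConnDeriv w₁ (u y) (c y) du₀ ddu) b d := by
    intro b d
    rw [hR b d, ricciOfConn]
    simp only [hK0, hK1]
  have hN : ∀ i j, modelRicci H (Φ y) (e i (Φ y)) (e j (Φ y)) = ricciOfConn w₀ w₁ i j := by
    intro i j
    have hq := h.maps hy
    rw [h.metric'.modelRicci_frame (K := connCoeff H e) h.smooth_e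
      (fun q hq i j => cov_orthonormal h.orthonormal hq i j) hq
      (fun i j k => differentiableAt_of_smoothOn h.metric'.isOpen
        (h.metric'.smooth_connCoeff h.smooth_e i j k) hq)
      (linearIndependent_of_orthogonal (H (Φ y)) _ (fun _ => 1) (fun _ => one_ne_zero)
        (h.orthonormal _ hq))]
    rfl
  have hw' : ∀ m i j k, w₁ m i j k = - w₁ m i k j := by
    intro m i j k
    have : connCoeff H e i j k =ᶠ[𝓝 (Φ y)] fun q => - connCoeff H e i k j q := by
      filter_upwards [h.metric'.isOpen.mem_nhds (h.maps hy)] with q hq using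
        h.metric'.connCoeff_antisymm h.smooth_e h.orthonormal hq i j k
    simp only [w₁]
    rw [this.fderiv_eq, fderiv_fun_neg, neg_apply]
  obtain ⟨r1, r2, r3, r4⟩ := ricciOfConn_lift w₀ w₁ (u y) (c y) du₀ ddu hu hw hw'
    (fun m k => h.comm_du hy m k) (h.div_du hy)
  refine ⟨?_, ?_, ?_, ?_⟩
  · exact (hR' 0 0).trans r1
  · exact fun i => (hR' 0 i.succ).trans (r2 i)
  · exact fun i => (hR' i.succ 0).trans (r3 i)
  · intro i j
    rw [hN]
    exact (hR' i.succ j.succ).trans (r4 i j)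

end TwistorFrame

/-! ### The Laplacian: traces, invariance, and the frame formula -/

section Trace

variable {n : ℕ}

/-- The trace of the bilinear form `Q` with respect to the metric `B`. -/
def bilinTrace (B Q : Rn n →L[ℝ] Rn n →L[ℝ] ℝ) : ℝ :=
  LinearMap.trace ℝ (Rn n) ((B.inverse ∘L Q : Rn n →L[ℝ] Rn n) : Rn n →ₗ[ℝ] Rn n)

/-- Both sides are the trace of B⁻¹Q; the trace form is the one that can be compared in different
bases. -/
theorem sum_modelInv_mul (G : Rn n → (Rn n →L[ℝ] Rn n →L[ℝ] ℝ)) (y : Rn n)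
    (Q : Rn n →L[ℝ] Rn n →L[ℝ] ℝ) :
    ∑ i : Fin n, ∑ j : Fin n, modelInv G y i j *
      Q (EuclideanSpace.single i (1 : ℝ)) (EuclideanSpace.single j (1 : ℝ))
      = bilinTrace (G y) Q := by
  rw [bilinTrace, LinearMap.trace_eq_matrix_trace ℝ (EuclideanSpace.basisFun (Fin n) ℝ).toBasis]
  simp only [Matrix.trace, Matrix.diag, LinearMap.toMatrix_apply]
  refine Finset.sum_congr rfl fun i _ => ?_
  have h1 : Q (EuclideanSpace.single i (1 : ℝ)) = ∑ j, Q (EuclideanSpace.single i (1 : ℝ))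
      (EuclideanSpace.single j (1 : ℝ)) • (EuclideanSpace.proj j : Rn n →L[ℝ] ℝ) := by
    ext w
    have hw : w = ∑ j, w j • EuclideanSpace.single j (1 : ℝ) := by
      have := (EuclideanSpace.basisFun (Fin n) ℝ).sum_repr w
      simpa using this.symm
    conv_lhs => rw [hw]
    simp [mul_comm]
  simp only [OrthonormalBasis.coe_toBasis, EuclideanSpace.basisFun_apply,
    ContinuousLinearMap.coe_coe, ContinuousLinearMap.comp_apply]
  conv_rhs => rw [h1]
  simp [modelInv, mul_comm]

/-- B'⁻¹Q' is the conjugate of B⁻¹Q by `A`. -/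
theorem bilinTrace_comp {B B' Q Q' : Rn n →L[ℝ] Rn n →L[ℝ] ℝ} (hB : B.IsInvertible)
    {A : Rn n →L[ℝ] Rn n} (hA : A.IsInvertible) (hBB' : ∀ u w, B' u w = B (A u) (A w))
    (hQQ' : ∀ u w, Q' u w = Q (A u) (A w)) : bilinTrace B' Q' = bilinTrace B Q := by
  obtain ⟨e, rfl⟩ := hA
  have hB' : B'.IsInvertible := by
    obtain ⟨b, rfl⟩ := hB
    refine ⟨(e.trans b).trans (e.arrowCongr (ContinuousLinearEquiv.refl ℝ ℝ)).symm, ?_⟩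
    ext u w
    rw [hBB']
    simp
  have key : ∀ u, (B.inverse ∘L Q) (e u) = e ((B'.inverse ∘L Q') u) := by
    intro u
    have h1 : B (e ((B'.inverse ∘L Q') u)) = Q (e u) := by
      ext w
      obtain ⟨w, rfl⟩ := e.surjective w
      have h2 := DFunLike.congr_fun (hB'.self_apply_inverse (Q' u)) w
      rw [hBB', hQQ'] at h2
      exact h2
    rw [ContinuousLinearMap.comp_apply, ← h1, hB.inverse_apply_self]
  rw [bilinTrace, bilinTrace, ← LinearMap.trace_conj' _ e.toLinearEquiv]
  congr 1
  refine LinearMap.ext fun u => ?_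
  have := key (e.symm u)
  simp only [ContinuousLinearEquiv.apply_symm_apply] at this
  exact this.symm

/-- In an orthogonal basis the i-th coordinate of a vector w is (ε_i)⁻¹ B(w, E_i). -/
theorem bilinTrace_frame {B : Rn n →L[ℝ] Rn n →L[ℝ] ℝ} (hB : B.IsInvertible)
    (hsymm : ∀ u w, B u w = B w u) (Q : Rn n →L[ℝ] Rn n →L[ℝ] ℝ)
    {E : Fin n → Rn n} {ε : Fin n → ℝ} (hε : ∀ i, ε i ≠ 0)
    (hE : ∀ i j, B (E i) (E j) = if i = j then ε i else 0) :
    bilinTrace B Q = ∑ a, (ε a)⁻¹ * Q (E a) (E a) := by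
  rcases Nat.eq_zero_or_pos n with h0 | hn
  · subst h0
    simp [bilinTrace, LinearMap.trace_eq_matrix_trace ℝ
      (EuclideanSpace.basisFun (Fin 0) ℝ).toBasis, Matrix.trace]
  have : Nonempty (Fin n) := ⟨⟨0, hn⟩⟩
  have hli := linearIndependent_of_orthogonal B E ε hε hE
  let b := basisOfLinearIndependentOfCardEqFinrank hli (by simp)
  have hb : ∀ i, b i = E i := fun i => by simp [b]
  have hrepr : ∀ w i, b.repr w i = (ε i)⁻¹ * B w (E i) := by
    intro w i
    conv_rhs => rw [← b.sum_repr w]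
    simp only [hb, map_sum, map_smul, sum_apply, smul_apply, hE, smul_eq_mul, mul_ite, mul_zero,
      Finset.sum_ite_eq', Finset.mem_univ, if_true]
    field_simp [hε i]
  rw [bilinTrace, LinearMap.trace_eq_matrix_trace ℝ b]
  simp only [Matrix.trace, Matrix.diag, LinearMap.toMatrix_apply]
  refine Finset.sum_congr rfl fun i _ => ?_
  rw [hrepr, hb]
  simp only [ContinuousLinearMap.coe_coe, ContinuousLinearMap.comp_apply]
  rw [hB.self_apply_inverse]

/-- The Hessian as a bilinear map. -/
def hessianL (G : Rn n → (Rn n →L[ℝ] Rn n →L[ℝ] ℝ)) (f : Rn n → ℝ) (y : Rn n) :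
    Rn n →L[ℝ] Rn n →L[ℝ] ℝ :=
  fderiv ℝ (fderiv ℝ f) y
    - (ContinuousLinearMap.compL ℝ (Rn n) (Rn n) ℝ (fderiv ℝ f y)).comp (christoffelL G y)

@[simp] theorem hessianL_apply (G : Rn n → (Rn n →L[ℝ] Rn n →L[ℝ] ℝ)) (f : Rn n → ℝ)
    (y u v : Rn n) : hessianL G f y u v = modelHessian G f y u v := by
  simp [hessianL, modelHessian]

theorem modelLaplacian_eq_bilinTrace (G : Rn n → (Rn n →L[ℝ] Rn n →L[ℝ] ℝ)) (f : Rn n → ℝ)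
    (y : Rn n) : modelLaplacian G f y = bilinTrace (G y) (hessianL G f y) := by
  rw [← sum_modelInv_mul]
  simp only [modelLaplacian, hessianL_apply]

end Trace

section Invariance

variable {n m : ℕ}

theorem fderiv_fderiv_comp {f : Rn m → ℝ} {τ : Rn n → Rn m} {y : Rn n}
    (hf : ContDiffAt ℝ 2 f (τ y)) (hτ : ContDiffAt ℝ 2 τ y) (a b : Rn n) :
    fderiv ℝ (fderiv ℝ (f ∘ τ)) y a b
      = fderiv ℝ (fderiv ℝ f) (τ y) (fderiv ℝ τ y a) (fderiv ℝ τ y b)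
        + fderiv ℝ f (τ y) (fderiv ℝ (fderiv ℝ τ) y a b) := by
  have hf' : ∀ᶠ p in 𝓝 y, DifferentiableAt ℝ f (τ p) := by
    have h1 : ∀ᶠ q in 𝓝 (τ y), DifferentiableAt ℝ f q :=
      (hf.eventually (by simp)).mono fun q hq => hq.differentiableAt (by simp)
    exact hτ.continuousAt.eventually h1
  have hτ' : ∀ᶠ p in 𝓝 y, DifferentiableAt ℝ τ p :=
    (hτ.eventually (by simp)).mono fun q hq => hq.differentiableAt (by simp)
  have h1 : fderiv ℝ (f ∘ τ) =ᶠ[𝓝 y] fun p => (fderiv ℝ f (τ p)).comp (fderiv ℝ τ p) := by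
    filter_upwards [hf', hτ'] with p h1 h2 using fderiv_comp p h1 h2
  have d1 : DifferentiableAt ℝ (fderiv ℝ f) (τ y) :=
    (hf.fderiv_right (m := 1) (by norm_num)).differentiableAt (by simp)
  have d2 : DifferentiableAt ℝ (fderiv ℝ τ) y :=
    (hτ.fderiv_right (m := 1) (by norm_num)).differentiableAt (by simp)
  have d3 := hτ.differentiableAt (by simp)
  have h2 := (d1.hasFDerivAt.comp y d3.hasFDerivAt).clm_comp d2.hasFDerivAt
  rw [h1.fderiv_eq]
  erw [h2.fderiv]
  simp [add_comm]

variable {G : Rn n → (Rn n →L[ℝ] Rn n →L[ℝ] ℝ)} {G' : Rn n → (Rn n →L[ℝ] Rn n →L[ℝ] ℝ)}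
  {s s' : Set (Rn n)} {τ : Rn n → Rn n}

/-- The transformation law of the Christoffel symbols, tested against vectors dτ(w), which are all
vectors. Differentiating the pull-back relation brings in D²τ, and its symmetry makes all but one of
these terms cancel. -/
theorem christoffel_pullback (hG : IsMetricOn G s) (hG' : IsMetricOn G' s')
    (hτ : ContDiffOn ℝ ∞ τ s') (hm : Set.MapsTo τ s' s)
    (hpull : ∀ y ∈ s', ∀ u w, G' y u w = G (τ y) (fderiv ℝ τ y u) (fderiv ℝ τ y w))
    {y : Rn n} (hy : y ∈ s') (hsurj : Function.Surjective (fderiv ℝ τ y)) (u v : Rn n) :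
    fderiv ℝ τ y (christoffel G' y u v) = fderiv ℝ (fderiv ℝ τ) y u v
      + christoffel G (τ y) (fderiv ℝ τ y u) (fderiv ℝ τ y v) := by
  have hs := hG'.isOpen.mem_nhds hy
  have dτ := differentiableAt_of_smoothOn hG'.isOpen hτ hy
  have ddτ : DifferentiableAt ℝ (fderiv ℝ τ) y :=
    differentiableAt_of_smoothOn hG'.isOpen (hτ.fderiv_of_isOpen hG'.isOpen (by simp)) hy
  have hsym : IsSymmSndFDerivAt ℝ τ y :=
    (hτ.contDiffAt hs).isSymmSndFDerivAt (by simpa using ENat.LEInfty.out)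
  have dG := (hG.differentiableAt (hm hy))
  have hD : ∀ a b c, fderiv ℝ G' y a b c
      = fderiv ℝ G (τ y) (fderiv ℝ τ y a) (fderiv ℝ τ y b) (fderiv ℝ τ y c)
        + G (τ y) (fderiv ℝ (fderiv ℝ τ) y a b) (fderiv ℝ τ y c)
        + G (τ y) (fderiv ℝ τ y b) (fderiv ℝ (fderiv ℝ τ) y a c) := by
    intro a b c
    have e1 := fderiv_bilin (hG'.differentiableAt hy) (differentiableAt_const b)
      (differentiableAt_const c) a
    simp only [fderiv_fun_const, Pi.zero_apply, zero_apply, map_zero, add_zero] at e1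
    have e2 : (fun p => G' p b c) =ᶠ[𝓝 y]
        fun p => (G ∘ τ) p (fderiv ℝ τ p b) (fderiv ℝ τ p c) := by
      filter_upwards [hs] with p hp using hpull p hp b c
    have dcl : ∀ b, HasFDerivAt (fun p => fderiv ℝ τ p b) ((fderiv ℝ (fderiv ℝ τ) y).flip b) y := by
      intro b
      have := ddτ.hasFDerivAt.clm_apply (hasFDerivAt_const b y)
      exact this.congr_fderiv (by ext; simp)
    rw [← e1, e2.fderiv_eq, fderiv_bilin (dG.comp y dτ) (dcl b).differentiableAt
      (dcl c).differentiableAt, (dcl b).fderiv, (dcl c).fderiv, fderiv_comp y dG dτ]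
    simp
  apply hG.ext_of_apply (hm hy)
  intro w
  obtain ⟨w, rfl⟩ := hsurj w
  rw [← hpull y hy, hG'.christoffel_spec hy, hD, hD, hD, map_add, add_apply,
    hG.christoffel_spec (hm hy), hsym.eq v u, hsym.eq w u, hsym.eq w v,
    hG.symm _ (hm hy) (fderiv ℝ τ y v) (fderiv ℝ (fderiv ℝ τ) y u w)]
  ring

/-- The term with D²τ in the chain rule cancels the inhomogeneous term in the law for Γ, so the
Hessian is a tensor, and its trace is invariant. -/
theorem modelLaplacian_pullback (hG : IsMetricOn G s) (hG' : IsMetricOn G' s')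
    (hτ : ContDiffOn ℝ ∞ τ s') (hm : Set.MapsTo τ s' s)
    (hpull : ∀ y ∈ s', ∀ u w, G' y u w = G (τ y) (fderiv ℝ τ y u) (fderiv ℝ τ y w))
    {y : Rn n} (hy : y ∈ s') (hinv : (fderiv ℝ τ y).IsInvertible) {f : Rn n → ℝ}
    (hf : ContDiffAt ℝ 2 f (τ y)) :
    modelLaplacian G' (f ∘ τ) y = modelLaplacian G f (τ y) := by
  have hs := hG'.isOpen.mem_nhds hy
  have hτ2 : ContDiffAt ℝ 2 τ y := (hτ.contDiffAt hs).of_le (by simpa using ENat.LEInfty.out)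
  rw [modelLaplacian_eq_bilinTrace, modelLaplacian_eq_bilinTrace]
  refine bilinTrace_comp (hG.invertible (hm hy)) hinv (hpull y hy) fun u w => ?_
  simp only [hessianL_apply, modelHessian]
  rw [fderiv_fderiv_comp hf hτ2, fderiv_comp y (hf.differentiableAt (by simp))
    (hτ2.differentiableAt (by simp)), ContinuousLinearMap.comp_apply,
    christoffel_pullback hG hG' hτ hm hpull hy hinv.bijective.surjective]
  simp
  ring

theorem modelHessian_field {f : Rn n → ℝ} {y : Rn n} (hf : ContDiffAt ℝ 2 f y)
    {A B : Rn n → Rn n} (hB : DifferentiableAt ℝ B y) :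
    modelHessian G f y (A y) (B y)
      = fderiv ℝ (fun p => fderiv ℝ f p (B p)) y (A y) - fderiv ℝ f y (cov G A B y) := by
  have d1 : DifferentiableAt ℝ (fderiv ℝ f) y :=
    (hf.fderiv_right (m := 1) (by norm_num)).differentiableAt (by simp)
  have h2 := d1.hasFDerivAt.clm_apply hB.hasFDerivAt
  rw [h2.fderiv, modelHessian, cov]
  simp

end Invariance

namespace LiftedFrame

variable {G : Rn 4 → (Rn 4 →L[ℝ] Rn 4 →L[ℝ] ℝ)} {s : Set (Rn 4)}
    {H : Rn 3 → (Rn 3 →L[ℝ] Rn 3 →L[ℝ] ℝ)} {t : Set (Rn 3)} {Φ : Rn 4 → Rn 3}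
    {v : Rn 4 → Rn 4} {u : Rn 4 → ℝ} {e : Fin 3 → Rn 3 → Rn 3} {X : Fin 3 → Rn 4 → Rn 4}

/-- Trace of the Hessian over the frame, with weight u on `v` and 1/u on the X_i. The gradient of u
enters through ∇_v v and through the three ∇_{X_i} X_i with opposite signs and cancels exactly
because g(v,v) = 1/u; only θ([v,X_k]) remains. -/
theorem modelLaplacian_comp (h : LiftedFrame G s H t Φ v u e X) {y : Rn 4} (hy : y ∈ s)
    {f : Rn 3 → ℝ} (hf : ContDiffAt ℝ 2 f (Φ y)) :
    u y * modelLaplacian G (f ∘ Φ) y = modelLaplacian H f (Φ y)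
      + ∑ k, vertBracket G v u v (X k) y * fderiv ℝ f (Φ y) (e k (Φ y)) := by
  have hu := (h.pos y hy).ne'
  have hs := h.metric.isOpen.mem_nhds hy
  have hq := h.maps hy
  have hΦ2 : ContDiffAt ℝ 2 Φ y :=
    (h.smooth_map.contDiffAt hs).of_le (by simpa using ENat.LEInfty.out)
  have hfΦ : ContDiffAt ℝ 2 (f ∘ Φ) y := hf.comp y hΦ2
  have hfn : ∀ᶠ q in 𝓝 (Φ y), DifferentiableAt ℝ f q :=
    (hf.eventually (by simp)).mono fun q hq => hq.differentiableAt (by simp)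
  have hΦf : ∀ᶠ p in 𝓝 y, DifferentiableAt ℝ f (Φ p) := hΦ2.continuousAt.eventually hfn
  have hd : ∀ ξ, fderiv ℝ (f ∘ Φ) y ξ = fderiv ℝ f (Φ y) (fderiv ℝ Φ y ξ) := by
    intro ξ
    rw [fderiv_comp y hfn.self_of_nhds (hΦ2.differentiableAt (by simp))]
    rfl
  have dE := fun a => differentiableAt_of_smoothOn h.metric.isOpen (h.smooth_frame a) hy
  have de := fun a => differentiableAt_of_smoothOn h.metric'.isOpen (h.smooth_e a) hq
  have hev : ∀ (A : Rn 4 → Rn 4) (A' : Rn 3 → Rn 3), (∀ p ∈ s, fderiv ℝ Φ p (A p) = A' (Φ p)) →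
      (fun p => fderiv ℝ (f ∘ Φ) p (A p)) =ᶠ[𝓝 y] (fun q => fderiv ℝ f q (A' q)) ∘ Φ := by
    intro A A' hA
    filter_upwards [hs, hΦf] with p hp hfp
    rw [fderiv_comp p hfp (differentiableAt_of_smoothOn h.metric.isOpen h.smooth_map hp)]
    simp [hA p hp]
  have hvv : modelHessian G (f ∘ Φ) y (v y) (v y) = - fderiv ℝ f (Φ y) (fderiv ℝ Φ y (cov G v v y)) := by
    rw [modelHessian_field (A := v) (B := v) hfΦ (dE 0), hd,
      (hev v 0 fun p hp => by simpa using h.vert p hp).fderiv_eq]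
    have : (fun q => fderiv ℝ f q ((0 : Rn 3 → Rn 3) q)) ∘ Φ = fun _ => 0 := by
      ext p; simp
    rw [this]
    simp
  have hXX : ∀ i, modelHessian G (f ∘ Φ) y (X i y) (X i y)
      = modelHessian H f (Φ y) (e i (Φ y)) (e i (Φ y))
        + fderiv ℝ f (Φ y) (cov H (e i) (e i) (Φ y))
        - fderiv ℝ f (Φ y) (fderiv ℝ Φ y (cov G (X i) (X i) y)) := by
    intro i
    have d1 : DifferentiableAt ℝ (fun q => fderiv ℝ f q (e i q)) (Φ y) :=
      ((hf.fderiv_right (m := 1) (by norm_num)).differentiableAt (by simp)).clm_apply (de i)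
    rw [modelHessian_field (A := X i) (B := X i) hfΦ (dE i.succ), hd,
      modelHessian_field (A := e i) (B := e i) hf (de i),
      (hev (X i) (e i) fun p hp => h.proj p hp i).fderiv_eq,
      fderiv_comp y d1 (hΦ2.differentiableAt (by simp)), ContinuousLinearMap.comp_apply,
      h.proj y hy]
    ring
  have hcovv : fderiv ℝ Φ y (cov G v v y)
      = ∑ k, liftedConn G H Φ v u e X 0 0 k.succ y • e k (Φ y) := by
    have := h.cov_frame hy 0 0
    rw [Fin.sum_univ_succ] at this
    simp only [frame_zero, frame_succ] at this
    rw [this, map_add, map_sum, map_smul, h.vert y hy]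
    simp [h.proj y hy]
  have hcovX : ∀ i, fderiv ℝ Φ y (cov G (X i) (X i) y)
      = ∑ k, liftedConn G H Φ v u e X i.succ i.succ k.succ y • e k (Φ y) := by
    intro i
    have := h.cov_frame hy i.succ i.succ
    rw [Fin.sum_univ_succ] at this
    simp only [frame_zero, frame_succ] at this
    rw [this, map_add, map_sum, map_smul, h.vert y hy]
    simp [h.proj y hy]
  rw [modelLaplacian_eq_bilinTrace, modelLaplacian_eq_bilinTrace,
    bilinTrace_frame (h.metric.invertible hy) (h.metric.symm y hy) _ (ε := frameNorm (u y))
      (fun a => by cases a using Fin.cases <;> simp [frameNorm, hu]) (h.frame_orthogonal hy),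
    bilinTrace_frame (h.metric'.invertible hq) (h.metric'.symm _ hq) _ (ε := fun _ => 1)
      (fun _ => one_ne_zero) (h.orthonormal _ hq), Fin.sum_univ_succ]
  simp only [hessianL_apply, frame_zero, frame_succ, frameNorm, Fin.cases_zero, Fin.cases_succ,
    hvv, hXX, hcovv, hcovX, cov_orthonormal h.orthonormal hq, map_sum, map_smul, smul_eq_mul,
    liftedConn, frameConn, Fin.sum_univ_three, if_true]
  simp
  field_simp
  ring

end LiftedFrame

/-! ### Coordinate expressions in a preferred chart -/

section Coordinates

variable {n : ℕ} {M : Type*} [TopologicalSpace M] [ChartedSpace (Rn n) M]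

/-- The components of a tangent vector at `p` in the preferred chart around `x`. -/
def coord (x p : M) : Tan n p →L[ℝ] Rn n := mfderiv (𝓡 n) 𝓘(ℝ, Rn n) (chart n x) p

/-- The tangent vector at `p` with given components in the preferred chart around `x`. -/
def coordInv (x p : M) : Rn n →L[ℝ] Tan n p := (coord x p).inverse

theorem isOpen_chart_source (x : M) : IsOpen (chart n x).source := isOpen_extChartAt_source x

theorem isOpen_chart_target (x : M) : IsOpen (chart n x).target := isOpen_extChartAt_target x

theorem coordVec_eq (x : M) (v : Tan n x) : coordVec x v = coord x x v := rfl

variable [IsManifold (𝓡 n) ∞ M]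

theorem isManifold_one : IsManifold (𝓡 n) 1 M := IsManifold.of_le (n := ∞) (by simp)

theorem coord_isInvertible {x p : M} (hp : p ∈ (chart n x).source) :
    (coord (n := n) x p).IsInvertible := by
  have : IsManifold (𝓡 n) 1 M := isManifold_one
  exact isInvertible_mfderiv_extChartAt hp

theorem coord_coordInv {x p : M} (hp : p ∈ (chart n x).source) (u : Rn n) :
    coord x p (coordInv x p u) = u := (coord_isInvertible hp).self_apply_inverse u

theorem coordInv_coord {x p : M} (hp : p ∈ (chart n x).source) (v : Tan n p) :
    coordInv x p (coord x p v) = v := (coord_isInvertible hp).inverse_apply_self v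

theorem coord_injective {x p : M} (hp : p ∈ (chart n x).source) :
    Function.Injective (coord (n := n) x p) := (coord_isInvertible hp).injective

theorem coord_surjective {x p : M} (hp : p ∈ (chart n x).source) :
    Function.Surjective (coord (n := n) x p) := (coord_isInvertible hp).surjective

theorem dChartInv_eq {x : M} {y : Rn n} (hy : y ∈ (chart n x).target) :
    dChartInv x y = coordInv x ((chart n x).symm y) := by
  have : IsManifold (𝓡 n) 1 M := isManifold_one
  have h1 := mfderivWithin_extChartAt_symm_comp_mfderiv_extChartAt (I := 𝓡 n) hy
  rw [ModelWithCorners.range_eq_univ, mfderivWithin_univ] at h1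
  have hp : (chart n x).symm y ∈ (chart n x).source := (chart n x).map_target hy
  ext u : 1
  obtain ⟨v, rfl⟩ := coord_surjective hp u
  rw [coordInv_coord hp]
  exact DFunLike.congr_fun h1 v

theorem dChartInv_coord {x : M} {y : Rn n} (hy : y ∈ (chart n x).target)
    (v : Tan n ((chart n x).symm y)) :
    dChartInv x y (coord x ((chart n x).symm y) v) = v := by
  rw [dChartInv_eq hy, coordInv_coord ((chart n x).map_target hy)]

theorem chartField_eq (X : (p : M) → Tan n p) {x : M} {y : Rn n} (hy : y ∈ (chart n x).target) :
    chartField X x y = coord x ((chart n x).symm y) (X ((chart n x).symm y)) := by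
  have h1 := dChartInv_eq hy
  have hp : (chart n x).symm y ∈ (chart n x).source := (chart n x).map_target hy
  rw [chartField, VectorField.mpullback_apply]
  change (dChartInv x y).inverse _ = _
  rw [h1, coordInv, (coord_isInvertible hp).inverse_inverse]

theorem chartField_chart (X : (p : M) → Tan n p) {x p : M} (hp : p ∈ (chart n x).source) :
    chartField X x (chart n x p) = coord x p (X p) := by
  rw [chartField_eq X ((chart n x).map_source hp), (chart n x).left_inv hp]

theorem chartMetric_chart (g : RMetric n M) {x p : M} (hp : p ∈ (chart n x).source)
    (a b : Tan n p) :
    chartMetric g x (chart n x p) (coord x p a) (coord x p b) = g.inner p a b := by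
  obtain ⟨y, hy, rfl⟩ : ∃ y ∈ (chart n x).target, (chart n x).symm y = p :=
    ⟨_, (chart n x).map_source hp, (chart n x).left_inv hp⟩
  rw [(chart n x).right_inv hy]
  change g.inner _ (dChartInv x y _) (dChartInv x y _) = _
  rw [dChartInv_coord hy, dChartInv_coord hy]

theorem chartTensor_chart (T : (p : M) → Tan n p → Tan n p → ℝ) {x p : M}
    (hp : p ∈ (chart n x).source) (a b : Tan n p) :
    chartTensor T x (chart n x p) (coord x p a) (coord x p b) = T p a b := by
  obtain ⟨y, hy, rfl⟩ : ∃ y ∈ (chart n x).target, (chart n x).symm y = p :=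
    ⟨_, (chart n x).map_source hp, (chart n x).left_inv hp⟩
  rw [(chart n x).right_inv hy, chartTensor, dChartInv_coord hy, dChartInv_coord hy]

theorem chartForm_chart (θ : (p : M) → (Tan n p →L[ℝ] ℝ)) {x p : M}
    (hp : p ∈ (chart n x).source) (a : Tan n p) :
    chartForm θ x (chart n x p) (coord x p a) = θ p a := by
  obtain ⟨y, hy, rfl⟩ : ∃ y ∈ (chart n x).target, (chart n x).symm y = p :=
    ⟨_, (chart n x).map_source hp, (chart n x).left_inv hp⟩
  rw [(chart n x).right_inv hy]
  change θ _ (dChartInv x y _) = _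
  rw [dChartInv_coord hy]

theorem smooth_chart (x : M) : ContMDiffOn (𝓡 n) 𝓘(ℝ, Rn n) ∞ (chart n x) (chart n x).source := by
  rw [extChartAt_source]; exact contMDiffOn_extChartAt

theorem smooth_chart_symm (x : M) :
    ContMDiffOn 𝓘(ℝ, Rn n) (𝓡 n) ∞ (chart n x).symm (chart n x).target :=
  contMDiffOn_extChartAt_symm x

theorem smoothFieldOn_coordInv (x : M) {A : Rn n → Rn n} {s : Set (Rn n)}
    (hA : ContDiffOn ℝ ∞ A s) (hs : IsOpen s) :
    SmoothFieldOn (fun p => coordInv x p (A (chart n x p)))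
      ((chart n x).source ∩ chart n x ⁻¹' s) := by
  intro p hp
  have hA' : ContMDiffOn 𝓘(ℝ, Rn n) 𝓘(ℝ, Rn n).tangent ∞
      (fun y => (⟨y, A y⟩ : TangentBundle 𝓘(ℝ, Rn n) (Rn n))) s := by
    intro y hy
    exact contMDiffWithinAt_vectorSpace_iff_contDiffWithinAt.2 (hA y hy)
  have h1 : ContMDiffAt (𝓡 n) 𝓘(ℝ, Rn n) ∞ (chart n x) p :=
    (smooth_chart x).contMDiffAt ((isOpen_chart_source x).mem_nhds hp.1)
  exact (ContMDiffAt.mpullback_vectorField_preimage (n := ∞)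
    (hA'.contMDiffAt (hs.mem_nhds hp.2)) h1 (coord_isInvertible hp.1)
    (by simp)).contMDiffWithinAt

theorem smoothOn_chartField {X : (p : M) → Tan n p} {U : Set M} (hU : IsOpen U)
    (hX : SmoothFieldOn X U) (x : M) :
    ContDiffOn ℝ ∞ (chartField X x) ((chart n x).target ∩ (chart n x).symm ⁻¹' U) := by
  intro y hy
  have h1 : ContMDiffAt 𝓘(ℝ, Rn n) (𝓡 n) ∞ (chart n x).symm y :=
    (smooth_chart_symm x).contMDiffAt ((isOpen_chart_target x).mem_nhds hy.1)
  have h2 := ContMDiffAt.mpullback_vectorField_preimage (n := ∞) (m := ∞)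
    (hX.contMDiffAt (hU.mem_nhds hy.2)) h1
    (by
      have : (dChartInv x y).IsInvertible := by
        rw [dChartInv_eq hy.1]
        exact (coord_isInvertible ((chart n x).map_target hy.1)).inverse
      exact this) (by simp)
  have h3 := (contMDiffWithinAt_vectorSpace_iff_contDiffWithinAt (s := Set.univ)).1
    h2.contMDiffWithinAt
  exact (contDiffWithinAt_univ.1 h3).contDiffWithinAt

theorem smooth_inner (g : RMetric n M) {X Y : (p : M) → Tan n p} {U : Set M}
    (hX : SmoothFieldOn X U) (hY : SmoothFieldOn Y U) :
    ContMDiffOn (𝓡 n) 𝓘(ℝ, ℝ) ∞ (fun p => g.inner p (X p) (Y p)) U := by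
  intro p hp
  have h1 : ContMDiffWithinAt (𝓡 n) ((𝓡 n).prod 𝓘(ℝ)) ∞
      (fun m => Bundle.TotalSpace.mk' ℝ (E := Bundle.Trivial M ℝ) m (g.inner m (X m) (Y m)))
      U p := by
    apply ContMDiffWithinAt.clm_bundle_apply₂ (F₁ := Rn n) (F₂ := Rn n)
    · exact g.contMDiff.contMDiffAt.contMDiffWithinAt
    · exact hX p hp
    · exact hY p hp
  simp only [Bundle.contMDiffWithinAt_totalSpace] at h1
  exact h1.2

theorem smoothOn_comp_symm {f : M → ℝ} {U : Set M} {k : ℕ∞ω} (hk : k ≤ ∞)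
    (hf : ContMDiffOn (𝓡 n) 𝓘(ℝ, ℝ) k f U)
    (x : M) : ContDiffOn ℝ k (f ∘ (chart n x).symm)
      ((chart n x).target ∩ (chart n x).symm ⁻¹' U) := by
  rw [← contMDiffOn_iff_contDiffOn]
  exact hf.comp (((smooth_chart_symm x).of_le hk).mono Set.inter_subset_left) fun y hy => hy.2

omit [IsManifold (𝓡 n) ∞ M] in
theorem isOpen_chart_inter {U : Set M} (hU : IsOpen U) (x : M) :
    IsOpen ((chart n x).target ∩ (chart n x).symm ⁻¹' U) :=
  (continuousOn_extChartAt_symm x).isOpen_inter_preimage (isOpen_chart_target x) hU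

theorem isMetricOn_chartMetric (g : RMetric n M) (x : M) :
    IsMetricOn (chartMetric g x) (chart n x).target where
  isOpen := isOpen_chart_target x
  smooth := by
    rw [contDiffOn_clm_apply]
    intro u
    rw [contDiffOn_clm_apply]
    intro w
    -- The entries of the metric in the chart are inner products of coordinate fields, which are
    -- smooth vector fields.
    have hc : ∀ u : Rn n, SmoothFieldOn (fun p => coordInv x p u) (chart n x).source := by
      intro u
      have := smoothFieldOn_coordInv x (A := fun _ => u) contDiffOn_const isOpen_univ
      simpa using this
    have h1 := smoothOn_comp_symm le_rfl (smooth_inner g (hc u) (hc w)) x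
    refine (h1.mono fun y hy => ⟨hy, (chart n x).map_target hy⟩).congr fun y hy => ?_
    have h2 := chartMetric_chart g ((chart n x).map_target hy) (coordInv x _ u) (coordInv x _ w)
    rw [coord_coordInv ((chart n x).map_target hy), coord_coordInv ((chart n x).map_target hy),
      (chart n x).right_inv hy] at h2
    exact h2
  symm := fun y hy u w => by
    have hp := (chart n x).map_target hy
    obtain ⟨a, rfl⟩ := coord_surjective hp u
    obtain ⟨b, rfl⟩ := coord_surjective hp w
    have h1 := chartMetric_chart g hp a b
    have h2 := chartMetric_chart g hp b a
    rw [(chart n x).right_inv hy] at h1 h2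
    rw [h1, h2, g.symm]
  pos := fun y hy u hu => by
    have hp := (chart n x).map_target hy
    obtain ⟨a, rfl⟩ := coord_surjective hp u
    have h1 := chartMetric_chart g hp a a
    rw [(chart n x).right_inv hy] at h1
    rw [h1]
    refine g.pos _ _ fun h0 => hu ?_
    rw [h0, map_zero]

theorem mvfderiv_eq {f : M → ℝ} {x p : M} (hp : p ∈ (chart n x).source)
    (hf : MDifferentiableAt (𝓡 n) 𝓘(ℝ, ℝ) f p) (a : Tan n p) :
    mvfderiv (𝓡 n) f p a = fderiv ℝ (f ∘ (chart n x).symm) (chart n x p) (coord x p a) := by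
  have hc : MDifferentiableAt (𝓡 n) 𝓘(ℝ, Rn n) (chart n x) p :=
    ((smooth_chart x).contMDiffAt ((isOpen_chart_source x).mem_nhds hp)).mdifferentiableAt (by simp)
  have hs : MDifferentiableAt 𝓘(ℝ, Rn n) (𝓡 n) (chart n x).symm (chart n x p) :=
    ((smooth_chart_symm x).contMDiffAt ((isOpen_chart_target x).mem_nhds
      ((chart n x).map_source hp))).mdifferentiableAt (by simp)
  have hf' : MDifferentiableAt (𝓡 n) 𝓘(ℝ, ℝ) f ((chart n x).symm (chart n x p)) := by
    rwa [(chart n x).left_inv hp]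
  have h1 : f =ᶠ[𝓝 p] (f ∘ (chart n x).symm) ∘ chart n x := by
    filter_upwards [(isOpen_chart_source x).mem_nhds hp] with q hq
    simp only [Function.comp_apply, (chart n x).left_inv hq]
  have hfs := hf'.comp _ hs
  have h2 := mfderiv_comp p hfs hc
  rw [← h1.mfderiv_eq, mfderiv_eq_fderiv] at h2
  exact DFunLike.congr_fun h2 a

theorem deriveAlong_eq {f : M → ℝ} {x p : M} (hp : p ∈ (chart n x).source)
    (hf : MDifferentiableAt (𝓡 n) 𝓘(ℝ, ℝ) f p) (X : (p : M) → Tan n p) :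
    deriveAlong X f p
      = fderiv ℝ (f ∘ (chart n x).symm) (chart n x p) (chartField X x (chart n x p)) := by
  rw [deriveAlong, mvfderiv_eq hp hf, chartField_chart X hp]

/-- The map `φ` in the preferred charts around `x` and `x'`. -/
def chartMap {m : ℕ} {N : Type*} [TopologicalSpace N] [ChartedSpace (Rn m) N] (φ : M → N) (x : M)
    (x' : N) : Rn n → Rn m := chart m x' ∘ φ ∘ (chart n x).symm

variable {m : ℕ} {N : Type*} [TopologicalSpace N] [ChartedSpace (Rn m) N] [IsManifold (𝓡 m) ∞ N]

omit [IsManifold (𝓡 n) ∞ M] [IsManifold (𝓡 m) ∞ N] in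
theorem chartMap_chart (φ : M → N) {x p : M} (x' : N) (hp : p ∈ (chart n x).source) :
    chartMap φ x x' (chart n x p) = chart m x' (φ p) := by
  simp only [Function.comp_apply, chartMap, (chart n x).left_inv hp]

theorem fderiv_chartMap {φ : M → N} {x p : M} {x' : N} (hp : p ∈ (chart n x).source)
    (hp' : φ p ∈ (chart m x').source) (hφ : MDifferentiableAt (𝓡 n) (𝓡 m) φ p) (a : Tan n p) :
    fderiv ℝ (chartMap φ x x') (chart n x p) (coord x p a)
      = coord x' (φ p) (mfderiv (𝓡 n) (𝓡 m) φ p a) := by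
  have hc : MDifferentiableAt (𝓡 n) 𝓘(ℝ, Rn n) (chart n x) p :=
    ((smooth_chart x).contMDiffAt ((isOpen_chart_source x).mem_nhds hp)).mdifferentiableAt (by simp)
  have hs : MDifferentiableAt 𝓘(ℝ, Rn n) (𝓡 n) (chart n x).symm (chart n x p) :=
    ((smooth_chart_symm x).contMDiffAt ((isOpen_chart_target x).mem_nhds
      ((chart n x).map_source hp))).mdifferentiableAt (by simp)
  have hc' : MDifferentiableAt (𝓡 m) 𝓘(ℝ, Rn m) (chart m x') (φ p) :=
    ((smooth_chart x').contMDiffAt ((isOpen_chart_source x').mem_nhds hp')).mdifferentiableAt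
      (by simp)
  have h0 := hc'.comp p hφ
  have h0' : MDifferentiableAt (𝓡 n) 𝓘(ℝ, Rn m) (chart m x' ∘ φ)
      ((chart n x).symm (chart n x p)) := by
    rwa [(chart n x).left_inv hp]
  have h1 : chart m x' ∘ φ =ᶠ[𝓝 p] (chartMap φ x x') ∘ chart n x := by
    filter_upwards [(isOpen_chart_source x).mem_nhds hp] with q hq
    simp only [Function.comp_apply, chartMap, (chart n x).left_inv hq]
  have hfs : MDifferentiableAt 𝓘(ℝ, Rn n) 𝓘(ℝ, Rn m) (chartMap φ x x') (chart n x p) :=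
    h0'.comp _ hs
  have h2 := mfderiv_comp p hfs hc
  rw [← h1.mfderiv_eq, mfderiv_eq_fderiv, mfderiv_comp p hc' hφ] at h2
  exact (DFunLike.congr_fun h2 a).symm

theorem smoothOn_chartMap {φ : M → N} (hφ : ContMDiff (𝓡 n) (𝓡 m) ∞ φ) (x : M) (x' : N) :
    ContDiffOn ℝ ∞ (chartMap (n := n) (m := m) φ x x')
      ((chart n x).target ∩ (chart n x).symm ⁻¹' (φ ⁻¹' (chart m x').source)) := by
  rw [← contMDiffOn_iff_contDiffOn]
  refine (smooth_chart (n := m) x').comp ((hφ.contMDiffOn (s := Set.univ)).comp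
    ((smooth_chart_symm x).mono Set.inter_subset_left) fun _ _ => trivial) fun y hy => hy.2

end Coordinates

/-! ### Passing from the chart centred at a point to an arbitrary chart around it -/

section ChartIndependence

variable {n : ℕ} {M : Type*} [TopologicalSpace M] [ChartedSpace (Rn n) M]
  [IsManifold (𝓡 n) ∞ M]

omit [IsManifold (𝓡 n) ∞ M] in
theorem mem_transition {x x' p : M} (hp : p ∈ (chart n x).source) (hp' : p ∈ (chart n x').source) :
    chart n x p ∈ (chart n x).target ∩ (chart n x).symm ⁻¹' (chart n x').source :=
  ⟨(chart n x).map_source hp, by rwa [Set.mem_preimage, (chart n x).left_inv hp]⟩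

theorem fderiv_transition {x x' p : M} (hp : p ∈ (chart n x).source)
    (hp' : p ∈ (chart n x').source) (a : Tan n p) :
    fderiv ℝ (chartMap (n := n) (m := n) id x x') (chart n x p) (coord x p a) = coord x' p a := by
  rw [fderiv_chartMap hp hp' mdifferentiableAt_id, mfderiv_id]
  rfl

theorem smoothOn_transition (x x' : M) :
    ContDiffOn ℝ ∞ (chartMap (n := n) (m := n) id x x')
      ((chart n x).target ∩ (chart n x).symm ⁻¹' (chart n x').source) :=
  smoothOn_chartMap contMDiff_id x x'

theorem isInvertible_transition {x x' p : M} (hp : p ∈ (chart n x).source)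
    (hp' : p ∈ (chart n x').source) :
    (fderiv ℝ (chartMap (n := n) (m := n) id x x') (chart n x p)).IsInvertible := by
  obtain ⟨e, he⟩ := coord_isInvertible (n := n) hp
  obtain ⟨e', he'⟩ := coord_isInvertible (n := n) hp'
  refine ⟨e.symm.trans e', ?_⟩
  ext u : 1
  obtain ⟨a, rfl⟩ := coord_surjective (n := n) hp u
  rw [fderiv_transition hp hp', ← he, ← he']
  simp

omit [IsManifold (𝓡 n) ∞ M] in
theorem exists_chart_eq {x : M} {y : Rn n} (hy : y ∈ (chart n x).target) :
    ∃ p ∈ (chart n x).source, chart n x p = y :=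
  ⟨_, (chart n x).map_target hy, (chart n x).right_inv hy⟩

omit [IsManifold (𝓡 n) ∞ M] in
theorem exists_chart_eq_of_mem {x : M} {U : Set M} {y : Rn n}
    (hy : y ∈ (chart n x).target ∩ (chart n x).symm ⁻¹' U) :
    ∃ p ∈ (chart n x).source, p ∈ U ∧ chart n x p = y :=
  ⟨_, (chart n x).map_target hy.1, hy.2, (chart n x).right_inv hy.1⟩

/-- Under a change of chart τ the derivative of the form acquires θ(D²τ), which disappears on
antisymmetrisation. With this, one chart serves for all nearby points, although the definition uses
a different chart at each. -/
theorem extDer_eq (θ : (p : M) → (Tan n p →L[ℝ] ℝ)) {x p : M} (hp : p ∈ (chart n x).source)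
    (hθ : DifferentiableAt ℝ (chartForm θ x) (chart n x p)) (a b : Tan n p) :
    extDer θ p a b = fderiv ℝ (chartForm θ x) (chart n x p) (coord x p a) (coord x p b)
      - fderiv ℝ (chartForm θ x) (chart n x p) (coord x p b) (coord x p a) := by
  have hpp : p ∈ (chart n p).source := mem_extChartAt_source p
  set τ := chartMap (n := n) (m := n) id p x with hτ
  set s' := (chart n p).target ∩ (chart n p).symm ⁻¹' (chart n x).source
  have hs' : IsOpen s' := isOpen_chart_inter (isOpen_chart_source x) p
  have hy : chart n p p ∈ s' := mem_transition hpp hp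
  have hsm : ContDiffOn ℝ ∞ τ s' := smoothOn_transition p x
  have hτy : τ (chart n p p) = chart n x p := chartMap_chart id x hpp
  have dτ : DifferentiableAt ℝ τ (chart n p p) := differentiableAt_of_smoothOn hs' hsm hy
  have ddτ : DifferentiableAt ℝ (fderiv ℝ τ) (chart n p p) :=
    differentiableAt_of_smoothOn hs' (hsm.fderiv_of_isOpen hs' (by simp)) hy
  have hsym : IsSymmSndFDerivAt ℝ τ (chart n p p) :=
    (hsm.contDiffAt (hs'.mem_nhds hy)).isSymmSndFDerivAt (by simpa using ENat.LEInfty.out)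
  have hpull : chartForm θ p =ᶠ[𝓝 (chart n p p)]
      fun y => (chartForm θ x (τ y)).comp (fderiv ℝ τ y) := by
    filter_upwards [hs'.mem_nhds hy] with y hy'
    obtain ⟨q, hq, hq', rfl⟩ := exists_chart_eq_of_mem hy'
    ext u : 1
    obtain ⟨c, rfl⟩ := coord_surjective hq u
    rw [chartForm_chart θ hq, ContinuousLinearMap.comp_apply, fderiv_transition hq hq', hτ,
      chartMap_chart id x hq]
    exact (chartForm_chart θ hq' c).symm
  rw [← hτy] at hθ
  have h1 := (hθ.hasFDerivAt.comp _ dτ.hasFDerivAt).clm_comp ddτ.hasFDerivAt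
  have h2 : ∀ u w, fderiv ℝ (chartForm θ p) (chart n p p) u w
      = fderiv ℝ (chartForm θ x) (chart n x p) (fderiv ℝ τ (chart n p p) u)
          (fderiv ℝ τ (chart n p p) w)
        + chartForm θ x (chart n x p) (fderiv ℝ (fderiv ℝ τ) (chart n p p) u w) := by
    intro u w
    rw [hpull.fderiv_eq]
    erw [h1.fderiv]
    rw [← hτy]
    simp [add_comm]
  rw [extDer, coordVec_eq, coordVec_eq, h2, h2, fderiv_transition hpp hp, fderiv_transition hpp hp,
    hsym.eq (coord p p b)]
  ring

/-- Invariance of the Laplacian under the transition map, needed because the definition uses the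
chart centred at the point. -/
theorem laplacian_eq (g : RMetric n M) {f : M → ℝ} {x p : M} (hp : p ∈ (chart n x).source)
    (hf : ContDiffAt ℝ 2 (f ∘ (chart n x).symm) (chart n x p)) :
    laplacian g f p = modelLaplacian (chartMetric g x) (f ∘ (chart n x).symm) (chart n x p) := by
  have hpp : p ∈ (chart n p).source := mem_extChartAt_source p
  set τ := chartMap (n := n) (m := n) id p x with hτ
  set s' := (chart n p).target ∩ (chart n p).symm ⁻¹' (chart n x).source
  have hs' : IsOpen s' := isOpen_chart_inter (isOpen_chart_source x) p
  have hy : chart n p p ∈ s' := mem_transition hpp hp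
  have hτy : τ (chart n p p) = chart n x p := chartMap_chart id x hpp
  have hG' := (isMetricOn_chartMetric g p).mono hs' Set.inter_subset_left
  have hm : Set.MapsTo τ s' (chart n x).target := by
    intro y hy'
    obtain ⟨q, hq, hq', rfl⟩ := exists_chart_eq_of_mem hy'
    rw [hτ, chartMap_chart id x hq]
    exact (chart n x).map_source hq'
  have hpull : ∀ y ∈ s', ∀ u w, chartMetric g p y u w
      = chartMetric g x (τ y) (fderiv ℝ τ y u) (fderiv ℝ τ y w) := by
    intro y hy' u w
    obtain ⟨q, hq, hq', rfl⟩ := exists_chart_eq_of_mem hy'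
    obtain ⟨a, rfl⟩ := coord_surjective hq u
    obtain ⟨b, rfl⟩ := coord_surjective hq w
    rw [chartMetric_chart g hq, fderiv_transition hq hq', fderiv_transition hq hq', hτ,
      chartMap_chart id x hq]
    exact (chartMetric_chart g hq' a b).symm
  rw [← hτy] at hf
  have h1 := modelLaplacian_pullback (isMetricOn_chartMetric g x) hG' (smoothOn_transition p x) hm
    hpull hy (isInvertible_transition hpp hp) hf
  have h1' := h1.trans (congrArg (modelLaplacian (chartMetric g x) (f ∘ (chart n x).symm)) hτy)
  rw [laplacian, ← h1']
  have h2 : f ∘ (chart n p).symm =ᶠ[𝓝 (chart n p p)] (f ∘ (chart n x).symm) ∘ τ := by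
    filter_upwards [hs'.mem_nhds hy] with y hy'
    obtain ⟨q, hq, hq', rfl⟩ := exists_chart_eq_of_mem hy'
    rw [Function.comp_apply, Function.comp_apply, Function.comp_apply, hτ, chartMap_chart id x hq,
      (chart n p).left_inv hq]
    exact congrArg f ((chart n x).left_inv hq').symm
  simp only [modelLaplacian, modelHessian, h2.fderiv.fderiv_eq, h2.fderiv_eq]
  rfl

omit [IsManifold (𝓡 n) ∞ M] in
-- The definition extends `v` and `w` by constant fields; extending them by fields `Y`, `Z` instead
-- changes the first term and the brackets by amounts that cancel.
theorem lieDer_eq (X : (p : M) → Tan n p) (T : (p : M) → Tan n p → Tan n p → ℝ) {x : M}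
    {B : Rn n → (Rn n →L[ℝ] Rn n →L[ℝ] ℝ)} {Y Z : Rn n → Rn n}
    (hB : DifferentiableAt ℝ B (chart n x x))
    (hTB : ∀ᶠ y in 𝓝 (chart n x x), ∀ u w, chartTensor T x y u w = B y u w)
    (hY : DifferentiableAt ℝ Y (chart n x x)) (hZ : DifferentiableAt ℝ Z (chart n x x))
    {v w : Tan n x} (hv : coord x x v = Y (chart n x x)) (hw : coord x x w = Z (chart n x x)) :
    lieDer X T x v w
      = fderiv ℝ (fun y => B y (Y y) (Z y)) (chart n x x) (chartField X x (chart n x x))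
        - B (chart n x x) (VectorField.lieBracket ℝ (chartField X x) Y (chart n x x))
          (Z (chart n x x))
        - B (chart n x x) (Y (chart n x x))
          (VectorField.lieBracket ℝ (chartField X x) Z (chart n x x)) := by
  have h1 : (fun y => chartTensor T x y (coordVec x v) (coordVec x w)) =ᶠ[𝓝 (chart n x x)]
      fun y => B y (coord x x v) (coord x x w) := by
    filter_upwards [hTB] with y hy using hy _ _
  rw [lieDer, h1.fderiv_eq, hTB.self_of_nhds, hTB.self_of_nhds, coordVec_eq, coordVec_eq,
    fderiv_bilin hB (differentiableAt_const _) (differentiableAt_const _),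
    fderiv_bilin hB hY hZ, hv, hw, VectorField.lieBracket_eq, VectorField.lieBracket_eq]
  simp
  ring

end ChartIndependence

/-! ### Fourier series of functions supported in a small ball -/

section Fourier

open MeasureTheory FourierTransform

/-- The vector of `ℝ³` with the given integral components. -/
def latticeVec (k : Fin 3 → ℤ) : Rn 3 := WithLp.toLp 2 fun i => (k i : ℝ)

/-- The plane wave `x ↦ exp (2πi ⟨ξ, x⟩)`. -/
def wave (ξ x : Rn 3) : ℂ := Complex.exp ((2 * Real.pi * inner ℝ ξ x : ℝ) * Complex.I)

theorem norm_wave (ξ x : Rn 3) : ‖wave ξ x‖ = 1 := Complex.norm_exp_ofReal_mul_I _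

theorem wave_add (ξ η x : Rn 3) : wave (ξ + η) x = wave ξ x * wave η x := by
  rw [wave, wave, wave, ← Complex.exp_add, inner_add_left]
  congr 1
  push_cast
  ring

theorem mFourier_coe (k : Fin 3 → ℤ) (x : Rn 3) :
    UnitAddTorus.mFourier k (fun i => (x i : UnitAddCircle)) = wave (latticeVec k) x := by
  have h1 : ∀ i, fourier (k i) (x i : UnitAddCircle)
      = Complex.exp ((2 * Real.pi * (x i * k i) : ℝ) * Complex.I) := by
    intro i
    rw [fourier_coe_apply]
    congr 1
    push_cast
    ring
  change ∏ i, fourier (k i) (x i : UnitAddCircle) = _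
  simp only [h1]
  rw [← Complex.exp_sum, wave, PiLp.inner_apply]
  congr 1
  rw [← Finset.sum_mul, ← Complex.ofReal_sum, ← Finset.mul_sum]
  rfl

/-- The chart of the torus with values in the open unit cube centred at the origin. -/
def torusChart : OpenPartialHomeomorph (Fin 3 → ℝ) (UnitAddTorus (Fin 3)) :=
  OpenPartialHomeomorph.pi fun _ => AddCircle.openPartialHomeomorphCoe (1 : ℝ) (-(1 / 2))

theorem mem_torusChart_source {x : Fin 3 → ℝ} :
    x ∈ torusChart.source ↔ ∀ i, -(1 / 2) < x i ∧ x i < 1 / 2 := by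
  change x ∈ Set.pi Set.univ _ ↔ _
  simp only [Set.mem_univ_pi, AddCircle.openPartialHomeomorphCoe_source, Set.mem_Ioo]
  norm_num

theorem mem_torusChart_source_of_norm {x : Rn 3} (hx : ‖x‖ ≤ 3 / 8) :
    WithLp.ofLp x ∈ torusChart.source := by
  rw [mem_torusChart_source]
  intro i
  have := abs_le.1 ((PiLp.norm_apply_le x i).trans hx)
  constructor <;> linarith [this.1, this.2]

/-- The function on the torus which extends a function supported in the unit cube. -/
def periodization (ψ : Rn 3 → ℂ) : UnitAddTorus (Fin 3) → ℂ :=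
  torusChart.target.indicator fun t => ψ (WithLp.toLp 2 (torusChart.symm t))

theorem periodization_coe {ψ : Rn 3 → ℂ} {x : Rn 3} (hx : WithLp.ofLp x ∈ torusChart.source) :
    periodization ψ (fun i => (x i : UnitAddCircle)) = ψ x := by
  have h1 : torusChart (WithLp.ofLp x) = fun i => (x i : UnitAddCircle) := rfl
  rw [periodization, ← h1, Set.indicator_of_mem (torusChart.map_source hx),
    torusChart.left_inv hx]

/-- The support stays in the compact image of the ball of radius 3/8, well inside the chart of the
torus, so extension by zero is continuous. -/
theorem continuous_periodization {ψ : Rn 3 → ℂ} (hψ : Continuous ψ)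
    (hsupp : ∀ x, 3 / 8 < ‖x‖ → ψ x = 0) : Continuous (periodization ψ) := by
  rw [continuous_iff_continuousAt]
  intro t
  by_cases ht : t ∈ torusChart.target
  · have h1 : ContinuousAt (fun t => ψ (WithLp.toLp 2 (torusChart.symm t))) t :=
      hψ.continuousAt.comp ((PiLp.continuous_toLp 2 _).continuousAt.comp
        (torusChart.continuousAt_symm ht))
    refine h1.congr ?_
    filter_upwards [torusChart.open_target.mem_nhds ht] with t' ht'
    rw [periodization, Set.indicator_of_mem ht']
  · set K : Set (UnitAddTorus (Fin 3)) :=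
      (fun x : Rn 3 => torusChart (WithLp.ofLp x)) '' Metric.closedBall (0 : Rn 3) (3 / 8)
    have hK : IsCompact K := by
      refine (isCompact_closedBall (0 : Rn 3) (3 / 8)).image_of_continuousOn ?_
      exact torusChart.continuousOn.comp (PiLp.continuous_ofLp 2 _).continuousOn
        fun x hx => mem_torusChart_source_of_norm (by simpa using hx)
    have htK : t ∉ K := by
      rintro ⟨x, hx, rfl⟩
      exact ht (torusChart.map_source (mem_torusChart_source_of_norm (by simpa using hx)))
    refine (continuousAt_const (y := (0 : ℂ))).congr ?_
    filter_upwards [hK.isClosed.isOpen_compl.mem_nhds htK] with t' ht'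
    by_cases h : t' ∈ torusChart.target
    · rw [periodization, Set.indicator_of_mem h]
      refine (hsupp _ ?_).symm
      by_contra! hle
      refine ht' ⟨_, by simpa using hle, ?_⟩
      exact torusChart.right_inv h
    · rw [periodization, Set.indicator_of_notMem h]

/-- Over a fundamental cube the integrand of the torus coefficient is that of the Fourier integral,
since ψ vanishes outside the ball. -/
theorem mFourierCoeff_periodization {ψ : Rn 3 → ℂ} (hsupp : ∀ x, 3 / 8 < ‖x‖ → ψ x = 0)
    (k : Fin 3 → ℤ) :
    UnitAddTorus.mFourierCoeff (periodization ψ) k = 𝓕 ψ (latticeVec k) := by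
  rw [UnitAddTorus.mFourierCoeff_eq_integral _ _ (fun _ => -(1 / 2)), Real.fourier_eq',
    ← (PiLp.volume_preserving_toLp (Fin 3)).integral_comp
      (MeasurableEquiv.toLp 2 (Fin 3 → ℝ)).measurableEmbedding]
  have hcube : MeasurableSet {x : Fin 3 → ℝ | ∀ i, x i ∈ Set.Ioc (-(1 / 2) : ℝ) (-(1 / 2) + 1)} :=
    MeasurableSet.univ_pi' (fun i => measurableSet_Ioc)
  rw [← integral_indicator hcube]
  congr 1
  funext x
  have hwave : UnitAddTorus.mFourier (-k) (fun i => (x i : UnitAddCircle))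
      = Complex.exp ((-2 * Real.pi * inner ℝ (WithLp.toLp 2 x) (latticeVec k) : ℝ) * Complex.I) := by
    refine (mFourier_coe (-k) (WithLp.toLp 2 x)).trans ?_
    rw [wave, real_inner_comm]
    congr 3
    rw [show latticeVec (-k) = -latticeVec k by ext i; simp [latticeVec], inner_neg_right]
    ring
  by_cases hx : ‖WithLp.toLp 2 x‖ ≤ 3 / 8
  · have hs := mem_torusChart_source_of_norm hx
    have hp := periodization_coe (ψ := ψ) hs
    rw [mem_torusChart_source] at hs
    rw [Set.indicator_of_mem]
    · rw [hwave]
      congr 1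
    · intro i
      exact ⟨(hs i).1, by linarith [(hs i).2]⟩
  · rw [hsupp _ (not_le.1 hx), smul_zero]
    by_cases hx' : x ∈ {x : Fin 3 → ℝ | ∀ i, x i ∈ Set.Ioc (-(1 / 2) : ℝ) (-(1 / 2) + 1)}
    · rw [Set.indicator_of_mem hx']
      by_cases hs : x ∈ torusChart.source
      · have hp := periodization_coe (ψ := ψ) (x := WithLp.toLp 2 x) hs
        rw [hsupp _ (not_le.1 hx)] at hp
        refine (congrArg (_ • ·) hp).trans (smul_zero _)
      · have : (fun i => (x i : UnitAddCircle)) ∉ torusChart.target := by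
          rw [mem_torusChart_source] at hs
          push Not at hs
          obtain ⟨i, hi⟩ := hs
          have hxi : x i = 1 / 2 := le_antisymm (by linarith [(hx' i).2]) (hi (hx' i).1)
          intro ht
          have h2 := ht i (Set.mem_univ i)
          apply h2
          change ((x i : ℝ) : UnitAddCircle) = ((-(1 / 2) : ℝ) : UnitAddCircle)
          rw [hxi]
          have := AddCircle.coe_add_period (1 : ℝ) (-(1 / 2))
          rw [← this]
          norm_num
        rw [periodization, Set.indicator_of_notMem this, smul_zero]
    · rw [Set.indicator_of_notMem hx']

/-- Fourier inversion on the torus, pulled back to the ball on which the periodization agrees with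
ψ. -/
theorem hasSum_wave {ψ : Rn 3 → ℂ} (hψ : Continuous ψ) (hsupp : ∀ x, 3 / 8 < ‖x‖ → ψ x = 0)
    (hsum : Summable fun k : Fin 3 → ℤ => 𝓕 ψ (latticeVec k)) {x : Rn 3} (hx : ‖x‖ ≤ 3 / 8) :
    HasSum (fun k : Fin 3 → ℤ => 𝓕 ψ (latticeVec k) * wave (latticeVec k) x) (ψ x) := by
  have h1 := UnitAddTorus.hasSum_mFourier_series_apply_of_summable
    (f := ⟨periodization ψ, continuous_periodization hψ hsupp⟩)
    (by simpa only [ContinuousMap.coe_mk, funext (mFourierCoeff_periodization hsupp)] using hsum)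
    (fun i => (x i : UnitAddCircle))
  simp only [ContinuousMap.coe_mk, mFourierCoeff_periodization hsupp, mFourier_coe,
    periodization_coe (mem_torusChart_source_of_norm hx)] at h1
  exact h1

end Fourier

/-! ### Smooth families of functions have small Fourier coefficients -/

section FourierDecay

open MeasureTheory FourierTransform Filter

/-- Every finite set of lattice points lies in a box, over which the sum factors into three
convergent one-dimensional sums. -/
theorem summable_prod_inv : Summable fun k : Fin 3 → ℤ => ∏ i, (1 + (k i : ℝ) ^ 2)⁻¹ := by
  have h1 : Summable fun j : ℤ => (1 + (j : ℝ) ^ 2)⁻¹ := by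
    refine Summable.of_norm_bounded_eventually
      (g := fun j : ℤ => 1 / (j : ℝ) ^ 2) (Real.summable_one_div_int_pow.2 (by norm_num)) ?_
    have : ∀ᶠ j : ℤ in cofinite, j ≠ 0 := by
      simpa using (Set.finite_singleton (0 : ℤ)).compl_mem_cofinite
    filter_upwards [this] with j hj
    have hj' : 0 < (j : ℝ) ^ 2 := by positivity
    rw [Real.norm_of_nonneg (by positivity), one_div]
    exact inv_anti₀ hj' (by linarith)
  refine summable_of_sum_le (c := ∏ _i : Fin 3, ∑' j : ℤ, (1 + (j : ℝ) ^ 2)⁻¹)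
    (fun k => by positivity) fun u => ?_
  have h2 : u ⊆ Fintype.piFinset fun i => u.image fun k => k i := by
    intro k hk
    rw [Fintype.mem_piFinset]
    exact fun i => Finset.mem_image_of_mem _ hk
  refine (Finset.sum_le_sum_of_subset_of_nonneg h2 fun k _ _ => by positivity).trans ?_
  rw [← Finset.prod_univ_sum (fun i => u.image fun k => k i)
    fun _ (j : ℤ) => (1 + (j : ℝ) ^ 2)⁻¹]
  exact Finset.prod_le_prod (fun i _ => Finset.sum_nonneg fun j _ => by positivity)
    fun i _ => h1.sum_le_tsum _ fun j _ => by positivity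

/-- The `W^{6,1}` norm. -/
def sobolevNorm (ψ : Rn 3 → ℂ) : ℝ := ∑ q ∈ Finset.range 7, ∫ x, ‖iteratedFDeriv ℝ q ψ x‖

theorem sobolevNorm_nonneg (ψ : Rn 3 → ℂ) : 0 ≤ sobolevNorm ψ :=
  Finset.sum_nonneg fun _ _ => integral_nonneg fun _ => norm_nonneg _

/-- Six derivatives are needed because the product over three coordinates has degree six. The
constant is 4(1 + 64): 64 = 2⁶ comes from the bound for ‖w‖⁶ times the transform, 4 from comparing
the product with 1 + ‖w‖⁶. -/
theorem norm_fourier_le {ψ : Rn 3 → ℂ} (hψ : ContDiff ℝ ∞ ψ) (hc : HasCompactSupport ψ)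
    (k : Fin 3 → ℤ) :
    ‖𝓕 ψ (latticeVec k)‖ ≤ 260 * sobolevNorm ψ * ∏ i, (1 + (k i : ℝ) ^ 2)⁻¹ := by
  have hint : ∀ (l n : ℕ), (l : ℕ∞) ≤ 0 → (n : ℕ∞) ≤ ⊤ →
      Integrable (fun v => ‖v‖ ^ l * ‖iteratedFDeriv ℝ n ψ v‖) := by
    intro l n _ _
    have hcn : Continuous (iteratedFDeriv ℝ n ψ) :=
      hψ.continuous_iteratedFDeriv (by exact_mod_cast le_top)
    refine Continuous.integrable_of_hasCompactSupport (by fun_prop) ?_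
    exact ((hc.iteratedFDeriv n).norm).mul_left
  have key := fun n : ℕ => Real.pow_mul_norm_iteratedFDeriv_fourier_le (K := 0) (N := ⊤) (f := ψ)
    (k := 0) (n := n) hψ hint (by simp) le_top (latticeVec k)
  have hb : ∀ n : ℕ, n ≤ 6 → ∑ p ∈ Finset.range (0 + 1) ×ˢ Finset.range (n + 1),
      ∫ v : Rn 3, ‖v‖ ^ p.1 * ‖iteratedFDeriv ℝ p.2 ψ v‖ ≤ sobolevNorm ψ := by
    intro n hn
    rw [Finset.sum_product]
    simp only [zero_add, Finset.range_one, Finset.sum_singleton, pow_zero, one_mul]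
    exact Finset.sum_le_sum_of_subset_of_nonneg (Finset.range_mono (by omega))
      fun _ _ _ => integral_nonneg fun _ => norm_nonneg _
  have h0 := key 0
  have h6 := key 6
  have b0 := hb 0 (by norm_num)
  have b6 := hb 6 le_rfl
  simp only [norm_iteratedFDeriv_zero] at h0 h6
  have hS := sobolevNorm_nonneg ψ
  set w := latticeVec k with hw
  set S := sobolevNorm ψ
  have h0' : ‖𝓕 ψ w‖ ≤ S := by
    refine le_trans ?_ (h0.trans (le_trans ?_ b0))
    · simp
    · simp
  have h6' : ‖w‖ ^ 6 * ‖𝓕 ψ w‖ ≤ 64 * S := by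
    refine h6.trans ?_
    norm_num at b6 ⊢
    exact b6
  have hprod : ∏ i, (1 + (k i : ℝ) ^ 2) ≤ 4 * (1 + ‖w‖ ^ 6) := by
    have hn : ‖w‖ ^ 2 = ∑ i, (k i : ℝ) ^ 2 := by
      rw [EuclideanSpace.norm_sq_eq]
      refine Finset.sum_congr rfl fun i _ => ?_
      rw [hw, Real.norm_eq_abs, sq_abs]
      rfl
    have hle : ∀ i, 1 + (k i : ℝ) ^ 2 ≤ 1 + ‖w‖ ^ 2 := by
      intro i
      rw [hn]
      have := Finset.single_le_sum (f := fun i => (k i : ℝ) ^ 2) (fun i _ => sq_nonneg _)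
        (Finset.mem_univ i)
      simpa using this
    calc ∏ i, (1 + (k i : ℝ) ^ 2) ≤ ∏ _i : Fin 3, (1 + ‖w‖ ^ 2) :=
          Finset.prod_le_prod (fun i _ => by positivity) fun i _ => hle i
      _ = (1 + ‖w‖ ^ 2) ^ 3 := by simp
      _ ≤ 4 * (1 + ‖w‖ ^ 6) := by
          have ht : 0 ≤ ‖w‖ ^ 2 := by positivity
          have h3 : ‖w‖ ^ 6 = (‖w‖ ^ 2) ^ 3 := by ring
          rw [h3]
          generalize ‖w‖ ^ 2 = t at ht
          nlinarith [mul_nonneg ht (sq_nonneg (t - 1)), sq_nonneg (t - 1)]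
  have hpos : 0 < ∏ i, (1 + (k i : ℝ) ^ 2) := by positivity
  rw [Finset.prod_inv_distrib, ← div_eq_mul_inv, le_div_iff₀ hpos]
  calc ‖𝓕 ψ w‖ * ∏ i, (1 + (k i : ℝ) ^ 2) ≤ ‖𝓕 ψ w‖ * (4 * (1 + ‖w‖ ^ 6)) := by gcongr
    _ = 4 * (‖𝓕 ψ w‖ + ‖w‖ ^ 6 * ‖𝓕 ψ w‖) := by ring
    _ ≤ 4 * (S + 64 * S) := by gcongr
    _ = 260 * S := by ring

theorem iteratedFDeriv_prodMk {Ψ : ℝ × Rn 3 → ℂ} (hΨ : ContDiff ℝ ∞ Ψ) (q : ℕ) (r : ℝ)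
    (x : Rn 3) :
    iteratedFDeriv ℝ q (fun x => Ψ (r, x)) x
      = (iteratedFDeriv ℝ q Ψ (r, x)).compContinuousLinearMap
          fun _ => ContinuousLinearMap.inr ℝ ℝ (Rn 3) := by
  have h1 : (fun x => Ψ (r, x))
      = (fun z => Ψ ((r, 0) + z)) ∘ ContinuousLinearMap.inr ℝ ℝ (Rn 3) := by
    funext x
    simp
  have h2 : ContDiff ℝ ∞ fun z => Ψ ((r, 0) + z) := hΨ.comp (contDiff_const.add contDiff_id)
  rw [h1, ContinuousLinearMap.iteratedFDeriv_comp_right _ h2 x (i := q)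
    (by exact_mod_cast le_top),
    iteratedFDeriv_comp_add_left]
  simp

/-- Each integral runs over a fixed compact ball with an integrand jointly continuous in r and x, so
it is continuous in r, and at r = 0 it vanishes. -/
theorem tendsto_sobolevNorm {Ψ : ℝ × Rn 3 → ℂ} (hΨ : ContDiff ℝ ∞ Ψ)
    (hsupp : ∀ r x, 3 / 8 < ‖x‖ → Ψ (r, x) = 0) (h0 : ∀ x, Ψ (0, x) = 0) :
    Tendsto (fun r => sobolevNorm fun x => Ψ (r, x)) (𝓝 0) (𝓝 0) := by
  have h1 : ∀ q : ℕ, Tendsto (fun r => ∫ x, ‖iteratedFDeriv ℝ q (fun x => Ψ (r, x)) x‖)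
      (𝓝 0) (𝓝 0) := by
    intro q
    have hcont : Continuous (fun r => ∫ x in Metric.closedBall (0 : Rn 3) (3 / 8),
        ‖iteratedFDeriv ℝ q (fun x => Ψ (r, x)) x‖) := by
      refine continuous_parametric_integral_of_continuous ?_ (isCompact_closedBall _ _)
      simp only [Function.uncurry_def, iteratedFDeriv_prodMk hΨ]
      have hcn : Continuous (iteratedFDeriv ℝ q Ψ) :=
        hΨ.continuous_iteratedFDeriv (by exact_mod_cast le_top)
      exact ((ContinuousMultilinearMap.compContinuousLinearMapL
        (fun _ : Fin q => ContinuousLinearMap.inr ℝ ℝ (Rn 3))).continuous.comp hcn).norm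
    have heq : ∀ r, ∫ x in Metric.closedBall (0 : Rn 3) (3 / 8),
        ‖iteratedFDeriv ℝ q (fun x => Ψ (r, x)) x‖
          = ∫ x, ‖iteratedFDeriv ℝ q (fun x => Ψ (r, x)) x‖ := by
      intro r
      refine setIntegral_eq_integral_of_forall_compl_eq_zero fun x hx => ?_
      have hx' : 3 / 8 < ‖x‖ := by simpa using hx
      have : (fun x => Ψ (r, x)) =ᶠ[𝓝 x] fun _ => 0 := by
        filter_upwards [(isOpen_lt continuous_const continuous_norm).mem_nhds hx'] with y hy
        exact hsupp r y hy
      rw [← iteratedFDerivWithin_univ, Filter.EventuallyEq.iteratedFDerivWithin_eq (f := fun _ => 0)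
        (f₁ := fun x => Ψ (r, x)) (x := x) (by rwa [nhdsWithin_univ]) this.self_of_nhds q, iteratedFDerivWithin_univ]
      simp
    simp only [heq] at hcont
    have h2 := hcont.tendsto 0
    simpa [h0] using h2
  have := tendsto_finsetSum (Finset.range 7) fun q _ => h1 q
  simpa [sobolevNorm] using this

/-- The space of summable families indexed by `ℤ³`. -/
abbrev Ell : Type := lp (fun _ : Fin 3 → ℤ => ℂ) 1

theorem norm_ell (c : Ell) : ‖c‖ = ∑' k, ‖c k‖ := by
  rw [lp.norm_eq_tsum_rpow (by simp)]
  simp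

theorem summable_ell (c : Ell) : Summable fun k => ‖c k‖ := by
  have := (lp.memℓp c).summable (by simp)
  simpa using this

/-- Cut off, expand in a Fourier series and use the decay of the coefficients: smallness of the
family as r → 0 becomes smallness in ℓ¹. The expansion is valid only on the small ball where the
cut-off is 1, and only that ball is used later. -/
theorem exists_fourier_family {Ψ : ℝ × Rn 3 → ℂ} (hΨ : ContDiff ℝ ∞ Ψ)
    (h0 : ∀ x, Ψ (0, x) = 0) :
    ∃ c : ℝ → Ell, Tendsto (fun r => ‖c r‖) (𝓝 0) (𝓝 0) ∧
      ∀ r x, ‖x‖ < 1 / 4 → HasSum (fun k => c r k * wave (latticeVec k) x) (Ψ (r, x)) := by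
  -- The outer radius 3/8 keeps the support inside the unit cube; the inner radius 1/4 is the ball
  -- of validity.
  let χ : ContDiffBump (0 : Rn 3) := ⟨1 / 4, 3 / 8, by norm_num, by norm_num⟩
  set Θ : ℝ × Rn 3 → ℂ := fun z => (χ z.2 : ℝ) • Ψ z with hΘ
  have hΘs : ContDiff ℝ ∞ Θ := (χ.contDiff.comp contDiff_snd).smul hΨ
  have hΘ0 : ∀ x, Θ (0, x) = 0 := fun x => by simp [hΘ, h0]
  have hsupp : ∀ r x, 3 / 8 < ‖x‖ → Θ (r, x) = 0 := by
    intro r x hx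
    have : χ x = 0 := χ.zero_of_le_dist (by rw [dist_zero_right]; exact hx.le)
    simp [hΘ, this]
  have hsm : ∀ r, ContDiff ℝ ∞ fun x => Θ (r, x) := fun r =>
    hΘs.comp (contDiff_const.prodMk contDiff_id)
  have hcs : ∀ r, HasCompactSupport fun x => Θ (r, x) := by
    intro r
    refine HasCompactSupport.intro (isCompact_closedBall (0 : Rn 3) (3 / 8)) fun x hx => ?_
    exact hsupp r x (by simpa using hx)
  have hle := fun r k => norm_fourier_le (hsm r) (hcs r) k
  have hsum : ∀ r, Summable fun k => ‖𝓕 (fun x => Θ (r, x)) (latticeVec k)‖ := fun r =>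
    Summable.of_nonneg_of_le (fun _ => norm_nonneg _) (hle r) (summable_prod_inv.mul_left _)
  have hmem : ∀ r, Memℓp (fun k => 𝓕 (fun x => Θ (r, x)) (latticeVec k)) 1 := fun r =>
    memℓp_gen (by simpa using hsum r)
  refine ⟨fun r => ⟨_, hmem r⟩, ?_, fun r x hx => ?_⟩
  · have h1 := (tendsto_sobolevNorm hΘs hsupp hΘ0).const_mul
      (260 * ∑' k : Fin 3 → ℤ, ∏ i, (1 + (k i : ℝ) ^ 2)⁻¹)
    rw [mul_zero] at h1
    refine squeeze_zero (fun _ => norm_nonneg _) (fun r => ?_) h1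
    rw [norm_ell]
    refine ((hsum r).tsum_le_tsum (hle r) (summable_prod_inv.mul_left _)).trans ?_
    rw [tsum_mul_left]
    exact le_of_eq (by ring)
  · have h1 := hasSum_wave (hsm r).continuous (hsupp r) (hsum r).of_norm (x := x) (by linarith)
    have h2 : χ x = 1 := χ.one_of_mem_closedBall (by rw [mem_closedBall_zero_iff]; exact hx.le)
    simpa [hΘ, h2] using h1

end FourierDecay

/-! ### Superpositions of plane waves without constant term -/

section Waves

open Filter

/-- The frequency `k + (½, 0, 0)`. -/
def freq (k : Fin 3 → ℤ) : Rn 3 := latticeVec k + EuclideanSpace.single 0 (1 / 2)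

/-- The half-integer shift keeps all frequencies away from 0, so a constant coefficient elliptic
operator without zeroth order term is invertible on these waves with no solvability condition. -/
theorem norm_freq (k : Fin 3 → ℤ) : 1 / 2 ≤ ‖freq k‖ := by
  refine le_trans ?_ (PiLp.norm_apply_le (freq k) 0)
  have h1 : freq k 0 = (k 0 : ℝ) + 1 / 2 := by simp [freq, latticeVec]
  rw [h1, Real.norm_eq_abs, le_abs]
  rcases le_or_gt 0 (k 0) with h | h
  · left
    have : (0 : ℝ) ≤ k 0 := by exact_mod_cast h
    linarith
  · right
    have : (k 0 : ℝ) ≤ -1 := by exact_mod_cast Int.le_sub_one_of_lt h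
    linarith

theorem wave_freq_add (k m : Fin 3 → ℤ) (x : Rn 3) :
    wave (freq (m + k)) x = wave (latticeVec m) x * wave (freq k) x := by
  rw [← wave_add]
  congr 1
  ext i
  simp [freq, latticeVec]
  ring

variable {E : Type*} [NormedAddCommGroup E] [NormedSpace ℂ E] [CompleteSpace E]

/-- The function `∑ exp (2πi ⟨ξ_k, x⟩) v_k`. -/
def waveSum (v : (Fin 3 → ℤ) → E) (x : Rn 3) : E := ∑' k, wave (freq k) x • v k

/-- The coefficients of the differential of `waveSum v`. -/
def waveDeriv (v : (Fin 3 → ℤ) → E) (k : Fin 3 → ℤ) : Rn 3 →L[ℝ] E :=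
  (innerSL ℝ (freq k)).smulRight ((2 * Real.pi * Complex.I : ℂ) • v k)

omit [CompleteSpace E] in
theorem norm_waveDeriv (v : (Fin 3 → ℤ) → E) (k : Fin 3 → ℤ) :
    ‖waveDeriv v k‖ = 2 * Real.pi * (‖freq k‖ * ‖v k‖) := by
  rw [waveDeriv, ContinuousLinearMap.norm_smulRight_apply, innerSL_apply_norm, norm_smul]
  simp [abs_of_pos Real.pi_pos]
  ring

theorem hasFDerivAt_wave (ξ x : Rn 3) :
    HasFDerivAt (wave ξ) ((innerSL ℝ ξ).smulRight (2 * Real.pi * Complex.I * wave ξ x)) x := by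
  have h1 : HasFDerivAt (fun x : Rn 3 => ((2 * Real.pi * inner ℝ ξ x : ℝ) : ℂ) * Complex.I)
      ((innerSL ℝ ξ).smulRight (2 * Real.pi * Complex.I : ℂ)) x := by
    have h2 : (fun x : Rn 3 => ((2 * Real.pi * inner ℝ ξ x : ℝ) : ℂ) * Complex.I)
        = ((innerSL ℝ ξ).smulRight (2 * Real.pi * Complex.I : ℂ)) := by
      funext y
      simp
      ring
    rw [h2]
    exact ContinuousLinearMap.hasFDerivAt _
  refine h1.cexp.congr_fderiv ?_
  ext y
  simp [wave]
  ring

theorem continuous_wave (ξ : Rn 3) : Continuous (wave ξ) :=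
  continuous_iff_continuousAt.2 fun x => (hasFDerivAt_wave ξ x).continuousAt

theorem continuous_waveSum {v : (Fin 3 → ℤ) → E} (hv : Summable fun k => ‖v k‖) :
    Continuous (waveSum v) :=
  continuous_tsum (fun k => (continuous_wave _).smul continuous_const) hv fun k x => by
    rw [norm_smul, norm_wave, one_mul]

omit [CompleteSpace E] in
theorem norm_waveSum_le {v : (Fin 3 → ℤ) → E} (hv : Summable fun k => ‖v k‖) (x : Rn 3) :
    ‖waveSum v x‖ ≤ ∑' k, ‖v k‖ := by
  have h : ∀ k, ‖wave (freq k) x • v k‖ = ‖v k‖ := fun k => by rw [norm_smul, norm_wave, one_mul]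
  refine (norm_tsum_le_tsum_norm ?_).trans (le_of_eq ?_)
  · simpa only [h] using hv
  · simp only [h]

theorem summable_waveSum {v : (Fin 3 → ℤ) → E} (hv : Summable fun k => ‖v k‖) (x : Rn 3) :
    Summable fun k => wave (freq k) x • v k :=
  Summable.of_norm (by simpa only [norm_smul, norm_wave, one_mul] using hv)

/-- Termwise differentiation. The differential is again a wave sum, with values in a space of linear
maps, so the statement can be iterated. -/
theorem hasFDerivAt_waveSum {v : (Fin 3 → ℤ) → E} (hv : Summable fun k => ‖v k‖)
    (hv' : Summable fun k => ‖waveDeriv v k‖) (x : Rn 3) :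
    HasFDerivAt (waveSum v) (waveSum (waveDeriv v) x) x := by
  refine hasFDerivAt_tsum (f := fun k x => wave (freq k) x • v k)
    (f' := fun k x => wave (freq k) x • waveDeriv v k) hv' (fun k y => ?_) (fun k y => ?_)
    (x₀ := 0) (summable_waveSum hv 0) x
  · refine ((hasFDerivAt_wave (freq k) y).smul_const (v k)).congr_fderiv ?_
    ext z
    simp only [waveDeriv, ContinuousLinearMap.smulRight_apply, smul_apply, innerSL_apply_apply]
    rw [← Complex.coe_smul, ← Complex.coe_smul, smul_smul, smul_smul, smul_eq_mul]
    congr 1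
    ring
  · rw [norm_smul, norm_wave, one_mul]

theorem contDiff_two_of_hasFDerivAt {F : Type*} [NormedAddCommGroup F] [NormedSpace ℝ F]
    {w : Rn 3 → F} {w' : Rn 3 → Rn 3 →L[ℝ] F} {w'' : Rn 3 → Rn 3 →L[ℝ] Rn 3 →L[ℝ] F}
    (h1 : ∀ x, HasFDerivAt w (w' x) x) (h2 : ∀ x, HasFDerivAt w' (w'' x) x)
    (h3 : Continuous w'') : ContDiff ℝ 2 w := by
  have e1 : fderiv ℝ w = w' := funext fun x => (h1 x).fderiv
  have e2 : fderiv ℝ w' = w'' := funext fun x => (h2 x).fderiv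
  have c1 : ContDiff ℝ 1 w' := by
    rw [contDiff_one_iff_fderiv, e2]
    exact ⟨fun x => (h2 x).differentiableAt, h3⟩
  rw [show (2 : ℕ∞ω) = 1 + 1 by norm_num, contDiff_succ_iff_fderiv, e1]
  exact ⟨fun x => (h1 x).differentiableAt, by simp, c1⟩

/-- The operator on summable families given by the images of the unit vectors. -/
def ellLift (v : (Fin 3 → ℤ) → E) (C : ℝ) (hC : ∀ k, ‖v k‖ ≤ C) : Ell →L[ℂ] E :=
  have hs : ∀ c : Ell, Summable fun k => c k • v k := fun c =>
    Summable.of_norm_bounded ((summable_ell c).mul_right C) fun k => by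
      rw [norm_smul]
      exact mul_le_mul_of_nonneg_left (hC k) (norm_nonneg _)
  LinearMap.mkContinuous
    { toFun := fun c => ∑' k, c k • v k
      map_add' := fun c d => by
        rw [← (hs c).tsum_add (hs d)]
        exact tsum_congr fun k => add_smul _ _ _
      map_smul' := fun a c => by
        rw [RingHom.id_apply, ← (hs c).tsum_const_smul]
        exact tsum_congr fun k => mul_smul _ _ _ } C fun c => by
    rw [norm_ell, mul_comm]
    refine tsum_of_norm_bounded ((summable_ell c).hasSum.mul_right C) fun k => ?_
    rw [norm_smul]
    exact mul_le_mul_of_nonneg_left (hC k) (norm_nonneg _)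

theorem hasSum_ellLift {v : (Fin 3 → ℤ) → E} {C : ℝ} (hC : ∀ k, ‖v k‖ ≤ C) (c : Ell) :
    HasSum (fun k => c k • v k) (ellLift v C hC c) := by
  refine (Summable.of_norm_bounded ((summable_ell c).mul_right C) fun k => ?_).hasSum
  rw [norm_smul]
  exact mul_le_mul_of_nonneg_left (hC k) (norm_nonneg _)

theorem norm_ellLift_le {v : (Fin 3 → ℤ) → E} {C : ℝ} (h0 : 0 ≤ C) (hC : ∀ k, ‖v k‖ ≤ C) :
    ‖ellLift v C hC‖ ≤ C :=
  ContinuousLinearMap.opNorm_le_bound _ h0 fun c => by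
    rw [norm_ell, mul_comm]
    refine tsum_of_norm_bounded ((summable_ell c).hasSum.mul_right C) fun k => ?_
    rw [norm_smul]
    exact mul_le_mul_of_nonneg_left (hC k) (norm_nonneg _)

/-- Translation of a family by a lattice vector. -/
def shift (k : Fin 3 → ℤ) (α : Ell) : Ell :=
  ⟨fun m => α (m - k), memℓp_gen (by
    have h1 := (Equiv.subRight k).summable_iff.2 (summable_ell α)
    simpa [Function.comp_def] using h1)⟩

theorem norm_shift (k : Fin 3 → ℤ) (α : Ell) : ‖shift k α‖ = ‖α‖ := by
  rw [norm_ell, norm_ell]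
  exact (Equiv.subRight k).tsum_eq fun m => ‖α m‖

/-- Evaluation at `x` of the superposition of plane waves with given coefficients. -/
def evalWave (x : Rn 3) : Ell →L[ℂ] ℂ := ellLift (fun k => wave (freq k) x) 1 fun _ =>
  (norm_wave _ _).le

theorem hasSum_evalWave (c : Ell) (x : Rn 3) :
    HasSum (fun k => c k * wave (freq k) x) (evalWave x c) :=
  hasSum_ellLift (fun _ => (norm_wave _ _).le) c

/-- Multiplication by a lattice series maps the shifted frequencies k + (½,0,0) to themselves; on
coefficients it is a sum of translations, of norm at most the ℓ¹ norm of the series. -/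
theorem evalWave_shift {α : Ell} {x : Rn 3} {A : ℂ}
    (hA : HasSum (fun k => α k * wave (latticeVec k) x) A) (k : Fin 3 → ℤ) :
    evalWave x (shift k α) = A * wave (freq k) x := by
  refine (hasSum_evalWave _ x).unique ?_
  have h1 := hA.mul_right (wave (freq k) x)
  rw [← (Equiv.subRight k).hasSum_iff] at h1
  refine h1.congr_fun fun m => ?_
  have h2 := wave_freq_add k (m - k) x
  rw [sub_add_cancel] at h2
  change α (m - k) * wave (freq m) x = α (m - k) * wave (latticeVec (m - k)) x * wave (freq k) x
  rw [mul_assoc, h2]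

end Waves

/-! ### Perturbation of a constant coefficient elliptic operator -/

section Perturbation

open Filter

/-- Neumann series for 1 + P; the norm bound follows from ‖c‖ ≤ ‖γ‖ + ‖c‖/2. -/
theorem exists_add_apply_eq {E : Type*} [NormedAddCommGroup E] [NormedSpace ℂ E] [CompleteSpace E]
    {P : E →L[ℂ] E} (hP : ‖P‖ ≤ 1 / 2) (γ : E) : ∃ c, c + P c = γ ∧ ‖c‖ ≤ 2 * ‖γ‖ := by
  have h1 : ‖-P‖ < 1 := by rw [norm_neg]; linarith
  set U := Units.oneSub (-P) h1
  have h2 : ∀ x, (U : E →L[ℂ] E) x = x + P x := fun x => by simp [U, Units.val_oneSub]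
  refine ⟨(U⁻¹ : (E →L[ℂ] E)ˣ).val γ, ?_, ?_⟩
  · rw [← h2]
    change ((U : E →L[ℂ] E) * (U⁻¹ : (E →L[ℂ] E)ˣ).val) γ = γ
    rw [Units.mul_inv]
    rfl
  · set c := (U⁻¹ : (E →L[ℂ] E)ˣ).val γ
    have h3 : c + P c = γ := by
      rw [← h2]
      change ((U : E →L[ℂ] E) * (U⁻¹ : (E →L[ℂ] E)ˣ).val) γ = γ
      rw [Units.mul_inv]
      rfl
    have h4 : ‖c‖ ≤ ‖γ‖ + ‖P c‖ := by
      rw [← h3]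
      have := norm_sub_le (c + P c) (P c)
      simpa using this
    have h5 : ‖P c‖ ≤ 1 / 2 * ‖c‖ := P.le_of_opNorm_le hP c
    linarith

/-- On wave sums with coefficients in ℓ¹, dividing by the symbol of the constant coefficient
operator gains two derivatives. The perturbation, composed with this inverse, is then a bounded
operator on ℓ¹ of norm at most ½, and a Neumann series solves the equation. `K` depends only on the
constant part; the solution is merely C², which is all that harmonicity asks for. The equation is
asserted at those points where the three series represent the given values. -/
theorem exists_perturbed_solution {a : Fin 3 → Fin 3 → ℝ} {l : ℝ} (hl : 0 < l)
    (ha : ∀ ξ : Rn 3, l * ‖ξ‖ ^ 2 ≤ ∑ i, ∑ j, a i j * (ξ i * ξ j)) :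
    ∃ K : ℝ, 0 < K ∧ ∀ (α : Fin 3 → Fin 3 → Ell) (β : Fin 3 → Ell) (γ : Ell),
      K * (∑ i, ∑ j, ‖α i j‖ + ∑ i, ‖β i‖) ≤ 1 →
      ∃ w : Rn 3 → ℂ, ContDiff ℝ 2 w ∧ (∀ x, ‖fderiv ℝ w x‖ ≤ K * ‖γ‖) ∧
        (∀ x, ‖fderiv ℝ (fderiv ℝ w) x‖ ≤ K * ‖γ‖) ∧
        ∀ (x : Rn 3) (A : Fin 3 → Fin 3 → ℂ) (B : Fin 3 → ℂ) (R : ℂ),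
          (∀ i j, HasSum (fun k => α i j k * wave (latticeVec k) x) (A i j)) →
          (∀ i, HasSum (fun k => β i k * wave (latticeVec k) x) (B i)) →
          HasSum (fun k => γ k * wave (freq k) x) R →
          ∑ i, ∑ j, (a i j + A i j) * fderiv ℝ (fderiv ℝ w) x (EuclideanSpace.single i 1)
              (EuclideanSpace.single j 1)
            + ∑ i, B i * fderiv ℝ w x (EuclideanSpace.single i 1) = R := by
  set Q : (Fin 3 → ℤ) → ℝ := fun k => ∑ i, ∑ j, a i j * (freq k i * freq k j) with hQ
  have hfreq : ∀ k, 1 / 2 ≤ ‖freq k‖ := norm_freq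
  have hQl : ∀ k, l * ‖freq k‖ ^ 2 ≤ Q k := fun k => ha _
  have hQpos : ∀ k, 0 < Q k := fun k =>
    lt_of_lt_of_le (mul_pos hl (pow_pos (lt_of_lt_of_le (by norm_num) (hfreq k)) 2)) (hQl k)
  -- The inverse symbol: w will be the wave sum with coefficients c_k m_k.
  set m : (Fin 3 → ℤ) → ℂ := fun k => (((2 * Real.pi * Complex.I) ^ 2 * (Q k : ℂ))⁻¹ : ℂ) with hm
  have hpi := Real.pi_pos
  -- Ellipticity bounds |ξ|²|m| by this constant; each power of |ξ| less costs a factor 2, since |ξ|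
  -- ≥ ½.
  set C : ℝ := (4 * Real.pi ^ 2 * l)⁻¹ with hC
  have hC0 : 0 < C := by positivity
  have hm2 : ∀ k, ‖freq k‖ ^ 2 * ‖m k‖ ≤ C := by
    intro k
    have h1 : ‖m k‖ = (4 * Real.pi ^ 2 * Q k)⁻¹ := by
      simp only [hm, norm_inv, norm_mul, norm_pow, Complex.norm_I, Complex.norm_real,
        Real.norm_of_nonneg hpi.le, Real.norm_of_nonneg (hQpos k).le, Complex.norm_ofNat]
      ring
    rw [h1, hC, ← div_eq_mul_inv, div_le_iff₀ (by have := hQpos k; positivity), ← div_eq_inv_mul,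
      le_div_iff₀ (by positivity)]
    nlinarith [mul_le_mul_of_nonneg_left (hQl k) (by positivity : 0 ≤ 4 * Real.pi ^ 2)]
  have hm1 : ∀ k, ‖freq k‖ * ‖m k‖ ≤ 2 * C := by
    intro k
    have : ‖freq k‖ * ‖m k‖ ≤ 2 * (‖freq k‖ ^ 2 * ‖m k‖) := by
      nlinarith [mul_nonneg (norm_nonneg (freq k)) (norm_nonneg (m k)), hfreq k]
    linarith [hm2 k]
  have hm0 : ∀ k, ‖m k‖ ≤ 4 * C := by
    intro k
    have : ‖m k‖ ≤ 2 * (‖freq k‖ * ‖m k‖) := by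
      nlinarith [norm_nonneg (m k), hfreq k]
    linarith [hm1 k]
  -- Multipliers of the first and second partial derivatives composed with the inverse of the
  -- constant part; `K₀` bounds them all.
  set d1 : Fin 3 → (Fin 3 → ℤ) → ℂ := fun i k => 2 * Real.pi * Complex.I * freq k i * m k with hd1
  set d2 : Fin 3 → Fin 3 → (Fin 3 → ℤ) → ℂ := fun i j k =>
    (2 * Real.pi * Complex.I) ^ 2 * (freq k i * freq k j) * m k with hd2
  have hcoord : ∀ k i, |freq k i| ≤ ‖freq k‖ := fun k i => PiLp.norm_apply_le (freq k) i
  set K₀ : ℝ := 4 * Real.pi ^ 2 * C + 4 * Real.pi * C with hK₀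
  have hK₀pos : 0 < K₀ := by positivity
  have hd1le : ∀ i k, ‖d1 i k‖ ≤ K₀ := by
    intro i k
    have h1 : ‖d1 i k‖ = 2 * Real.pi * (|freq k i| * ‖m k‖) := by
      simp only [hd1, norm_mul, Complex.norm_I, Complex.norm_real, Real.norm_eq_abs,
        abs_of_pos hpi, Complex.norm_ofNat]
      ring
    have h2 : |freq k i| * ‖m k‖ ≤ 2 * C :=
      (mul_le_mul_of_nonneg_right (hcoord k i) (norm_nonneg _)).trans (hm1 k)
    rw [h1, hK₀]
    nlinarith [mul_le_mul_of_nonneg_left h2 (by positivity : 0 ≤ 2 * Real.pi),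
      (by positivity : 0 < 4 * Real.pi ^ 2 * C)]
  have hd2le : ∀ i j k, ‖d2 i j k‖ ≤ K₀ := by
    intro i j k
    have h1 : ‖d2 i j k‖ = 4 * Real.pi ^ 2 * (|freq k i| * |freq k j| * ‖m k‖) := by
      simp only [hd2, norm_mul, norm_pow, Complex.norm_I, Complex.norm_real, Real.norm_eq_abs,
        abs_of_pos hpi, Complex.norm_ofNat]
      ring
    have h2 : |freq k i| * |freq k j| * ‖m k‖ ≤ C := by
      refine le_trans ?_ (hm2 k)
      rw [pow_two]
      exact mul_le_mul_of_nonneg_right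
        (mul_le_mul (hcoord k i) (hcoord k j) (abs_nonneg _) (norm_nonneg _)) (norm_nonneg _)
    rw [h1, hK₀]
    nlinarith [mul_le_mul_of_nonneg_left h2 (by positivity : 0 ≤ 4 * Real.pi ^ 2),
      (by positivity : 0 < 4 * Real.pi * C)]
  have had2 : ∀ k, ∑ i, ∑ j, a i j * d2 i j k = 1 := by
    intro k
    have h1 : ∑ i, ∑ j, a i j * d2 i j k
        = ((2 * Real.pi * Complex.I) ^ 2 * ((Q k : ℝ) : ℂ)) * m k := by
      simp only [hQ, Complex.ofReal_sum, Complex.ofReal_mul, Finset.mul_sum, Finset.sum_mul, hd2]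
      refine Finset.sum_congr rfl fun i _ => Finset.sum_congr rfl fun j _ => ?_
      ring
    rw [h1, hm]
    refine mul_inv_cancel₀ (mul_ne_zero (pow_ne_zero 2 Complex.two_pi_I_ne_zero) ?_)
    exact_mod_cast (hQpos k).ne'
  refine ⟨2 * K₀, by positivity, fun α β γ hαβ => ?_⟩
  -- The perturbation applied to the k-th wave, as a family of coefficients: the k-th column of the
  -- operator on ℓ¹. Uniformly bounded columns define a bounded operator.
  set col : (Fin 3 → ℤ) → Ell := fun k =>
    ∑ i, ∑ j, d2 i j k • shift k (α i j) + ∑ i, d1 i k • shift k (β i) with hcol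
  have hcolle : ∀ k, ‖col k‖ ≤ 1 / 2 := by
    intro k
    have h1 : ‖∑ i, ∑ j, d2 i j k • shift k (α i j)‖ ≤ K₀ * ∑ i, ∑ j, ‖α i j‖ := by
      rw [Finset.mul_sum]
      refine norm_sum_le_of_le _ fun i _ => ?_
      rw [Finset.mul_sum]
      refine norm_sum_le_of_le _ fun j _ => ?_
      rw [norm_smul, norm_shift]
      exact mul_le_mul_of_nonneg_right (hd2le i j k) (norm_nonneg _)
    have h2 : ‖∑ i, d1 i k • shift k (β i)‖ ≤ K₀ * ∑ i, ‖β i‖ := by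
      rw [Finset.mul_sum]
      refine norm_sum_le_of_le _ fun i _ => ?_
      rw [norm_smul, norm_shift]
      exact mul_le_mul_of_nonneg_right (hd1le i k) (norm_nonneg _)
    have h3 := (norm_add_le _ _).trans (add_le_add h1 h2)
    refine h3.trans ?_
    linarith
  obtain ⟨c, hc, hcn⟩ := exists_add_apply_eq
    (norm_ellLift_le (by norm_num : (0 : ℝ) ≤ 1 / 2) hcolle) γ
  set v : (Fin 3 → ℤ) → ℂ := fun k => c k * m k with hv
  have hvs0 : Summable fun k => ‖v k‖ := by
    refine ((summable_ell c).mul_right (4 * C)).of_nonneg_of_le (fun _ => norm_nonneg _) fun k => ?_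
    rw [hv, norm_mul]
    exact mul_le_mul_of_nonneg_left (hm0 k) (norm_nonneg _)
  have hv1 : ∀ k, ‖waveDeriv v k‖ ≤ ‖c k‖ * K₀ := by
    intro k
    rw [norm_waveDeriv, hv, norm_mul, hK₀]
    have h1 := mul_le_mul_of_nonneg_left (hm1 k) (norm_nonneg (c k))
    nlinarith [mul_le_mul_of_nonneg_left h1 (by positivity : 0 ≤ 2 * Real.pi),
      mul_nonneg (norm_nonneg (c k)) (by positivity : 0 ≤ 4 * Real.pi ^ 2 * C)]
  have hv2 : ∀ k, ‖waveDeriv (waveDeriv v) k‖ ≤ ‖c k‖ * K₀ := by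
    intro k
    rw [norm_waveDeriv, norm_waveDeriv, hv, norm_mul, hK₀]
    have h1 := mul_le_mul_of_nonneg_left (hm2 k) (norm_nonneg (c k))
    nlinarith [mul_le_mul_of_nonneg_left h1 (by positivity : 0 ≤ 4 * Real.pi ^ 2),
      mul_nonneg (norm_nonneg (c k)) (by positivity : 0 ≤ 4 * Real.pi * C)]
  have hcs : Summable fun k => ‖c k‖ * K₀ := (summable_ell c).mul_right K₀
  have hvs1 := hcs.of_nonneg_of_le (fun _ => norm_nonneg _) hv1
  have hvs2 := hcs.of_nonneg_of_le (fun _ => norm_nonneg _) hv2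
  have hf1 := hasFDerivAt_waveSum hvs0 hvs1
  have hf2 := hasFDerivAt_waveSum hvs1 hvs2
  have e1 : fderiv ℝ (waveSum v) = waveSum (waveDeriv v) := funext fun x => (hf1 x).fderiv
  have e2 : fderiv ℝ (waveSum (waveDeriv v)) = waveSum (waveDeriv (waveDeriv v)) :=
    funext fun x => (hf2 x).fderiv
  have hbound : (∑' k, ‖c k‖ * K₀) ≤ 2 * K₀ * ‖γ‖ := by
    rw [tsum_mul_right, ← norm_ell]
    nlinarith
  refine ⟨waveSum v, contDiff_two_of_hasFDerivAt hf1 hf2 (continuous_waveSum hvs2), fun x => ?_,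
    fun x => ?_, fun x A B R hA hB hR => ?_⟩
  · rw [e1]
    exact ((norm_waveSum_le hvs1 x).trans (hvs1.tsum_le_tsum hv1 hcs)).trans hbound
  · rw [e1, e2]
    exact ((norm_waveSum_le hvs2 x).trans (hvs2.tsum_le_tsum hv2 hcs)).trans hbound
  · have hin : ∀ k i, inner ℝ (freq k) (EuclideanSpace.single i (1 : ℝ)) = freq k i := fun k i => by
      rw [EuclideanSpace.inner_single_right]
      simp
    have s1 : ∀ i, HasSum (fun k => c k * wave (freq k) x * d1 i k)
        (waveSum (waveDeriv v) x (EuclideanSpace.single i 1)) := by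
      intro i
      have h1 := (summable_waveSum hvs1 x).hasSum.mapL
        (ContinuousLinearMap.apply ℝ ℂ (EuclideanSpace.single i (1 : ℝ) : Rn 3))
      refine h1.congr_fun fun k => ?_
      simp [waveDeriv, hv, hd1, hin]
      ring
    have s2 : ∀ i j, HasSum (fun k => c k * wave (freq k) x * d2 i j k)
        (waveSum (waveDeriv (waveDeriv v)) x (EuclideanSpace.single i 1)
          (EuclideanSpace.single j 1)) := by
      intro i j
      have h1 := (summable_waveSum hvs2 x).hasSum.mapL
        ((ContinuousLinearMap.apply ℝ ℂ (EuclideanSpace.single j (1 : ℝ) : Rn 3)).comp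
          (ContinuousLinearMap.apply ℝ (Rn 3 →L[ℝ] ℂ) (EuclideanSpace.single i (1 : ℝ) : Rn 3)))
      refine h1.congr_fun fun k => ?_
      simp [waveDeriv, hv, hd2, hin]
      ring
    have s3 : HasSum (fun k => c k * evalWave x (col k)) (evalWave x (ellLift col (1 / 2) hcolle c)) := by
      have h1 := (hasSum_ellLift hcolle c).mapL (evalWave x)
      refine h1.congr_fun fun k => ?_
      simp
    have s4 := (hasSum_evalWave c x).add s3
    rw [← map_add, hc] at s4
    have hR' : evalWave x γ = R := (hasSum_evalWave γ x).unique hR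
    rw [hR'] at s4
    have s5 := (hasSum_sum (s := Finset.univ) fun i _ => hasSum_sum (s := Finset.univ) fun j _ =>
      (s2 i j).mul_left (a i j + A i j)).add
        (hasSum_sum (s := Finset.univ) fun i _ => (s1 i).mul_left (B i))
    rw [e1, e2]
    -- Expanded over the waves of `c`, the left-hand side has as its k-th term c_k times the k-th
    -- wave plus c_k times the k-th column evaluated at x, and these sum to the value of c + Pc = γ.
    refine s5.unique (s4.congr_fun fun k => ?_)
    have h1 : evalWave x (col k) = (∑ i, ∑ j, d2 i j k * A i j + ∑ i, d1 i k * B i)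
        * wave (freq k) x := by
      simp only [hcol, map_add, map_sum, map_smul, evalWave_shift (hA _ _), evalWave_shift (hB _),
        smul_eq_mul, add_mul, Finset.sum_mul, mul_assoc]
    have h2 : ∑ i, ∑ j, (a i j + A i j) * (c k * wave (freq k) x * d2 i j k)
        = (∑ i, ∑ j, a i j * d2 i j k) * (c k * wave (freq k) x)
          + (∑ i, ∑ j, d2 i j k * A i j) * (c k * wave (freq k) x) := by
      simp only [Finset.sum_mul, ← Finset.sum_add_distrib]
      refine Finset.sum_congr rfl fun i _ => Finset.sum_congr rfl fun j _ => ?_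
      ring
    have h3 : ∑ i, B i * (c k * wave (freq k) x * d1 i k)
        = (∑ i, d1 i k * B i) * (c k * wave (freq k) x) := by
      simp only [Finset.sum_mul]
      refine Finset.sum_congr rfl fun i _ => ?_
      ring
    rw [h1, h2, h3, had2]
    ring

end Perturbation

/-! ### Local harmonic functions with prescribed approximate jets -/

section HarmonicFunctions

open Filter

/-- Multiply by a bump function. Only the germ at `q` matters, but the Fourier construction needs
functions on the whole space. -/
theorem exists_smooth_extension {g : Rn 3 → ℝ} {t : Set (Rn 3)} (ht : IsOpen t)
    (hg : ContDiffOn ℝ ∞ g t) {q : Rn 3} (hq : q ∈ t) :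
    ∃ g' : Rn 3 → ℝ, ContDiff ℝ ∞ g' ∧ g' =ᶠ[𝓝 q] g := by
  obtain ⟨ε, hε, hball⟩ := Metric.isOpen_iff.1 ht q hq
  let χ : ContDiffBump q := ⟨ε / 4, ε / 2, by linarith, by linarith⟩
  refine ⟨fun z => χ z * g z, ?_, ?_⟩
  · rw [contDiff_iff_contDiffAt]
    intro z
    by_cases hz : z ∈ t
    · exact χ.contDiff.contDiffAt.mul (hg.contDiffAt (ht.mem_nhds hz))
    · have hz' : ε / 2 < dist z q := by
        by_contra! h
        exact hz (hball (by rw [Metric.mem_ball]; linarith))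
      have : (fun z => χ z * g z) =ᶠ[𝓝 z] fun _ => 0 := by
        filter_upwards [(isOpen_lt continuous_const (continuous_id.dist continuous_const)).mem_nhds
          hz'] with y hy
        rw [χ.zero_of_le_dist (x := y) (le_of_lt hy), zero_mul]
      exact contDiffAt_const.congr_of_eventuallyEq this
  · filter_upwards [χ.eventuallyEq_one] with z hz
    rw [hz, Pi.one_apply, one_mul]

/-- The quadratic form of the inverse matrix at ξ is H(w,w) for the vector w dual to ξ, so it is
positive; by homogeneity its minimum on the unit sphere is an ellipticity constant. -/
theorem modelInv_elliptic {H : Rn 3 → (Rn 3 →L[ℝ] Rn 3 →L[ℝ] ℝ)} {t : Set (Rn 3)}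
    (hH : IsMetricOn H t) {q : Rn 3} (hq : q ∈ t) :
    ∃ l : ℝ, 0 < l ∧ ∀ ξ : Rn 3, l * ‖ξ‖ ^ 2 ≤ ∑ i, ∑ j, modelInv H q i j * (ξ i * ξ j) := by
  set Q : Rn 3 → ℝ := fun ξ => ∑ i, ∑ j, modelInv H q i j * (ξ i * ξ j) with hQ
  have hQc : Continuous Q := by fun_prop
  have hpos : ∀ ξ, ξ ≠ 0 → 0 < Q ξ := by
    intro ξ hξ
    set L : Rn 3 →L[ℝ] ℝ := ∑ j, ξ j • (EuclideanSpace.proj j : Rn 3 →L[ℝ] ℝ) with hL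
    set w := (H q).inverse L with hw
    have h1 : H q w = L := hH.apply_inverse hq L
    have h2 : Q ξ = L w := by
      have h3 : ∀ i, w i = ∑ j, ξ j * modelInv H q i j := by
        intro i
        rw [hw, hL, map_sum]
        simp [modelInv]
      rw [hL]
      simp only [sum_apply, smul_apply, hQ, PiLp.proj_apply, h3, smul_eq_mul]
      refine Finset.sum_congr rfl fun i _ => ?_
      rw [Finset.mul_sum]
      exact Finset.sum_congr rfl fun j _ => by ring
    rw [h2, ← h1]
    refine hH.pos q hq w fun h0 => hξ ?_
    rw [h0, map_zero] at h1
    ext i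
    have := DFunLike.congr_fun h1 (EuclideanSpace.single i 1)
    simpa [hL] using this.symm
  have hne : (Metric.sphere (0 : Rn 3) 1).Nonempty := NormedSpace.sphere_nonempty.2 zero_le_one
  obtain ⟨ξ₀, hξ₀, hmin⟩ := (isCompact_sphere (0 : Rn 3) 1).exists_isMinOn hne hQc.continuousOn
  have hξ₀' : ξ₀ ≠ 0 := by
    rintro rfl
    simp at hξ₀
  refine ⟨Q ξ₀, hpos _ hξ₀', fun ξ => ?_⟩
  by_cases hξ : ξ = 0
  · subst hξ
    simp
  · have hn : ‖ξ‖ ≠ 0 := norm_ne_zero_iff.2 hξ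
    have h1 := hmin (a := ‖ξ‖⁻¹ • ξ) (by simp [norm_smul, hn])
    have h2 : Q ξ = ‖ξ‖ ^ 2 * Q (‖ξ‖⁻¹ • ξ) := by
      simp only [hQ, Finset.mul_sum]
      refine Finset.sum_congr rfl fun i _ => Finset.sum_congr rfl fun j _ => ?_
      simp only [PiLp.smul_apply, smul_eq_mul]
      field_simp
    change Q ξ₀ * ‖ξ‖ ^ 2 ≤ Q ξ
    rw [h2, mul_comm]
    exact mul_le_mul_of_nonneg_left h1 (by positivity)

/-- The coefficients of the first order part of the Laplacian. -/
def laplacianDrift (H : Rn 3 → (Rn 3 →L[ℝ] Rn 3 →L[ℝ] ℝ)) (l : Fin 3) (y : Rn 3) : ℝ :=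
  -∑ i, ∑ j, modelInv H y i j *
    christoffelL H y (EuclideanSpace.single i 1) (EuclideanSpace.single j 1) l

theorem modelLaplacian_eq_drift (H : Rn 3 → (Rn 3 →L[ℝ] Rn 3 →L[ℝ] ℝ)) (f : Rn 3 → ℝ) (y : Rn 3) :
    modelLaplacian H f y
      = ∑ i, ∑ j, modelInv H y i j * fderiv ℝ (fderiv ℝ f) y (EuclideanSpace.single i 1)
          (EuclideanSpace.single j 1)
        + ∑ l, laplacianDrift H l y * fderiv ℝ f y (EuclideanSpace.single l 1) := by
  have h1 : ∀ w : Rn 3, fderiv ℝ f y w = ∑ l, w l * fderiv ℝ f y (EuclideanSpace.single l 1) := by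
    intro w
    have hw := (EuclideanSpace.basisFun (Fin 3) ℝ).sum_repr w
    conv_lhs => rw [← hw]
    simp
  simp only [modelLaplacian, modelHessian, laplacianDrift, ← christoffelL_apply]
  have h2 := fun i j : Fin 3 => h1 (christoffelL H y (EuclideanSpace.single i 1)
    (EuclideanSpace.single j 1))
  simp only [h2, Fin.sum_univ_three]
  ring

theorem smooth_modelInv {H : Rn 3 → (Rn 3 →L[ℝ] Rn 3 →L[ℝ] ℝ)} {t : Set (Rn 3)}
    (hH : IsMetricOn H t) (i j : Fin 3) : ContDiffOn ℝ ∞ (fun y => modelInv H y i j) t := by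
  have h1 : ContDiffOn ℝ ∞ (fun y => (H y).inverse (EuclideanSpace.proj j : Rn 3 →L[ℝ] ℝ)) t :=
    hH.smooth_inverse.clm_apply contDiffOn_const
  exact (EuclideanSpace.proj i : Rn 3 →L[ℝ] ℝ).contDiff.comp_contDiffOn h1

theorem smooth_laplacianDrift {H : Rn 3 → (Rn 3 →L[ℝ] Rn 3 →L[ℝ] ℝ)} {t : Set (Rn 3)}
    (hH : IsMetricOn H t) (l : Fin 3) : ContDiffOn ℝ ∞ (laplacianDrift H l) t := by
  refine (ContDiffOn.sum fun i _ => ContDiffOn.sum fun j _ =>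
    (smooth_modelInv hH i j).mul ?_).neg
  have h1 : ContDiffOn ℝ ∞ (fun y => christoffelL H y (EuclideanSpace.single i (1 : ℝ))
      (EuclideanSpace.single j (1 : ℝ))) t :=
    (hH.smooth_christoffelL.clm_apply contDiffOn_const).clm_apply contDiffOn_const
  exact (EuclideanSpace.proj l : Rn 3 →L[ℝ] ℝ).contDiff.comp_contDiffOn h1

theorem contDiff_wave (ξ : Rn 3) : ContDiff ℝ ∞ (wave ξ) := by
  have h1 : ContDiff ℝ ∞ fun x : Rn 3 => ((2 * Real.pi * inner ℝ ξ x : ℝ) : ℂ) * Complex.I :=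
    (Complex.ofRealCLM.contDiff.comp (contDiff_const.mul (contDiff_const.inner ℝ contDiff_id))).mul
      contDiff_const
  exact h1.cexp

/-- If a smooth family vanishes for `r = 0`, then so does its expansion in the frequencies
`freq k`. -/
theorem exists_freq_family {Ψ : ℝ × Rn 3 → ℂ} (hΨ : ContDiff ℝ ∞ Ψ) (h0 : ∀ x, Ψ (0, x) = 0) :
    ∃ c : ℝ → Ell, Tendsto (fun r => ‖c r‖) (𝓝 0) (𝓝 0) ∧
      ∀ r x, ‖x‖ < 1 / 4 → HasSum (fun k => c r k * wave (freq k) x) (Ψ (r, x)) := by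
  set κ : Rn 3 := EuclideanSpace.single 0 (1 / 2)
  obtain ⟨c, hc, hcs⟩ := exists_fourier_family
    (Ψ := fun z => Ψ z * wave (-κ) z.2) (hΨ.mul ((contDiff_wave _).comp contDiff_snd))
    fun x => by rw [h0, zero_mul]
  refine ⟨c, hc, fun r x hx => ?_⟩
  have h1 := (hcs r x hx).mul_right (wave κ x)
  have h2 : wave (-κ) x * wave κ x = 1 := by
    rw [← wave_add, neg_add_cancel]
    simp [wave]
  simp only [mul_assoc, h2, mul_one] at h1
  refine h1.congr_fun fun k => ?_
  rw [← wave_add]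
  rfl

end HarmonicFunctions

/-! ### Harmonic functions obtained by blowing up at a point -/

section HarmonicJets

open Filter

theorem fderiv_rescale {F : Type*} [NormedAddCommGroup F] [NormedSpace ℝ F] {u : Rn 3 → F}
    (hu : Differentiable ℝ u) (r : ℝ) (q z : Rn 3) :
    fderiv ℝ (fun z => u (r • (z - q))) z = r • fderiv ℝ u (r • (z - q)) := by
  have h1 : HasFDerivAt (fun z : Rn 3 => r • (z - q)) (r • ContinuousLinearMap.id ℝ (Rn 3)) z :=
    ((hasFDerivAt_id z).sub_const q).const_smul r
  have h2 := (hu (r • (z - q))).hasFDerivAt.comp z h1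
  refine h2.fderiv.trans ?_
  ext v
  simp

/-- In the variable x = (z - q)/r the operator r²Δ has second order coefficients close to those
frozen at `q` and first order ones of size r. The function `u` solves the frozen equation, so its
error is small and is corrected by a small `w`; then f(z) = (u + Re w)((z - q)/r), and the powers of
r undo the rescaling of the derivatives. -/
theorem exists_harmonic_perturbation {H : Rn 3 → (Rn 3 →L[ℝ] Rn 3 →L[ℝ] ℝ)} {t : Set (Rn 3)}
    (hH : IsMetricOn H t) {q : Rn 3} (hq : q ∈ t) {u : Rn 3 → ℝ} (hu : ContDiff ℝ ∞ u)
    (hu0 : ∀ x, ∑ i, ∑ j, modelInv H q i j * fderiv ℝ (fderiv ℝ u) x (EuclideanSpace.single i 1)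
      (EuclideanSpace.single j 1) = 0) {ε : ℝ} (hε : 0 < ε) :
    ∀ᶠ r in 𝓝[>] (0 : ℝ), ∃ f : Rn 3 → ℝ, ContDiff ℝ 2 f ∧
      (∀ᶠ z in 𝓝 q, modelLaplacian H f z = 0) ∧
      ‖r • fderiv ℝ f q - fderiv ℝ u 0‖ ≤ ε ∧
      ‖r ^ 2 • fderiv ℝ (fderiv ℝ f) q - fderiv ℝ (fderiv ℝ u) 0‖ ≤ ε := by
  choose a ha hae using fun i j => exists_smooth_extension hH.isOpen (smooth_modelInv hH i j) hq
  choose b hb hbe using fun l => exists_smooth_extension hH.isOpen (smooth_laplacianDrift hH l) hq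
  obtain ⟨l, hl, hell⟩ := modelInv_elliptic hH hq
  obtain ⟨K, hK, hsol⟩ := exists_perturbed_solution hl hell
  have haff : ContDiff ℝ ∞ fun z : ℝ × Rn 3 => q + z.1 • z.2 :=
    contDiff_const.add (contDiff_fst.smul contDiff_snd)
  have haq : ∀ i j, a i j q = modelInv H q i j := fun i j => (hae i j).self_of_nhds
  -- Deviation of the rescaled coefficients from the frozen ones; all of `A`, `B`, `R` vanish at r =
  -- 0.
  set A : Fin 3 → Fin 3 → ℝ × Rn 3 → ℝ := fun i j z => a i j (q + z.1 • z.2) - a i j q with hA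
  set B : Fin 3 → ℝ × Rn 3 → ℝ := fun l z => z.1 * b l (q + z.1 • z.2) with hB
  have hAs : ∀ i j, ContDiff ℝ ∞ (A i j) := fun i j => ((ha i j).comp haff).sub contDiff_const
  have hBs : ∀ i, ContDiff ℝ ∞ (B i) := fun i => contDiff_fst.mul ((hb i).comp haff)
  have hu1 : ContDiff ℝ ∞ (fderiv ℝ u) := hu.fderiv_right (by simp)
  have hu2 : ContDiff ℝ ∞ (fderiv ℝ (fderiv ℝ u)) := hu1.fderiv_right (by simp)
  -- Minus the rescaled Laplacian of `u`: only the perturbation terms occur, since the frozen part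
  -- annihilates `u`.
  set R : ℝ × Rn 3 → ℝ := fun z => -(∑ i, ∑ j, A i j z * fderiv ℝ (fderiv ℝ u) z.2
      (EuclideanSpace.single i 1) (EuclideanSpace.single j 1)
    + ∑ i, B i z * fderiv ℝ u z.2 (EuclideanSpace.single i 1)) with hR
  have hRs : ContDiff ℝ ∞ R := by
    refine ((ContDiff.sum fun i _ => ContDiff.sum fun j _ => (hAs i j).mul ?_).add
      (ContDiff.sum fun i _ => (hBs i).mul ?_)).neg
    · exact ((hu2.comp contDiff_snd).clm_apply contDiff_const).clm_apply contDiff_const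
    · exact (hu1.comp contDiff_snd).clm_apply contDiff_const
  have hA0 : ∀ i j x, A i j (0, x) = 0 := fun i j x => by simp [hA]
  have hB0 : ∀ i x, B i (0, x) = 0 := fun i x => by simp [hB]
  have hR0 : ∀ x, R (0, x) = 0 := fun x => by simp [hR, hA0, hB0]
  have hcplx : ∀ {f : ℝ × Rn 3 → ℝ}, ContDiff ℝ ∞ f → ContDiff ℝ ∞ fun z => (f z : ℂ) :=
    fun hf => Complex.ofRealCLM.contDiff.comp hf
  choose α hα hαs using fun i j => exists_fourier_family (hcplx (hAs i j)) fun x => by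
    rw [hA0, Complex.ofReal_zero]
  choose β hβ hβs using fun i => exists_fourier_family (hcplx (hBs i)) fun x => by
    rw [hB0, Complex.ofReal_zero]
  obtain ⟨γ, hγ, hγs⟩ := exists_freq_family (hcplx hRs) fun x => by rw [hR0, Complex.ofReal_zero]
  have hsmall : ∀ᶠ r in 𝓝 (0 : ℝ), K * (∑ i, ∑ j, ‖α i j r‖ + ∑ i, ‖β i r‖) < 1 := by
    have h1 := ((tendsto_finsetSum Finset.univ fun i _ => tendsto_finsetSum Finset.univ
      fun j _ => hα i j).add (tendsto_finsetSum Finset.univ fun i _ => hβ i)).const_mul K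
    simp only [Finset.sum_const_zero, add_zero, mul_zero] at h1
    exact h1.eventually_lt_const one_pos
  have hsmall' : ∀ᶠ r in 𝓝 (0 : ℝ), K * ‖γ r‖ < ε := by
    have h1 := hγ.const_mul K
    rw [mul_zero] at h1
    exact h1.eventually_lt_const hε
  filter_upwards [nhdsWithin_le_nhds hsmall, nhdsWithin_le_nhds hsmall', self_mem_nhdsWithin]
    with r hr1 hr2 hr0
  have hr0' : r ≠ 0 := ne_of_gt hr0
  obtain ⟨w, hw, hw1, hw2, hweq⟩ := hsol (fun i j => α i j r) (fun i => β i r) (γ r) hr1.le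
  -- The coefficients are real, so the real part of `w` solves the real part of the equation.
  set v : Rn 3 → ℝ := fun x => u x + (w x).re with hv
  have hwre : ContDiff ℝ 2 fun x => (w x).re := Complex.reCLM.contDiff.comp hw
  have hvs : ContDiff ℝ 2 v := (hu.of_le (by simpa using ENat.LEInfty.out)).add hwre
  have dw : Differentiable ℝ w := hw.differentiable (by simp)
  have dw1 : Differentiable ℝ (fderiv ℝ w) :=
    (hw.fderiv_right (m := 1) (by norm_num)).differentiable (by simp)
  have du : Differentiable ℝ u := hu.differentiable (by simp)
  have du1 : Differentiable ℝ (fderiv ℝ u) := hu1.differentiable (by simp)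
  have dv : Differentiable ℝ v := hvs.differentiable (by simp)
  have dv1 : Differentiable ℝ (fderiv ℝ v) :=
    (hvs.fderiv_right (m := 1) (by norm_num)).differentiable (by simp)
  have e1 : fderiv ℝ v = fun x => fderiv ℝ u x
      + (ContinuousLinearMap.compL ℝ (Rn 3) ℂ ℝ Complex.reCLM) (fderiv ℝ w x) := by
    funext x
    exact ((du x).hasFDerivAt.add (Complex.reCLM.hasFDerivAt.comp x (dw x).hasFDerivAt)).fderiv
  have e2 : ∀ x y, fderiv ℝ (fderiv ℝ v) x y = fderiv ℝ (fderiv ℝ u) x y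
      + Complex.reCLM.comp (fderiv ℝ (fderiv ℝ w) x y) := by
    intro x y
    rw [e1]
    exact DFunLike.congr_fun ((du1 x).hasFDerivAt.add ((ContinuousLinearMap.compL ℝ (Rn 3) ℂ ℝ
      Complex.reCLM).hasFDerivAt.comp x (dw1 x).hasFDerivAt)).fderiv y
  have e1' : ∀ x y, fderiv ℝ v x y = fderiv ℝ u x y + (fderiv ℝ w x y).re := fun x y => by
    rw [e1]
    rfl
  have e2' : ∀ x y y', fderiv ℝ (fderiv ℝ v) x y y' = fderiv ℝ (fderiv ℝ u) x y y'
      + (fderiv ℝ (fderiv ℝ w) x y y').re := fun x y y' => by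
    rw [e2]
    rfl
  set f : Rn 3 → ℝ := fun z => v (r⁻¹ • (z - q)) with hf
  have f1 : fderiv ℝ f = fun z => r⁻¹ • fderiv ℝ v (r⁻¹ • (z - q)) :=
    funext fun z => fderiv_rescale dv _ _ _
  have f2 : ∀ z, fderiv ℝ (fderiv ℝ f) z = (r⁻¹ * r⁻¹) • fderiv ℝ (fderiv ℝ v) (r⁻¹ • (z - q)) := by
    intro z
    rw [f1]
    have hd : DifferentiableAt ℝ (fun z => fderiv ℝ v (r⁻¹ • (z - q))) z := by fun_prop
    rw [fderiv_fun_const_smul hd, fderiv_rescale dv1, smul_smul]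
  refine ⟨f, by fun_prop, ?_, ?_, ?_⟩
  -- Near `q` the rescaled point lies in the ball where the series converge to the coefficients, and
  -- there the extended coefficients are the true ones.
  · have hnear : ∀ᶠ z in 𝓝 q, ‖r⁻¹ • (z - q)‖ < 1 / 4 := by
      have : Continuous fun z : Rn 3 => ‖r⁻¹ • (z - q)‖ := by fun_prop
      refine this.continuousAt.eventually_lt_const ?_
      simp
    have hae' : ∀ᶠ z in 𝓝 q, ∀ i j, a i j z = modelInv H z i j := by
      rw [eventually_all]; intro i
      rw [eventually_all]; intro j
      exact hae i j
    have hbe' : ∀ᶠ z in 𝓝 q, ∀ i, b i z = laplacianDrift H i z := by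
      rw [eventually_all]; intro i
      exact hbe i
    filter_upwards [hnear, hae', hbe'] with z hz haz hbz
    set x := r⁻¹ • (z - q) with hx
    have hqx : q + r • x = z := by rw [hx, smul_smul, mul_inv_cancel₀ hr0', one_smul]; abel
    have key := congrArg Complex.re (hweq x (fun i j => A i j (r, x)) (fun i => B i (r, x))
      (R (r, x)) (fun i j => hαs i j r x hz) (fun i => hβs i r x hz) (hγs r x hz))
    rw [Complex.ofReal_re, Complex.add_re, Complex.re_sum, Complex.re_sum] at key
    simp only [Complex.re_sum, ← Complex.ofReal_add, Complex.re_ofReal_mul] at key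
    rw [modelLaplacian_eq_drift, f2]
    simp only [f1, ← haz, ← hbz, smul_apply, smul_eq_mul, e2', e1']
    have hAz : ∀ i j, a i j z = modelInv H q i j + A i j (r, x) := by
      intro i j
      rw [← haq]
      simp only [hA, hqx]
      ring
    have hBz : ∀ i, r * b i z = B i (r, x) := by
      intro i
      simp only [hB, hqx]
    have hu0x := hu0 x
    simp only [hR] at key
    have goal' : r * r * (∑ i, ∑ j, a i j z * (r⁻¹ * r⁻¹ * (fderiv ℝ (fderiv ℝ u) x
          (EuclideanSpace.single i 1) (EuclideanSpace.single j 1)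
          + (fderiv ℝ (fderiv ℝ w) x (EuclideanSpace.single i 1) (EuclideanSpace.single j 1)).re))
        + ∑ i, b i z * (r⁻¹ * (fderiv ℝ u x (EuclideanSpace.single i 1)
          + (fderiv ℝ w x (EuclideanSpace.single i 1)).re))) = 0 := by
      rw [mul_add, Finset.mul_sum, Finset.mul_sum]
      have s1 : ∀ i, r * r * ∑ j, a i j z * (r⁻¹ * r⁻¹ * (fderiv ℝ (fderiv ℝ u) x
          (EuclideanSpace.single i 1) (EuclideanSpace.single j 1)
          + (fderiv ℝ (fderiv ℝ w) x (EuclideanSpace.single i 1) (EuclideanSpace.single j 1)).re))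
          = ∑ j, (modelInv H q i j * fderiv ℝ (fderiv ℝ u) x
            (EuclideanSpace.single i 1) (EuclideanSpace.single j 1)
            + A i j (r, x) * fderiv ℝ (fderiv ℝ u) x
            (EuclideanSpace.single i 1) (EuclideanSpace.single j 1)
            + (modelInv H q i j + A i j (r, x)) * (fderiv ℝ (fderiv ℝ w) x
              (EuclideanSpace.single i 1) (EuclideanSpace.single j 1)).re) := by
        intro i
        rw [Finset.mul_sum]
        refine Finset.sum_congr rfl fun j _ => ?_
        rw [hAz]
        field_simp
      have s2 : ∀ i, r * r * (b i z * (r⁻¹ * (fderiv ℝ u x (EuclideanSpace.single i 1)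
          + (fderiv ℝ w x (EuclideanSpace.single i 1)).re)))
          = B i (r, x) * fderiv ℝ u x (EuclideanSpace.single i 1)
            + B i (r, x) * (fderiv ℝ w x (EuclideanSpace.single i 1)).re := by
        intro i
        rw [← hBz]
        field_simp
      simp only [s1, s2, Finset.sum_add_distrib]
      rw [hu0x]
      linarith [key]
    exact (mul_eq_zero.1 goal').resolve_left (mul_ne_zero hr0' hr0')
  · rw [f1]
    simp only [sub_self, smul_zero, smul_smul, mul_inv_cancel₀ hr0', one_smul, e1,
      add_sub_cancel_left]
    refine (ContinuousLinearMap.opNorm_comp_le _ _).trans ?_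
    rw [Complex.reCLM_norm, one_mul]
    exact (hw1 0).trans hr2.le
  · rw [f2]
    simp only [sub_self, smul_zero, smul_smul]
    rw [show r ^ 2 * (r⁻¹ * r⁻¹) = 1 by field_simp, one_smul]
    refine ContinuousLinearMap.opNorm_le_bound _ hε.le fun y => ?_
    rw [sub_apply, e2, add_sub_cancel_left]
    refine (ContinuousLinearMap.opNorm_comp_le _ _).trans ?_
    rw [Complex.reCLM_norm, one_mul]
    exact ((fderiv ℝ (fderiv ℝ w) 0).le_opNorm y).trans
      (mul_le_mul_of_nonneg_right ((hw2 0).trans hr2.le) (norm_nonneg _))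

/-- There are harmonic functions whose differential at `q` is arbitrarily close to a given one. -/
theorem exists_harmonic_gradient {H : Rn 3 → (Rn 3 →L[ℝ] Rn 3 →L[ℝ] ℝ)} {t : Set (Rn 3)}
    (hH : IsMetricOn H t) {q : Rn 3} (hq : q ∈ t) (p : Rn 3 →L[ℝ] ℝ) {ε : ℝ} (hε : 0 < ε) :
    ∃ f : Rn 3 → ℝ, ContDiff ℝ 2 f ∧ (∀ᶠ z in 𝓝 q, modelLaplacian H f z = 0) ∧
      ‖fderiv ℝ f q - p‖ ≤ ε := by
  have hp : fderiv ℝ p = fun _ => p := funext fun _ => p.fderiv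
  -- A linear `u` solves every frozen equation; for one sufficiently small r, the multiple r f has
  -- the required differential.
  have h1 := exists_harmonic_perturbation hH hq p.contDiff (by simp [hp]) hε
  obtain ⟨r, ⟨f, hf, hlap, hd, -⟩, hr⟩ := (h1.and self_mem_nhdsWithin).exists
  refine ⟨fun z => r * f z, contDiff_const.mul hf, ?_, ?_⟩
  · filter_upwards [hlap] with z hz
    have hd1 : fderiv ℝ (fun z => r * f z) = fun z => r • fderiv ℝ f z := funext fun z =>
      fderiv_const_mul (hf.differentiable (by simp) z) r
    have hd2 : fderiv ℝ (fun z => r • fderiv ℝ f z) z = r • fderiv ℝ (fderiv ℝ f) z :=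
      fderiv_fun_const_smul ((hf.fderiv_right (m := 1) (by norm_num)).differentiable (by simp) z) r
    simp only [modelLaplacian, modelHessian, hd1, hd2, smul_apply, smul_eq_mul, ← mul_sub,
      mul_left_comm _ r, ← Finset.mul_sum] at hz ⊢
    rw [hz, mul_zero]
  · rw [fderiv_const_mul (hf.differentiable (by simp) q) r]
    rwa [hp] at hd

/-- There are harmonic functions whose differential at `q` is arbitrarily small and whose
second derivative at `q` is arbitrarily close to a given trace-free one. -/
theorem exists_harmonic_hessian {H : Rn 3 → (Rn 3 →L[ℝ] Rn 3 →L[ℝ] ℝ)} {t : Set (Rn 3)}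
    (hH : IsMetricOn H t) {q : Rn 3} (hq : q ∈ t) {S : Rn 3 →L[ℝ] Rn 3 →L[ℝ] ℝ}
    (hS : ∀ v w, S v w = S w v) (htr : bilinTrace (H q) S = 0) {ε : ℝ} (hε : 0 < ε) :
    ∃ f : Rn 3 → ℝ, ContDiff ℝ 2 f ∧ (∀ᶠ z in 𝓝 q, modelLaplacian H f z = 0) ∧
      ‖fderiv ℝ f q‖ ≤ ε ∧ ‖fderiv ℝ (fderiv ℝ f) q - S‖ ≤ ε := by
  set u : Rn 3 → ℝ := fun x => (1 / 2) * S x x with hu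
  have hus : ContDiff ℝ ∞ u :=
    contDiff_const.mul ((S.contDiff.clm_apply contDiff_id))
  have hu1 : fderiv ℝ u = S := by
    funext x
    have h1 : HasFDerivAt (fun x => S x x) _ x := S.hasFDerivAt.clm_apply (hasFDerivAt_id x)
    ext v
    rw [hu, (h1.const_mul (1 / 2)).fderiv]
    simp
    rw [hS v x]
    ring
  have hu2 : ∀ x, fderiv ℝ (fderiv ℝ u) x = S := fun x => by rw [hu1]; exact S.fderiv
  -- With the quadratic function of `S`, trace-freeness is the frozen equation and r²f has second
  -- derivative near `S`. Its differential is r times r df, where ‖r df‖ ≤ 1 by the second entry of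
  -- the minimum, so r < ε makes it small.
  have h1 := exists_harmonic_perturbation hH hq hus
    (fun x => by rw [hu2, sum_modelInv_mul, htr]) (lt_min hε one_pos)
  have h2 : ∀ᶠ r in 𝓝[>] (0 : ℝ), r < ε := nhdsWithin_le_nhds (eventually_lt_nhds hε)
  obtain ⟨r, ⟨⟨f, hf, hlap, hd, hdd⟩, hr⟩, hr0⟩ := ((h1.and h2).and self_mem_nhdsWithin).exists
  have hr0' : 0 < r := hr0
  refine ⟨fun z => r ^ 2 * f z, contDiff_const.mul hf, ?_, ?_, ?_⟩
  · filter_upwards [hlap] with z hz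
    have hd1 : fderiv ℝ (fun z => r ^ 2 * f z) = fun z => r ^ 2 • fderiv ℝ f z := funext fun z =>
      fderiv_const_mul (hf.differentiable (by simp) z) _
    have hd2 : fderiv ℝ (fun z => r ^ 2 • fderiv ℝ f z) z = r ^ 2 • fderiv ℝ (fderiv ℝ f) z :=
      fderiv_fun_const_smul ((hf.fderiv_right (m := 1) (by norm_num)).differentiable (by simp) z) _
    simp only [modelLaplacian, modelHessian, hd1, hd2, smul_apply, smul_eq_mul, ← mul_sub,
      mul_left_comm _ (r ^ 2), ← Finset.mul_sum] at hz ⊢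
    rw [hz, mul_zero]
  · rw [fderiv_const_mul (hf.differentiable (by simp) q), pow_two, ← smul_smul, norm_smul,
      Real.norm_of_nonneg hr0'.le]
    rw [hu1, map_zero, sub_zero] at hd
    have := hd.trans (min_le_right _ _)
    nlinarith [norm_nonneg (r • fderiv ℝ f q)]
  · have hd1 : fderiv ℝ (fun z => r ^ 2 * f z) = fun z => r ^ 2 • fderiv ℝ f z := funext fun z =>
      fderiv_const_mul (hf.differentiable (by simp) z) _
    rw [hd1, fderiv_fun_const_smul
      ((hf.fderiv_right (m := 1) (by norm_num)).differentiable (by simp) q), ← hu2 0]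
    exact hdd.trans (min_le_left _ _)

end HarmonicJets

/-! ### Maps which pull back harmonic functions are horizontally conformal -/

section Conformality

open Filter

theorem eq_zero_of_forall_abs_le {a C : ℝ} (h : ∀ ε, 0 < ε → |a| ≤ ε * C) : a = 0 := by
  have h1 : Tendsto (fun ε : ℝ => ε * C) (𝓝[>] 0) (𝓝 0) := by
    have : Tendsto (fun ε : ℝ => ε * C) (𝓝 0) (𝓝 (0 * C)) := tendsto_id.mul_const C
    rw [zero_mul] at this
    exact this.mono_left nhdsWithin_le_nhds
  have h2 : |a| ≤ 0 := ge_of_tendsto h1 (by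
    filter_upwards [self_mem_nhdsWithin] with ε hε using h ε hε)
  exact abs_eq_zero.1 (le_antisymm h2 (abs_nonneg _))

theorem bilinTrace_smulRight {n : ℕ} (B : Rn n →L[ℝ] Rn n →L[ℝ] ℝ) (l m : Rn n →L[ℝ] ℝ) :
    bilinTrace B (l.smulRight m) = l (B.inverse m) := by
  have h1 : ((B.inverse ∘L l.smulRight m : Rn n →L[ℝ] Rn n) : Rn n →ₗ[ℝ] Rn n)
      = (l : Rn n →ₗ[ℝ] ℝ).smulRight (B.inverse m) := by
    ext x
    simp
  rw [bilinTrace, h1, LinearMap.trace_smulRight]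
  rfl

theorem bilinTrace_sub_smul {n : ℕ} (B Q Q' : Rn n →L[ℝ] Rn n →L[ℝ] ℝ) (c : ℝ) :
    bilinTrace B (Q - c • Q') = bilinTrace B Q - c * bilinTrace B Q' := by
  have h1 : ((B.inverse ∘L (Q - c • Q') : Rn n →L[ℝ] Rn n) : Rn n →ₗ[ℝ] Rn n)
      = ((B.inverse ∘L Q : Rn n →L[ℝ] Rn n) : Rn n →ₗ[ℝ] Rn n)
        - c • ((B.inverse ∘L Q' : Rn n →L[ℝ] Rn n) : Rn n →ₗ[ℝ] Rn n) := by
    ext x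
    simp
  rw [bilinTrace, h1, map_sub, map_smul]
  rfl

theorem bilinTrace_self {n : ℕ} {B : Rn n →L[ℝ] Rn n →L[ℝ] ℝ} (hB : B.IsInvertible) :
    bilinTrace B B = n := by
  have h1 : ((B.inverse ∘L B : Rn n →L[ℝ] Rn n) : Rn n →ₗ[ℝ] Rn n) = LinearMap.id := by
    ext x : 1
    simp [hB.inverse_apply_self]
  rw [bilinTrace, h1, LinearMap.trace_id]
  simp

/-- Germs of harmonic functions at `Φ y` are pulled back to functions with vanishing Laplacian
at `y`. -/
def PreservesHarmonicAt (G : Rn 4 → (Rn 4 →L[ℝ] Rn 4 →L[ℝ] ℝ))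
    (H : Rn 3 → (Rn 3 →L[ℝ] Rn 3 →L[ℝ] ℝ)) (Φ : Rn 4 → Rn 3) (y : Rn 4) : Prop :=
  ∀ f : Rn 3 → ℝ, ContDiff ℝ 2 f → (∀ᶠ z in 𝓝 (Φ y), modelLaplacian H f z = 0) →
    modelLaplacian G (f ∘ Φ) y = 0

variable {G : Rn 4 → (Rn 4 →L[ℝ] Rn 4 →L[ℝ] ℝ)} {s : Set (Rn 4)}
  {H : Rn 3 → (Rn 3 →L[ℝ] Rn 3 →L[ℝ] ℝ)} {t : Set (Rn 3)} {Φ : Rn 4 → Rn 3} {y : Rn 4}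

/-- Pull back a harmonic f with df ≈ 0 and D²f ≈ S at Φ(y): its Laplacian vanishes and differs from
the trace of the pulled-back `S` by at most a fixed multiple of ε. -/
theorem PreservesHarmonicAt.bilinTrace_eq_zero (hh : PreservesHarmonicAt G H Φ y)
    (hΦ : ContDiffAt ℝ 2 Φ y) (hH : IsMetricOn H t) (hq : Φ y ∈ t)
    {S : Rn 3 →L[ℝ] Rn 3 →L[ℝ] ℝ} (hS : ∀ v w, S v w = S w v) (htr : bilinTrace (H (Φ y)) S = 0) :
    bilinTrace (G y) (S.bilinearComp (fderiv ℝ Φ y) (fderiv ℝ Φ y)) = 0 := by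
  set A := fderiv ℝ Φ y with hA
  set b : Fin 4 → Rn 4 := fun i => EuclideanSpace.single i 1 with hb
  set r : Fin 4 → Fin 4 → Rn 3 := fun i j =>
    fderiv ℝ (fderiv ℝ Φ) y (b i) (b j) - A (christoffel G y (b i) (b j)) with hr
  refine eq_zero_of_forall_abs_le (C := ∑ i, ∑ j, |modelInv G y i j| *
    (‖A (b i)‖ * ‖A (b j)‖ + ‖r i j‖)) fun ε hε => ?_
  obtain ⟨f, hf, hlap, hf1, hf2⟩ := exists_harmonic_hessian hH hq hS htr hε
  have h0 := hh f hf hlap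
  have hmod : ∀ i j, modelHessian G (f ∘ Φ) y (b i) (b j)
      = fderiv ℝ (fderiv ℝ f) (Φ y) (A (b i)) (A (b j)) + fderiv ℝ f (Φ y) (r i j) := by
    intro i j
    rw [modelHessian, fderiv_fderiv_comp hf.contDiffAt hΦ, fderiv_comp y
      (hf.differentiable (by simp) _) (hΦ.differentiableAt (by simp)),
      ContinuousLinearMap.comp_apply, hr, map_sub]
    ring
  rw [← sum_modelInv_mul]
  have h1 : ∑ i, ∑ j, modelInv G y i j * (S.bilinearComp A A) (b i) (b j)
      = ∑ i, ∑ j, modelInv G y i j * ((S - fderiv ℝ (fderiv ℝ f) (Φ y)) (A (b i)) (A (b j))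
        - fderiv ℝ f (Φ y) (r i j)) := by
    rw [← sub_zero (∑ i, ∑ j, modelInv G y i j * (S.bilinearComp A A) (b i) (b j)), ← h0,
      modelLaplacian, ← Finset.sum_sub_distrib]
    refine Finset.sum_congr rfl fun i _ => ?_
    rw [← Finset.sum_sub_distrib]
    refine Finset.sum_congr rfl fun j _ => ?_
    have := hmod i j
    simp only [hb] at this
    rw [this]
    simp [hb]
    ring
  simp only [hb] at h1 ⊢
  rw [h1, Finset.mul_sum]
  refine Finset.abs_sum_le_sum_abs _ _ |>.trans (Finset.sum_le_sum fun i _ => ?_)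
  rw [Finset.mul_sum]
  refine Finset.abs_sum_le_sum_abs _ _ |>.trans (Finset.sum_le_sum fun j _ => ?_)
  rw [abs_mul, mul_left_comm]
  refine mul_le_mul_of_nonneg_left ?_ (abs_nonneg _)
  refine (abs_sub _ _).trans ?_
  rw [mul_add]
  refine add_le_add ?_ ?_
  · refine ((S - fderiv ℝ (fderiv ℝ f) (Φ y)).le_opNorm₂ _ _).trans ?_
    rw [← norm_neg, neg_sub, mul_assoc]
    exact mul_le_mul_of_nonneg_right hf2 (by positivity)
  · exact (fderiv ℝ f (Φ y)).le_of_opNorm_le hf1 _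

/-- The horizontal vector `G⁻¹ (H (e, dΦ ·))`. -/
def gradLift (G : Rn 4 → (Rn 4 →L[ℝ] Rn 4 →L[ℝ] ℝ)) (H : Rn 3 → (Rn 3 →L[ℝ] Rn 3 →L[ℝ] ℝ))
    (Φ : Rn 4 → Rn 3) (y : Rn 4) (e : Rn 3) : Rn 4 :=
  (G y).inverse ((H (Φ y) e).comp (fderiv ℝ Φ y))

theorem apply_gradLift (hG : IsMetricOn G s) (hy : y ∈ s) (e : Rn 3) (w : Rn 4) :
    G y (gradLift G H Φ y e) w = H (Φ y) e (fderiv ℝ Φ y w) := by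
  rw [gradLift, hG.apply_inverse hy]
  rfl

/-- `gradLift` is the adjoint of dΦ, so dΦ∘dΦ* is symmetric. The vanishing of traces for trace-free
forms fixes its quadratic form as μ times the metric, and polarisation gives the operator itself. -/
theorem PreservesHarmonicAt.fderiv_gradLift (hh : PreservesHarmonicAt G H Φ y)
    (hG : IsMetricOn G s) (hy : y ∈ s)
    (hΦ : ContDiffAt ℝ 2 Φ y) (hH : IsMetricOn H t) (hq : Φ y ∈ t)
    (hsurj : Function.Surjective (fderiv ℝ Φ y)) :
    ∃ μ : ℝ, 0 < μ ∧ ∀ e, fderiv ℝ Φ y (gradLift G H Φ y e) = μ • e := by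
  set A := fderiv ℝ Φ y with hA
  set h := H (Φ y) with hh'
  set μ : ℝ := bilinTrace (G y) (h.bilinearComp A A) / 3 with hμ
  have hsym := hH.symm _ hq
  have key : ∀ e, h e (A (gradLift G H Φ y e)) = μ * h e e := by
    intro e
    -- The test form is the trace-free part of the square of H(e,·); the factor 1/3 reflects dim N =
    -- 3.
    set S₀ : Rn 3 →L[ℝ] Rn 3 →L[ℝ] ℝ := (h e).smulRight (h e) with hS₀
    have t0 : bilinTrace h S₀ = h e e := by
      rw [bilinTrace_smulRight, (hH.invertible hq).inverse_apply_self]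
    have h1 := hh.bilinTrace_eq_zero hΦ hH hq (S := S₀ - (h e e / 3) • h)
      (fun v w => by
        have := hsym v w
        rw [← hh'] at this
        simp [hS₀, this, mul_comm])
      (by rw [bilinTrace_sub_smul, t0, bilinTrace_self (hH.invertible hq)]; norm_num)
    have h2 : (S₀ - (h e e / 3) • h).bilinearComp A A
        = ((h e).comp A).smulRight ((h e).comp A) - (h e e / 3) • h.bilinearComp A A := by
      ext v w
      simp [hS₀]
    rw [h2, bilinTrace_sub_smul, bilinTrace_smulRight] at h1
    change h e (A (gradLift G H Φ y e)) - _ = 0 at h1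
    rw [hμ]
    linarith
  have hadd : ∀ e e', gradLift G H Φ y (e + e') = gradLift G H Φ y e + gradLift G H Φ y e' := by
    intro e e'
    simp [gradLift, ContinuousLinearMap.add_comp]
  have hswap : ∀ e e', h e (A (gradLift G H Φ y e')) = h e' (A (gradLift G H Φ y e)) := by
    intro e e'
    rw [← apply_gradLift hG hy, ← apply_gradLift hG hy, hG.symm y hy]
  have hall : ∀ e, A (gradLift G H Φ y e) = μ • e := by
    intro e
    apply hH.ext_of_apply hq
    intro e'
    have k1 := key (e + e')
    rw [hadd, map_add, map_add, map_add, add_apply, add_apply] at k1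
    have k2 := key e
    have k3 := key e'
    have k4 := hswap e e'
    have k5 : h (μ • e) e' = μ * h e e' := by simp
    have k6 := hsym (A (gradLift G H Φ y e)) e'
    have k7 := hsym e e'
    simp only [← hh', map_add, add_apply] at k1 k2 k3 k4 k5 k6 k7 ⊢
    rw [k6, k5]
    linear_combination (1 / 2) * k1 - (1 / 2) * k2 - (1 / 2) * k3 - (1 / 2) * k4 - (μ / 2) * k7
  refine ⟨μ, ?_, hall⟩
  -- Positivity of μ: μ H(e,e) is the squared length of the adjoint applied to e, nonzero because dΦ
  -- is onto.
  obtain ⟨e, he⟩ : ∃ e : Rn 3, e ≠ 0 := exists_ne 0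
  have h1 : gradLift G H Φ y e ≠ 0 := by
    intro h0
    obtain ⟨w, hw⟩ := hsurj e
    have h2 := apply_gradLift (H := H) (Φ := Φ) hG hy e w
    rw [h0, map_zero, ← hA, hw] at h2
    exact (hH.pos _ hq e he).ne h2
  have h2 := hG.pos y hy _ h1
  rw [apply_gradLift hG hy, ← hA, ← hh', key] at h2
  exact pos_of_mul_pos_left h2 (hH.pos _ hq e he).le

/-- Horizontal vectors are stretched by a common factor. -/
theorem PreservesHarmonicAt.conformal (hh : PreservesHarmonicAt G H Φ y)
    (hG : IsMetricOn G s) (hy : y ∈ s)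
    (hΦ : ContDiffAt ℝ 2 Φ y) (hH : IsMetricOn H t) (hq : Φ y ∈ t)
    (hsurj : Function.Surjective (fderiv ℝ Φ y)) :
    ∃ μ : ℝ, 0 < μ ∧ ∀ a b, (∀ w, fderiv ℝ Φ y w = 0 → G y a w = 0) →
      (∀ w, fderiv ℝ Φ y w = 0 → G y b w = 0) →
      H (Φ y) (fderiv ℝ Φ y a) (fderiv ℝ Φ y b) = μ * G y a b := by
  obtain ⟨μ, hμ, hall⟩ := hh.fderiv_gradLift hG hy hΦ hH hq hsurj
  refine ⟨μ, hμ, fun a b ha hb => ?_⟩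
  have h1 : μ • a = gradLift G H Φ y (fderiv ℝ Φ y a) := by
    -- `d` is vertical and also orthogonal to vertical vectors, hence zero.
    set d := μ • a - gradLift G H Φ y (fderiv ℝ Φ y a) with hd
    have hd1 : fderiv ℝ Φ y d = 0 := by rw [hd, map_sub, map_smul, hall, sub_self]
    have hd2 : G y d d = 0 := by
      have hdc : ∀ c, G y d c = μ * G y a c - G y (gradLift G H Φ y (fderiv ℝ Φ y a)) c := by
        intro c
        rw [hd]
        simp
      rw [hdc, ha d hd1, apply_gradLift hG hy, hd1]
      simp
    by_contra hne
    have hd0 : d ≠ 0 := sub_ne_zero.2 hne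
    exact (hG.pos y hy d hd0).ne' hd2
  rw [← apply_gradLift hG hy, ← h1]
  simp

/-- The horizontal component of `[V, X]` vanishes on the vertical direction. -/
theorem LiftedFrame.vertBracket_eq_zero {v : Rn 4 → Rn 4} {u : Rn 4 → ℝ}
    {e : Fin 3 → Rn 3 → Rn 3} {X : Fin 3 → Rn 4 → Rn 4}
    (h : LiftedFrame G s H t Φ v u e X) (hh : ∀ y ∈ s, PreservesHarmonicAt G H Φ y)
    (hy : y ∈ s) (i : Fin 3) : LiftedFrame.vertBracket G v u v (X i) y = 0 := by
  have hq := h.maps hy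
  set b : Fin 3 → ℝ := fun k => LiftedFrame.vertBracket G v u v (X k) y with hb
  refine eq_zero_of_forall_abs_le (C := ∑ k, |b k| * ‖e k (Φ y)‖) fun ε hε => ?_
  -- A harmonic function with gradient close to e_i: in the formula for Δ(f∘Φ) both Laplacians
  -- vanish, which leaves θ([v,X_i]) up to O(ε).
  obtain ⟨f, hf, hlap, hd⟩ := exists_harmonic_gradient h.metric' hq (H (Φ y) (e i (Φ y))) hε
  have h1 := h.modelLaplacian_comp hy hf.contDiffAt
  rw [hh y hy f hf hlap, hlap.self_of_nhds, mul_zero, zero_add] at h1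
  have h2 : ∑ k, b k * H (Φ y) (e i (Φ y)) (e k (Φ y)) = b i := by
    simp [h.orthonormal _ hq]
  have h3 : b i = -∑ k, b k * (fderiv ℝ f (Φ y) - H (Φ y) (e i (Φ y))) (e k (Φ y)) := by
    simp only [sub_apply, mul_sub, Finset.sum_sub_distrib]
    rw [h2, ← h1]
    ring
  change |b i| ≤ _
  rw [h3, abs_neg, Finset.mul_sum]
  refine (Finset.abs_sum_le_sum_abs _ _).trans (Finset.sum_le_sum fun k _ => ?_)
  rw [abs_mul, mul_left_comm]
  exact mul_le_mul_of_nonneg_left (ContinuousLinearMap.le_of_opNorm_le _ hd _) (abs_nonneg _)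

end Conformality

/-! ### Submersive harmonic morphisms -/

section HarmonicSubmersion

open Filter

theorem modelLaplacian_congr {n : ℕ} (G : Rn n → (Rn n →L[ℝ] Rn n →L[ℝ] ℝ)) {f f' : Rn n → ℝ}
    {y : Rn n} (h : f =ᶠ[𝓝 y] f') : modelLaplacian G f y = modelLaplacian G f' y := by
  simp only [modelLaplacian, modelHessian, h.fderiv.fderiv_eq, h.fderiv_eq]

variable {M : Type*} [TopologicalSpace M] [ChartedSpace (Rn 4) M] [IsManifold (𝓡 4) ∞ M]
  {N : Type*} [TopologicalSpace N] [ChartedSpace (Rn 3) N] [IsManifold (𝓡 3) ∞ N]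

/-- `φ` is a smooth submersion which is a harmonic morphism. -/
structure IsHarmonicSubmersion (g : RMetric 4 M) (h : RMetric 3 N) (φ : M → N) : Prop where
  smooth : ContMDiff (𝓡 4) (𝓡 3) ∞ φ
  surjective : ∀ x, Function.Surjective (dφ φ x)
  harmonic : IsHarmonicMorphism g h φ

variable {g : RMetric 4 M} {h : RMetric 3 N} {φ : M → N}

namespace IsHarmonicSubmersion

theorem fderiv_chart (hs : IsHarmonicSubmersion g h φ) {x p : M} {x' : N}
    (hp : p ∈ (chart 4 x).source) (hp' : φ p ∈ (chart 3 x').source) (a : Tan 4 p) :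
    fderiv ℝ (chartMap (n := 4) (m := 3) φ x x') (chart 4 x p) (coord x p a)
      = coord x' (φ p) (dφ φ p a) :=
  fderiv_chartMap hp hp' (hs.smooth.mdifferentiable (by simp) p) a

/-- Local version of the morphism property: a function harmonic near the point in coordinates is
transported to an open set of `N`, and both Laplacians are computed in arbitrary charts. -/
theorem preservesHarmonicAt (hs : IsHarmonicSubmersion g h φ) {x p : M} {x' : N}
    (hp : p ∈ (chart 4 x).source) (hp' : φ p ∈ (chart 3 x').source) :
    PreservesHarmonicAt (chartMetric g x) (chartMetric h x')
      (chartMap (n := 4) (m := 3) φ x x') (chart 4 x p) := by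
  intro f hf hlap
  rw [chartMap_chart φ x' hp] at hlap
  obtain ⟨O, hO, hOo, hpO⟩ := eventually_nhds_iff.1 hlap
  set W : Set N := (chart 3 x').source ∩ chart 3 x' ⁻¹' O with hW
  have hWo : IsOpen W :=
    (continuousOn_extChartAt x').isOpen_inter_preimage (isOpen_chart_source x') hOo
  have hloc : ∀ q ∈ (chart 3 x').source,
      (f ∘ chart 3 x') ∘ (chart 3 x').symm =ᶠ[𝓝 (chart 3 x' q)] f := by
    intro q hq
    filter_upwards [(isOpen_chart_target x').mem_nhds ((chart 3 x').map_source hq)] with z hz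
    simp only [Function.comp_apply, (chart 3 x').right_inv hz]
  have hharm : HarmonicOn h (f ∘ chart 3 x') W := by
    refine ⟨?_, fun q hq => ?_⟩
    · exact (hf.contMDiff.comp_contMDiffOn
        ((smooth_chart x').of_le (by simpa using ENat.LEInfty.out))).mono Set.inter_subset_left
    · rw [laplacian_eq h hq.1 (hf.contDiffAt.congr_of_eventuallyEq (hloc q hq.1)),
        modelLaplacian_congr _ (hloc q hq.1)]
      exact hO _ hq.2
  obtain ⟨hsm, h0⟩ := hs.harmonic W _ hWo hharm
  have hpW : p ∈ φ ⁻¹' W := ⟨hp', hpO⟩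
  have hφW : IsOpen (φ ⁻¹' W) := hWo.preimage hs.smooth.continuous
  have hy : chart 4 x p ∈ (chart 4 x).target ∩ (chart 4 x).symm ⁻¹' (φ ⁻¹' W) :=
    ⟨(chart 4 x).map_source hp, by rwa [Set.mem_preimage, (chart 4 x).left_inv hp]⟩
  have hsm' := (smoothOn_comp_symm (by simpa using ENat.LEInfty.out) hsm x).contDiffAt
    ((isOpen_chart_inter hφW x).mem_nhds hy)
  rw [← h0 p hpW, laplacian_eq g hp hsm']
  rfl

theorem exists_conformal (hs : IsHarmonicSubmersion g h φ) (p : M) :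
    ∃ μ : ℝ, 0 < μ ∧ (∀ a b, IsHorizontal g φ p a → IsHorizontal g φ p b →
      pullbackMetric h φ p a b = μ * g.inner p a b) ∧
      ∀ b : Tan 3 (φ p), ∃ a, IsHorizontal g φ p a ∧ dφ φ p a = b := by
  have hp : p ∈ (chart 4 p).source := mem_extChartAt_source p
  have hp' : φ p ∈ (chart 3 (φ p)).source := mem_extChartAt_source (φ p)
  set y := chart 4 p p
  have hG := isMetricOn_chartMetric g p
  have hH := isMetricOn_chartMetric h (φ p)
  have hy : y ∈ (chart 4 p).target := (chart 4 p).map_source hp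
  have hΦy : chartMap (n := 4) (m := 3) φ p (φ p) y = chart 3 (φ p) (φ p) :=
    chartMap_chart φ (φ p) hp
  have hq : chartMap (n := 4) (m := 3) φ p (φ p) y ∈ (chart 3 (φ p)).target := by
    rw [hΦy]
    exact (chart 3 (φ p)).map_source hp'
  have hΦ : ContDiffAt ℝ 2 (chartMap (n := 4) (m := 3) φ p (φ p)) y := by
    have h1 := smoothOn_chartMap hs.smooth p (φ p)
    refine (h1.contDiffAt ((isOpen_chart_inter ((isOpen_chart_source (n := 3)
      (φ p)).preimage hs.smooth.continuous) p).mem_nhds ⟨hy, ?_⟩)).of_le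
      (by simpa using ENat.LEInfty.out)
    rw [Set.mem_preimage, (chart 4 p).left_inv hp]
    exact hp'
  have hsurj : Function.Surjective (fderiv ℝ (chartMap (n := 4) (m := 3) φ p (φ p)) y) := by
    intro u
    obtain ⟨b, rfl⟩ := coord_surjective hp' u
    obtain ⟨a, rfl⟩ := hs.surjective p b
    exact ⟨_, hs.fderiv_chart hp hp' a⟩
  have hpr := hs.preservesHarmonicAt hp hp'
  have hhor : ∀ a, IsHorizontal g φ p a → ∀ w,
      fderiv ℝ (chartMap (n := 4) (m := 3) φ p (φ p)) y w = 0 →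
      chartMetric g p y (coord p p a) w = 0 := by
    intro a ha w hw
    obtain ⟨w, rfl⟩ := coord_surjective hp w
    rw [hs.fderiv_chart hp hp'] at hw
    rw [chartMetric_chart g hp]
    exact ha w (coord_injective hp' (by rw [hw, map_zero]))
  obtain ⟨μ, hμ, hconf⟩ := hpr.conformal hG hy hΦ hH hq hsurj
  refine ⟨μ, hμ, fun a b ha hb => ?_, fun b => ?_⟩
  · have := hconf _ _ (hhor a ha) (hhor b hb)
    rw [hs.fderiv_chart hp hp', hs.fderiv_chart hp hp', hΦy, chartMetric_chart g hp] at this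
    rw [← this]
    exact (chartMetric_chart h hp' _ _).symm
  · obtain ⟨ν, hν, hall⟩ := hpr.fderiv_gradLift hG hy hΦ hH hq hsurj
    set c := gradLift (chartMetric g p) (chartMetric h (φ p))
      (chartMap (n := 4) (m := 3) φ p (φ p)) y (coord (φ p) (φ p) b) with hc
    refine ⟨coordInv p p (ν⁻¹ • c), fun w hw => ?_, ?_⟩
    · rw [← chartMetric_chart g hp, coord_coordInv hp, map_smul, smul_apply]
      change ν⁻¹ • chartMetric g p y c (coord p p w) = 0
      rw [apply_gradLift hG hy, hs.fderiv_chart hp hp', hw]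
      simp
    · apply coord_injective hp'
      rw [← hs.fderiv_chart hp hp', coord_coordInv hp, map_smul]
      change ν⁻¹ • fderiv ℝ (chartMap (n := 4) (m := 3) φ p (φ p)) y c = _
      rw [hall, smul_smul, inv_mul_cancel₀ hν.ne', one_smul]

theorem exists_horizontal_lift (hs : IsHarmonicSubmersion g h φ) (p : M) (b : Tan 3 (φ p)) :
    ∃ a, IsHorizontal g φ p a ∧ dφ φ p a = b := by
  obtain ⟨_, _, _, h1⟩ := hs.exists_conformal p
  exact h1 b

/-- All horizontal unit vectors have the same stretching factor, so the supremum defining `dilation`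
is over the single value √μ; surjectivity of dφ supplies a horizontal unit vector. -/
theorem conformal (hs : IsHarmonicSubmersion g h φ) (p : M) :
    0 < dilation g h φ p ∧ ∀ a b, IsHorizontal g φ p a → IsHorizontal g φ p b →
      pullbackMetric h φ p a b = dilation g h φ p ^ 2 * g.inner p a b := by
  obtain ⟨μ, hμ, hconf, hlift⟩ := hs.exists_conformal p
  have hset : {r : ℝ | ∃ v : Tan 4 p, IsHorizontal g φ p v ∧ g.inner p v v = 1 ∧
      r = Real.sqrt (pullbackMetric h φ p v v)} = {Real.sqrt μ} := by
    ext r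
    simp only [Set.mem_ofPred_eq, Set.mem_singleton_iff]
    constructor
    · rintro ⟨v, hv, h1, rfl⟩
      rw [hconf v v hv hv, h1, mul_one]
    · rintro rfl
      have : Nontrivial (Tan 3 (φ p)) := inferInstanceAs (Nontrivial (Rn 3))
      obtain ⟨b, hb⟩ := exists_ne (0 : Tan 3 (φ p))
      obtain ⟨a, ha, rfl⟩ := hlift b
      have ha0 : a ≠ 0 := fun h0 => hb (by rw [h0, map_zero])
      have hpos := g.pos p a ha0
      have hsm : IsHorizontal g φ p ((Real.sqrt (g.inner p a a))⁻¹ • a) := by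
        intro w hw
        rw [ContinuousLinearMap.map_smul₂, ha w hw, smul_zero]
      have h1 : g.inner p ((Real.sqrt (g.inner p a a))⁻¹ • a)
          ((Real.sqrt (g.inner p a a))⁻¹ • a) = 1 := by
        rw [ContinuousLinearMap.map_smul₂, map_smul, smul_smul, smul_eq_mul, ← mul_inv,
          Real.mul_self_sqrt hpos.le, inv_mul_cancel₀ hpos.ne']
      exact ⟨_, hsm, h1, by rw [hconf _ _ hsm hsm, h1, mul_one]⟩
  have hd : dilation g h φ p = Real.sqrt μ := by
    rw [dilation, hset, csSup_singleton]
  rw [hd, Real.sq_sqrt hμ.le]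
  exact ⟨Real.sqrt_pos.2 hμ, hconf⟩

theorem dilation_pos (hs : IsHarmonicSubmersion g h φ) (p : M) : 0 < dilation g h φ p :=
  (hs.conformal p).1

theorem dilInvSq_pos (hs : IsHarmonicSubmersion g h φ) (p : M) : 0 < dilInvSq g h φ p :=
  inv_pos.2 (pow_pos (hs.dilation_pos p) 2)

theorem inner_horizontal (hs : IsHarmonicSubmersion g h φ) {p : M} {a b : Tan 4 p}
    (ha : IsHorizontal g φ p a) (hb : IsHorizontal g φ p b) :
    g.inner p a b = dilInvSq g h φ p * h.inner (φ p) (dφ φ p a) (dφ φ p b) := by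
  have h1 := (hs.conformal p).2 a b ha hb
  rw [pullbackMetric] at h1
  have h2 := (hs.dilation_pos p).ne'
  rw [h1, dilInvSq, ← mul_assoc, inv_mul_cancel₀ (pow_ne_zero 2 h2), one_mul]

end IsHarmonicSubmersion

end HarmonicSubmersion

/-! ### Positive bases -/

section Positive

variable {n : ℕ} {W : Type*} [AddCommGroup W] [Module ℝ W]

theorem isPositiveBasis_iff (b : Module.Basis (Fin n) ℝ W) {o : Orientation ℝ W (Fin n)}
    (hb : b.orientation = o) {w : Fin n → W} : IsPositiveBasis o w ↔ 0 < b.det w := by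
  constructor
  · rintro ⟨b', rfl, hb'⟩
    exact (Module.Basis.orientation_eq_iff_det_pos b b').1 (hb.trans hb'.symm)
  · intro hw
    have h1 := (Module.Basis.is_basis_iff_det b).2 (isUnit_iff_ne_zero.2 hw.ne')
    refine ⟨Module.Basis.mk h1.1 h1.2.ge, Module.Basis.coe_mk _ _, ?_⟩
    rw [← hb, eq_comm, Module.Basis.orientation_eq_iff_det_pos, Module.Basis.coe_mk]
    exact hw

/-- A cyclic permutation of three vectors is even. -/
theorem IsPositiveBasis.cycle {o : Orientation ℝ W (Fin 3)} {e₁ e₂ e₃ : W}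
    (h : IsPositiveBasis o ![e₁, e₂, e₃]) : IsPositiveBasis o ![e₂, e₃, e₁] := by
  obtain ⟨b, hb, ho⟩ := h
  rw [isPositiveBasis_iff b ho]
  have h1 : ![e₂, e₃, e₁] = ⇑b ∘ (finRotate 3) := by
    rw [hb]
    funext i
    fin_cases i <;> rfl
  rw [h1, AlternatingMap.map_perm, b.det_self, sign_finRotate]
  norm_num

end Positive

section PosOrthonormal

variable {N : Type*} [TopologicalSpace N] [ChartedSpace (Rn 3) N] [IsManifold (𝓡 3) ∞ N]
  {h : RMetric 3 N} {oN : ManifoldOrientation 3 N} {y : N}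

theorem IsPosOrthonormal.cycle {e₁ e₂ e₃ : Tan 3 y} (he : IsPosOrthonormal h oN y e₁ e₂ e₃) :
    IsPosOrthonormal h oN y e₂ e₃ e₁ := by
  obtain ⟨h1, h2, h3, h12, h13, h23, hp⟩ := he
  exact ⟨h2, h3, h1, h23, by rw [h.symm, h12], by rw [h.symm, h13], hp.cycle⟩

theorem IsPosOrthonormal.inner_eq {e : Fin 3 → Tan 3 y}
    (he : IsPosOrthonormal h oN y (e 0) (e 1) (e 2)) (i j : Fin 3) :
    h.inner y (e i) (e j) = if i = j then 1 else 0 := by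
  obtain ⟨h1, h2, h3, h12, h13, h23, -⟩ := he
  have h21 := h12
  have h31 := h13
  have h32 := h23
  rw [h.symm] at h21 h31 h32
  fin_cases i <;> fin_cases j <;> simp [h1, h2, h3, h12, h13, h23, h21, h31, h32]

end PosOrthonormal

/-! ### The twistorial setting, in coordinates -/

section Setting

open Filter

variable {M : Type*} [TopologicalSpace M] [ChartedSpace (Rn 4) M] [IsManifold (𝓡 4) ∞ M]
  {N : Type*} [TopologicalSpace N] [ChartedSpace (Rn 3) N] [IsManifold (𝓡 3) ∞ N]

/-- A twistorial harmonic submersion with nowhere vanishing `Ω`. -/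
structure IsTwistorSetting (g : RMetric 4 M) (h : RMetric 3 N) (oM : ManifoldOrientation 4 M)
    (oN : ManifoldOrientation 3 N) (φ : M → N) (V : (x : M) → Tan 4 x) : Prop
    extends IsHarmonicSubmersion g h φ where
  field : IsFundamentalField g h oM oN φ V
  twistorial : IsTwistorial g h oN φ V
  nonzero : ∀ x, ∃ v w, Omega g h φ V x v w ≠ 0

/-- A frame of the horizontal bundle which is projected onto a positive orthonormal frame. -/
structure BasicFrame (g : RMetric 4 M) (h : RMetric 3 N) (oN : ManifoldOrientation 3 N)
    (φ : M → N) (U : Set M) (W : Set N) (X : Fin 3 → (p : M) → Tan 4 p)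
    (e : Fin 3 → (q : N) → Tan 3 q) : Prop where
  isOpen : IsOpen U
  isOpen' : IsOpen W
  maps : Set.MapsTo φ U W
  smooth_X : ∀ i, SmoothFieldOn (X i) U
  smooth_e : ∀ i, SmoothFieldOn (e i) W
  horizontal : ∀ p ∈ U, ∀ i, IsHorizontal g φ p (X i p)
  proj : ∀ p ∈ U, ∀ i, dφ φ p (X i p) = e i (φ p)
  orthonormal : ∀ q ∈ W, IsPosOrthonormal h oN q (e 0 q) (e 1 q) (e 2 q)

variable {g : RMetric 4 M} {h : RMetric 3 N} {oM : ManifoldOrientation 4 M}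
  {oN : ManifoldOrientation 3 N} {φ : M → N} {V : (x : M) → Tan 4 x}
  {U : Set M} {W : Set N} {X : Fin 3 → (p : M) → Tan 4 p} {e : Fin 3 → (q : N) → Tan 3 q}

/-- The coordinate domain in `M`. -/
def dom (φ : M → N) (U : Set M) (x : M) (x' : N) : Set (Rn 4) :=
  (chart 4 x).target ∩ (chart 4 x).symm ⁻¹' (U ∩ φ ⁻¹' (chart 3 x').source)

/-- The coordinate domain in `N`. -/
def dom' (W : Set N) (x' : N) : Set (Rn 3) := (chart 3 x').target ∩ (chart 3 x').symm ⁻¹' W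

omit [IsManifold (𝓡 4) ∞ M] [IsManifold (𝓡 3) ∞ N] in
theorem exists_of_mem_dom {x : M} {x' : N} {y : Rn 4} (hy : y ∈ dom φ U x x') :
    ∃ p ∈ (chart 4 x).source, p ∈ U ∧ φ p ∈ (chart 3 x').source ∧ chart 4 x p = y := by
  obtain ⟨p, hp, hp', rfl⟩ := exists_chart_eq_of_mem hy
  exact ⟨p, hp, hp'.1, hp'.2, rfl⟩

omit [IsManifold (𝓡 4) ∞ M] [IsManifold (𝓡 3) ∞ N] in
theorem mem_dom {x p : M} {x' : N} (hp : p ∈ (chart 4 x).source) (hpU : p ∈ U)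
    (hp' : φ p ∈ (chart 3 x').source) : chart 4 x p ∈ dom φ U x x' :=
  ⟨(chart 4 x).map_source hp, by
    rw [Set.mem_preimage, (chart 4 x).left_inv hp]
    exact ⟨hpU, hp'⟩⟩

namespace IsTwistorSetting

variable (hs : IsTwistorSetting g h oM oN φ V)

include hs in
theorem inner_V (p : M) : g.inner p (V p) (V p) = (dilInvSq g h φ p)⁻¹ := by
  rw [hs.field.norm_sq, dilInvSq, inv_inv]

include hs in
-- The dilation is a supremum, with no evident regularity; its smoothness comes from λ² = g(V,V)
-- with V smooth.
theorem smooth_dilInvSq : ContMDiff (𝓡 4) 𝓘(ℝ, ℝ) ∞ (dilInvSq g h φ) := by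
  have h1 : dilInvSq g h φ = fun p => (g.inner p (V p) (V p))⁻¹ := by
    funext p
    rw [hs.inner_V, inv_inv]
  rw [h1, ← contMDiffOn_univ]
  exact (smooth_inner g hs.field.smooth hs.field.smooth).inv₀ fun p _ => by
    rw [hs.inner_V]
    exact inv_ne_zero (hs.dilInvSq_pos p).ne'

end IsTwistorSetting

end Setting

/-! ### The frames in coordinates -/

section FramesInCoordinates

open Filter

variable {M : Type*} [TopologicalSpace M] [ChartedSpace (Rn 4) M] [IsManifold (𝓡 4) ∞ M]
  {N : Type*} [TopologicalSpace N] [ChartedSpace (Rn 3) N] [IsManifold (𝓡 3) ∞ N]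
  {g : RMetric 4 M} {h : RMetric 3 N} {oM : ManifoldOrientation 4 M}
  {oN : ManifoldOrientation 3 N} {φ : M → N} {V : (x : M) → Tan 4 x}
  {U : Set M} {W : Set N} {X : Fin 3 → (p : M) → Tan 4 p} {e : Fin 3 → (q : N) → Tan 3 q}

theorem fderiv_form_antisymm {θ : Rn 4 → (Rn 4 →L[ℝ] ℝ)} {A B : Rn 4 → Rn 4} {y : Rn 4}
    (hθ : DifferentiableAt ℝ θ y) (hA : DifferentiableAt ℝ A y) (hB : DifferentiableAt ℝ B y) :
    fderiv ℝ θ y (A y) (B y) - fderiv ℝ θ y (B y) (A y)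
      = fderiv ℝ (fun p => θ p (B p)) y (A y) - fderiv ℝ (fun p => θ p (A p)) y (B y)
        - θ y (VectorField.lieBracket ℝ A B y) := by
  have h1 := (hθ.hasFDerivAt.clm_apply hB.hasFDerivAt).fderiv
  have h2 := (hθ.hasFDerivAt.clm_apply hA.hasFDerivAt).fderiv
  rw [h1, h2, VectorField.lieBracket_eq]
  simp
  ring

namespace IsTwistorSetting

theorem chartForm_dualForm (x : M) {y : Rn 4} (hy : y ∈ (chart 4 x).target) (w : Rn 4) :
    chartForm (dualForm g h φ V) x y w
      = dilInvSq g h φ ((chart 4 x).symm y) * chartMetric g x y (chartField V x y) w := by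
  obtain ⟨p, hp, rfl⟩ := exists_chart_eq hy
  obtain ⟨a, rfl⟩ := coord_surjective hp w
  rw [chartForm_chart _ hp, chartField_chart V hp, chartMetric_chart g hp, (chart 4 x).left_inv hp]
  rfl

theorem smoothOn_u (hs : IsTwistorSetting g h oM oN φ V) (x : M) :
    ContDiffOn ℝ ∞ (dilInvSq g h φ ∘ (chart 4 x).symm) (chart 4 x).target :=
  (smoothOn_comp_symm le_rfl (hs.smooth_dilInvSq.contMDiffOn (s := Set.univ)) x).mono fun _ hy =>
    ⟨hy, Set.mem_univ _⟩

theorem smoothOn_V (hs : IsTwistorSetting g h oM oN φ V) (x : M) :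
    ContDiffOn ℝ ∞ (chartField V x) (chart 4 x).target :=
  (smoothOn_chartField isOpen_univ hs.field.smooth x).mono fun _ hy => ⟨hy, Set.mem_univ _⟩

theorem smoothOn_dualForm (hs : IsTwistorSetting g h oM oN φ V) (x : M) :
    ContDiffOn ℝ ∞ (chartForm (dualForm g h φ V) x) (chart 4 x).target := by
  have h1 : ContDiffOn ℝ ∞ (fun y => (dilInvSq g h φ ∘ (chart 4 x).symm) y •
      chartMetric g x y (chartField V x y)) (chart 4 x).target :=
    (hs.smoothOn_u x).smul ((isMetricOn_chartMetric g x).smooth.clm_apply (hs.smoothOn_V x))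
  refine h1.congr fun y hy => ?_
  ext w
  rw [chartForm_dualForm x hy]
  rfl

theorem horizontal_inner (p : M) {a : Tan 4 p} (hs : IsTwistorSetting g h oM oN φ V)
    (ha : IsHorizontal g φ p a) : g.inner p (V p) a = 0 := by
  rw [g.symm]
  exact ha _ (hs.field.vertical p)

theorem isOpen_dom (hs : IsTwistorSetting g h oM oN φ V) (hU : IsOpen U) (x : M) (x' : N) :
    IsOpen (dom φ U x x') :=
  isOpen_chart_inter (hU.inter ((isOpen_chart_source x').preimage hs.smooth.continuous)) x

theorem liftedFrame (hs : IsTwistorSetting g h oM oN φ V) (hX : BasicFrame g h oN φ U W X e)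
    (x : M) (x' : N) :
    LiftedFrame (chartMetric g x) (dom φ U x x') (chartMetric h x') (dom' W x')
      (chartMap (n := 4) (m := 3) φ x x') (chartField V x) (dilInvSq g h φ ∘ (chart 4 x).symm)
      (fun i => chartField (e i) x') (fun i => chartField (X i) x) where
  metric := (isMetricOn_chartMetric g x).mono (hs.isOpen_dom hX.isOpen x x') Set.inter_subset_left
  metric' := (isMetricOn_chartMetric h x').mono (isOpen_chart_inter hX.isOpen' x')
    Set.inter_subset_left
  maps := by
    intro y hy
    obtain ⟨p, hp, hpU, hp', rfl⟩ := exists_of_mem_dom hy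
    rw [chartMap_chart φ x' hp]
    refine ⟨(chart 3 x').map_source hp', ?_⟩
    rw [Set.mem_preimage, (chart 3 x').left_inv hp']
    exact hX.maps hpU
  smooth_map := (smoothOn_chartMap hs.smooth x x').mono fun y hy => ⟨hy.1, hy.2.2⟩
  smooth_v := (hs.smoothOn_V x).mono Set.inter_subset_left
  smooth_u := (hs.smoothOn_u x).mono Set.inter_subset_left
  smooth_e := fun i => smoothOn_chartField hX.isOpen' (hX.smooth_e i) x'
  smooth_X := fun i => (smoothOn_chartField hX.isOpen (hX.smooth_X i) x).mono
    fun y hy => ⟨hy.1, hy.2.1⟩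
  pos := fun y _ => hs.dilInvSq_pos _
  vert := by
    intro y hy
    obtain ⟨p, hp, hpU, hp', rfl⟩ := exists_of_mem_dom hy
    rw [chartField_chart V hp, hs.fderiv_chart hp hp', hs.field.vertical p, map_zero]
  proj := by
    intro y hy i
    obtain ⟨p, hp, hpU, hp', rfl⟩ := exists_of_mem_dom hy
    rw [chartField_chart _ hp, hs.fderiv_chart hp hp', hX.proj p hpU, chartMap_chart φ x' hp,
      chartField_chart _ hp']
  orth := by
    intro y hy i
    obtain ⟨p, hp, hpU, hp', rfl⟩ := exists_of_mem_dom hy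
    rw [chartField_chart _ hp, chartField_chart _ hp, chartMetric_chart g hp,
      hs.horizontal_inner p (hX.horizontal p hpU i)]
  norm_v := by
    intro y hy
    obtain ⟨p, hp, hpU, hp', rfl⟩ := exists_of_mem_dom hy
    rw [chartField_chart _ hp, chartMetric_chart g hp, hs.inner_V, Function.comp_apply,
      (chart 4 x).left_inv hp]
  norm_X := by
    intro y hy i j
    obtain ⟨p, hp, hpU, hp', rfl⟩ := exists_of_mem_dom hy
    rw [chartField_chart _ hp, chartField_chart _ hp, chartMetric_chart g hp,
      hs.inner_horizontal (hX.horizontal p hpU i) (hX.horizontal p hpU j), hX.proj p hpU,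
      hX.proj p hpU, (hX.orthonormal _ (hX.maps hpU)).inner_eq (e := fun i => e i (φ p)),
      Function.comp_apply, (chart 4 x).left_inv hp, mul_ite, mul_one, mul_zero]
  orthonormal := by
    intro y hy i j
    obtain ⟨q, hq, hqW, rfl⟩ := exists_chart_eq_of_mem hy
    rw [chartField_chart _ hq, chartField_chart _ hq, chartMetric_chart h hq,
      (hX.orthonormal q hqW).inner_eq (e := fun i => e i q)]

theorem Omega_eq (hs : IsTwistorSetting g h oM oN φ V) {x p : M} (hp : p ∈ (chart 4 x).source)
    (a b : Tan 4 p) : Omega g h φ V p a b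
      = fderiv ℝ (chartForm (dualForm g h φ V) x) (chart 4 x p) (coord x p a) (coord x p b)
        - fderiv ℝ (chartForm (dualForm g h φ V) x) (chart 4 x p) (coord x p b) (coord x p a) :=
  extDer_eq _ hp (differentiableAt_of_smoothOn (isOpen_chart_target x) (hs.smoothOn_dualForm x)
    ((chart 4 x).map_source hp)) a b

/-- `Ω (A, B) = -θ ([A, B])` if `θ(A)` and `θ(B)` are constant. -/
theorem Omega_eq_bracket (hs : IsTwistorSetting g h oM oN φ V) {A B : (p : M) → Tan 4 p}
    (hU : IsOpen U) (hA : SmoothFieldOn A U) (hB : SmoothFieldOn B U) {a b : ℝ}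
    (hAa : ∀ p ∈ U, dualForm g h φ V p (A p) = a) (hBb : ∀ p ∈ U, dualForm g h φ V p (B p) = b)
    {x p : M} (hp : p ∈ (chart 4 x).source) (hpU : p ∈ U) :
    Omega g h φ V p (A p) (B p)
      = -LiftedFrame.vertBracket (chartMetric g x) (chartField V x)
          (dilInvSq g h φ ∘ (chart 4 x).symm) (chartField A x) (chartField B x) (chart 4 x p) := by
  have ho := isOpen_chart_inter (n := 4) hU x
  have hy : chart 4 x p ∈ (chart 4 x).target ∩ (chart 4 x).symm ⁻¹' U :=
    ⟨(chart 4 x).map_source hp, by rwa [Set.mem_preimage, (chart 4 x).left_inv hp]⟩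
  have hconst : ∀ (C : (p : M) → Tan 4 p) (c : ℝ), (∀ p ∈ U, dualForm g h φ V p (C p) = c) →
      fderiv ℝ (fun y => chartForm (dualForm g h φ V) x y (chartField C x y)) (chart 4 x p) = 0 := by
    intro C c hC
    have : (fun y => chartForm (dualForm g h φ V) x y (chartField C x y))
        =ᶠ[𝓝 (chart 4 x p)] fun _ => c := by
      filter_upwards [ho.mem_nhds hy] with y hy'
      obtain ⟨q, hq, hqU, rfl⟩ := exists_chart_eq_of_mem hy'
      rw [chartField_chart C hq, chartForm_chart _ hq, hC q hqU]
    rw [this.fderiv_eq, fderiv_fun_const, Pi.zero_apply]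
  rw [hs.Omega_eq hp, ← chartField_chart A hp, ← chartField_chart B hp, fderiv_form_antisymm
    (differentiableAt_of_smoothOn (isOpen_chart_target x) (hs.smoothOn_dualForm x) hy.1)
    (differentiableAt_of_smoothOn ho (smoothOn_chartField hU hA x) hy)
    (differentiableAt_of_smoothOn ho (smoothOn_chartField hU hB x) hy), hconst A a hAa,
    hconst B b hBb, chartForm_dualForm x hy.1]
  simp [LiftedFrame.vertBracket]

theorem dualForm_V (hs : IsTwistorSetting g h oM oN φ V) (p : M) :
    dualForm g h φ V p (V p) = 1 := by
  change dilInvSq g h φ p * g.inner p (V p) (V p) = 1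
  rw [hs.inner_V, mul_inv_cancel₀ (hs.dilInvSq_pos p).ne']

theorem dualForm_horizontal (hs : IsTwistorSetting g h oM oN φ V) (p : M) {a : Tan 4 p}
    (ha : IsHorizontal g φ p a) : dualForm g h φ V p a = 0 := by
  change dilInvSq g h φ p * g.inner p (V p) a = 0
  rw [hs.horizontal_inner p ha, mul_zero]

end IsTwistorSetting

end FramesInCoordinates

/-! ### The monopole equation in lifted frames -/

section TwistorFrames

open Filter

variable {M : Type*} [TopologicalSpace M] [ChartedSpace (Rn 4) M] [IsManifold (𝓡 4) ∞ M]
  {N : Type*} [TopologicalSpace N] [ChartedSpace (Rn 3) N] [IsManifold (𝓡 3) ∞ N]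
  {g : RMetric 4 M} {h : RMetric 3 N} {oM : ManifoldOrientation 4 M}
  {oN : ManifoldOrientation 3 N} {φ : M → N} {V : (x : M) → Tan 4 x}
  {U : Set M} {W : Set N} {X : Fin 3 → (p : M) → Tan 4 p} {e : Fin 3 → (q : N) → Tan 3 q}

namespace IsTwistorSetting

theorem Omega_swap (hs : IsTwistorSetting g h oM oN φ V) (p : M) (a b : Tan 4 p) :
    Omega g h φ V p a b = -Omega g h φ V p b a := by
  rw [hs.Omega_eq (mem_extChartAt_source p), hs.Omega_eq (mem_extChartAt_source p)]
  ring

/-- This is where the harmonic morphism property makes the lifted frame commute with V. -/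
theorem vertBracket_V (hs : IsTwistorSetting g h oM oN φ V) (hX : BasicFrame g h oN φ U W X e)
    (x : M) (x' : N) {y : Rn 4} (hy : y ∈ dom φ U x x') (i : Fin 3) :
    LiftedFrame.vertBracket (chartMetric g x) (chartField V x)
      (dilInvSq g h φ ∘ (chart 4 x).symm) (chartField V x) (chartField (X i) x) y = 0 := by
  refine (hs.liftedFrame hX x x').vertBracket_eq_zero (fun y hy => ?_) hy i
  obtain ⟨p, hp, hpU, hp', rfl⟩ := exists_of_mem_dom hy
  exact hs.preservesHarmonicAt hp hp'

theorem Omega_V (hs : IsTwistorSetting g h oM oN φ V) (hX : BasicFrame g h oN φ U W X e)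
    {p : M} (hp : p ∈ U) (i : Fin 3) : Omega g h φ V p (V p) (X i p) = 0 := by
  have hpp := mem_extChartAt_source (I := 𝓡 4) p
  rw [hs.Omega_eq_bracket hX.isOpen (hs.field.smooth.mono (Set.subset_univ _)) (hX.smooth_X i)
    (fun p _ => hs.dualForm_V p)
    (fun p hp => hs.dualForm_horizontal p (hX.horizontal p hp i)) hpp hp,
    hs.vertBracket_V hX p (φ p) (mem_dom hpp hp (mem_extChartAt_source _)), neg_zero]

theorem Omega_X (hs : IsTwistorSetting g h oM oN φ V) (hX : BasicFrame g h oN φ U W X e)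
    {x p : M} (hpp : p ∈ (chart 4 x).source) (hp : p ∈ U) (i j : Fin 3) :
    Omega g h φ V p (X i p) (X j p)
      = -LiftedFrame.vertBracket (chartMetric g x) (chartField V x)
          (dilInvSq g h φ ∘ (chart 4 x).symm) (chartField (X i) x) (chartField (X j) x)
            (chart 4 x p) :=
  hs.Omega_eq_bracket hX.isOpen (hX.smooth_X i) (hX.smooth_X j)
    (fun p hp => hs.dualForm_horizontal p (hX.horizontal p hp i))
    (fun p hp => hs.dualForm_horizontal p (hX.horizontal p hp j)) hpp hp

theorem mvfderiv_dilInvSq (hs : IsTwistorSetting g h oM oN φ V) {x p : M}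
    (hpp : p ∈ (chart 4 x).source) (a : Tan 4 p) :
    mvfderiv (𝓡 4) (dilInvSq g h φ) p a
      = fderiv ℝ (dilInvSq g h φ ∘ (chart 4 x).symm) (chart 4 x p) (coord x p a) :=
  mvfderiv_eq hpp (hs.smooth_dilInvSq.mdifferentiable (by simp) p) a

/-- The components of `Ω` in terms of the derivatives of `λ⁻²`. -/
theorem Omega_frame (hs : IsTwistorSetting g h oM oN φ V) (hX : BasicFrame g h oN φ U W X e)
    {p : M} (hp : p ∈ U) (i j : Fin 3) : Omega g h φ V p (X i p) (X j p)
      = starForm (fun k => mvfderiv (𝓡 4) (dilInvSq g h φ) p (X k p)) i j := by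
  have ho := hX.orthonormal _ (hX.maps hp)
  simp only [← hX.proj p hp] at ho
  have hh := hX.horizontal p hp
  have h01 := hs.twistorial p _ _ _ (hh 0) (hh 1) (hh 2) ho
  have h12 := hs.twistorial p _ _ _ (hh 1) (hh 2) (hh 0) ho.cycle
  have h20 := hs.twistorial p _ _ _ (hh 2) (hh 0) (hh 1) ho.cycle.cycle
  have hd : ∀ i, Omega g h φ V p (X i p) (X i p) = 0 := fun i => by
    have := hs.Omega_swap p (X i p) (X i p)
    linarith
  have h10 := hs.Omega_swap p (X 1 p) (X 0 p)
  have h21 := hs.Omega_swap p (X 2 p) (X 1 p)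
  have h02 := hs.Omega_swap p (X 0 p) (X 2 p)
  rw [← h01] at h10
  rw [← h12] at h21
  rw [← h20] at h02
  fin_cases i <;> fin_cases j <;>
    simp [starForm, hd, h01, h12, h20, h10, h21, h02]

theorem twistorFrame (hs : IsTwistorSetting g h oM oN φ V) (hX : BasicFrame g h oN φ U W X e)
    (x : M) (x' : N) :
    TwistorFrame (chartMetric g x) (dom φ U x x') (chartMetric h x') (dom' W x')
      (chartMap (n := 4) (m := 3) φ x x') (chartField V x) (dilInvSq g h φ ∘ (chart 4 x).symm)
      (fun i => chartField (e i) x') (fun i => chartField (X i) x) where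
  toLiftedFrame := hs.liftedFrame hX x x'
  basic := fun y hy i => hs.vertBracket_V hX x x' hy i
  monopole := by
    intro y hy i j
    obtain ⟨p, hp, hpU, hp', rfl⟩ := exists_of_mem_dom hy
    have h1 := hs.Omega_X hX hp hpU i j
    rw [hs.Omega_frame hX hpU] at h1
    simp only [hs.mvfderiv_dilInvSq hp, ← chartField_chart _ hp] at h1
    linarith
  nonzero := by
    intro y hy
    obtain ⟨p, hp, hpU, hp', rfl⟩ := exists_of_mem_dom hy
    -- If all X_k(u) vanished, twistoriality and ι_V Ω = 0 would make Ω vanish on the whole frame.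
    by_contra! hzero
    have hz : ∀ i j, Omega g h φ V p (X i p) (X j p) = 0 := by
      intro i j
      rw [hs.Omega_frame hX hpU]
      simp only [hs.mvfderiv_dilInvSq hp, ← chartField_chart _ hp, hzero]
      fin_cases i <;> fin_cases j <;> simp [starForm]
    have hV : ∀ i, Omega g h φ V p (V p) (X i p) = 0 := hs.Omega_V hX hpU
    have hV' : ∀ i, Omega g h φ V p (X i p) (V p) = 0 := fun i => by
      rw [hs.Omega_swap, hV, neg_zero]
    have hVV : Omega g h φ V p (V p) (V p) = 0 := by
      have := hs.Omega_swap p (V p) (V p)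
      linarith
    obtain ⟨a, b, hab⟩ := hs.nonzero p
    apply hab
    have hL := hs.liftedFrame hX x x'
    have ha := hL.decomp hy (coord x p a)
    have hb := hL.decomp hy (coord x p b)
    simp only [hs.Omega_eq hp, ← chartField_chart _ hp] at hz hV hV' hVV
    rw [hs.Omega_eq hp, ha, hb]
    simp only [map_add, map_smul, map_sum, add_apply, smul_apply, sum_apply, smul_eq_mul,
      Fin.sum_univ_three] at hz hV hV' hVV ⊢
    have z01 := hz 0 1
    have z02 := hz 0 2
    have z12 := hz 1 2
    have v0 := hV 0
    have v1 := hV 1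
    have v2 := hV 2
    simp only [sub_eq_zero] at z01 z02 z12 v0 v1 v2
    simp only [z01, z02, z12, v0, v1, v2]
    ring

end IsTwistorSetting

end TwistorFrames

/-! ### Lie derivatives of metrics in frames -/

section LieMetric

variable {n : ℕ}

/-- `(L_E B)(A, C)` for vector fields `A, C`. -/
def lieMetric (B : Rn n → (Rn n →L[ℝ] Rn n →L[ℝ] ℝ)) (E A C : Rn n → Rn n) (y : Rn n) : ℝ :=
  fderiv ℝ (fun p => B p (A p) (C p)) y (E y) - B y (VectorField.lieBracket ℝ E A y) (C y)
    - B y (A y) (VectorField.lieBracket ℝ E C y)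

theorem IsMetricOn.curvature_add_smul {G : Rn n → (Rn n →L[ℝ] Rn n →L[ℝ] ℝ)} {s : Set (Rn n)}
    (hG : IsMetricOn G s) {y : Rn n} (hy : y ∈ s) (c : ℝ) (z v v' w w' : Rn n) :
    curvature G y z (c • v + v') w = c • curvature G y z v w + curvature G y z v' w ∧
    curvature G y z v (c • w + w') = c • curvature G y z v w + curvature G y z v w' := by
  constructor <;>
  · simp only [hG.curvature_eq hy, map_add, map_smul, add_apply, smul_apply]
    module

/-- The Ricci tensor of a metric, as a bilinear form. -/
def IsMetricOn.ricciForm {G : Rn n → (Rn n →L[ℝ] Rn n →L[ℝ] ℝ)} {s : Set (Rn n)}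
    (hG : IsMetricOn G s) {y : Rn n} (hy : y ∈ s) : Rn n →ₗ[ℝ] Rn n →ₗ[ℝ] ℝ :=
  LinearMap.mk₂ ℝ (modelRicci G y)
    (fun v v' w => by
      have := fun z => (hG.curvature_add_smul hy 1 z v v' w w).1
      simp only [one_smul] at this
      simp [modelRicci, this, Finset.sum_add_distrib])
    (fun c v w => by
      have := fun z => (hG.curvature_add_smul hy c z v 0 w w).1
      have h0 := fun z => (hG.curvature_add_smul hy 1 z 0 0 w w).1
      simp only [one_smul, add_zero, left_eq_add] at this h0
      simp [modelRicci, this, h0, Finset.mul_sum])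
    (fun v w w' => by
      have := fun z => (hG.curvature_add_smul hy 1 z v v w w').2
      simp only [one_smul] at this
      simp [modelRicci, this, Finset.sum_add_distrib])
    (fun c v w => by
      have := fun z => (hG.curvature_add_smul hy c z v v w 0).2
      have h0 := fun z => (hG.curvature_add_smul hy 1 z v v 0 0).2
      simp only [one_smul, add_zero, left_eq_add] at this h0
      simp [modelRicci, this, h0, Finset.mul_sum])

end LieMetric

namespace TwistorFrame

open LiftedFrame Filter

variable {G : Rn 4 → (Rn 4 →L[ℝ] Rn 4 →L[ℝ] ℝ)} {s : Set (Rn 4)}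
    {H : Rn 3 → (Rn 3 →L[ℝ] Rn 3 →L[ℝ] ℝ)} {t : Set (Rn 3)} {Φ : Rn 4 → Rn 3}
    {v : Rn 4 → Rn 4} {u : Rn 4 → ℝ} {e : Fin 3 → Rn 3 → Rn 3} {X : Fin 3 → Rn 4 → Rn 4}

theorem inner_X (h : LiftedFrame G s H t Φ v u e X) {y : Rn 4} (hy : y ∈ s) (a : Rn 4)
    (i : Fin 3) : G y a (X i y) = u y * H (Φ y) (fderiv ℝ Φ y a) (e i (Φ y)) := by
  rw [h.metric.symm y hy, h.decomp hy a]
  simp only [map_add, map_sum, map_smul, add_apply, sum_apply, smul_apply, h.norm_X y hy,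
    h.orth' hy, h.vert y hy, h.proj y hy, h.orthonormal _ (h.maps hy)]
  fin_cases i <;> simp [Fin.sum_univ_three, mul_comm]

variable {E : Rn 4 → Rn 4} {f : Rn 4 → ℝ} {x : Fin 3 → Rn 4 → ℝ} {y : Rn 4}

theorem lieBracket_field (h : TwistorFrame G s H t Φ v u e X) (hy : y ∈ s)
    (hE : E =ᶠ[𝓝 y] fun p => f p • v p + ∑ k, x k p • X k p) (hf : DifferentiableAt ℝ f y)
    (hx : ∀ k, DifferentiableAt ℝ (x k) y) (A : Rn 4 → Rn 4) :
    VectorField.lieBracket ℝ E A y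
      = -(fderiv ℝ f y (A y) • v y + ∑ k, fderiv ℝ (x k) y (A y) • X k y)
        + f y • VectorField.lieBracket ℝ v A y
        + ∑ k, x k y • VectorField.lieBracket ℝ (X k) A y := by
  have h1 : E =ᶠ[𝓝 y] fun p => ∑ a : Fin 4, (Fin.cases f x a : Rn 4 → ℝ) p • frame v X a p := by
    filter_upwards [hE] with p hp
    rw [hp, Fin.sum_univ_succ]
    rfl
  have hF : ∀ a, DifferentiableAt ℝ (Fin.cases f x a : Rn 4 → ℝ) y := by
    intro a
    cases a using Fin.cases
    exacts [hf, hx _]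
  have h2 := lieBracket_sum_right Finset.univ (f := fun a : Fin 4 => (Fin.cases f x a : Rn 4 → ℝ))
    (E := frame v X) A (y := y) (fun a _ => hF a) (fun a _ =>
      differentiableAt_of_smoothOn h.metric.isOpen (h.smooth_frame a) hy)
  rw [VectorField.lieBracket_swap, (EventuallyEq.refl _ A).lieBracket_vectorField_eq h1, h2,
    Fin.sum_univ_succ, Finset.sum_add_distrib, VectorField.lieBracket_swap (V := v)]
  simp only [VectorField.lieBracket_swap (V := X _) (W := A), Fin.cases_zero, Fin.cases_succ,
    frame_zero, frame_succ, smul_neg, Finset.sum_neg_distrib]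
  abel

theorem lieBracket_field_v (h : TwistorFrame G s H t Φ v u e X) (hy : y ∈ s)
    (hE : E =ᶠ[𝓝 y] fun p => f p • v p + ∑ k, x k p • X k p) (hf : DifferentiableAt ℝ f y)
    (hx : ∀ k, DifferentiableAt ℝ (x k) y) :
    VectorField.lieBracket ℝ E v y
      = -(fderiv ℝ f y (v y) • v y + ∑ k, fderiv ℝ (x k) y (v y) • X k y) := by
  rw [h.lieBracket_field hy hE hf hx]
  simp only [VectorField.lieBracket_self, Pi.zero_apply, smul_zero, add_zero,
    VectorField.lieBracket_swap (V := X _) (W := v), h.lieBracket_v_X hy, neg_zero,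
    Finset.sum_const_zero]

theorem lieBracket_field_X (h : TwistorFrame G s H t Φ v u e X) (hy : y ∈ s)
    (hE : E =ᶠ[𝓝 y] fun p => f p • v p + ∑ k, x k p • X k p) (hf : DifferentiableAt ℝ f y)
    (hx : ∀ k, DifferentiableAt ℝ (x k) y) (i : Fin 3) :
    VectorField.lieBracket ℝ E (X i) y
      = -(fderiv ℝ f y (X i y) • v y + ∑ k, fderiv ℝ (x k) y (X i y) • X k y)
        + ∑ k, x k y • VectorField.lieBracket ℝ (X k) (X i) y := by
  rw [h.lieBracket_field hy hE hf hx, h.lieBracket_v_X hy, smul_zero, add_zero]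

theorem lieMetric_v_v (h : TwistorFrame G s H t Φ v u e X) (hy : y ∈ s)
    (hE : E =ᶠ[𝓝 y] fun p => f p • v p + ∑ k, x k p • X k p) (hf : DifferentiableAt ℝ f y)
    (hx : ∀ k, DifferentiableAt ℝ (x k) y) :
    lieMetric G E v v y = -fderiv ℝ u y (E y) / u y ^ 2 + 2 * fderiv ℝ f y (v y) / u y := by
  have hu := (h.pos y hy).ne'
  have h1 : (fun p => G p (v p) (v p)) =ᶠ[𝓝 y] fun p => 1 / u p := by
    filter_upwards [h.metric.isOpen.mem_nhds hy] with p hp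
    rw [h.norm_v p hp, one_div]
  rw [lieMetric, h1.fderiv_eq, fderiv_div_apply (differentiableAt_const 1)
    (differentiableAt_of_smoothOn h.metric.isOpen h.smooth_u hy) hu,
    h.lieBracket_field_v hy hE hf hx]
  simp only [fderiv_fun_const, Pi.zero_apply, zero_apply, map_neg, map_add, map_sum, map_smul,
    neg_apply, add_apply, sum_apply, smul_apply, h.norm_v y hy, h.orth y hy, h.orth' hy,
    smul_eq_mul, mul_zero, Finset.sum_const_zero]
  field_simp
  ring

theorem inner_v_lieBracket (h : TwistorFrame G s H t Φ v u e X) (hy : y ∈ s) (i k : Fin 3) :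
    G y (v y) (VectorField.lieBracket ℝ (X k) (X i) y)
      = -starForm (fun k => fderiv ℝ u y (X k y)) k i / u y := by
  have hu := (h.pos y hy).ne'
  rw [← h.monopole y hy, vertBracket]
  field_simp

theorem lieMetric_v_X (h : TwistorFrame G s H t Φ v u e X) (hy : y ∈ s)
    (hE : E =ᶠ[𝓝 y] fun p => f p • v p + ∑ k, x k p • X k p) (hf : DifferentiableAt ℝ f y)
    (hx : ∀ k, DifferentiableAt ℝ (x k) y) (i : Fin 3) :
    lieMetric G E v (X i) y = u y * fderiv ℝ (x i) y (v y) + fderiv ℝ f y (X i y) / u y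
      + ∑ k, x k y * (starForm (fun k => fderiv ℝ u y (X k y)) k i / u y) := by
  have hu := (h.pos y hy).ne'
  have h1 : (fun p => G p (v p) (X i p)) =ᶠ[𝓝 y] fun p => 0 := by
    filter_upwards [h.metric.isOpen.mem_nhds hy] with p hp using h.orth p hp i
  rw [lieMetric, h1.fderiv_eq, h.lieBracket_field_v hy hE hf hx,
    h.lieBracket_field_X hy hE hf hx]
  simp only [fderiv_fun_const, Pi.zero_apply, zero_apply, map_neg, map_add, map_sum, map_smul,
    neg_apply, add_apply, sum_apply, smul_apply, h.norm_v y hy, h.orth y hy, h.orth' hy,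
    smul_eq_mul, mul_zero, Finset.sum_const_zero, h.norm_X y hy, h.inner_v_lieBracket hy,
    mul_ite, Finset.sum_ite_eq', Finset.mem_univ, if_true, neg_div, mul_neg,
    Finset.sum_neg_distrib]
  field_simp
  ring

theorem lieMetric_symm {B : Rn 4 → (Rn 4 →L[ℝ] Rn 4 →L[ℝ] ℝ)} (hB : ∀ᶠ p in 𝓝 y, ∀ a b,
    B p a b = B p b a) (A C : Rn 4 → Rn 4) : lieMetric B E A C y = lieMetric B E C A y := by
  have h1 : (fun p => B p (A p) (C p)) =ᶠ[𝓝 y] fun p => B p (C p) (A p) := by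
    filter_upwards [hB] with p hp using hp _ _
  rw [lieMetric, lieMetric, h1.fderiv_eq, hB.self_of_nhds (A y), hB.self_of_nhds _ (C y)]
  ring

/-- On horizontal vectors the metric is u φ*h, whence the term E(u) φ*h by the Leibniz rule. The
vertical part of `E` does not contribute to the derivative of φ*h, its bracket with X_i being
vertical. -/
theorem lieMetric_X_X (h : TwistorFrame G s H t Φ v u e X) (hy : y ∈ s)
    (hE : E =ᶠ[𝓝 y] fun p => f p • v p + ∑ k, x k p • X k p) (hf : DifferentiableAt ℝ f y)
    (hx : ∀ k, DifferentiableAt ℝ (x k) y)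
    {F : Rn 4 → Rn 4} (hF : F =ᶠ[𝓝 y] fun p => ∑ k, x k p • X k p) (i j : Fin 3) :
    lieMetric G E (X i) (X j) y = (if i = j then fderiv ℝ u y (E y) else 0)
      + u y * lieMetric (fun p => (H (Φ p)).bilinearComp (fderiv ℝ Φ p) (fderiv ℝ Φ p)) F
        (X i) (X j) y := by
  have h1 : (fun p => G p (X i p) (X j p)) =ᶠ[𝓝 y] fun p => if i = j then u p else 0 := by
    filter_upwards [h.metric.isOpen.mem_nhds hy] with p hp using h.norm_X p hp i j
  have h2 : (fun p => (H (Φ p)).bilinearComp (fderiv ℝ Φ p) (fderiv ℝ Φ p) (X i p) (X j p))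
      =ᶠ[𝓝 y] fun p => if i = j then 1 else 0 := by
    filter_upwards [h.metric.isOpen.mem_nhds hy] with p hp
    simp only [ContinuousLinearMap.bilinearComp_apply, h.proj p hp,
      h.orthonormal _ (h.maps hp)]
  have h3 : ∀ i, fderiv ℝ Φ y (VectorField.lieBracket ℝ E (X i) y)
      = fderiv ℝ Φ y (VectorField.lieBracket ℝ F (X i) y) := by
    intro i
    have hF' : F =ᶠ[𝓝 y] fun p => (0 : Rn 4 → ℝ) p • v p + ∑ k, x k p • X k p := by
      filter_upwards [hF] with p hp
      rw [hp, Pi.zero_apply, zero_smul, zero_add]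
    rw [h.lieBracket_field_X hy hE hf hx, h.lieBracket_field_X hy hF' (differentiableAt_const 0) hx]
    simp only [map_add, map_neg, map_smul, h.vert y hy, smul_zero]
  have h4 : fderiv ℝ (fun p => if i = j then u p else 0) y (E y)
      = if i = j then fderiv ℝ u y (E y) else 0 := by
    split_ifs <;> simp
  rw [lieMetric, lieMetric, h1.fderiv_eq, h2.fderiv_eq, h4, h.metric.symm y hy (X i y),
    inner_X h.toLiftedFrame hy, inner_X h.toLiftedFrame hy, h3, h3]
  simp only [ContinuousLinearMap.bilinearComp_apply, h.proj y hy, fderiv_fun_const, Pi.zero_apply,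
    zero_apply, h.metric'.symm _ (h.maps hy) (e i (Φ y))]
  ring

end TwistorFrame

/-! ### The soliton equation in frames -/

/-- Tensoriality in `v` and `w`, so that vanishing can be tested on a frame. -/
theorem lieDer_bilinear {n : ℕ} {M : Type*} [TopologicalSpace M] [ChartedSpace (Rn n) M]
    [IsManifold (𝓡 n) ∞ M] (X : (p : M) → Tan n p) (T : (p : M) → Tan n p → Tan n p → ℝ) {x : M}
    {B : Rn n → (Rn n →L[ℝ] Rn n →L[ℝ] ℝ)} (hB : DifferentiableAt ℝ B (chart n x x))
    (hTB : ∀ᶠ y in 𝓝 (chart n x x), ∀ u w, chartTensor T x y u w = B y u w) :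
    ∃ L : Rn n →L[ℝ] Rn n →L[ℝ] ℝ, ∀ v w, lieDer X T x v w = L (coord x x v) (coord x x w) := by
  refine ⟨fderiv ℝ B (chart n x x) (chartField X x (chart n x x))
    + (B (chart n x x)).bilinearComp (fderiv ℝ (chartField X x) (chart n x x))
      (ContinuousLinearMap.id ℝ _)
    + (B (chart n x x)).bilinearComp (ContinuousLinearMap.id ℝ _)
      (fderiv ℝ (chartField X x) (chart n x x)), fun v w => ?_⟩
  have h1 : (fun y => chartTensor T x y (coordVec x v) (coordVec x w)) =ᶠ[𝓝 (chart n x x)]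
      fun y => B y (coordVec x v) (coordVec x w) := by
    filter_upwards [hTB] with y hy using hy _ _
  have h2 : fderiv ℝ (fun y => B y (coordVec x v) (coordVec x w)) (chart n x x)
      = ((fderiv ℝ B (chart n x x)).flip (coordVec x v)).flip (coordVec x w) := by
    ext a
    rw [fderiv_bilin hB (differentiableAt_const _) (differentiableAt_const _)]
    simp
  rw [lieDer, h1.fderiv_eq, hTB.self_of_nhds, hTB.self_of_nhds, h2, coordVec_eq, coordVec_eq]
  rfl

section Soliton

open Filter

variable {M : Type*} [TopologicalSpace M] [ChartedSpace (Rn 4) M] [IsManifold (𝓡 4) ∞ M]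
  {N : Type*} [TopologicalSpace N] [ChartedSpace (Rn 3) N] [IsManifold (𝓡 3) ∞ N]
  {g : RMetric 4 M} {h : RMetric 3 N} {oM : ManifoldOrientation 4 M}
  {oN : ManifoldOrientation 3 N} {φ : M → N} {V : (x : M) → Tan 4 x}
  {U : Set M} {W : Set N} {X : Fin 3 → (p : M) → Tan 4 p} {e : Fin 3 → (q : N) → Tan 3 q}
  {E : (x : M) → Tan 4 x} {f : M → ℝ} {F : (x : M) → Tan 4 x} {x : Fin 3 → M → ℝ} {p : M}

theorem chartTensor_metric (g : RMetric 4 M) (p : M) : ∀ᶠ y in 𝓝 (chart 4 p p), ∀ u w,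
    chartTensor (fun p u u' => g.inner p u u') p y u w = chartMetric g p y u w := by
  filter_upwards [(isOpen_chart_target p).mem_nhds ((chart 4 p).map_source
    (mem_extChartAt_source p))] with y hy u w
  obtain ⟨q, hq, rfl⟩ := exists_chart_eq hy
  obtain ⟨a, rfl⟩ := coord_surjective hq u
  obtain ⟨b, rfl⟩ := coord_surjective hq w
  rw [chartTensor_chart _ hq, chartMetric_chart g hq]

/-- The metric `φ*(h)` in coordinates. -/
def chartPullback (h : RMetric 3 N) (φ : M → N) (x : M) (x' : N) (y : Rn 4) :
    Rn 4 →L[ℝ] Rn 4 →L[ℝ] ℝ :=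
  (chartMetric h x' (chartMap (n := 4) (m := 3) φ x x' y)).bilinearComp
    (fderiv ℝ (chartMap (n := 4) (m := 3) φ x x') y) (fderiv ℝ (chartMap (n := 4) (m := 3) φ x x') y)

namespace IsTwistorSetting

theorem mem_dom_univ (hs : IsTwistorSetting g h oM oN φ V) (p : M) :
    dom φ Set.univ p (φ p) ∈ 𝓝 (chart 4 p p) :=
  (hs.isOpen_dom isOpen_univ p (φ p)).mem_nhds
    (mem_dom (mem_extChartAt_source p) (Set.mem_univ p) (mem_extChartAt_source _))

theorem chartTensor_pullback (hs : IsTwistorSetting g h oM oN φ V) (p : M) :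
    ∀ᶠ y in 𝓝 (chart 4 p p), ∀ u w,
      chartTensor (pullbackMetric h φ) p y u w = chartPullback h φ p (φ p) y u w := by
  filter_upwards [hs.mem_dom_univ p] with y hy u w
  obtain ⟨q, hq, -, hq', rfl⟩ := exists_of_mem_dom hy
  obtain ⟨a, rfl⟩ := coord_surjective hq u
  obtain ⟨b, rfl⟩ := coord_surjective hq w
  rw [chartTensor_chart _ hq, chartPullback, ContinuousLinearMap.bilinearComp_apply,
    hs.fderiv_chart hq hq', hs.fderiv_chart hq hq', chartMap_chart φ _ hq, chartMetric_chart h hq']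
  rfl

theorem differentiableAt_chartPullback (hs : IsTwistorSetting g h oM oN φ V) (p : M) :
    DifferentiableAt ℝ (chartPullback h φ p (φ p)) (chart 4 p p) := by
  have ho := hs.isOpen_dom isOpen_univ p (φ p)
  have h1 : ContDiffOn ℝ ∞ (chartMap (n := 4) (m := 3) φ p (φ p)) (dom φ Set.univ p (φ p)) :=
    (smoothOn_chartMap hs.smooth p (φ p)).mono fun y hy => ⟨hy.1, hy.2.2⟩
  have h2 : ContDiffOn ℝ ∞ (fun y => chartMetric h (φ p) (chartMap (n := 4) (m := 3) φ p (φ p) y))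
      (dom φ Set.univ p (φ p)) :=
    (isMetricOn_chartMetric h (φ p)).smooth.comp h1 fun y hy => by
      obtain ⟨q, hq, -, hq', rfl⟩ := exists_of_mem_dom hy
      rw [chartMap_chart φ _ hq]
      exact (chart 3 (φ p)).map_source hq'
  have h3 : ContDiffOn ℝ ∞ (chartPullback h φ p (φ p)) (dom φ Set.univ p (φ p)) := by
    rw [contDiffOn_clm_apply]
    intro u
    rw [contDiffOn_clm_apply]
    intro w
    exact (h2.clm_apply (smoothOn_fderiv_apply ho h1 contDiffOn_const)).clm_apply
      (smoothOn_fderiv_apply ho h1 contDiffOn_const)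
  exact differentiableAt_of_smoothOn ho h3 (mem_of_mem_nhds (hs.mem_dom_univ p))

theorem differentiableAt_metric (g : RMetric 4 M) (p : M) :
    DifferentiableAt ℝ (chartMetric g p) (chart 4 p p) :=
  (isMetricOn_chartMetric g p).differentiableAt
    ((chart 4 p).map_source (mem_extChartAt_source p))

/-- f = θ(E), a smooth expression in E. -/
theorem smooth_f (hs : IsTwistorSetting g h oM oN φ V) (hE : SmoothFieldOn E Set.univ)
    (hF : ∀ x, IsHorizontal g φ x (F x)) (hEF : ∀ x, E x = f x • V x + F x) :
    ContMDiff (𝓡 4) 𝓘(ℝ, ℝ) ∞ f := by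
  have h1 : f = fun p => dilInvSq g h φ p * g.inner p (V p) (E p) := by
    funext p
    rw [hEF, map_add, map_smul, hs.horizontal_inner p (hF p), hs.inner_V]
    have := (hs.dilInvSq_pos p).ne'
    simp only [smul_eq_mul, add_zero]
    field_simp
  rw [h1, ← contMDiffOn_univ]
  exact hs.smooth_dilInvSq.contMDiffOn.mul (smooth_inner g hs.field.smooth hE)

/-- The k-th component is λ² g(E, X_k), by orthogonality of the frame. -/
theorem smooth_component (hs : IsTwistorSetting g h oM oN φ V) (hX : BasicFrame g h oN φ U W X e)
    (hE : SmoothFieldOn E Set.univ) (hEF : ∀ x, E x = f x • V x + F x)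
    (hx : ∀ p ∈ U, F p = ∑ k, x k p • X k p) (k : Fin 3) :
    ContMDiffOn (𝓡 4) 𝓘(ℝ, ℝ) ∞ (x k) U := by
  have h1 : ∀ p ∈ U, x k p = (dilInvSq g h φ p)⁻¹ * g.inner p (E p) (X k p) := by
    intro p hp
    have h2 : ∀ i, g.inner p (X k p) (X i p) = if k = i then dilInvSq g h φ p else 0 := by
      intro i
      rw [hs.inner_horizontal (hX.horizontal p hp k) (hX.horizontal p hp i), hX.proj p hp,
        hX.proj p hp, (hX.orthonormal _ (hX.maps hp)).inner_eq (e := fun i => e i (φ p)),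
        mul_ite, mul_one, mul_zero]
    have h3 : g.inner p (X k p) (V p) = 0 := by
      rw [g.symm]
      exact hs.horizontal_inner p (hX.horizontal p hp k)
    have := (hs.dilInvSq_pos p).ne'
    rw [g.symm, hEF, hx p hp, map_add, map_sum, map_smul, h3]
    simp only [map_smul, h2, smul_eq_mul, mul_ite, mul_zero, Finset.sum_ite_eq, Finset.mem_univ,
      if_true, zero_add]
    field_simp
  refine ContMDiffOn.congr ?_ h1
  exact (hs.smooth_dilInvSq.contMDiffOn.inv₀ fun p _ => (hs.dilInvSq_pos p).ne').mul
    (smooth_inner g (hE.mono (Set.subset_univ _)) (hX.smooth_X k))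

omit [IsManifold (𝓡 4) ∞ M] [IsManifold (𝓡 3) ∞ N] in
theorem mem_dom_self (φ : M → N) (hp : p ∈ U) :
    chart 4 p p ∈ dom φ U p (φ p) :=
  mem_dom (mem_extChartAt_source p) hp (mem_extChartAt_source _)

theorem chartField_E (hs : IsTwistorSetting g h oM oN φ V) (hX : BasicFrame g h oN φ U W X e)
    (hEF : ∀ x, E x = f x • V x + F x) (hx : ∀ p ∈ U, F p = ∑ k, x k p • X k p) (hp : p ∈ U) :
    chartField E p =ᶠ[𝓝 (chart 4 p p)] fun y => (f ∘ (chart 4 p).symm) y • chartField V p y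
      + ∑ k, (x k ∘ (chart 4 p).symm) y • chartField (X k) p y := by
  filter_upwards [(hs.isOpen_dom hX.isOpen p (φ p)).mem_nhds (mem_dom_self φ hp)] with y hy
  obtain ⟨q, hq, hqU, -, rfl⟩ := exists_of_mem_dom hy
  simp only [chartField_chart _ hq, Function.comp_apply, (chart 4 p).left_inv hq, hEF q, hx q hqU,
    map_add, map_sum, map_smul]

theorem chartField_F (hs : IsTwistorSetting g h oM oN φ V) (hX : BasicFrame g h oN φ U W X e)
    (hx : ∀ p ∈ U, F p = ∑ k, x k p • X k p) (hp : p ∈ U) :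
    chartField F p =ᶠ[𝓝 (chart 4 p p)]
      fun y => ∑ k, (x k ∘ (chart 4 p).symm) y • chartField (X k) p y := by
  filter_upwards [(hs.isOpen_dom hX.isOpen p (φ p)).mem_nhds (mem_dom_self φ hp)] with y hy
  obtain ⟨q, hq, hqU, -, rfl⟩ := exists_of_mem_dom hy
  simp only [chartField_chart _ hq, Function.comp_apply, (chart 4 p).left_inv hq, hx q hqU,
    map_sum, map_smul]

end IsTwistorSetting

end Soliton

/-! ### Ricci tensor and Lie derivatives on a lifted frame -/

section SolitonFrames

open Filter

variable {M : Type*} [TopologicalSpace M] [ChartedSpace (Rn 4) M] [IsManifold (𝓡 4) ∞ M]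
  {N : Type*} [TopologicalSpace N] [ChartedSpace (Rn 3) N] [IsManifold (𝓡 3) ∞ N]
  {g : RMetric 4 M} {h : RMetric 3 N} {oM : ManifoldOrientation 4 M}
  {oN : ManifoldOrientation 3 N} {φ : M → N} {V : (x : M) → Tan 4 x}
  {U : Set M} {W : Set N} {X : Fin 3 → (p : M) → Tan 4 p} {e : Fin 3 → (q : N) → Tan 3 q}
  {E : (x : M) → Tan 4 x} {f : M → ℝ} {F : (x : M) → Tan 4 x} {x : Fin 3 → M → ℝ} {p : M}

namespace IsTwistorSetting

theorem lieDer_metric (g : RMetric 4 M) (E : (x : M) → Tan 4 x)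
    {A B : (x : M) → Tan 4 x} (hA : DifferentiableAt ℝ (chartField A p) (chart 4 p p))
    (hB : DifferentiableAt ℝ (chartField B p) (chart 4 p p)) :
    lieDer E (fun p u u' => g.inner p u u') p (A p) (B p)
      = lieMetric (chartMetric g p) (chartField E p) (chartField A p) (chartField B p)
        (chart 4 p p) :=
  lieDer_eq E _ (differentiableAt_metric g p) (chartTensor_metric g p) hA hB
    (chartField_chart A (mem_extChartAt_source p)).symm
    (chartField_chart B (mem_extChartAt_source p)).symm

theorem lieDer_pullback (hs : IsTwistorSetting g h oM oN φ V) (E : (x : M) → Tan 4 x)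
    {A B : (x : M) → Tan 4 x} (hA : DifferentiableAt ℝ (chartField A p) (chart 4 p p))
    (hB : DifferentiableAt ℝ (chartField B p) (chart 4 p p)) :
    lieDer E (pullbackMetric h φ) p (A p) (B p)
      = lieMetric (chartPullback h φ p (φ p)) (chartField E p) (chartField A p) (chartField B p)
        (chart 4 p p) :=
  lieDer_eq E _ (hs.differentiableAt_chartPullback p) (hs.chartTensor_pullback p) hA hB
    (chartField_chart A (mem_extChartAt_source p)).symm
    (chartField_chart B (mem_extChartAt_source p)).symm

theorem ricci_frame (hs : IsTwistorSetting g h oM oN φ V) (hX : BasicFrame g h oN φ U W X e)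
    (hp : p ∈ U) : ricci g p (V p) (V p) = 0 ∧ (∀ i, ricci g p (V p) (X i p) = 0) ∧
    (∀ i, ricci g p (X i p) (V p) = 0) ∧
    ∀ i j, ricci g p (X i p) (X j p) = ricci h (φ p) (e i (φ p)) (e j (φ p))
      - if i = j then deriveAlong V (dilInvSq g h φ) p ^ 2 / 2 else 0 := by
  have hpp := mem_extChartAt_source (I := 𝓡 4) p
  have hr := (hs.twistorFrame hX p (φ p)).ricci (mem_dom_self φ hp)
  rw [chartMap_chart φ _ hpp] at hr
  simp only [chartField_chart _ hpp, chartField_chart _ (mem_extChartAt_source (I := 𝓡 3) (φ p)),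
    ← hs.mvfderiv_dilInvSq hpp] at hr
  exact hr

theorem lieDer_frame (hs : IsTwistorSetting g h oM oN φ V) (hX : BasicFrame g h oN φ U W X e)
    (hE : SmoothFieldOn E Set.univ) (hF : ∀ x, IsHorizontal g φ x (F x))
    (hEF : ∀ x, E x = f x • V x + F x) (hx : ∀ p ∈ U, F p = ∑ k, x k p • X k p) (hp : p ∈ U) :
    lieDer E (fun p u u' => g.inner p u u') p (V p) (V p)
      = -deriveAlong E (dilInvSq g h φ) p / dilInvSq g h φ p ^ 2
        + 2 * deriveAlong V f p / dilInvSq g h φ p ∧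
    (∀ i, lieDer E (fun p u u' => g.inner p u u') p (V p) (X i p)
      = dilInvSq g h φ p * deriveAlong V (x i) p + deriveAlong (X i) f p / dilInvSq g h φ p
      + ∑ k, x k p * (Omega g h φ V p (X k p) (X i p) / dilInvSq g h φ p)) ∧
    (∀ i, lieDer E (fun p u u' => g.inner p u u') p (X i p) (V p)
      = lieDer E (fun p u u' => g.inner p u u') p (V p) (X i p)) ∧
    ∀ i j, lieDer E (fun p u u' => g.inner p u u') p (X i p) (X j p)
      = (if i = j then deriveAlong E (dilInvSq g h φ) p else 0)
        + dilInvSq g h φ p * lieDer F (pullbackMetric h φ) p (X i p) (X j p) := by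
  have hpp := mem_extChartAt_source (I := 𝓡 4) p
  have hy := mem_dom_self (N := N) φ hp
  have ho := hs.isOpen_dom hX.isOpen p (φ p)
  have T := hs.twistorFrame hX p (φ p)
  have hfm := (hs.smooth_f hE hF hEF).mdifferentiable (by simp) p
  have hxm : ∀ k, MDifferentiableAt (𝓡 4) 𝓘(ℝ, ℝ) (x k) p := fun k =>
    ((hs.smooth_component hX hE hEF hx k).contMDiffAt (hX.isOpen.mem_nhds hp)).mdifferentiableAt
      (by simp)
  have hum := hs.smooth_dilInvSq.mdifferentiable (by simp) p
  have hfd : DifferentiableAt ℝ (f ∘ (chart 4 p).symm) (chart 4 p p) :=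
    differentiableAt_of_smoothOn ho ((smoothOn_comp_symm le_rfl
      ((hs.smooth_f hE hF hEF).contMDiffOn (s := Set.univ)) p).mono
        fun y hy => ⟨hy.1, Set.mem_univ _⟩) hy
  have hxd : ∀ k, DifferentiableAt ℝ (x k ∘ (chart 4 p).symm) (chart 4 p p) := fun k =>
    differentiableAt_of_smoothOn ho ((smoothOn_comp_symm le_rfl
      (hs.smooth_component hX hE hEF hx k) p).mono fun y hy => ⟨hy.1, hy.2.1⟩) hy
  have hvd := differentiableAt_of_smoothOn ho T.smooth_v hy
  have hXd := fun i => differentiableAt_of_smoothOn ho (T.smooth_X i) hy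
  have hEE := hs.chartField_E hX hEF hx hp
  have hFF := hs.chartField_F hX hx hp
  refine ⟨?_, fun i => ?_, fun i => ?_, fun i j => ?_⟩
  · rw [lieDer_metric g E hvd hvd, T.lieMetric_v_v hy hEE hfd hxd,
      deriveAlong_eq hpp hum, deriveAlong_eq hpp hfm]
    simp only [Function.comp_apply, (chart 4 p).left_inv hpp]
  · rw [lieDer_metric g E hvd (hXd i), T.lieMetric_v_X hy hEE hfd hxd,
      deriveAlong_eq hpp (hxm i), deriveAlong_eq hpp hfm]
    simp only [hs.Omega_frame hX hp, hs.mvfderiv_dilInvSq hpp, ← chartField_chart _ hpp]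
    simp only [Function.comp_apply, (chart 4 p).left_inv hpp]
  · rw [lieDer_metric g E hvd (hXd i), lieDer_metric g E (hXd i) hvd]
    refine TwistorFrame.lieMetric_symm ?_ _ _
    filter_upwards [ho.mem_nhds hy] with y hy using T.metric.symm y hy
  · rw [lieDer_metric g E (hXd i) (hXd j), hs.lieDer_pullback F (hXd i) (hXd j),
      T.lieMetric_X_X hy hEE hfd hxd hFF, deriveAlong_eq hpp hum]
    simp only [Function.comp_apply, (chart 4 p).left_inv hpp]
    rfl

theorem exists_coeff (hs : IsTwistorSetting g h oM oN φ V) (hX : BasicFrame g h oN φ U W X e)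
    (hp : p ∈ U) (a : Tan 4 p) : ∃ r : ℝ, ∃ c : Fin 3 → ℝ, a = r • V p + ∑ k, c k • X k p := by
  have hpp := mem_extChartAt_source (I := 𝓡 4) p
  have h1 := (hs.twistorFrame hX p (φ p)).decomp (mem_dom_self φ hp) (coord p p a)
  simp only [chartField_chart _ hpp] at h1
  obtain ⟨r, c, hrc⟩ : ∃ r : ℝ, ∃ c : Fin 3 → ℝ,
      coord p p a = r • coord p p (V p) + ∑ k, c k • coord p p (X k p) := ⟨_, _, h1⟩
  refine ⟨r, c, coord_injective hpp ?_⟩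
  rw [hrc, map_add, map_sum, map_smul]
  simp only [map_smul]

theorem exists_coeff_horizontal (hs : IsTwistorSetting g h oM oN φ V)
    (hX : BasicFrame g h oN φ U W X e)
    (hp : p ∈ U) {a : Tan 4 p} (ha : IsHorizontal g φ p a) :
    ∃ c : Fin 3 → ℝ, a = ∑ k, c k • X k p := by
  obtain ⟨r, c, hc⟩ := hs.exists_coeff hX hp a
  have h1 : r = 0 := by
    have h2 := hs.horizontal_inner p ha
    rw [hc, map_add, map_sum, map_smul, hs.inner_V] at h2
    simpa only [map_smul, hs.horizontal_inner p (hX.horizontal p hp _), smul_eq_mul, mul_zero,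
      Finset.sum_const_zero, add_zero, mul_eq_zero, inv_eq_zero,
      (hs.dilInvSq_pos p).ne', or_false] using h2
  exact ⟨c, by rw [hc, h1, zero_smul, zero_add]⟩

/-- A bilinear form which vanishes on a frame is zero. -/
theorem forall_eq_zero_iff_frame (hs : IsTwistorSetting g h oM oN φ V)
    (hX : BasicFrame g h oN φ U W X e) (hp : p ∈ U) {S : Tan 4 p → Tan 4 p → ℝ}
    (hS : ∃ L : Rn 4 →ₗ[ℝ] Rn 4 →ₗ[ℝ] ℝ, ∀ v w, S v w = L (coord p p v) (coord p p w)) :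
    (∀ v w, S v w = 0) ↔ S (V p) (V p) = 0 ∧ (∀ i, S (V p) (X i p) = 0) ∧
      (∀ i, S (X i p) (V p) = 0) ∧ ∀ i j, S (X i p) (X j p) = 0 := by
  refine ⟨fun h => ⟨h _ _, fun _ => h _ _, fun _ => h _ _, fun _ _ => h _ _⟩, ?_⟩
  obtain ⟨L, hL⟩ := hS
  simp only [hL]
  rintro ⟨h1, h2, h3, h4⟩ v w
  obtain ⟨r, c, rfl⟩ := hs.exists_coeff hX hp v
  obtain ⟨r', c', rfl⟩ := hs.exists_coeff hX hp w
  simp only [map_add, map_sum, map_smul, LinearMap.add_apply, LinearMap.sum_apply,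
    LinearMap.smul_apply, h1, h2, h3, h4, smul_zero, Finset.sum_const_zero, add_zero]

theorem forall_horizontal_eq_zero_iff_frame (hs : IsTwistorSetting g h oM oN φ V)
    (hX : BasicFrame g h oN φ U W X e) (hp : p ∈ U) {S : Tan 4 p → Tan 4 p → ℝ}
    (hS : ∃ L : Rn 4 →ₗ[ℝ] Rn 4 →ₗ[ℝ] ℝ, ∀ v w, S v w = L (coord p p v) (coord p p w)) :
    (∀ v w, IsHorizontal g φ p v → IsHorizontal g φ p w → S v w = 0) ↔
      ∀ i j, S (X i p) (X j p) = 0 := by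
  refine ⟨fun h i j => h _ _ (hX.horizontal p hp i) (hX.horizontal p hp j), ?_⟩
  obtain ⟨L, hL⟩ := hS
  simp only [hL]
  intro h4 v w hv hw
  obtain ⟨c, rfl⟩ := hs.exists_coeff_horizontal hX hp hv
  obtain ⟨c', rfl⟩ := hs.exists_coeff_horizontal hX hp hw
  simp only [map_add, map_sum, map_smul, LinearMap.add_apply, LinearMap.sum_apply,
    LinearMap.smul_apply, h4, smul_zero, Finset.sum_const_zero]

end IsTwistorSetting

end SolitonFrames

/-! ### The soliton equation and the five relations at a point -/

section SolitonEquation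

open Filter

variable {M : Type*} [TopologicalSpace M] [ChartedSpace (Rn 4) M] [IsManifold (𝓡 4) ∞ M]
  {N : Type*} [TopologicalSpace N] [ChartedSpace (Rn 3) N] [IsManifold (𝓡 3) ∞ N]
  {g : RMetric 4 M} {h : RMetric 3 N} {oM : ManifoldOrientation 4 M}
  {oN : ManifoldOrientation 3 N} {φ : M → N} {V : (x : M) → Tan 4 x}
  {U : Set M} {X Y Z : (p : M) → Tan 4 p}
  {E : (x : M) → Tan 4 x} {f : M → ℝ} {F : (x : M) → Tan 4 x} {x y z : M → ℝ} {p : M}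

theorem IsAdaptedFrame.exists_basicFrame (hA : IsAdaptedFrame g h oN φ V U X Y Z) :
    ∃ (W : Set N) (e : Fin 3 → (q : N) → Tan 3 q), BasicFrame g h oN φ U W ![X, Y, Z] e := by
  obtain ⟨W, X', Y', Z', hW, hm, hX', hY', hZ', ho, hp⟩ := hA.projectable
  refine ⟨W, ![X', Y', Z'], hA.isOpen, hW, hm, ?_, ?_, ?_, ?_, ho⟩
  · intro i; fin_cases i
    exacts [hA.smooth_X, hA.smooth_Y, hA.smooth_Z]
  · intro i; fin_cases i
    exacts [hX', hY', hZ']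
  · intro p hpU i; fin_cases i
    exacts [hA.horizontal_X p hpU, hA.horizontal_Y p hpU, hA.horizontal_Z p hpU]
  · intro p hpU i; fin_cases i
    exacts [(hp p hpU).1, (hp p hpU).2.1, (hp p hpU).2.2]

theorem ricci_bilinear {n : ℕ} {P : Type*} [TopologicalSpace P] [ChartedSpace (Rn n) P]
    [IsManifold (𝓡 n) ∞ P] (k : RMetric n P) (q : P) :
    ∃ L : Rn n →ₗ[ℝ] Rn n →ₗ[ℝ] ℝ, ∀ v w, ricci k q v w = L (coord q q v) (coord q q w) :=
  ⟨(isMetricOn_chartMetric k q).ricciForm ((chart n q).map_source (mem_extChartAt_source q)),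
    fun _ _ => rfl⟩

namespace IsTwistorSetting

theorem exists_solitonForm (g : RMetric 4 M) (E : (x : M) → Tan 4 x) (a : ℝ) (p : M) :
    ∃ L : Rn 4 →ₗ[ℝ] Rn 4 →ₗ[ℝ] ℝ, ∀ v w, ricci g p v w + a * g.inner p v w
      + (1 / 2) * lieDer E (fun p u u' => g.inner p u u') p v w
        = L (coord p p v) (coord p p w) := by
  obtain ⟨L, hL⟩ := lieDer_bilinear E _ (differentiableAt_metric g p) (chartTensor_metric g p)
  obtain ⟨R, hR⟩ := ricci_bilinear g p
  refine ⟨R + a • (chartMetric g p (chart 4 p p)).toLinearMap₁₂ + (1 / 2 : ℝ) • L.toLinearMap₁₂,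
    fun v w => ?_⟩
  rw [hL, hR, ← chartMetric_chart g (mem_extChartAt_source p)]
  rfl

theorem exists_horizontalForm (hs : IsTwistorSetting g h oM oN φ V) (F : (x : M) → Tan 4 x)
    (k k' : ℝ) (p : M) :
    ∃ L : Rn 4 →ₗ[ℝ] Rn 4 →ₗ[ℝ] ℝ, ∀ v w, lieDer F (pullbackMetric h φ) p v w
      + k * pullbackMetric h φ p v w + k' * ricci h (φ p) (dφ φ p v) (dφ φ p w)
        = L (coord p p v) (coord p p w) := by
  have hpp := mem_extChartAt_source (I := 𝓡 4) p
  obtain ⟨L, hL⟩ := lieDer_bilinear F _ (hs.differentiableAt_chartPullback p)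
    (hs.chartTensor_pullback p)
  obtain ⟨R, hR⟩ := ricci_bilinear h (φ p)
  let D : Rn 4 →ₗ[ℝ] Rn 3 := fderiv ℝ (chartMap (n := 4) (m := 3) φ p (φ p)) (chart 4 p p)
  have hD : ∀ v, coord (φ p) (φ p) (dφ φ p v) = D (coord p p v) := fun v =>
    (hs.fderiv_chart hpp (mem_extChartAt_source (φ p)) v).symm
  refine ⟨L.toLinearMap₁₂ + k • (chartPullback h φ p (φ p) (chart 4 p p)).toLinearMap₁₂
    + k' • R.compl₁₂ D D, fun v w => ?_⟩
  rw [hL, hR, hD, hD, ← chartTensor_chart (pullbackMetric h φ) hpp,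
    (hs.chartTensor_pullback p).self_of_nhds]
  rfl

/-- The soliton form is evaluated on the frame (V, X_i). Multiplied by u, 2u and 2/u respectively,
its components (V,V), (V,X_i) and (X_i,X_j) are the first relation, the next three, and the last
one; λ⁻⁴ appears as u². -/
theorem soliton_iff_of_basicFrame (hs : IsTwistorSetting g h oM oN φ V)
    {W : Set N} {X : Fin 3 → (p : M) → Tan 4 p} {e : Fin 3 → (q : N) → Tan 3 q}
    {x : Fin 3 → M → ℝ} (hB : BasicFrame g h oN φ U W X e)
    (hE : SmoothFieldOn E Set.univ) (hF : ∀ x, IsHorizontal g φ x (F x))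
    (hEF : ∀ x, E x = f x • V x + F x)
    (hx : ∀ p ∈ U, F p = ∑ k, x k p • X k p) (hp : p ∈ U)
    (hZ : ∀ w : Tan 4 p, Omega g h φ V p (X 2 p) w = 0) (a : ℝ) :
    (∀ v w : Tan 4 p, ricci g p v w + a * g.inner p v w
      + (1 / 2) * lieDer E (fun p u u' => g.inner p u u') p v w = 0) ↔
      FiveRelations g h φ V f F a (X 0) (X 1) (X 2) (x 0) (x 1) (x 2) p := by
  have hu := hs.dilInvSq_pos p
  have hu0 := hu.ne'
  obtain ⟨hr1, hr2, hr3, hr4⟩ := hs.ricci_frame hB hp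
  obtain ⟨hl1, hl2, hl3, hl4⟩ := hs.lieDer_frame hB hE hF hEF hx hp
  have h01 := hs.Omega_frame hB hp 0 1
  have h12 := hs.Omega_frame hB hp 1 2
  have h20 := hs.Omega_frame hB hp 2 0
  have hO10 := hs.Omega_swap p (X 1 p) (X 0 p)
  have hOd : ∀ i, Omega g h φ V p (X i p) (X i p) = 0 := fun i => by
    have := hs.Omega_swap p (X i p) (X i p)
    linarith
  have hOZ : ∀ i, Omega g h φ V p (X i p) (X 2 p) = 0 := fun i => by
    rw [hs.Omega_swap, hZ, neg_zero]
  rw [hOZ] at h12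
  rw [hZ] at h20
  simp only [starForm, Matrix.cons_val] at h01 h12 h20
  -- ι_Z Ω = 0 forces X(u) = Y(u) = 0 by the monopole equation, and Z(u) = Ω(X,Y).
  have hEu : deriveAlong E (dilInvSq g h φ) p = f p * deriveAlong V (dilInvSq g h φ) p
      + x 2 p * Omega g h φ V p (X 0 p) (X 1 p) := by
    rw [h01, deriveAlong, hEF, hx p hp, Fin.sum_univ_three, map_add, map_add, map_add, map_smul,
      map_smul, map_smul, map_smul, ← h12, ← h20, smul_zero, smul_zero, zero_add, zero_add]
    rfl
  have hV2 := hs.inner_V p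
  have hVX : ∀ i, g.inner p (V p) (X i p) = 0 :=
    fun i => hs.horizontal_inner p (hB.horizontal p hp i)
  have hXV : ∀ i, g.inner p (X i p) (V p) = 0 := fun i => by rw [g.symm, hVX]
  have hpb : ∀ i j, pullbackMetric h φ p (X i p) (X j p) = if i = j then 1 else 0 := by
    intro i j
    rw [pullbackMetric, hB.proj p hp, hB.proj p hp,
      (hB.orthonormal _ (hB.maps hp)).inner_eq (e := fun i => e i (φ p))]
  have hXX : ∀ i j, g.inner p (X i p) (X j p) = if i = j then dilInvSq g h φ p else 0 := by
    intro i j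
    have := hpb i j
    rw [pullbackMetric] at this
    rw [hs.inner_horizontal (hB.horizontal p hp i) (hB.horizontal p hp j), this, mul_ite,
      mul_one, mul_zero]
  have hlam2 : dilation g h φ p ^ 2 = (dilInvSq g h φ p)⁻¹ := by rw [dilInvSq, inv_inv]
  have hlam4 : (dilation g h φ p ^ 4)⁻¹ = dilInvSq g h φ p ^ 2 := by
    rw [dilInvSq, inv_pow]
    ring
  rw [hs.forall_eq_zero_iff_frame hB hp (exists_solitonForm g E a p), FiveRelations,
    hs.forall_horizontal_eq_zero_iff_frame hB hp (hs.exists_horizontalForm F _ _ p)]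
  simp only [hr1, hr2, hr3, hr4, hl1, hl2, hl3, hl4, hV2, hVX, hXV, hXX, hpb, hEu, hlam2, hlam4,
    hB.proj p hp, Fin.sum_univ_three]
  constructor
  · rintro ⟨h1, h2, -, h4⟩
    have b0 := h2 0
    have b1 := h2 1
    have b2 := h2 2
    simp only [hOd, hOZ, hZ, hO10] at b0 b1 b2
    refine ⟨?_, ?_, ?_, ?_, fun i j => ?_⟩
    · field_simp at h1 ⊢
      linarith
    · field_simp at b0 ⊢
      linarith
    · field_simp at b1 ⊢
      linarith
    · field_simp at b2 ⊢
      linarith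
    · have h5 := h4 i j
      split_ifs at h5 ⊢
      · field_simp at h5 ⊢
        linarith
      · field_simp at h5 ⊢
        linarith
  · rintro ⟨h1, b0, b1, b2, h4⟩
    -- The mixed components; those with the arguments interchanged are the same by symmetry.
    have hb : ∀ i : Fin 3, (0 : ℝ) + a * 0 + 1 / 2 * (dilInvSq g h φ p * deriveAlong V (x i) p
        + deriveAlong (X i) f p / dilInvSq g h φ p
        + (x 0 p * (Omega g h φ V p (X 0 p) (X i p) / dilInvSq g h φ p)
          + x 1 p * (Omega g h φ V p (X 1 p) (X i p) / dilInvSq g h φ p)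
          + x 2 p * (Omega g h φ V p (X 2 p) (X i p) / dilInvSq g h φ p))) = 0 := by
      intro i
      fin_cases i
      · simp only [hOd, hOZ, hZ, hO10, Fin.zero_eta]
        field_simp at b0 ⊢
        linarith
      · simp only [hOd, hOZ, hZ, hO10, Fin.mk_one]
        field_simp at b1 ⊢
        linarith
      · simp only [hOd, hOZ, hZ, hO10, Fin.reduceFinMk]
        field_simp at b2 ⊢
        linarith
    refine ⟨?_, hb, hb, fun i j => ?_⟩
    · field_simp at h1 ⊢
      linarith
    · have h5 := h4 i j
      split_ifs at h5 ⊢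
      · field_simp at h5 ⊢
        linarith
      · field_simp at h5 ⊢
        linarith

theorem soliton_iff_fiveRelations (hs : IsTwistorSetting g h oM oN φ V)
    (hA : IsAdaptedFrame g h oN φ V U X Y Z)
    (hE : SmoothFieldOn E Set.univ) (hF : ∀ x, IsHorizontal g φ x (F x))
    (hEF : ∀ x, E x = f x • V x + F x)
    (hx : ∀ p ∈ U, F p = x p • X p + y p • Y p + z p • Z p) (hp : p ∈ U) (a : ℝ) :
    (∀ v w : Tan 4 p, ricci g p v w + a * g.inner p v w
      + (1 / 2) * lieDer E (fun p u u' => g.inner p u u') p v w = 0) ↔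
      FiveRelations g h φ V f F a X Y Z x y z p := by
  obtain ⟨W, e, hB⟩ := hA.exists_basicFrame
  refine hs.soliton_iff_of_basicFrame (x := ![x, y, z]) hB hE hF hEF ?_ hp (hA.omega_Z p hp) a
  intro p hp
  rw [hx p hp, Fin.sum_univ_three]
  rfl

end IsTwistorSetting

end SolitonEquation

/-! ### Orthonormalisation of frames -/

section GramSchmidt

/-- The matrix of the new triple has determinant r t. A single move of this kind covers every step
of Gram-Schmidt. -/
theorem IsPositiveBasis.combination {W : Type*} [AddCommGroup W] [Module ℝ W]
    {o : Orientation ℝ W (Fin 3)} {a b c : W} (h : IsPositiveBasis o ![a, b, c]) {r t : ℝ}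
    (hrt : 0 < r * t) (s s' : ℝ) :
    IsPositiveBasis o ![r • a + s • b + s' • c, b, t • c] := by
  obtain ⟨B, hB, ho⟩ := h
  have ha : a = B 0 := by rw [hB]; rfl
  have hb : b = B 1 := by rw [hB]; rfl
  have hc : c = B 2 := by rw [hB]; rfl
  rw [isPositiveBasis_iff B ho, Module.Basis.det_apply, Matrix.det_fin_three, ha, hb, hc]
  simp only [Module.Basis.toMatrix_apply, Matrix.cons_val, map_add, map_smul,
    Module.Basis.repr_self, Finsupp.add_apply, Finsupp.smul_apply, Finsupp.single_apply]
  simpa using hrt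

theorem IsPositiveBasis.ne_zero {W : Type*} [AddCommGroup W] [Module ℝ W]
    {o : Orientation ℝ W (Fin 3)} {a b c : W} (h : IsPositiveBasis o ![a, b, c]) : a ≠ 0 := by
  obtain ⟨B, hB, ho⟩ := h
  have ha : a = B 0 := by rw [hB]; rfl
  rw [ha]
  exact B.ne_zero 0

variable {N : Type*} [TopologicalSpace N] [ChartedSpace (Rn 3) N] [IsManifold (𝓡 3) ∞ N]
  {h : RMetric 3 N} {oN : ManifoldOrientation 3 N} {W : Set N}

theorem SmoothFieldOn.mul_left {n : ℕ} {P : Type*} [TopologicalSpace P] [ChartedSpace (Rn n) P]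
    [IsManifold (𝓡 n) ∞ P] {A : (q : P) → Tan n q} {s : P → ℝ} {U : Set P}
    (hA : SmoothFieldOn A U) (hs : ContMDiffOn (𝓡 n) 𝓘(ℝ, ℝ) ∞ s U) :
    SmoothFieldOn (fun q => s q • A q) U :=
  ContMDiffOn.smul_section hs hA

theorem SmoothFieldOn.add {n : ℕ} {P : Type*} [TopologicalSpace P] [ChartedSpace (Rn n) P]
    [IsManifold (𝓡 n) ∞ P] {A B : (q : P) → Tan n q} {U : Set P}
    (hA : SmoothFieldOn A U) (hB : SmoothFieldOn B U) :
    SmoothFieldOn (fun q => A q + B q) U :=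
  ContMDiffOn.add_section hA hB

/-- The inverse length of a vector field. -/
def invNorm (h : RMetric 3 N) (A : (q : N) → Tan 3 q) (q : N) : ℝ :=
  (Real.sqrt (h.inner q (A q) (A q)))⁻¹

theorem invNorm_pos {A : (q : N) → Tan 3 q} {q : N} (hA : A q ≠ 0) : 0 < invNorm h A q :=
  inv_pos.2 (Real.sqrt_pos.2 (h.pos q _ hA))

theorem smooth_invNorm {A : (q : N) → Tan 3 q} (hA : SmoothFieldOn A W) (h0 : ∀ q ∈ W, A q ≠ 0) :
    ContMDiffOn (𝓡 3) 𝓘(ℝ, ℝ) ∞ (invNorm h A) W := by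
  have h1 : ContDiffOn ℝ ∞ (fun r : ℝ => (Real.sqrt r)⁻¹) (Set.Ioi 0) := fun r hr =>
    ((Real.contDiffAt_sqrt hr.ne').inv (Real.sqrt_ne_zero'.2 hr)).contDiffWithinAt
  exact h1.contMDiffOn.comp (smooth_inner h hA hA) fun q hq => h.pos q _ (h0 q hq)

theorem inner_invNorm {A : (q : N) → Tan 3 q} {q : N} (hA : A q ≠ 0) :
    h.inner q (invNorm h A q • A q) (invNorm h A q • A q) = 1 := by
  have h1 := h.pos q _ hA
  have h2 := Real.mul_self_sqrt h1.le
  have h3 := (Real.sqrt_pos.2 h1).ne'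
  rw [map_smul, ContinuousLinearMap.map_smul₂, smul_eq_mul, smul_eq_mul, invNorm]
  nth_rewrite 3 [← h2]
  field_simp

theorem inner_project {q : N} {e f : Tan 3 q} (he : h.inner q e e = 1) (a : Tan 3 q) (r : ℝ)
    (hr : r * h.inner q e f = 0) :
    h.inner q e (a + (-h.inner q a e) • e + r • f) = 0 := by
  rw [map_add, map_add, map_smul, map_smul, he, smul_eq_mul, smul_eq_mul, hr, h.symm q e a]
  ring

/-- Gram-Schmidt keeping track of the orientation: between steps the triple is permuted cyclically,
so that the vector to be modified stands first. That e₁ stays along `A` is what allows a frame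
aligned with a gradient. -/
theorem exists_orthonormal_frame {A B C : (q : N) → Tan 3 q} (hA : SmoothFieldOn A W)
    (hB : SmoothFieldOn B W) (hC : SmoothFieldOn C W)
    (hpos : ∀ q ∈ W, IsPositiveBasis (oN.orient q) ![A q, B q, C q]) :
    ∃ e₁ e₂ e₃ : (q : N) → Tan 3 q, SmoothFieldOn e₁ W ∧ SmoothFieldOn e₂ W ∧ SmoothFieldOn e₃ W ∧
      (∀ q ∈ W, IsPosOrthonormal h oN q (e₁ q) (e₂ q) (e₃ q)) ∧
      ∀ q ∈ W, ∃ r : ℝ, A q = r • e₁ q := by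
  have hA0 : ∀ q ∈ W, A q ≠ 0 := fun q hq => (hpos q hq).ne_zero
  set e₁ : (q : N) → Tan 3 q := fun q => invNorm h A q • A q with he₁
  have s1 : SmoothFieldOn e₁ W := hA.mul_left (smooth_invNorm hA hA0)
  have p1 : ∀ q ∈ W, IsPositiveBasis (oN.orient q) ![B q, C q, e₁ q] := by
    intro q hq
    have := (hpos q hq).combination (r := invNorm h A q) (t := 1)
      (by simpa using invNorm_pos (hA0 q hq)) 0 0
    simp only [zero_smul, add_zero, one_smul] at this
    exact this.cycle
  have n1 : ∀ q ∈ W, h.inner q (e₁ q) (e₁ q) = 1 := fun q hq => inner_invNorm (hA0 q hq)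
  set B' : (q : N) → Tan 3 q := fun q => B q + (-h.inner q (B q) (e₁ q)) • e₁ q with hB'
  have sB' : SmoothFieldOn B' W := hB.add (s1.mul_left (smooth_inner h hB s1).neg)
  have pB' : ∀ q ∈ W, IsPositiveBasis (oN.orient q) ![B' q, C q, e₁ q] := by
    intro q hq
    have := (p1 q hq).combination (r := 1) (t := 1) (by norm_num) 0 (-h.inner q (B q) (e₁ q))
    simpa only [zero_smul, add_zero, one_smul] using this
  have hB0 : ∀ q ∈ W, B' q ≠ 0 := fun q hq => (pB' q hq).ne_zero
  have o1 : ∀ q ∈ W, h.inner q (e₁ q) (B' q) = 0 := by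
    intro q hq
    have := inner_project (n1 q hq) (f := e₁ q) (B q) 0 (by rw [zero_mul])
    simpa only [zero_smul, add_zero] using this
  set e₂ : (q : N) → Tan 3 q := fun q => invNorm h B' q • B' q with he₂
  have s2 : SmoothFieldOn e₂ W := sB'.mul_left (smooth_invNorm sB' hB0)
  have n2 : ∀ q ∈ W, h.inner q (e₂ q) (e₂ q) = 1 := fun q hq => inner_invNorm (hB0 q hq)
  have o12 : ∀ q ∈ W, h.inner q (e₁ q) (e₂ q) = 0 := by
    intro q hq
    rw [he₂, map_smul, o1 q hq, smul_zero]
  have p2 : ∀ q ∈ W, IsPositiveBasis (oN.orient q) ![C q, e₁ q, e₂ q] := by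
    intro q hq
    have := (pB' q hq).combination (r := invNorm h B' q) (t := 1)
      (by simpa using invNorm_pos (hB0 q hq)) 0 0
    simp only [zero_smul, add_zero, one_smul] at this
    exact this.cycle
  set C' : (q : N) → Tan 3 q := fun q => C q + (-h.inner q (C q) (e₁ q)) • e₁ q
    + (-h.inner q (C q) (e₂ q)) • e₂ q with hC'
  have sC' : SmoothFieldOn C' W :=
    (hC.add (s1.mul_left (smooth_inner h hC s1).neg)).add (s2.mul_left (smooth_inner h hC s2).neg)
  have pC' : ∀ q ∈ W, IsPositiveBasis (oN.orient q) ![C' q, e₁ q, e₂ q] := by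
    intro q hq
    have := (p2 q hq).combination (r := 1) (t := 1) (by norm_num) (-h.inner q (C q) (e₁ q))
      (-h.inner q (C q) (e₂ q))
    simpa only [one_smul] using this
  have hC0 : ∀ q ∈ W, C' q ≠ 0 := fun q hq => (pC' q hq).ne_zero
  set e₃ : (q : N) → Tan 3 q := fun q => invNorm h C' q • C' q with he₃
  have o13 : ∀ q ∈ W, h.inner q (e₁ q) (e₃ q) = 0 := by
    intro q hq
    have := inner_project (n1 q hq) (f := e₂ q) (C q) (-h.inner q (C q) (e₂ q))
      (by rw [o12 q hq, mul_zero])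
    rw [he₃, map_smul, this, smul_zero]
  have o23 : ∀ q ∈ W, h.inner q (e₂ q) (e₃ q) = 0 := by
    intro q hq
    have := inner_project (n2 q hq) (f := e₁ q) (C q) (-h.inner q (C q) (e₁ q))
      (by rw [h.symm q (e₂ q), o12 q hq, mul_zero])
    rw [add_right_comm] at this
    rw [he₃, map_smul, this, smul_zero]
  refine ⟨e₁, e₂, e₃, s1, s2, sC'.mul_left (smooth_invNorm sC' hC0), fun q hq =>
    ⟨n1 q hq, n2 q hq, inner_invNorm (hC0 q hq), o12 q hq, o13 q hq, o23 q hq, ?_⟩,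
    fun q hq => ⟨(invNorm h A q)⁻¹, ?_⟩⟩
  · have := (pC' q hq).combination (r := invNorm h C' q) (t := 1)
      (by simpa using invNorm_pos (hC0 q hq)) 0 0
    simp only [zero_smul, add_zero, one_smul] at this
    exact this.cycle
  · rw [he₁, smul_smul, inv_mul_cancel₀ (invNorm_pos (hA0 q hq)).ne', one_smul]

end GramSchmidt

/-! ### Horizontal lifts -/

section HorizontalLift

open Filter

variable {M : Type*} [TopologicalSpace M] [ChartedSpace (Rn 4) M] [IsManifold (𝓡 4) ∞ M]
  {N : Type*} [TopologicalSpace N] [ChartedSpace (Rn 3) N] [IsManifold (𝓡 3) ∞ N]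
  {g : RMetric 4 M} {h : RMetric 3 N} {oM : ManifoldOrientation 4 M}
  {oN : ManifoldOrientation 3 N} {φ : M → N} {V : (x : M) → Tan 4 x} {W : Set N}

namespace IsTwistorSetting

theorem inner_lift (hs : IsTwistorSetting g h oM oN φ V) {p : M} {a : Tan 4 p}
    (ha : IsHorizontal g φ p a) (w : Tan 4 p) :
    g.inner p a w = dilInvSq g h φ p * h.inner (φ p) (dφ φ p a) (dφ φ p w) := by
  obtain ⟨w', hw', hww⟩ := hs.exists_horizontal_lift p (dφ φ p w)
  have h1 : g.inner p a (w - w') = 0 := ha _ (by rw [IsVertical, map_sub, hww, sub_self])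
  rw [map_sub, sub_eq_zero] at h1
  rw [h1, hs.inner_horizontal ha hw', hww]

/-- The lift is λ⁻² times the adjoint of dφ applied to `e`, by the conformality identity g(X,w) =
λ⁻² h(e, dφ(w)). In coordinates this formula is visibly smooth. -/
theorem smooth_horizontalLift (hs : IsTwistorSetting g h oM oN φ V) (hW : IsOpen W)
    {e : (q : N) → Tan 3 q} (he : SmoothFieldOn e W) {X : (p : M) → Tan 4 p}
    (hX : ∀ p, IsHorizontal g φ p (X p)) (hp : ∀ p, dφ φ p (X p) = e (φ p)) :
    SmoothFieldOn X (φ ⁻¹' W) := by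
  intro q hq
  have hU : IsOpen (φ ⁻¹' W) := hW.preimage hs.smooth.continuous
  set s := dom φ (φ ⁻¹' W) q (φ q) with hs'
  have ho : IsOpen s := hs.isOpen_dom hU q (φ q)
  set G := chartMetric g q
  set H := chartMetric h (φ q)
  set Φ := chartMap (n := 4) (m := 3) φ q (φ q)
  have hΦc : ∀ p ∈ (chart 4 q).source, Φ (chart 4 q p) = chart 3 (φ q) (φ p) := fun p hp =>
    chartMap_chart φ (φ q) hp
  have hG : IsMetricOn G s := (isMetricOn_chartMetric g q).mono ho Set.inter_subset_left
  have hΦ : ContDiffOn ℝ ∞ Φ s :=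
    (smoothOn_chartMap hs.smooth q (φ q)).mono fun y hy => ⟨hy.1, hy.2.2⟩
  have hm : Set.MapsTo Φ s (dom' W (φ q)) := by
    intro y hy
    obtain ⟨p, hp, hpU, hp', rfl⟩ := exists_of_mem_dom hy
    rw [hΦc p hp]
    refine ⟨(chart 3 (φ q)).map_source hp', ?_⟩
    rw [Set.mem_preimage, (chart 3 (φ q)).left_inv hp']
    exact hpU
  have h1 : ContDiffOn ℝ ∞ (fun y => H (Φ y) (chartField e (φ q) (Φ y))) s :=
    (((isMetricOn_chartMetric h (φ q)).smooth.mono Set.inter_subset_left).clm_apply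
      (smoothOn_chartField hW he (φ q))).comp hΦ hm
  have h2 : ContDiffOn ℝ ∞ (fun y => gradLift G H Φ y (chartField e (φ q) (Φ y))) s :=
    hG.smooth_inverse.clm_apply (h1.clm_comp (hΦ.fderiv_of_isOpen ho (by simp)))
  have h3 := smoothFieldOn_coordInv q (((hs.smoothOn_u q).mono Set.inter_subset_left).smul h2) ho
  have h4 : ∀ p ∈ (chart 4 q).source ∩ chart 4 q ⁻¹' s, X p = coordInv q p
      ((dilInvSq g h φ ∘ (chart 4 q).symm) (chart 4 q p) •
        gradLift G H Φ (chart 4 q p) (chartField e (φ q) (Φ (chart 4 q p)))) := by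
    rintro p ⟨hp1, hp2⟩
    obtain ⟨p', hp', hpU, hpφ, hpp'⟩ := exists_of_mem_dom hp2
    obtain rfl : p' = p := (chart 4 q).injOn hp' hp1 hpp'
    refine coord_injective hp1 ?_
    rw [coord_coordInv hp1]
    refine hG.ext_of_apply hp2 fun w => ?_
    obtain ⟨b, rfl⟩ := coord_surjective hp1 w
    rw [map_smul, smul_apply, apply_gradLift hG hp2, hs.fderiv_chart hp1 hpφ,
      hΦc p' hp1, chartField_chart e hpφ, chartMetric_chart h hpφ,
      chartMetric_chart g hp1, hs.inner_lift (hX p'), hp, Function.comp_apply,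
      (chart 4 q).left_inv hp1, smul_eq_mul]
  have h5 : (chart 4 q).source ∩ chart 4 q ⁻¹' s ∈ 𝓝 q :=
    ((continuousOn_extChartAt q).isOpen_inter_preimage (isOpen_chart_source q) ho).mem_nhds
      ⟨mem_extChartAt_source q, mem_dom (mem_extChartAt_source q) hq (mem_extChartAt_source _)⟩
  have h6 : ContMDiffOn (𝓡 4) (𝓡 4).tangent ∞ (fun x => (⟨x, X x⟩ : TangentBundle (𝓡 4) M))
      ((chart 4 q).source ∩ chart 4 q ⁻¹' s) :=
    ContMDiffOn.congr h3 fun p hp => by rw [h4 p hp]; rfl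
  exact (h6.contMDiffAt h5).contMDiffWithinAt

theorem exists_basicFrame (hs : IsTwistorSetting g h oM oN φ V) (hW : IsOpen W)
    {e : Fin 3 → (q : N) → Tan 3 q} (he : ∀ i, SmoothFieldOn (e i) W)
    (ho : ∀ q ∈ W, IsPosOrthonormal h oN q (e 0 q) (e 1 q) (e 2 q)) :
    ∃ X : Fin 3 → (p : M) → Tan 4 p, BasicFrame g h oN φ (φ ⁻¹' W) W X e := by
  choose X hX hp using fun i p => hs.exists_horizontal_lift p (e i (φ p))
  exact ⟨X, hW.preimage hs.smooth.continuous, hW, Set.mapsTo_preimage φ W,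
    fun i => hs.smooth_horizontalLift hW (he i) (hX i) (hp i), he, fun p _ i => hX i p,
    fun p _ i => hp i p, ho⟩

end IsTwistorSetting

end HorizontalLift

/-! ### Basic functions descend -/

section Descent

open Filter

variable {G : Rn 4 → (Rn 4 →L[ℝ] Rn 4 →L[ℝ] ℝ)} {s : Set (Rn 4)}
    {H : Rn 3 → (Rn 3 →L[ℝ] Rn 3 →L[ℝ] ℝ)} {t : Set (Rn 3)} {Φ : Rn 4 → Rn 3}
    {v : Rn 4 → Rn 4} {u : Rn 4 → ℝ} {e : Fin 3 → Rn 3 → Rn 3} {X : Fin 3 → Rn 4 → Rn 4}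

theorem LiftedFrame.eq_smul_of_fderiv_eq_zero (h : LiftedFrame G s H t Φ v u e X) {y : Rn 4}
    (hy : y ∈ s) {a : Rn 4} (ha : fderiv ℝ Φ y a = 0) : a = (u y * G y (v y) a) • v y := by
  have := h.decomp hy a
  simpa [ha] using this

/-- Completing Φ by one function transverse to the fibres gives local coordinates. On a product of
balls the fibres of Φ are connected curves tangent to `v`, along which `r` is constant. -/
theorem LiftedFrame.descend (h : LiftedFrame G s H t Φ v u e X) {y₀ : Rn 4} (hy₀ : y₀ ∈ s)
    {r : Rn 4 → Fin 3 → ℝ} (hr : ContDiffOn ℝ ∞ r s) (hrv : ∀ y ∈ s, fderiv ℝ r y (v y) = 0) :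
    ∃ (O : Set (Rn 4)) (O' : Set (Rn 3)) (r' : Rn 3 → Fin 3 → ℝ), IsOpen O ∧ IsOpen O' ∧
      y₀ ∈ O ∧ Set.MapsTo Φ O O' ∧ ContDiffOn ℝ ∞ r' O' ∧ ∀ y ∈ O, r y = r' (Φ y) := by
  have ho := h.metric.isOpen
  -- A linear function with nonzero derivative along `v` at the base point, hence on a neighbourhood
  -- of it.
  set l : Rn 4 →L[ℝ] ℝ := G y₀ (v y₀) with hl
  set Ψ : Rn 4 → Rn 3 × ℝ := fun y => (Φ y, l y) with hΨ
  set s₁ : Set (Rn 4) := s ∩ (fun y => l (v y)) ⁻¹' {0}ᶜ with hs₁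
  have hlv : ContDiffOn ℝ ∞ (fun y => l (v y)) s := l.contDiff.comp_contDiffOn h.smooth_v
  have ho₁ : IsOpen s₁ := hlv.continuousOn.isOpen_inter_preimage ho isOpen_compl_singleton
  have hy₁ : y₀ ∈ s₁ := by
    refine ⟨hy₀, ?_⟩
    change G y₀ (v y₀) (v y₀) ≠ 0
    rw [h.norm_v y₀ hy₀]
    exact inv_ne_zero (h.pos y₀ hy₀).ne'
  have hΨs : ∀ y ∈ s₁, ContDiffAt ℝ ∞ Ψ y := fun y hy =>
    (h.smooth_map.contDiffAt (ho.mem_nhds hy.1)).prodMk l.contDiff.contDiffAt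
  have hinv : ∀ y ∈ s₁, ∃ D : Rn 4 ≃L[ℝ] Rn 3 × ℝ, HasFDerivAt Ψ (D : Rn 4 →L[ℝ] Rn 3 × ℝ) y := by
    intro y hy
    have hd := (differentiableAt_of_smoothOn ho h.smooth_map hy.1).hasFDerivAt.prodMk
      (l.hasFDerivAt (x := y))
    have hinj : Function.Injective ((fderiv ℝ Φ y).prod l) := by
      rw [injective_iff_map_eq_zero]
      intro a ha
      rw [ContinuousLinearMap.prod_apply, Prod.mk_eq_zero] at ha
      have h1 := h.eq_smul_of_fderiv_eq_zero hy.1 ha.1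
      have h2 := ha.2
      rw [h1, map_smul, smul_eq_mul, mul_eq_zero] at h2
      rw [h1, h2.resolve_right hy.2, zero_smul]
    have hfin : Module.finrank ℝ (Rn 4) = Module.finrank ℝ (Rn 3 × ℝ) := by simp
    let D := LinearEquiv.ofInjectiveOfFinrankEq (((fderiv ℝ Φ y).prod l : Rn 4 →L[ℝ] Rn 3 × ℝ) :
      Rn 4 →ₗ[ℝ] Rn 3 × ℝ) hinj hfin
    refine ⟨D.toContinuousLinearEquiv, ?_⟩
    have hD : ((D.toContinuousLinearEquiv : Rn 4 ≃L[ℝ] Rn 3 × ℝ) : Rn 4 →L[ℝ] Rn 3 × ℝ)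
        = (fderiv ℝ Φ y).prod l := ContinuousLinearMap.ext fun a => rfl
    rw [hD]
    exact hd
  obtain ⟨D₀, hD₀⟩ := hinv y₀ hy₁
  set P := (hΨs y₀ hy₁).toOpenPartialHomeomorph Ψ hD₀ (by simp) with hP
  have hPc : (P : Rn 4 → Rn 3 × ℝ) = Ψ := rfl
  have hP₀ : y₀ ∈ P.source := (hΨs y₀ hy₁).mem_toOpenPartialHomeomorph_source hD₀ (by simp)
  set T := P.target ∩ P.symm ⁻¹' s₁ with hT
  have hTo : IsOpen T := P.isOpen_inter_preimage_symm ho₁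
  have hT₀ : (Φ y₀, l y₀) ∈ T := by
    refine ⟨P.map_source hP₀, ?_⟩
    change P.symm (P y₀) ∈ s₁
    rwa [P.left_inv hP₀]
  obtain ⟨ε, hε, hball⟩ := Metric.isOpen_iff.1 hTo _ hT₀
  rw [← ball_prod_same] at hball
  have hsymm : ContDiffOn ℝ ∞ P.symm T := by
    intro z hz
    obtain ⟨D, hD⟩ := hinv _ hz.2
    exact (P.contDiffAt_symm hz.1 hD (hΨs _ hz.2)).contDiffWithinAt
  have hrT : ContDiffOn ℝ ∞ (r ∘ P.symm) T := hr.comp hsymm fun z hz => hz.2.1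
  have hconst : ∀ z ∈ Metric.ball (Φ y₀) ε, ∀ τ ∈ Metric.ball (l y₀) ε,
      r (P.symm (z, τ)) = r (P.symm (z, l y₀)) := by
    intro z hz τ hτ
    have hmem : ∀ τ ∈ Metric.ball (l y₀) ε, (z, τ) ∈ T := fun τ hτ => hball ⟨hz, hτ⟩
    -- Moving in the last coordinate leaves Φ fixed, so the velocity is a multiple of `v` and the
    -- derivative of `r` along it is zero.
    have hder : ∀ τ ∈ Metric.ball (l y₀) ε, HasDerivAt (fun τ => r (P.symm (z, τ))) 0 τ := by
      intro τ hτ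
      have hzT := hmem τ hτ
      have h1 : HasDerivAt (fun τ : ℝ => (z, τ)) ((0 : Rn 3), (1 : ℝ)) τ :=
        (hasDerivAt_const τ z).prodMk (hasDerivAt_id τ)
      have h2 := (differentiableAt_of_smoothOn hTo hsymm hzT).hasFDerivAt.comp_hasDerivAt τ h1
      set a := fderiv ℝ P.symm (z, τ) ((0 : Rn 3), (1 : ℝ)) with ha
      have hys := hzT.2.1
      have h3 := (differentiableAt_of_smoothOn ho h.smooth_map hys).hasFDerivAt.comp_hasDerivAt τ h2
      have h4 : (Φ ∘ (P.symm ∘ fun τ : ℝ => (z, τ))) =ᶠ[𝓝 τ] fun _ => z := by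
        filter_upwards [Metric.isOpen_ball.mem_nhds hτ] with τ' hτ'
        exact congrArg Prod.fst (P.right_inv (hmem τ' hτ').1)
      have h5 := h3.unique ((hasDerivAt_const τ z).congr_of_eventuallyEq h4)
      have h6 := h.eq_smul_of_fderiv_eq_zero hys h5
      have h7 := (differentiableAt_of_smoothOn ho hr hys).hasFDerivAt.comp_hasDerivAt τ h2
      rw [h6, map_smul, hrv _ hys, smul_zero] at h7
      exact h7
    refine Metric.isOpen_ball.is_const_of_deriv_eq_zero (convex_ball _ _).isPreconnected
      (fun τ hτ => (hder τ hτ).differentiableAt.differentiableWithinAt)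
      (fun τ hτ => (hder τ hτ).deriv) hτ (Metric.mem_ball_self hε)
  refine ⟨P.source ∩ Ψ ⁻¹' (Metric.ball (Φ y₀) ε ×ˢ Metric.ball (l y₀) ε),
    Metric.ball (Φ y₀) ε, fun z => r (P.symm (z, l y₀)), ?_, Metric.isOpen_ball, ?_, ?_, ?_, ?_⟩
  · exact P.isOpen_inter_preimage (Metric.isOpen_ball.prod Metric.isOpen_ball)
  · exact ⟨hP₀, Metric.mem_ball_self hε, Metric.mem_ball_self hε⟩
  · exact fun y hy => hy.2.1
  · exact hrT.comp (contDiffOn_id.prodMk contDiffOn_const) fun z hz =>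
      hball ⟨hz, Metric.mem_ball_self hε⟩
  · rintro y ⟨hy, hy1, hy2⟩
    simp only
    rw [← hconst (Φ y) hy1 (l y) hy2]
    exact congrArg r (P.left_inv hy).symm

end Descent

/-! ### Existence of adapted frames -/

section AdaptedFrames

open Filter

variable {M : Type*} [TopologicalSpace M] [ChartedSpace (Rn 4) M] [IsManifold (𝓡 4) ∞ M]
  {N : Type*} [TopologicalSpace N] [ChartedSpace (Rn 3) N] [IsManifold (𝓡 3) ∞ N]
  {g : RMetric 4 M} {h : RMetric 3 N} {oM : ManifoldOrientation 4 M}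
  {oN : ManifoldOrientation 3 N} {φ : M → N} {V : (x : M) → Tan 4 x}
  {U : Set M} {W : Set N} {X : Fin 3 → (p : M) → Tan 4 p} {e : Fin 3 → (q : N) → Tan 3 q}

theorem BasicFrame.mono (hB : BasicFrame g h oN φ U W X e) {U' : Set M} (hU' : IsOpen U')
    (hUU : U' ⊆ U) : BasicFrame g h oN φ U' W X e where
  isOpen := hU'
  isOpen' := hB.isOpen'
  maps := fun _ hp => hB.maps (hUU hp)
  smooth_X := fun i => (hB.smooth_X i).mono hUU
  smooth_e := hB.smooth_e
  horizontal := fun p hp => hB.horizontal p (hUU hp)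
  proj := fun p hp => hB.proj p (hUU hp)
  orthonormal := hB.orthonormal

theorem exists_orthonormal_frame_near (h : RMetric 3 N) (oN : ManifoldOrientation 3 N) (q : N) :
    ∃ (W : Set N) (b : Fin 3 → (q : N) → Tan 3 q), IsOpen W ∧ q ∈ W ∧
      (∀ i, SmoothFieldOn (b i) W) ∧
      ∀ n ∈ W, IsPosOrthonormal h oN n (b 0 n) (b 1 n) (b 2 n) := by
  obtain ⟨W, hW, hq, e, he, hpos⟩ := oN.exists_positive_frame q
  obtain ⟨e₁, e₂, e₃, h1, h2, h3, ho, -⟩ := exists_orthonormal_frame (h := h) (oN := oN)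
    (he 0) (he 1) (he 2) fun n hn => by
      have : (fun i => e i n) = ![e 0 n, e 1 n, e 2 n] := by
        funext i
        fin_cases i <;> rfl
      rw [← this]
      exact hpos n hn
  refine ⟨W, ![e₁, e₂, e₃], hW, hq, ?_, ho⟩
  intro i
  fin_cases i
  exacts [h1, h2, h3]

namespace IsTwistorSetting

/-- By the monopole equation Ω(Z,X) = Y(u) and Ω(Z,Y) = -X(u), while Ω(Z,V) = 0 always; so ι_Z Ω = 0
once X and Y kill u. -/
theorem isAdaptedFrame_of_basicFrame (hs : IsTwistorSetting g h oM oN φ V)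
    (hB : BasicFrame g h oN φ U W X e)
    (h0 : ∀ p ∈ U, mvfderiv (𝓡 4) (dilInvSq g h φ) p (X 0 p) = 0)
    (h1 : ∀ p ∈ U, mvfderiv (𝓡 4) (dilInvSq g h φ) p (X 1 p) = 0) :
    IsAdaptedFrame g h oN φ V U (X 0) (X 1) (X 2) where
  isOpen := hB.isOpen
  smooth_X := hB.smooth_X 0
  smooth_Y := hB.smooth_X 1
  smooth_Z := hB.smooth_X 2
  horizontal_X := fun p hp => hB.horizontal p hp 0
  horizontal_Y := fun p hp => hB.horizontal p hp 1
  horizontal_Z := fun p hp => hB.horizontal p hp 2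
  projectable := ⟨W, e 0, e 1, e 2, hB.isOpen', hB.maps, hB.smooth_e 0, hB.smooth_e 1,
    hB.smooth_e 2, hB.orthonormal, fun p hp => ⟨hB.proj p hp 0, hB.proj p hp 1, hB.proj p hp 2⟩⟩
  omega_Z := by
    intro p hp w
    have hV : Omega g h φ V p (X 2 p) (V p) = 0 := by
      rw [hs.Omega_swap, hs.Omega_V hB hp, neg_zero]
    have hX0 : Omega g h φ V p (X 2 p) (X 0 p) = 0 := by
      rw [hs.Omega_frame hB hp]
      exact h1 p hp
    have hX1 : Omega g h φ V p (X 2 p) (X 1 p) = 0 := by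
      rw [hs.Omega_frame hB hp]
      change -mvfderiv (𝓡 4) (dilInvSq g h φ) p (X 0 p) = 0
      rw [h0 p hp, neg_zero]
    have hX2 : Omega g h φ V p (X 2 p) (X 2 p) = 0 := by
      have := hs.Omega_swap p (X 2 p) (X 2 p)
      linarith
    obtain ⟨r, c, rfl⟩ := hs.exists_coeff hB hp w
    rw [hs.Omega_eq (mem_extChartAt_source p)] at hV hX0 hX1 hX2 ⊢
    simp only [map_add, map_sum, map_smul, add_apply, sum_apply, smul_apply, smul_eq_mul,
      Fin.sum_univ_three]
    linear_combination r * hV + c 0 * hX0 + c 1 * hX1 + c 2 * hX2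

/-- The horizontal gradient of `λ⁻²` is basic. -/
theorem exists_gradient (hs : IsTwistorSetting g h oM oN φ V)
    (hB : BasicFrame g h oN φ (φ ⁻¹' W) W X e) {q : M} (hq : φ q ∈ W) :
    ∃ (U : Set M) (W' : Set N) (ρ : Fin 3 → N → ℝ), IsOpen U ∧ IsOpen W' ∧ q ∈ U ∧
      W' ⊆ W ∧ Set.MapsTo φ U W' ∧ (∀ k, ContMDiffOn (𝓡 3) 𝓘(ℝ, ℝ) ∞ (ρ k) W') ∧
      (∀ p ∈ U, ∀ k, mvfderiv (𝓡 4) (dilInvSq g h φ) p (X k p) = ρ k (φ p)) ∧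
      ∃ i, ρ i (φ q) ≠ 0 := by
  have hqq := mem_extChartAt_source (I := 𝓡 4) q
  have T := hs.twistorFrame hB q (φ q)
  have hy : chart 4 q q ∈ dom φ (φ ⁻¹' W) q (φ q) := mem_dom_self φ hq
  have ho := hs.isOpen_dom hB.isOpen q (φ q)
  obtain ⟨O, O', r', hO, hO', hyO, hm, hr', hrr'⟩ := T.toLiftedFrame.descend hy
    (r := fun y k => fderiv ℝ (dilInvSq g h φ ∘ (chart 4 q).symm) y (chartField (X k) q y))
    -- The three functions X_k(u) are constant along V, so they descend together.
    (contDiffOn_pi.2 fun k => TwistorFrame.smooth_du T.toLiftedFrame k) fun y hy => by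
      ext k
      rw [fderiv_pi fun k => differentiableAt_of_smoothOn ho
        (TwistorFrame.smooth_du T.toLiftedFrame k) hy]
      exact T.fderiv_du_v hy k
  set U₁ : Set M := (chart 4 q).source ∩ chart 4 q ⁻¹' (O ∩ dom φ (φ ⁻¹' W) q (φ q)) with hU₁
  set W₁ : Set N := W ∩ ((chart 3 (φ q)).source ∩ chart 3 (φ q) ⁻¹' O') with hW₁
  have hdu : ∀ p ∈ U₁, ∀ k, mvfderiv (𝓡 4) (dilInvSq g h φ) p (X k p)
      = r' (chart 3 (φ q) (φ p)) k := by
    rintro p ⟨hp, hpO, hpd⟩ k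
    have h1 := congrFun (hrr' _ hpO) k
    rw [chartMap_chart φ _ hp, chartField_chart _ hp, ← hs.mvfderiv_dilInvSq hp] at h1
    exact h1
  have hqU : q ∈ U₁ := ⟨hqq, hyO, hy⟩
  refine ⟨U₁, W₁, fun k n => r' (chart 3 (φ q) n) k,
    (continuousOn_extChartAt q).isOpen_inter_preimage (isOpen_chart_source q) (hO.inter ho),
    hB.isOpen'.inter ((continuousOn_extChartAt (φ q)).isOpen_inter_preimage
      (isOpen_chart_source _) hO'), hqU, Set.inter_subset_left, ?_, fun k => ?_, hdu, ?_⟩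
  · rintro p ⟨hp, hpO, hpd⟩
    obtain ⟨p', hp1, hpW, hpφ, hpp'⟩ := exists_of_mem_dom hpd
    obtain rfl : p' = p := (chart 4 q).injOn hp1 hp hpp'
    refine ⟨hpW, hpφ, ?_⟩
    have := hm hpO
    rwa [chartMap_chart φ _ hp] at this
  · exact (contDiffOn_pi.1 hr' k).contMDiffOn.comp ((smooth_chart (φ q)).mono
      fun n hn => hn.2.1) fun n hn => hn.2.2
  · obtain ⟨i, hi⟩ := T.nonzero _ hy
    refine ⟨i, ?_⟩
    rw [chartField_chart _ hqq, ← hs.mvfderiv_dilInvSq hqq, hdu q hqU] at hi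
    exact hi

/-- The horizontal gradient of u projects to a nowhere zero field near the point. A positive
orthonormal frame on N with one vector along it lifts to a frame whose other two vectors kill u; the
aligned vector becomes Z. -/
theorem exists_adaptedFrame (hs : IsTwistorSetting g h oM oN φ V) (q : M) :
    ∃ (U : Set M) (X Y Z : (p : M) → Tan 4 p), q ∈ U ∧ IsAdaptedFrame g h oN φ V U X Y Z := by
  obtain ⟨W₀, b, hW₀, hqW₀, hb, hob⟩ := exists_orthonormal_frame_near h oN (φ q)
  obtain ⟨B, hB⟩ := hs.exists_basicFrame hW₀ hb hob
  obtain ⟨U₁, W₁, ρ, hU₁, hW₁, hqU₁, hWW, hm, hρ, hdu, i, hi⟩ := hs.exists_gradient hB hqW₀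
  have hpos : ∀ i, ∀ n ∈ W₀, IsPositiveBasis (oN.orient n) ![b i n, b (i + 1) n, b (i + 2) n] := by
    intro i n hn
    have h1 : IsPositiveBasis (oN.orient n) ![b 0 n, b 1 n, b 2 n] := (hob n hn).2.2.2.2.2.2
    fin_cases i
    exacts [h1, h1.cycle, h1.cycle.cycle]
  -- On this set ρ_i keeps the sign it has at φ(q), where i is an index with ρ_i nonzero there.
  set W₂ : Set N := W₁ ∩ (fun n => ρ i n * ρ i (φ q)) ⁻¹' Set.Ioi 0 with hW₂
  have hW₂o : IsOpen W₂ := ((hρ i).continuousOn.mul continuousOn_const).isOpen_inter_preimage hW₁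
    isOpen_Ioi
  have hqW₂ : φ q ∈ W₂ := ⟨hm hqU₁, mul_self_pos.2 hi⟩
  have hb₂ : ∀ i, SmoothFieldOn (b i) W₂ := fun i => (hb i).mono fun n hn => hWW hn.1
  have hρ₂ : ∀ i, ContMDiffOn (𝓡 3) 𝓘(ℝ, ℝ) ∞ (ρ i) W₂ := fun i => (hρ i).mono fun n hn => hn.1
  -- The first vector is the gradient, replacing b_i; the third is multiplied by the constant
  -- ρ_i(φ(q)), so that the determinant ρ_i(n) ρ_i(φ(q)) is positive whatever the sign of ρ_i.
  obtain ⟨e₁, e₂, e₃, s1, s2, s3, ho, hA⟩ := exists_orthonormal_frame (h := h) (oN := oN)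
    (((hb₂ i).mul_left (hρ₂ i)).add ((hb₂ (i + 1)).mul_left (hρ₂ (i + 1))) |>.add
      ((hb₂ (i + 2)).mul_left (hρ₂ (i + 2)))) (hb₂ (i + 1))
    ((hb₂ (i + 2)).mul_left (contMDiffOn_const (c := ρ i (φ q)))) fun n hn =>
      (hpos i n (hWW hn.1)).combination hn.2 _ _
  -- Cycling the frame puts the gradient direction e₁ in third place and preserves the orientation.
  obtain ⟨X, hX⟩ := hs.exists_basicFrame (oN := oN) hW₂o (e := ![e₂, e₃, e₁])
    (fun i => by fin_cases i; exacts [s2, s3, s1]) fun n hn => (ho n hn).cycle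
  have hX' := hX.mono (hX.isOpen.inter hU₁) Set.inter_subset_left
  -- A horizontal vector whose projection is orthogonal to e₁ is orthogonal to the gradient, so it
  -- kills u.
  have hgrad : ∀ p ∈ φ ⁻¹' W₂ ∩ U₁, ∀ a : Tan 4 p, IsHorizontal g φ p a →
      h.inner (φ p) (e₁ (φ p)) (dφ φ p a) = 0 → mvfderiv (𝓡 4) (dilInvSq g h φ) p a = 0 := by
    rintro p ⟨hp, hpU⟩ a ha hea
    have hpW : p ∈ φ ⁻¹' W₀ := hWW hp.1
    obtain ⟨r, hr⟩ := hA _ hp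
    obtain ⟨c, rfl⟩ := hs.exists_coeff_horizontal hB hpW ha
    have h1 : h.inner (φ p) (ρ i (φ p) • b i (φ p) + ρ (i + 1) (φ p) • b (i + 1) (φ p)
        + ρ (i + 2) (φ p) • b (i + 2) (φ p)) (dφ φ p (∑ k, c k • B k p)) = 0 := by
      rw [hr, ContinuousLinearMap.map_smul₂, hea, smul_zero]
    rw [map_sum] at h1 ⊢
    simp only [map_smul, hdu p hpU, hB.proj p hpW, map_add, map_sum, add_apply, smul_apply,
      (hob _ hpW).inner_eq (e := fun i => b i (φ p)), smul_eq_mul] at h1 ⊢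
    rw [← h1]
    fin_cases i <;> simp [Fin.sum_univ_three]
  refine ⟨φ ⁻¹' W₂ ∩ U₁, X 0, X 1, X 2, ⟨hqW₂, hqU₁⟩, hs.isAdaptedFrame_of_basicFrame hX'
    (fun p hp => hgrad p hp _ (hX.horizontal p hp.1 0) ?_)
    (fun p hp => hgrad p hp _ (hX.horizontal p hp.1 1) ?_)⟩
  · rw [hX.proj p hp.1]
    exact (ho _ hp.1).2.2.2.1
  · rw [hX.proj p hp.1]
    exact (ho _ hp.1).2.2.2.2.1

theorem exists_adaptedFrame_components (hs : IsTwistorSetting g h oM oN φ V)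
    {F : (p : M) → Tan 4 p} (hF : ∀ p, IsHorizontal g φ p (F p)) (q : M) :
    ∃ (U : Set M) (X Y Z : (p : M) → Tan 4 p) (x y z : M → ℝ), q ∈ U ∧
      IsAdaptedFrame g h oN φ V U X Y Z ∧ ∀ p ∈ U, F p = x p • X p + y p • Y p + z p • Z p := by
  obtain ⟨U, X, Y, Z, hq, hA⟩ := hs.exists_adaptedFrame q
  obtain ⟨W, e, hB⟩ := hA.exists_basicFrame
  have hc : ∀ p, ∃ c : Fin 3 → ℝ, p ∈ U → F p = c 0 • X p + c 1 • Y p + c 2 • Z p := by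
    intro p
    by_cases hp : p ∈ U
    · obtain ⟨c, hc⟩ := hs.exists_coeff_horizontal hB hp (hF p)
      rw [Fin.sum_univ_three] at hc
      exact ⟨c, fun _ => hc⟩
    · exact ⟨0, fun hp' => (hp hp').elim⟩
  choose c hc using hc
  exact ⟨U, X, Y, Z, fun p => c p 0, fun p => c p 1, fun p => c p 2, hq, hA, hc⟩

end IsTwistorSetting

end AdaptedFrames

end SolitonFlow

end

theorem proposition2p1
    {M : Type*} [TopologicalSpace M] [T2Space M] [SecondCountableTopology M]
    [ChartedSpace (SolitonFlow.Rn 4) M] [IsManifold (𝓡 4) ∞ M]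
    {N : Type*} [TopologicalSpace N] [T2Space N] [SecondCountableTopology N]
    [ChartedSpace (SolitonFlow.Rn 3) N] [IsManifold (𝓡 3) ∞ N]
    (g : SolitonFlow.RMetric 4 M) (h : SolitonFlow.RMetric 3 N)
    (oM : SolitonFlow.ManifoldOrientation 4 M) (oN : SolitonFlow.ManifoldOrientation 3 N)
    (φ : M → N) (hφ : ContMDiff (𝓡 4) (𝓡 3) ∞ φ)
    (hsub : ∀ x, Function.Surjective (SolitonFlow.dφ φ x))
    (hharm : SolitonFlow.IsHarmonicMorphism g h φ)
    (V : (x : M) → SolitonFlow.Tan 4 x)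
    (hV : SolitonFlow.IsFundamentalField g h oM oN φ V)
    (htw : SolitonFlow.IsTwistorial g h oN φ V)
    (hΩ : ∀ x, ∃ v w, SolitonFlow.Omega g h φ V x v w ≠ 0)
    (E : (x : M) → SolitonFlow.Tan 4 x) (hE : SolitonFlow.SmoothFieldOn E Set.univ)
    (f : M → ℝ) (F : (x : M) → SolitonFlow.Tan 4 x)
    (hF : ∀ x, SolitonFlow.IsHorizontal g φ x (F x))
    (hEF : ∀ x, E x = f x • V x + F x)
    (a : ℝ) :
    (SolitonFlow.IsSolitonFlow g E a ↔
      ∀ (U : Set M) (X Y Z : (x : M) → SolitonFlow.Tan 4 x) (x y z : M → ℝ),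
        SolitonFlow.IsAdaptedFrame g h oN φ V U X Y Z →
        (∀ p ∈ U, F p = x p • X p + y p • Y p + z p • Z p) →
        ∀ p ∈ U, SolitonFlow.FiveRelations g h φ V f F a X Y Z x y z p) ∧
    (SolitonFlow.IsSolitonFlow g E a ↔
      ∀ q : M, ∃ (U : Set M) (X Y Z : (x : M) → SolitonFlow.Tan 4 x) (x y z : M → ℝ),
        q ∈ U ∧ SolitonFlow.IsAdaptedFrame g h oN φ V U X Y Z ∧
        (∀ p ∈ U, F p = x p • X p + y p • Y p + z p • Z p) ∧
        ∀ p ∈ U, SolitonFlow.FiveRelations g h φ V f F a X Y Z x y z p) := by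
  have hs : SolitonFlow.IsTwistorSetting g h oM oN φ V := ⟨⟨hφ, hsub, hharm⟩, hV, htw, hΩ⟩
  refine ⟨⟨fun hsol U X Y Z x y z hA hx p hp =>
      (hs.soliton_iff_fiveRelations hA hE hF hEF hx hp a).1 (hsol p), fun hall q => ?_⟩,
    ⟨fun hsol q => ?_, fun hex q => ?_⟩⟩
  -- A hypothesis on all adapted frames says something at q only because an adapted frame around q
  -- exists.
  · obtain ⟨U, X, Y, Z, x, y, z, hq, hA, hx⟩ := hs.exists_adaptedFrame_components hF q
    exact (hs.soliton_iff_fiveRelations hA hE hF hEF hx hq a).2 (hall U X Y Z x y z hA hx q hq)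
  · obtain ⟨U, X, Y, Z, x, y, z, hq, hA, hx⟩ := hs.exists_adaptedFrame_components hF q
    exact ⟨U, X, Y, Z, x, y, z, hq, hA, hx, fun p hp =>
      (hs.soliton_iff_fiveRelations hA hE hF hEF hx hp a).1 (hsol p)⟩
  · obtain ⟨U, X, Y, Z, x, y, z, hq, hA, hx, hrel⟩ := hex q
    exact (hs.soliton_iff_fiveRelations hA hE hF hEF hx hq a).2 (hrel q hq)
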